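/- Let $\mathbb K$ be a field of characteristic zero. Let $\mathbf{comm}^+$ (resp. $\mathbf{lie}^+$) be the $2$-colored symmetric operad over $\mathbb K$ governing pairs "commutative associative algebra without unit $+$ its module" (resp. "Lie algebra $+$ its module"), presented as a binary quadratic operad, and let $\mathbf{colie}^+$ be the cooperad governing pairs "Lie coalgebra $+$ its comodule", i.e. the arity-wise linear dual of $\mathbf{lie}^+$. For a (co)operad $\mathcal C$ let $\Lambda\mathcal C$ denote its suspension, $(\Lambda\mathcal C)(m)=\Sigma^{1-m}\,\mathcal C(m)\otimes \mathrm{sgn}_m$, where $m$ is the total number of inputs and $\Sigma$ raises degrees by $1$. For a binary quadratic operad $\mathcal O$ with finitely many generators of degree zero let $\mathcal O^!$ be its quadratic dual operad (generators: the dual space twisted by the sign representation; relations: the annihilator of the relations of $\mathcal O$), let $\mathcal O^\vee=\Lambda\big((\mathcal O^!)^*\big)$ be its Koszul dual cooperad, and let $\mathrm{Cobar}(\mathcal O^\vee)$ be the cobar construction, the quasi-free operad generated by $\Sigma\overline{\mathcal O^\vee}$ with the differential of degree $+1$ induced by the cocomposition. Then: 1. the operad $\mathbf{comm}^+$ is Koszul,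 i.e. the canonical map of operads $\mathrm{Cobar}((\mathbf{comm}^+)^\vee)\to\mathbf{comm}^+$ is a quasi-isomorphism (in every arity and for all colors of the inputs and the output); 2. its Koszul dual cooperad is $(\mathbf{comm}^+)^\vee\cong\Lambda\,\mathbf{colie}^+$, as $2$-colored graded cooperads. -/

import Mathlib

open scoped TensorProduct

noncomputable section

namespace ColoredKoszul

universe u

/-! ### Binary quadratic data -/

/-- A finite basis of binary generating operations, all of degree zero.
`Gen a b d` is a basis of the space of generating operations with inputs of colours `a`, `b` and
output of colour `d`. The transposition of the inputs acts by
`g (x, y) = sign g • (swap g) (y, x)`. -/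
structure Generators (C : Type) where
  Gen : C → C → C → Type
  [fintypeGen : ∀ a b d, Fintype (Gen a b d)]
  swap : ∀ {a b d : C}, Gen a b d → Gen b a d
  swap_swap : ∀ {a b d : C} (g : Gen a b d), swap (swap g) = g
  sign : ∀ {a b d : C}, Gen a b d → ℤˣ
  sign_swap : ∀ {a b d : C} (g : Gen a b d), sign (swap g) = sign g

attribute [instance] Generators.fintypeGen

namespace Generators

variable {K : Type u} [Field K] {C : Type} (E : Generators C)

/-- The dual basis, with the action of the transposition twisted by the sign representation. -/
def twistedDual : Generators C where
  Gen := E.Gen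
  swap := E.swap
  swap_swap := E.swap_swap
  sign g := -E.sign g
  sign_swap g := by rw [E.sign_swap]

/-- Monomials `g (h (x, y), z)` built from two generators, where `x`, `y`, `z` have colours
`a`, `b`, `c`, the output has colour `d`, and the inner edge may have any colour `e`. -/
abbrev Mono (a b c d : C) : Type := Σ e : C, E.Gen e c d × E.Gen a b e

/-- The weight two part, with inputs `x`, `y`, `z` of colours `a`, `b`, `c` and output of colour
`d`, of the free symmetric operad on the generators. A basis is given by the monomials
`g (h (x, y), z)`, `g (h (y, z), x)` and `g (h (z, x), y)`; an element is recorded by its three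
families of coefficients. -/
abbrev Weight2 (K : Type u) (a b c d : C) : Type u :=
  (E.Mono a b c d → K) × (E.Mono b c a d → K) × (E.Mono c a b d → K)

variable {E}

/-- The same element, with the variables listed in the order `y`, `z`, `x`. -/
def Weight2.rot {a b c d : C} (w : E.Weight2 K a b c d) : E.Weight2 K b c a d :=
  (w.2.1, w.2.2, w.1)

/-- The same element, with the variables listed in the order `y`, `x`, `z`; it is rewritten in the
basis for that order by means of the action of the transposition on the inner generator. -/
def Weight2.flip {a b c d : C} (w : E.Weight2 K a b c d) : E.Weight2 K b a c d :=
  (fun m => E.sign m.2.2 • w.1 ⟨m.1, m.2.1, E.swap m.2.2⟩,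
   fun m => E.sign m.2.2 • w.2.2 ⟨m.1, m.2.1, E.swap m.2.2⟩,
   fun m => E.sign m.2.2 • w.2.1 ⟨m.1, m.2.1, E.swap m.2.2⟩)

/-- The pairing of the weight two parts for the generators and for their twisted duals, for which
the monomials are dual bases. -/
def Weight2.pairing [Fintype C] {a b c d : C}
    (w : E.twistedDual.Weight2 K a b c d) (r : E.Weight2 K a b c d) : K :=
  ∑ m : E.Mono a b c d, w.1 m * r.1 m + ∑ m : E.Mono b c a d, w.2.1 m * r.2.1 m +
    ∑ m : E.Mono c a b d, w.2.2 m * r.2.2 m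

theorem Weight2.pairing_add [Fintype C] {a b c d : C} (v w : E.twistedDual.Weight2 K a b c d)
    (r : E.Weight2 K a b c d) : (v + w).pairing r = v.pairing r + w.pairing r := by
  change ∑ m : E.Mono a b c d, (v.1 m + w.1 m) * r.1 m +
    ∑ m : E.Mono b c a d, (v.2.1 m + w.2.1 m) * r.2.1 m +
    ∑ m : E.Mono c a b d, (v.2.2 m + w.2.2 m) * r.2.2 m = _
  simp only [pairing, add_mul, Finset.sum_add_distrib]
  ring

theorem Weight2.pairing_smul [Fintype C] {a b c d : C} (k : K)
    (w : E.twistedDual.Weight2 K a b c d) (r : E.Weight2 K a b c d) :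
    (k • w).pairing r = k * w.pairing r := by
  change ∑ m : E.Mono a b c d, (k * w.1 m) * r.1 m +
    ∑ m : E.Mono b c a d, (k * w.2.1 m) * r.2.1 m +
    ∑ m : E.Mono c a b d, (k * w.2.2 m) * r.2.2 m = _
  simp only [pairing, mul_assoc, mul_add, Finset.mul_sum]

theorem Weight2.flip_pairing [Fintype C] {a b c d : C} (w : E.twistedDual.Weight2 K a b c d)
    (r : E.Weight2 K b a c d) : Weight2.pairing (E := E) (Weight2.flip w) r =
      - Weight2.pairing w (Weight2.flip r) := by
  have key : ∀ {a b c d : C} (p : E.Mono a b c d → K) (q : E.Mono b a c d → K),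
      ∑ m : E.Mono b a c d, ((-E.sign m.2.2) • p ⟨m.1, m.2.1, E.swap m.2.2⟩) * q m =
        - ∑ m : E.Mono a b c d, p m * (E.sign m.2.2 • q ⟨m.1, m.2.1, E.swap m.2.2⟩) := by
    intro a b c d p q
    rw [← Finset.sum_neg_distrib]
    refine Fintype.sum_equiv
      ⟨fun m => ⟨m.1, m.2.1, E.swap m.2.2⟩, fun m => ⟨m.1, m.2.1, E.swap m.2.2⟩, ?_, ?_⟩ _ _ ?_
    · intro m; simp [E.swap_swap]
    · intro m; simp [E.swap_swap]
    · intro m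
      simp only [Equiv.coe_fn_mk, E.swap_swap, E.sign_swap, Units.smul_def, Units.val_neg,
        zsmul_eq_mul, Int.cast_neg]
      ring
  have h := congrArg₂ (· + ·) (congrArg₂ (· + ·) (key w.1 r.1) (key w.2.2 r.2.1))
    (key w.2.1 r.2.2)
  refine Eq.trans h ?_
  simp only [Weight2.pairing, Weight2.flip]
  ring

end Generators

/-- Data presenting a binary quadratic operad with finitely many generators, coloured by the
set `C`: generators, and spaces of quadratic relations that are stable under permutations
of the inputs. -/
structure QuadraticData (K : Type u) [Field K] (C : Type) extends Generators C where
  Rel : ∀ a b c d : C, Submodule K (toGenerators.Weight2 K a b c d)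
  rot_mem : ∀ {a b c d : C} (w : toGenerators.Weight2 K a b c d),
    w ∈ Rel a b c d → w.rot ∈ Rel b c a d
  flip_mem : ∀ {a b c d : C} (w : toGenerators.Weight2 K a b c d),
    w ∈ Rel a b c d → w.flip ∈ Rel b a c d

namespace QuadraticData

variable {K : Type u} [Field K] {C : Type} (Q : QuadraticData K C)

/-- The data presenting the quadratic dual operad: the generators are dual to those of `Q`, with
the symmetric group action twisted by the sign representation, and the relations are the
annihilators of those of `Q`. -/
def dual [Fintype C] : QuadraticData K C where
  toGenerators := Q.twistedDual
  Rel a b c d :=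
    { carrier := {w | ∀ r ∈ Q.Rel a b c d, Generators.Weight2.pairing w r = 0}
      add_mem' := by
        intro v w hv hw r hr
        rw [Generators.Weight2.pairing_add, hv r hr, hw r hr, add_zero]
      zero_mem' := by
        intro r _
        have h := Generators.Weight2.pairing_smul (0 : K) (0 : Q.twistedDual.Weight2 K a b c d) r
        rwa [zero_smul, zero_mul] at h
      smul_mem' := by
        intro k w hw r hr
        rw [Generators.Weight2.pairing_smul, hw r hr, mul_zero] }
  rot_mem := by
    intro a b c d w hw r hr
    have h := hw r.rot.rot (Q.rot_mem _ (Q.rot_mem _ hr))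
    simp only [Generators.Weight2.pairing, Generators.Weight2.rot] at h ⊢
    linear_combination h
  flip_mem := by
    intro a b c d w hw r hr
    rw [Generators.Weight2.flip_pairing, hw _ (Q.flip_mem _ hr), neg_zero]

/-! ### The operad presented by quadratic data -/

/-- Binary trees whose vertices are decorated by generators and whose leaves are labelled
by elements of `ι`; the label `i` has colour `c i`. -/
inductive Tree {ι : Type} (c : ι → C) : C → Type
  | leaf (i : ι) : Tree c (c i)
  | node {a b d : C} (g : Q.Gen a b d) (s : Tree c a) (t : Tree c b) : Tree c d

namespace Tree

variable {Q} {ι ι' : Type} {c : ι → C} {c' : ι' → C}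

/-- The labels of the leaves of a tree. -/
def leaves : ∀ {d : C}, Q.Tree c d → Multiset ι
  | _, leaf i => {i}
  | _, node _ s t => s.leaves + t.leaves

/-- Each label is used exactly once. -/
def IsMultilinear {d : C} (t : Q.Tree c d) : Prop :=
  t.leaves.Nodup ∧ ∀ i, i ∈ t.leaves

/-- Substitution of trees for leaves. -/
def bind (f : ∀ i, Q.Tree c' (c i)) : ∀ {d : C}, Q.Tree c d → Q.Tree c' d
  | _, leaf i => f i
  | _, node g s t => node g (s.bind f) (t.bind f)

theorem leaves_bind (f : ∀ i, Q.Tree c' (c i)) {d : C} (t : Q.Tree c d) :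
    (t.bind f).leaves = t.leaves.bind fun i => (f i).leaves := by
  induction t with
  | leaf i => simp [bind, leaves]
  | node g s t hs ht => simp [bind, leaves, hs, ht]

end Tree

/-- Multilinear tree monomials. -/
abbrev MTree {ι : Type} (c : ι → C) (d : C) : Type := {t : Q.Tree c d // t.IsMultilinear}

variable [Fintype C]

/-- The sum of trees obtained by inserting trees `x`, `y`, `z` in an element of weight two. -/
def relator {ι : Type} {c : ι → C} {a₁ a₂ a₃ d : C} (w : Q.Weight2 K a₁ a₂ a₃ d)
    (x : Q.Tree c a₁) (y : Q.Tree c a₂) (z : Q.Tree c a₃) : Q.Tree c d →₀ K :=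
  ∑ m, Finsupp.single (Tree.node m.2.1 (Tree.node m.2.2 x y) z) (w.1 m) +
  ∑ m, Finsupp.single (Tree.node m.2.1 (Tree.node m.2.2 y z) x) (w.2.1 m) +
  ∑ m, Finsupp.single (Tree.node m.2.1 (Tree.node m.2.2 z x) y) (w.2.2 m)

/-- The relations in the free algebra: symmetry of the generators, the quadratic relations, and
the consequences of these under applying generators. -/
inductive IsRelation {ι : Type} (c : ι → C) : ∀ {d : C}, (Q.Tree c d →₀ K) → Prop
  | symm {a b d : C} (g : Q.Gen a b d) (s : Q.Tree c a) (t : Q.Tree c b) :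
      IsRelation c (Finsupp.single (Tree.node g s t) 1 -
        Q.sign g • Finsupp.single (Tree.node (Q.swap g) t s) 1)
  | quad {a₁ a₂ a₃ d : C} (w : Q.Weight2 K a₁ a₂ a₃ d) (hw : w ∈ Q.Rel a₁ a₂ a₃ d)
      (x : Q.Tree c a₁) (y : Q.Tree c a₂) (z : Q.Tree c a₃) : IsRelation c (Q.relator w x y z)
  | left {a b d : C} (g : Q.Gen a b d) {f : Q.Tree c a →₀ K} (t : Q.Tree c b)
      (hf : IsRelation c f) : IsRelation c (Finsupp.lmapDomain K K (fun s => Tree.node g s t) f)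
  | right {a b d : C} (g : Q.Gen a b d) (s : Q.Tree c a) {f : Q.Tree c b →₀ K}
      (hf : IsRelation c f) : IsRelation c (Finsupp.lmapDomain K K (fun t => Tree.node g s t) f)

/-- The span of the relations. -/
def relations {ι : Type} (c : ι → C) (d : C) : Submodule K (Q.Tree c d →₀ K) :=
  Submodule.span K {f | Q.IsRelation c f}

/-- The colour `d` component of the free algebra, over the operad presented by `Q`, on generators
indexed by `ι`, where the generator `i` has colour `c i`. -/
abbrev FreeAlg {ι : Type} (c : ι → C) (d : C) : Type u :=
  (Q.Tree c d →₀ K) ⧸ Q.relations c d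

/-- The relations among multilinear trees. -/
def multilinearRelations {ι : Type} (c : ι → C) (d : C) : Submodule K (Q.MTree c d →₀ K) :=
  (Q.relations c d).comap (Finsupp.lmapDomain K K Subtype.val)

/-- The component of the symmetric coloured operad presented by `Q` with inputs indexed by `ι`,
of colours `c`, and output of colour `d`: the free symmetric operad on the generators modulo the
ideal generated by the relations. Equivalently, it is the multilinear part of the free algebra. -/
abbrev Op {ι : Type} (c : ι → C) (d : C) : Type u :=
  (Q.MTree c d →₀ K) ⧸ Q.multilinearRelations c d

/-- The class of a multilinear tree. -/
def treeClass {ι : Type} {c : ι → C} {d : C} (t : Q.MTree c d) : Q.Op c d :=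
  Submodule.Quotient.mk (Finsupp.single t 1)

/-- The inclusion of the multilinear part in the free algebra. -/
def toFreeAlg {ι : Type} (c : ι → C) (d : C) : Q.Op c d →ₗ[K] Q.FreeAlg c d :=
  Submodule.mapQ _ _ (Finsupp.lmapDomain K K Subtype.val) le_rfl

theorem lmapDomain_right_mem {ι : Type} {c : ι → C} {a b d : C} (g : Q.Gen a b d)
    (s : Q.Tree c a) : Q.relations c b ≤
      (Q.relations c d).comap (Finsupp.lmapDomain K K fun t => Tree.node g s t) :=
  Submodule.span_le.2 fun _ hf => Submodule.subset_span (IsRelation.right g s hf)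

theorem lmapDomain_left_mem {ι : Type} {c : ι → C} {a b d : C} (g : Q.Gen a b d)
    (t : Q.Tree c b) : Q.relations c a ≤
      (Q.relations c d).comap (Finsupp.lmapDomain K K fun s => Tree.node g s t) :=
  Submodule.span_le.2 fun _ hf => Submodule.subset_span (IsRelation.left g t hf)

/-- The action of a generator on the free algebra, with the first argument a tree. -/
def actTree {ι : Type} {c : ι → C} {a b d : C} (g : Q.Gen a b d) (s : Q.Tree c a) :
    Q.FreeAlg c b →ₗ[K] Q.FreeAlg c d :=
  Submodule.mapQ _ _ (Finsupp.lmapDomain K K fun t => Tree.node g s t)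
    (Q.lmapDomain_right_mem g s)

theorem lift_actTree {ι : Type} {c : ι → C} {a b d : C} (g : Q.Gen a b d) (f : Q.Tree c a →₀ K)
    (t : Q.Tree c b) :
    Finsupp.lift (Q.FreeAlg c b →ₗ[K] Q.FreeAlg c d) K _ (Q.actTree g) f
        (Submodule.Quotient.mk (Finsupp.single t 1)) =
      Submodule.Quotient.mk (Finsupp.lmapDomain K K (fun s => Tree.node g s t) f) := by
  induction f using Finsupp.induction_linear with
  | zero => simp
  | add f₁ f₂ h₁ h₂ => rw [map_add, LinearMap.add_apply, h₁, h₂, map_add]; rfl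
  | single s k => simp [actTree, ← Submodule.Quotient.mk_smul]

/-- The action of a generator on the free algebra. -/
def act {ι : Type} {c : ι → C} {a b d : C} (g : Q.Gen a b d) :
    Q.FreeAlg c a →ₗ[K] Q.FreeAlg c b →ₗ[K] Q.FreeAlg c d :=
  Submodule.liftQ _ (Finsupp.lift _ K _ (Q.actTree g)) fun f hf => by
    rw [LinearMap.mem_ker]
    ext t
    exact (Q.lift_actTree g f t).trans
      ((Submodule.Quotient.mk_eq_zero _).2 (Q.lmapDomain_left_mem g t hf))

theorem isRelation_bind {ι ι' : Type} {c : ι → C} {c' : ι' → C} (φ : ∀ i, Q.Tree c' (c i)) {d : C}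
    {f : Q.Tree c d →₀ K} (hf : Q.IsRelation c f) :
    Q.IsRelation c' (Finsupp.lmapDomain K K (Tree.bind φ) f) := by
  induction hf with
  | symm g s t =>
    have h := IsRelation.symm g (s.bind φ) (t.bind φ)
    rwa [map_sub, Units.smul_def, map_zsmul, Finsupp.lmapDomain_apply, Finsupp.lmapDomain_apply,
      Finsupp.mapDomain_single, Finsupp.mapDomain_single]
  | quad w hw x y z =>
    have h := IsRelation.quad w hw (x.bind φ) (y.bind φ) (z.bind φ)
    simpa only [relator, map_add, map_sum, Finsupp.lmapDomain_apply, Finsupp.mapDomain_single,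
      Tree.bind] using h
  | left g t _ ih =>
    have h := IsRelation.left g (t.bind φ) ih
    simp only [Finsupp.lmapDomain_apply, ← Finsupp.mapDomain_comp] at h ⊢
    exact h
  | right g s _ ih =>
    have h := IsRelation.right g (s.bind φ) ih
    simp only [Finsupp.lmapDomain_apply, ← Finsupp.mapDomain_comp] at h ⊢
    exact h

theorem relations_bind {ι ι' : Type} {c : ι → C} {c' : ι' → C} (φ : ∀ i, Q.Tree c' (c i)) (d : C) :
    Q.relations c d ≤ (Q.relations c' d).comap (Finsupp.lmapDomain K K (Tree.bind φ)) :=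
  Submodule.span_le.2 fun _ hf => Submodule.subset_span (Q.isRelation_bind φ hf)

/-- The map of components induced by a substitution that preserves multilinearity. -/
def substitution {ι ι' : Type} {c : ι → C} {c' : ι' → C} {d : C} (φ : ∀ i, Q.Tree c' (c i))
    (hφ : ∀ t : Q.MTree c d, (t.1.bind φ).IsMultilinear) : Q.Op c d →ₗ[K] Q.Op c' d :=
  Submodule.mapQ _ _ (Finsupp.lmapDomain K K fun t => ⟨t.1.bind φ, hφ t⟩) fun f hf => by
    have h := Q.relations_bind φ d hf
    simp only [multilinearRelations, Submodule.mem_comap, Finsupp.lmapDomain_apply,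
      ← Finsupp.mapDomain_comp] at h ⊢
    exact h

/-- The action of bijections of the sets of inputs on the operad. -/
def relabel {ι κ : Type} (σ : ι ≃ κ) (c : κ → C) (d : C) : Q.Op (c ∘ σ) d →ₗ[K] Q.Op c d :=
  Q.substitution (fun i => Tree.leaf (σ i)) fun t => by
    have h : (t.1.bind fun i => Tree.leaf (c := c) (σ i)).leaves = t.1.leaves.map σ := by
      rw [Tree.leaves_bind]
      exact Multiset.bind_singleton _ _
    refine ⟨h ▸ t.2.1.map σ.injective, fun k => h ▸ Multiset.mem_map.2 ⟨σ.symm k, t.2.2 _, ?_⟩⟩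
    simp

/-- The unit of the operad: the tree with one leaf and no vertices. -/
def unit (d : C) : Q.Op (fun _ : Unit => d) d :=
  Q.treeClass ⟨Tree.leaf (c := fun _ : Unit => d) (), by simp [Tree.leaves],
    by simp [Tree.leaves]⟩

end QuadraticData

/-- The set of inputs obtained from `ι` by contracting the subset `J` to a single new input. -/
inductive Contract {ι : Type} (J : Finset ι) : Type
  | new : Contract J
  | old (i : {i // i ∉ J}) : Contract J

namespace Contract

variable {ι : Type} {J : Finset ι}

/-- Contractions as optional elements of the complement. -/
def equivOption : Contract J ≃ Option {i // i ∉ J} where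
  toFun o := match o with
    | new => none
    | old i => some i
  invFun o := match o with
    | none => new
    | some i => old i
  left_inv o := by cases o <;> rfl
  right_inv o := by cases o <;> rfl

instance [Fintype ι] [DecidableEq ι] : Fintype (Contract J) := Fintype.ofEquiv _ equivOption.symm

instance [Finite ι] : Finite (Contract J) := Finite.of_equiv _ equivOption.symm

/-- The new input is smaller than all others, which keep their order. -/
instance [LinearOrder ι] : LinearOrder (Contract J) :=
  LinearOrder.lift' (fun o => (match o with
    | new => ⊥
    | old i => (i : ι) : WithBot ι)) (by
      intro o o' h
      cases o <;> cases o'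
      · rfl
      · exact absurd h WithBot.bot_ne_coe
      · exact absurd h WithBot.coe_ne_bot
      · exact congrArg old (Subtype.ext (WithBot.coe_injective h)))

/-- The colours of the inputs after contracting `J` to an input of colour `e`. -/
def color {C : Type} (c : ι → C) (J : Finset ι) (e : C) : Contract J → C
  | new => e
  | old i => c i

end Contract

/-- The colours of the inputs in `J`. -/
abbrev restrictColor {C ι : Type} (c : ι → C) (J : Finset ι) : J → C := fun j => c j

namespace QuadraticData

variable {K : Type u} [Field K] {C : Type} (Q : QuadraticData K C)

namespace Tree

variable {Q} {ι : Type} {c : ι → C} {J : Finset ι} {d e : C}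

/-- The substitution that grafts a tree at the new input. -/
def graftLeaf (t : Q.Tree (restrictColor c J) e) :
    ∀ o : Contract J, Q.Tree c (Contract.color c J e o)
  | Contract.new => bind (c := restrictColor c J) (d := e) (fun j => leaf (c := c) j) t
  | Contract.old i => leaf (c := c) i

/-- Grafting the root of `t` on the leaf of `s` labelled by the new input. -/
def graft (s : Q.Tree (Contract.color c J e) d) (t : Q.Tree (restrictColor c J) e) : Q.Tree c d :=
  s.bind (graftLeaf t)

theorem leaves_graftLeaf_new (t : Q.Tree (restrictColor c J) e) :
    (graftLeaf t Contract.new).leaves = t.leaves.map Subtype.val := by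
  refine (leaves_bind _ _).trans ?_
  exact Multiset.bind_singleton _ _

theorem IsMultilinear.graft {s : Q.Tree (Contract.color c J e) d} (hs : s.IsMultilinear)
    {t : Q.Tree (restrictColor c J) e} (ht : t.IsMultilinear) : (s.graft t).IsMultilinear := by
  have hnew := leaves_graftLeaf_new t
  have hold : ∀ i : {i // i ∉ J}, (graftLeaf t (Contract.old i)).leaves = {(i : ι)} :=
    fun i => rfl
  constructor
  · rw [Tree.graft, leaves_bind, Multiset.nodup_bind]
    constructor
    · intro o _
      cases o with
      | new => rw [hnew]; exact ht.1.map Subtype.val_injective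
      | old i => rw [hold]; exact Multiset.nodup_singleton _
    · refine Multiset.Nodup.pairwise (fun o _ p _ hne => ?_) hs.1
      have hdisj : ∀ i : {i // i ∉ J}, (i : ι) ∉ t.leaves.map Subtype.val := fun i hi => by
        obtain ⟨j, -, hj⟩ := Multiset.mem_map.1 hi
        exact i.2 (hj ▸ j.2)
      cases o with
      | new =>
        cases p with
        | new => exact absurd rfl hne
        | old j => simpa only [Function.onFun, hnew, hold, Multiset.disjoint_singleton] using hdisj j
      | old i =>
        cases p with
        | new => simpa only [Function.onFun, hnew, hold, Multiset.singleton_disjoint] using hdisj i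
        | old j =>
          simp only [Function.onFun, hold, Multiset.singleton_disjoint, Multiset.mem_singleton]
          exact fun h => hne (congrArg Contract.old (Subtype.ext h))
  · intro i
    rw [Tree.graft, leaves_bind, Multiset.mem_bind]
    by_cases hi : i ∈ J
    · exact ⟨Contract.new, hs.2 _, by rw [hnew]; exact Multiset.mem_map.2 ⟨⟨i, hi⟩, ht.2 _, rfl⟩⟩
    · exact ⟨Contract.old ⟨i, hi⟩, hs.2 _, by rw [hold]; simp⟩

theorem graft_eq_of_notMem (s : Q.Tree (Contract.color c J e) d) (hs : Contract.new ∉ s.leaves)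
    (t t' : Q.Tree (restrictColor c J) e) : s.graft t = s.graft t' := by
  induction s with
  | leaf o =>
    cases o with
    | new => simp [leaves] at hs
    | old i => rfl
  | node g s₁ s₂ h₁ h₂ =>
    simp only [leaves, Multiset.mem_add, not_or] at hs
    exact congrArg₂ (node g) (h₁ hs.1) (h₂ hs.2)

end Tree

variable [Fintype C]

theorem graft_right_mem {ι : Type} {c : ι → C} {J : Finset ι} {d e : C}
    (s : Q.Tree (Contract.color c J e) d) (hs : s.leaves.Nodup) (hs' : Contract.new ∈ s.leaves)
    {f : Q.Tree (restrictColor c J) e →₀ K} (hf : f ∈ Q.relations (restrictColor c J) e) :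
    Finsupp.lmapDomain K K s.graft f ∈ Q.relations c d := by
  by_cases hne : Nonempty (Q.Tree (restrictColor c J) e)
  swap
  · rw [not_nonempty_iff] at hne
    rw [Subsingleton.elim f 0, map_zero]
    exact zero_mem _
  obtain ⟨t₀⟩ := hne
  induction s with
  | leaf o =>
    cases o with
    | new => exact Q.relations_bind _ _ hf
    | old i => simp [Tree.leaves] at hs'
  | node g s₁ s₂ h₁ h₂ =>
    simp only [Tree.leaves, Multiset.mem_add, Multiset.nodup_add] at hs hs'
    rcases hs' with h | h
    · have h' : Contract.new ∉ s₂.leaves := fun h' => Multiset.disjoint_left.1 hs.2.2 h h'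
      have := Q.lmapDomain_left_mem g (s₂.graft t₀) (h₁ hs.1 h)
      simp only [Submodule.mem_comap, Finsupp.lmapDomain_apply, ← Finsupp.mapDomain_comp] at this ⊢
      convert this using 2
      ext t
      exact congrArg (Tree.node g _) (Tree.graft_eq_of_notMem _ h' _ _)
    · have h' : Contract.new ∉ s₁.leaves := fun h' => Multiset.disjoint_left.1 hs.2.2 h' h
      have := Q.lmapDomain_right_mem g (s₁.graft t₀) (h₂ hs.2.1 h)
      simp only [Submodule.mem_comap, Finsupp.lmapDomain_apply, ← Finsupp.mapDomain_comp] at this ⊢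
      convert this using 2
      ext t
      exact congrArg (fun x => Tree.node g x _) (Tree.graft_eq_of_notMem _ h' _ _)

/-- Grafting multilinear trees. -/
def graftM {ι : Type} {c : ι → C} {J : Finset ι} {d e : C} (s : Q.MTree (Contract.color c J e) d)
    (t : Q.MTree (restrictColor c J) e) : Q.MTree c d :=
  ⟨s.1.graft t.1, s.2.graft t.2⟩

/-- Partial composition with a fixed tree as outer operation. -/
def compTree {ι : Type} {c : ι → C} {J : Finset ι} {d e : C}
    (s : Q.MTree (Contract.color c J e) d) : Q.Op (restrictColor c J) e →ₗ[K] Q.Op c d :=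
  Submodule.mapQ _ _ (Finsupp.lmapDomain K K (Q.graftM s)) fun f hf => by
    have h := Q.graft_right_mem s.1 s.2.1 (s.2.2 _) hf
    simp only [multilinearRelations, Submodule.mem_comap, Finsupp.lmapDomain_apply,
      ← Finsupp.mapDomain_comp] at h ⊢
    exact h

theorem lift_compTree {ι : Type} {c : ι → C} {J : Finset ι} {d e : C}
    (f : Q.MTree (Contract.color c J e) d →₀ K) (t : Q.MTree (restrictColor c J) e) :
    Finsupp.lift (Q.Op (restrictColor c J) e →ₗ[K] Q.Op c d) K _ Q.compTree f (Q.treeClass t) =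
      Submodule.Quotient.mk (Finsupp.lmapDomain K K (fun s => Q.graftM s t) f) := by
  induction f using Finsupp.induction_linear with
  | zero => simp
  | add f₁ f₂ h₁ h₂ => rw [map_add, LinearMap.add_apply, h₁, h₂, map_add]; rfl
  | single s k => simp [treeClass, compTree, ← Submodule.Quotient.mk_smul]

/-- The partial composition of the operad along a subset `J` of the inputs: an operation with
inputs in `J` is inserted in the new input of an operation whose other inputs are
those not in `J`. -/
def comp {ι : Type} (c : ι → C) (J : Finset ι) (d e : C) :
    Q.Op (Contract.color c J e) d →ₗ[K] Q.Op (restrictColor c J) e →ₗ[K] Q.Op c d :=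
  Submodule.liftQ _ (Finsupp.lift _ K _ Q.compTree) fun f hf => by
    rw [LinearMap.mem_ker]
    ext t
    refine (Q.lift_compTree f t).trans ((Submodule.Quotient.mk_eq_zero _).2 ?_)
    have h := Q.relations_bind (Tree.graftLeaf t.1) d hf
    simp only [multilinearRelations, Submodule.mem_comap, Finsupp.lmapDomain_apply,
      ← Finsupp.mapDomain_comp] at h ⊢
    exact h

theorem finite_card_leaves_le {ι : Type} [Finite ι] (c : ι → C) (n : ℕ) (d : C) :
    {t : Q.Tree c d | t.leaves.card ≤ n}.Finite := by
  have hpos : ∀ {d : C} (t : Q.Tree c d), 0 < t.leaves.card := by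
    intro d t
    induction t with
    | leaf i => simp [Tree.leaves]
    | node g s t hs ht => simp only [Tree.leaves, Multiset.card_add]; omega
  induction n generalizing d with
  | zero =>
    convert Set.finite_empty
    ext t
    have := hpos t
    simp only [Set.mem_ofPred_eq, Set.mem_empty_iff_false, iff_false]
    omega
  | succ n ih =>
    have h₁ : {t : Q.Tree c d | ∃ i : {i // c i = d}, t = i.2 ▸ Tree.leaf i.1}.Finite := by
      refine (Set.finite_range fun i : {i // c i = d} =>
        (i.2 ▸ Tree.leaf i.1 : Q.Tree c d)).subset ?_
      rintro t ⟨i, rfl⟩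
      exact ⟨i, rfl⟩
    have h₂ : (⋃ a : C, ⋃ b : C, ⋃ g : Q.Gen a b d,
        Set.image2 (Tree.node (c := c) g) {t | t.leaves.card ≤ n} {t | t.leaves.card ≤ n}).Finite :=
      Set.finite_iUnion fun a => Set.finite_iUnion fun b => Set.finite_iUnion fun g =>
        (ih a).image2 _ (ih b)
    refine (h₁.union h₂).subset ?_
    intro t ht
    cases t with
    | leaf i => exact Or.inl ⟨⟨i, rfl⟩, rfl⟩
    | node g s t =>
      right
      simp only [Set.mem_ofPred_eq, Tree.leaves, Multiset.card_add] at ht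
      have := hpos s
      have := hpos t
      simp only [Set.mem_iUnion]
      exact ⟨_, _, g, s, by simp only [Set.mem_ofPred_eq]; omega, t,
        by simp only [Set.mem_ofPred_eq]; omega, rfl⟩

instance {ι : Type} [Finite ι] (c : ι → C) (d : C) : Finite (Q.MTree c d) := by
  cases nonempty_fintype ι
  refine ((Q.finite_card_leaves_le c (Fintype.card ι) d).subset ?_).to_subtype
  intro t ht
  exact Finset.card_le_univ (⟨t.leaves, ht.1⟩ : Finset ι)

instance {ι : Type} [Finite ι] (c : ι → C) (d : C) : Module.Finite K (Q.Op c d) :=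
  inferInstance

end QuadraticData

/-! ### Cooperads and their suspension -/

/-- The Koszul sign of the permutation of homogeneous factors induced by a bijection `σ` of linearly
ordered sets, where the factor at `k` has degree `n k`. -/
def koszulSign {ι κ : Type} [Fintype ι] [LinearOrder ι] [LinearOrder κ] (σ : ι ≃ κ) (n : κ → ℤ) :
    ℤˣ :=
  ∏ p : ι × ι with p.1 < p.2 ∧ σ p.2 < σ p.1, (n (σ p.1) * n (σ p.2)).negOnePow

/-- The Koszul sign of the permutation moving the factors in `J` to the front, where the factor at
`i` has degree `n i`. -/
def frontSign {ι : Type} [Fintype ι] [LinearOrder ι] (J : Finset ι) (n : ι → ℤ) : ℤˣ :=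
  ∏ p : ι × ι with p.1 < p.2 ∧ p.1 ∉ J ∧ p.2 ∈ J, (n p.1 * n p.2).negOnePow

/-- The structure maps of a `C`-coloured symmetric cooperad in graded vector spaces, each of whose
components is concentrated in a single degree. The component `obj c d` has inputs
indexed by a finite set `ι`, of colours `c`, and output of colour `d`, and it sits in degree
`deg c d`. The map `pull σ` is the action of a bijection on the inputs, and `decomp c J d e` is
the component of the partial cocomposition in which the inputs in `J` belong to the upper factor
and the two factors are joined by an edge of colour `e`. Linear orders on the sets of inputs are
only used to fix signs. The structure only packages the structure maps; it is used for the explicit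
cooperads constructed below. -/
structure GradedCooperad (K : Type u) [Field K] (C : Type) where
  obj : ∀ {ι : Type} [Fintype ι] [LinearOrder ι], (ι → C) → C → Type u
  [addCommGroup : ∀ {ι : Type} [Fintype ι] [LinearOrder ι] (c : ι → C) (d : C),
    AddCommGroup (obj c d)]
  [module : ∀ {ι : Type} [Fintype ι] [LinearOrder ι] (c : ι → C) (d : C), Module K (obj c d)]
  deg : ∀ {ι : Type} [Fintype ι] [LinearOrder ι], (ι → C) → C → ℤ
  pull : ∀ {ι κ : Type} [Fintype ι] [LinearOrder ι] [Fintype κ] [LinearOrder κ] (σ : ι ≃ κ)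
    (c : κ → C) (d : C), obj c d →ₗ[K] obj (c ∘ σ) d
  counit : ∀ d : C, obj (fun _ : Unit => d) d →ₗ[K] K
  decomp : ∀ {ι : Type} [Fintype ι] [LinearOrder ι] (c : ι → C) (J : Finset ι) (d e : C),
    obj c d →ₗ[K] obj (Contract.color c J e) d ⊗[K] obj (restrictColor c J) e

attribute [instance] GradedCooperad.addCommGroup GradedCooperad.module

namespace GradedCooperad

variable {K : Type u} [Field K] {C : Type}

/-- The suspension `Λ`: the component with `m` inputs is the original one
tensored with the sign representation and with a line in degree `1 - m`. The structure
maps are multiplied by the Koszul signs of that line, regarded as an operation with one output and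
`m` inputs of odd degree. -/
def susp (A : GradedCooperad K C) : GradedCooperad K C where
  obj c d := A.obj c d
  deg {ι} _ _ c d := 1 - (Fintype.card ι : ℤ) + A.deg c d
  pull σ c d := koszulSign σ (fun _ => 1) • A.pull σ c d
  counit := A.counit
  decomp c J d e :=
    (frontSign J (fun _ => 1) *
      ((1 - (J.card : ℤ)) * A.deg (Contract.color c J e) d).negOnePow) • A.decomp c J d e

/-- An isomorphism of graded cooperads. -/
structure Iso (A B : GradedCooperad K C) where
  equiv : ∀ {ι : Type} [Fintype ι] [LinearOrder ι] (c : ι → C) (d : C), A.obj c d ≃ₗ[K] B.obj c d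
  deg_eq : ∀ {ι : Type} [Fintype ι] [LinearOrder ι] (c : ι → C) (d : C),
    Nontrivial (A.obj c d) → A.deg c d = B.deg c d
  equiv_pull : ∀ {ι κ : Type} [Fintype ι] [LinearOrder ι] [Fintype κ] [LinearOrder κ] (σ : ι ≃ κ)
    (c : κ → C) (d : C) (x : A.obj c d),
    equiv (c ∘ σ) d (A.pull σ c d x) = B.pull σ c d (equiv c d x)
  counit_equiv : ∀ (d : C) (x : A.obj (fun _ : Unit => d) d),
    B.counit d (equiv _ d x) = A.counit d x
  decomp_equiv : ∀ {ι : Type} [Fintype ι] [LinearOrder ι] (c : ι → C) (J : Finset ι) (d e : C)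
    (x : A.obj c d), B.decomp c J d e (equiv c d x) =
      TensorProduct.map (equiv (Contract.color c J e) d).toLinearMap
        (equiv (restrictColor c J) e).toLinearMap (A.decomp c J d e x)

end GradedCooperad

namespace QuadraticData

variable {K : Type u} [Field K] {C : Type} [Fintype C] (Q : QuadraticData K C)

/-- The linear dual of the operad presented by `Q`, a cooperad in degree zero. The components of
the operad are finite dimensional, so the dual of the partial composition takes values in
the tensor product of the duals. -/
def dualCooperad : GradedCooperad K C where
  obj c d := Module.Dual K (Q.Op c d)
  deg _ _ := 0
  pull σ c d := (Q.relabel σ c d).dualMap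
  counit d := Module.Dual.eval K _ (Q.unit d)
  decomp c J d e :=
    (TensorProduct.dualDistribEquiv K (Q.Op (Contract.color c J e) d)
        (Q.Op (restrictColor c J) e)).symm.toLinearMap ∘ₗ
      (TensorProduct.lift (Q.comp c J d e)).dualMap

/-- The Koszul dual cooperad of the operad presented by `Q`: the suspension of
the linear dual of the quadratic dual operad. -/
def koszulDual : GradedCooperad K C := Q.dual.dualCooperad.susp

end QuadraticData

/-! ### The cobar construction -/

/-- Trees whose vertices are decorated by elements of the components with at least two inputs of a
cooperad, and whose leaves are labelled by elements of `κ`, of colours `b`. The inputs of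
each vertex are linearly ordered. -/
inductive CobarTree {K : Type u} [Field K] {C : Type} (A : GradedCooperad K C) {κ : Type}
    (b : κ → C) : C → Type (max 1 u)
  | leaf (k : κ) : CobarTree A b (b k)
  | node {ι : Type} [Fintype ι] [LinearOrder ι] (hι : 2 ≤ Fintype.card ι) {c : ι → C} {d : C}
      (x : A.obj c d) (ts : ∀ i, CobarTree A b (c i)) : CobarTree A b d

namespace CobarTree

variable {K : Type u} [Field K] {C : Type} {A : GradedCooperad K C} {κ : Type} {b : κ → C}

/-- The labels of the leaves. -/
def leaves : ∀ {d : C}, CobarTree A b d → Multiset κ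
  | _, leaf k => {k}
  | _, node _ _ ts => ∑ i, (ts i).leaves

/-- Each label is used exactly once. -/
def IsMultilinear {d : C} (t : CobarTree A b d) : Prop :=
  t.leaves.Nodup ∧ ∀ k, k ∈ t.leaves

/-- The degree of a tree: the degree of each decoration is raised by one. -/
def deg : ∀ {d : C}, CobarTree A b d → ℤ
  | _, leaf _ => 0
  | _, node (c := c) (d := d) _ _ ts => A.deg c d + 1 + ∑ i, (ts i).deg

/-- The relations between decorated trees: a tree depends linearly on each decoration, and
renaming or reordering the inputs of a vertex has the effect prescribed by the symmetric group
action and the Koszul sign rule. -/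
inductive IsRelation : ∀ {d : C}, (CobarTree A b d →₀ K) → Prop
  | add {ι : Type} [Fintype ι] [LinearOrder ι] (hι : 2 ≤ Fintype.card ι) {c : ι → C} {d : C}
      (x y : A.obj c d) (ts : ∀ i, CobarTree A b (c i)) :
      IsRelation (Finsupp.single (node hι (x + y) ts) 1 - Finsupp.single (node hι x ts) 1 -
        Finsupp.single (node hι y ts) 1)
  | smul {ι : Type} [Fintype ι] [LinearOrder ι] (hι : 2 ≤ Fintype.card ι) {c : ι → C} {d : C}
      (r : K) (x : A.obj c d) (ts : ∀ i, CobarTree A b (c i)) :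
      IsRelation (Finsupp.single (node hι (r • x) ts) 1 - Finsupp.single (node hι x ts) r)
  | perm {ι ι' : Type} [Fintype ι] [LinearOrder ι] [Fintype ι'] [LinearOrder ι']
      (hι : 2 ≤ Fintype.card ι) (hι' : 2 ≤ Fintype.card ι') (σ : ι ≃ ι') {c : ι' → C} {d : C}
      (x : A.obj c d) (ts : ∀ i, CobarTree A b (c i)) :
      IsRelation (Finsupp.single (node hι (A.pull σ c d x) fun i => ts (σ i)) 1 -
        koszulSign σ (fun i => (ts i).deg) • Finsupp.single (node hι' x ts) 1)
  | plug {ι : Type} [Fintype ι] [LinearOrder ι] (hι : 2 ≤ Fintype.card ι) {c : ι → C} {d : C}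
      (x : A.obj c d) (ts : ∀ i, CobarTree A b (c i)) (i : ι) {f : CobarTree A b (c i) →₀ K}
      (hf : IsRelation f) :
      IsRelation (Finsupp.lmapDomain K K (fun t => node hι x (Function.update ts i t)) f)

end CobarTree

/-- The free algebra over the cobar construction of a cooperad with no components of arity zero and
only the counit in arity one, on generators of degree zero indexed by `κ`, of colours `b`, as a
graded vector space. -/
abbrev Cobar {K : Type u} [Field K] {C : Type} (A : GradedCooperad K C) {κ : Type} (b : κ → C)
    (d : C) : Type (max 1 u) :=
  (CobarTree A b d →₀ K) ⧸ Submodule.span K {f | CobarTree.IsRelation (A := A) (b := b) f}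

namespace Cobar

variable {K : Type u} [Field K] {C : Type} {A : GradedCooperad K C} {κ : Type} {b : κ → C}

/-- The class of a tree. -/
def mk {d : C} (t : CobarTree A b d) : Cobar A b d := Submodule.Quotient.mk (Finsupp.single t 1)

/-- The degree `n` part of the component of the cobar construction with inputs indexed by `κ`: the
span of the trees of degree `n` in which every label is used exactly once. -/
def part (A : GradedCooperad K C) (b : κ → C) (d : C) (n : ℤ) : Submodule K (Cobar A b d) :=
  Submodule.span K {x | ∃ t : CobarTree A b d, t.IsMultilinear ∧ t.deg = n ∧ x = mk t}

/-- Replacing the branch of a tree at the `i`-th input of the root by an arbitrary element. -/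
def plug {ι : Type} [Fintype ι] [LinearOrder ι] (hι : 2 ≤ Fintype.card ι) {c : ι → C} {d : C}
    (x : A.obj c d) (ts : ∀ i, CobarTree A b (c i)) (i : ι) :
    Cobar A b (c i) →ₗ[K] Cobar A b d :=
  Submodule.mapQ _ _
    (Finsupp.lmapDomain K K fun t => CobarTree.node hι x (Function.update ts i t))
    (Submodule.span_le.2 fun _ hf =>
      Submodule.subset_span (CobarTree.IsRelation.plug hι x ts i hf))

/-- The branches at the inputs of the root after grouping the inputs in `J`. -/
def contractBranches {ι : Type} [LinearOrder ι] {c : ι → C} {J : Finset ι} {e : C}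
    (t : CobarTree A b e) (ts : ∀ i, CobarTree A b (c i)) :
    ∀ o, CobarTree A b (Contract.color c J e o)
  | Contract.new => t
  | Contract.old i => ts i

theorem update_contractBranches {ι : Type} [LinearOrder ι] {c : ι → C} {J : Finset ι}
    {e : C} (t t' : CobarTree A b e) (ts : ∀ i, CobarTree A b (c i)) :
    Function.update (contractBranches (J := J) t ts) Contract.new t' = contractBranches t' ts := by
  funext o
  cases o with
  | new =>
    exact Function.update_self (β := fun o => CobarTree A b (Contract.color c J e o))
      Contract.new t' _
  | old i =>
    exact Function.update_of_ne (β := fun o => CobarTree A b (Contract.color c J e o))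
      (a := Contract.old i) (a' := Contract.new) (by simp) t' (contractBranches t ts)

theorem two_le_card_contract {ι : Type} [Fintype ι] [LinearOrder ι] {J : Finset ι}
    (hJ : J.card < Fintype.card ι) : 2 ≤ Fintype.card (Contract J) := by
  rw [Fintype.card_congr Contract.equivOption, Fintype.card_option]
  have h : Fintype.card {i // i ∉ J} = Fintype.card ι - J.card := by
    rw [Fintype.card_subtype_compl, Fintype.card_coe]
  omega

theorem mk_node_add {ι : Type} [Fintype ι] [LinearOrder ι] (hι : 2 ≤ Fintype.card ι) {c : ι → C}
    {d : C} (x y : A.obj c d) (ts : ∀ i, CobarTree A b (c i)) :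
    mk (CobarTree.node hι (x + y) ts) =
      mk (CobarTree.node hι x ts) + mk (CobarTree.node hι y ts) := by
  have h := (Submodule.Quotient.mk_eq_zero _).2 (Submodule.subset_span (R := K)
    (CobarTree.IsRelation.add hι x y ts))
  rw [Submodule.Quotient.mk_sub, Submodule.Quotient.mk_sub, sub_sub, sub_eq_zero] at h
  exact h

theorem mk_node_smul {ι : Type} [Fintype ι] [LinearOrder ι] (hι : 2 ≤ Fintype.card ι) {c : ι → C}
    {d : C} (r : K) (x : A.obj c d) (ts : ∀ i, CobarTree A b (c i)) :
    mk (CobarTree.node hι (r • x) ts) = r • mk (CobarTree.node hι x ts) := by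
  have h := (Submodule.Quotient.mk_eq_zero _).2 (Submodule.subset_span (R := K)
    (CobarTree.IsRelation.smul hι r x ts))
  rw [Submodule.Quotient.mk_sub, sub_eq_zero] at h
  rw [mk, h, mk, ← Submodule.Quotient.mk_smul, Finsupp.smul_single, smul_eq_mul, mul_one]

theorem plug_mk {ι : Type} [Fintype ι] [LinearOrder ι] (hι : 2 ≤ Fintype.card ι) {c : ι → C} {d : C}
    (x : A.obj c d) (ts : ∀ i, CobarTree A b (c i)) (i : ι) (t : CobarTree A b (c i)) :
    plug hι x ts i (mk t) = mk (CobarTree.node hι x (Function.update ts i t)) := by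
  simp only [plug, mk, Submodule.mapQ_apply, Finsupp.lmapDomain_apply, Finsupp.mapDomain_single]

theorem exists_mk_contractBranches {ι : Type} [Fintype ι] [LinearOrder ι] {c : ι → C} {d : C}
    {J : Finset ι} {e : C} (hι : 2 ≤ Fintype.card (Contract J)) (x : A.obj (Contract.color c J e) d)
    (ts : ∀ i, CobarTree A b (c i)) (t : CobarTree A b e) :
    ∃ L : Cobar A b e →ₗ[K] Cobar A b d, ∀ t' : CobarTree A b e,
      mk (CobarTree.node hι x (contractBranches t' ts)) = L (mk t') :=
  ⟨plug hι x (contractBranches t ts) Contract.new, fun t' =>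
    ((plug_mk hι x (contractBranches t ts) Contract.new t').trans
      (by rw [update_contractBranches])).symm⟩

/-- Splitting the root of a tree in two vertices: the lower one, decorated by the first factor, is
attached to the branches not in `J`, and its first input is attached to the upper one,
decorated by the second factor and carrying the branches in `J`. -/
def split {ι : Type} [Fintype ι] [LinearOrder ι] {c : ι → C} (d : C)
    (ts : ∀ i, CobarTree A b (c i)) (J : Finset ι) (e : C) (hJ : 2 ≤ J.card)
    (hJ' : J.card < Fintype.card ι) :
    A.obj (Contract.color c J e) d ⊗[K] A.obj (restrictColor c J) e →ₗ[K] Cobar A b d :=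
  TensorProduct.lift <| LinearMap.mk₂ K
    (fun x y => mk (CobarTree.node (two_le_card_contract hJ') x
      (contractBranches (CobarTree.node (by rwa [Fintype.card_coe]) y fun j => ts j) ts)))
    (fun x x' y => mk_node_add _ x x' _)
    (fun r x y => mk_node_smul _ r x _)
    (fun x y y' => by
      obtain ⟨L, hL⟩ := exists_mk_contractBranches (two_le_card_contract hJ') x ts
        (CobarTree.node (by rwa [Fintype.card_coe]) y fun j => ts j)
      rw [hL, hL, hL, mk_node_add, map_add])
    (fun r x y => by
      obtain ⟨L, hL⟩ := exists_mk_contractBranches (two_le_card_contract hJ') x ts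
        (CobarTree.node (by rwa [Fintype.card_coe]) y fun j => ts j)
      rw [hL, hL, mk_node_smul, map_smul])

/-- The differential of the cobar construction: the derivation of degree `1` determined on
the generators `s x` by `D (s x) = ∑ ± s x' ∘ s x''`, where `∑ x' ⊗ x''` runs over the
components of the partial cocomposition of `x` and the sign is `(-1) ^ deg x'`. The signs below
are those of the Koszul rule for a tree read from the root, the branches being taken in order. -/
structure IsDifferential [Fintype C] (D : ∀ d, Cobar A b d →ₗ[K] Cobar A b d) : Prop where
  leaf : ∀ k : κ, D (b k) (mk (CobarTree.leaf k)) = 0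
  node : ∀ {ι : Type} [Fintype ι] [LinearOrder ι] (hι : 2 ≤ Fintype.card ι) {c : ι → C} {d : C}
    (x : A.obj c d) (ts : ∀ i, CobarTree A b (c i)),
    D d (mk (CobarTree.node hι x ts)) =
      ∑ J : {J : Finset ι // 2 ≤ J.card ∧ J.card < Fintype.card ι}, ∑ e : C,
        ((A.deg (Contract.color c J.1 e) d).negOnePow * frontSign J.1 fun i => (ts i).deg) •
          split d ts J.1 e J.2.1 J.2.2 (A.decomp c J.1 d e x) +
      ∑ i, (A.deg c d + 1 + ∑ j with j < i, (ts j).deg).negOnePow •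
        plug hι x ts i (D (c i) (mk (ts i)))

end Cobar

/-! ### Koszul operads -/

namespace QuadraticData

variable {K : Type u} [Field K] {C : Type} [Fintype C] (Q : QuadraticData K C)

/-- The tree with a single vertex `g`, with inputs labelled by the two elements of `ι`. -/
def corolla {ι : Type} {c : ι → C} {d : C} {i j : ι} (hij : i ≠ j) (h : ∀ k, k = i ∨ k = j)
    (g : Q.Gen (c i) (c j) d) : Q.MTree c d :=
  ⟨Tree.node g (Tree.leaf i) (Tree.leaf j), by
    simpa [Tree.leaves, Multiset.nodup_add] using hij, fun k => by
    simpa [Tree.leaves] using h k⟩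

/-- The value at the generator `g` of an element of arity two of the Koszul dual cooperad. -/
def coefficient {ι : Type} [Fintype ι] [LinearOrder ι] {c : ι → C} {d : C}
    (x : Q.koszulDual.obj c d) {i j : ι} (hij : i < j) (h : ∀ k, k = i ∨ k = j)
    (g : Q.Gen (c i) (c j) d) : K :=
  (show Module.Dual K (Q.dual.Op c d) from x)
    (Q.dual.treeClass (Q.dual.corolla (c := c) hij.ne h g))

/-- The canonical map from the cobar construction of the Koszul dual cooperad to the operad presented
by `Q`: the morphism of operads that on generators is the projection to arity
two, where the (desuspended) Koszul dual cooperad is identified with the space of generators, and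
that vanishes on generators of higher arity. -/
structure IsCanonicalMap {κ : Type} (b : κ → C)
    (γ : ∀ d, Cobar Q.koszulDual b d →ₗ[K] Q.FreeAlg b d) : Prop where
  leaf : ∀ k : κ, γ (b k) (Cobar.mk (CobarTree.leaf k)) =
    Submodule.Quotient.mk (Finsupp.single (Tree.leaf k) 1)
  binary : ∀ {ι : Type} [Fintype ι] [LinearOrder ι] (hι : 2 ≤ Fintype.card ι) {c : ι → C} {d : C}
    (x : Q.koszulDual.obj c d) (ts : ∀ i, CobarTree Q.koszulDual b (c i)) {i j : ι} (hij : i < j)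
    (h : ∀ k, k = i ∨ k = j),
    γ d (Cobar.mk (CobarTree.node hι x ts)) =
      ∑ g : Q.Gen (c i) (c j) d, Q.coefficient x hij h g •
        Q.act g (γ (c i) (Cobar.mk (ts i))) (γ (c j) (Cobar.mk (ts j)))
  higher : ∀ {ι : Type} [Fintype ι] [LinearOrder ι] (hι : 2 ≤ Fintype.card ι) {c : ι → C} {d : C}
    (x : Q.koszulDual.obj c d) (ts : ∀ i, CobarTree Q.koszulDual b (c i)),
    2 < Fintype.card ι → γ d (Cobar.mk (CobarTree.node hι x ts)) = 0

/-- The component with inputs indexed by `κ`, of colours `b`, and output of colour `d`, of the cobar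
construction with differential `D` is a complex, `γ` restricts to a map of complexes from it to
the corresponding component of the operad, placed in degree zero, and this map induces an
isomorphism on cohomology. -/
structure IsQuasiIso {κ : Type} (b : κ → C)
    (D : ∀ d, Cobar Q.koszulDual b d →ₗ[K] Cobar Q.koszulDual b d)
    (γ : ∀ d, Cobar Q.koszulDual b d →ₗ[K] Q.FreeAlg b d) (d : C) : Prop where
  differential_mem : ∀ n, ∀ x ∈ Cobar.part Q.koszulDual b d n,
    D d x ∈ Cobar.part Q.koszulDual b d (n + 1)
  differential_sq : ∀ n, ∀ x ∈ Cobar.part Q.koszulDual b d n, D d (D d x) = 0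
  map_mem : ∀ x ∈ Cobar.part Q.koszulDual b d 0, γ d x ∈ LinearMap.range (Q.toFreeAlg b d)
  map_eq_zero : ∀ n, n ≠ 0 → ∀ x ∈ Cobar.part Q.koszulDual b d n, γ d x = 0
  map_differential : ∀ n, ∀ x ∈ Cobar.part Q.koszulDual b d n, γ d (D d x) = 0
  exact : ∀ n, n ≠ 0 → ∀ x ∈ Cobar.part Q.koszulDual b d n, D d x = 0 →
    ∃ y ∈ Cobar.part Q.koszulDual b d (n - 1), D d y = x
  injective : ∀ x ∈ Cobar.part Q.koszulDual b d 0, D d x = 0 → γ d x = 0 →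
    ∃ y ∈ Cobar.part Q.koszulDual b d (-1), D d y = x
  surjective : ∀ z : Q.Op b d, ∃ x ∈ Cobar.part Q.koszulDual b d 0,
    D d x = 0 ∧ γ d x = Q.toFreeAlg b d z

/-- The operad presented by `Q` is Koszul if the canonical map from the cobar construction of its
Koszul dual cooperad is a quasi-isomorphism. The differential of the cobar construction and the
canonical map are uniquely determined by their defining properties. -/
def IsKoszul : Prop :=
  ∀ {κ : Type} [Fintype κ] (b : κ → C),
    ∃ (D : ∀ d, Cobar Q.koszulDual b d →ₗ[K] Cobar Q.koszulDual b d)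
      (γ : ∀ d, Cobar Q.koszulDual b d →ₗ[K] Q.FreeAlg b d),
      Cobar.IsDifferential D ∧ Q.IsCanonicalMap b γ ∧ ∀ d, Q.IsQuasiIso b D γ d

end QuadraticData

/-! ### Algebras and modules -/

/-- The colours of the operads of pairs consisting of an algebra and a module over it. -/
inductive PairColor : Type
  | algebra
  | module
  deriving DecidableEq

instance : Fintype PairColor :=
  ⟨{PairColor.algebra, PairColor.module}, fun a => by cases a <;> simp⟩

/-- The generating operations for pairs `(A, M)`: a product `A ⊗ A → A`, an action `A ⊗ M → M`, and
the same action with its arguments in the other order, `M ⊗ A → M`. -/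
inductive PairGen : PairColor → PairColor → PairColor → Type
  | product : PairGen .algebra .algebra .algebra
  | action : PairGen .algebra .module .module
  | actionSwap : PairGen .module .algebra .module

namespace PairGen

instance (a b d : PairColor) : Subsingleton (PairGen a b d) :=
  ⟨fun g h => by cases g <;> cases h <;> rfl⟩

instance (a b d : PairColor) : Fintype (PairGen a b d) := Fintype.ofFinite _

/-- The action of the transposition, up to sign. -/
def swap : ∀ {a b d : PairColor}, PairGen a b d → PairGen b a d
  | _, _, _, product => product
  | _, _, _, action => actionSwap
  | _, _, _, actionSwap => action

/-- The generators, on which the transposition acts with the sign `ε`: the product `x * y` satisfies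
`x * y = ε • y * x`, and the two forms of the action satisfy `x ⬝ v = ε • v ⬝ x`. -/
def generators (ε : ℤˣ) : Generators PairColor where
  Gen := PairGen
  swap := swap
  swap_swap g := by cases g <;> rfl
  sign _ := ε
  sign_swap _ := rfl

end PairGen

theorem PairGen.sum_flip {K : Type u} [Field K] {ε : ℤˣ} {a b c d : PairColor}
    (p : (PairGen.generators ε).Mono a b c d → K) :
    ∑ m : (PairGen.generators ε).Mono b a c d, p ⟨m.1, m.2.1, (PairGen.generators ε).swap m.2.2⟩ =
      ∑ m, p m :=
  Fintype.sum_equiv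
    ⟨fun m => ⟨m.1, m.2.1, (PairGen.generators ε).swap m.2.2⟩,
      fun m => ⟨m.1, m.2.1, (PairGen.generators ε).swap m.2.2⟩,
      fun m => by simp only [Generators.swap_swap],
      fun m => by simp only [Generators.swap_swap]⟩
    _ _ fun _ => rfl

/-- The two-coloured operad `comm⁺` of pairs consisting of a commutative (associative, not
necessarily unital) algebra and a module over it. The product is commutative, and the relations
are the linear combinations with vanishing sum of coefficients of the monomials
`(x y) z`, `(y z) x`, `(z x) y`, for `x`, `y`, `z` all in the algebra or exactly one
of them in the module; that is, these three monomials are equal. In the presence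
of commutativity this is associativity of the product, respectively
`(x y) v = x (y v) = y (x v)`. -/
def commPlus (K : Type u) [Field K] : QuadraticData K PairColor where
  toGenerators := PairGen.generators 1
  Rel a b c d :=
    { carrier := {w | ∑ m, w.1 m + ∑ m, w.2.1 m + ∑ m, w.2.2 m = 0}
      add_mem' := by
        intro v w hv hw
        have h := congrArg₂ (· + ·) hv hw
        change ∑ m, (v.1 m + w.1 m) + ∑ m, (v.2.1 m + w.2.1 m) + ∑ m, (v.2.2 m + w.2.2 m) = 0
        simp only [Finset.sum_add_distrib] at h ⊢
        linear_combination h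
      zero_mem' := by
        change ∑ m, (0 : K) + ∑ m, (0 : K) + ∑ m, (0 : K) = 0
        simp
      smul_mem' := by
        intro k w hw
        have h := congrArg (k * ·) hw
        change ∑ m, k * w.1 m + ∑ m, k * w.2.1 m + ∑ m, k * w.2.2 m = 0
        simp only [← Finset.mul_sum] at h ⊢
        linear_combination h }
  rot_mem w hw := by
    change ∑ m, w.2.1 m + ∑ m, w.2.2 m + ∑ m, w.1 m = 0
    change ∑ m, w.1 m + ∑ m, w.2.1 m + ∑ m, w.2.2 m = 0 at hw
    linear_combination hw
  flip_mem w hw := by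
    change ∑ m, w.1 m + ∑ m, w.2.1 m + ∑ m, w.2.2 m = 0 at hw
    change ∑ m, (1 : ℤˣ) • w.1 _ + ∑ m, (1 : ℤˣ) • w.2.2 _ + ∑ m, (1 : ℤˣ) • w.2.1 _ = 0
    simp only [one_smul]
    rw [PairGen.sum_flip, PairGen.sum_flip, PairGen.sum_flip]
    linear_combination hw

/-- The two-coloured operad `lie⁺` of pairs consisting of a Lie algebra and a module over it.
The bracket is antisymmetric, and the relations are spanned by the sum of all the monomials
`[[x, y], z]`, `[[y, z], x]`, `[[z, x], y]`, for `x`, `y`, `z` all in the Lie algebra or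
exactly one of them in the module. This is the Jacobi identity, respectively
`[x, y] v = x (y v) - y (x v)`, where `[v, x] = - x v` for `v` in the module. -/
def liePlus (K : Type u) [Field K] : QuadraticData K PairColor where
  toGenerators := PairGen.generators (-1)
  Rel _ _ _ _ := Submodule.span K {(fun _ => 1, fun _ => 1, fun _ => 1)}
  rot_mem w hw := by
    obtain ⟨k, rfl⟩ := Submodule.mem_span_singleton.1 hw
    exact Submodule.mem_span_singleton.2 ⟨k, rfl⟩
  flip_mem w hw := by
    obtain ⟨k, rfl⟩ := Submodule.mem_span_singleton.1 hw
    refine Submodule.mem_span_singleton.2 ⟨-k, ?_⟩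
    have h : -k * 1 = (-1 : ℤˣ) • (k * 1) := by rw [Units.neg_smul, one_smul, neg_mul]
    exact Prod.ext (funext fun _ => h) (Prod.ext (funext fun _ => h) (funext fun _ => h))

/-- The two-coloured cooperad `colie⁺` of pairs consisting of a Lie coalgebra and a comodule over it:
the linear dual of `lie⁺`. -/
def coliePlus (K : Type u) [Field K] : GradedCooperad K PairColor :=
  (liePlus K).dualCooperad

end ColoredKoszul

end

/-!
The space of relations of `comm⁺` has the multiples of the Jacobi identity as its annihilator
(`commDual_rel`). The quadratic dual of `comm⁺` is therefore equal to `lie⁺` (`commDual_eq_liePlus`),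
and the isomorphism of cooperads is the identity. What remains is the acyclicity of the cobar
construction.

*The cooperad.* An element of the Koszul dual cooperad is a function `val` on the bracketings of its
inputs. If the input `i` has the colour of the output and all others are of the colour of the algebra
(`Based`), each bracketing expands in right-normed brackets that act on `i`, so that the element is a
function on the words in the other inputs (`val_eq_wordForm`, `eq_zero_of_val_comb`). Such a function
can be extended by a new first letter (`pre`), each element is a sum of extensions
(`exists_eq_sum_pre`), and the extension commutes with the partial cocompositions that do not involve
the new letter (`dec_pre`).

*The differential.* After multiplication of each tree by `rootSign` a vertex becomes a graded
symmetric operation of degree one on its branches in their shifted degrees (`nd_perm`). In these terms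
`D_D` is coassociativity (`dec_nested`, `dec_disjoint`) together with the compatibility of signs, and
`γ_D` reduces by induction to roots with three inputs, where it is the Jacobi identity (`γ_rootPart_fin_three`).

*The homotopy.* A nonzero tree has a leaf `k₀` of the colour of its root (`leaf_color`). The trees are
filtered by the number of inputs on the path from the root to `k₀`, the `trunk`. The homotopy takes a
tree with a binary root with branches `T` and `t`, where `k₀` is a leaf of `t`, to the tree obtained
from `t` by adding `T` to the root as a new first letter, with the input towards `k₀` as base point.
Modulo trees with a shorter trunk, the differential of the latter tree is, up to sign, the given
tree plus terms in which `T` stays the first letter (`D_prefixed`).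
Hence `D h + h D - 1` lowers the filtration as long as the trunk is longer than one
(`homotopyError_mem_fil`), and a cocycle is cohomologous to one made of trees with a binary root that
has `k₀` as its second branch (`exists_addLeaf_eq`). These form the complex for one leaf less, so by
induction a cocycle is a coboundary if the coefficients of its image in `comm⁺` add up to zero
(`exists_D_eq`). This is automatic outside degree zero, and in degree zero it is the injectivity of
the map induced by `γ` (`isQuasiIso`).
-/

open scoped TensorProduct

noncomputable section

namespace ColoredKoszul

universe u

open Contract (color new old)
open LinearMap (comp_apply)
open Function (update update_self update_of_ne update_comm)

/-! ### Words and commutators in a free associative algebra -/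

section Words

variable (K : Type u) [Field K] {ι κ : Type}

/-- The monomial of the free associative algebra spelled by a list of generators. -/
def word (w : List ι) : FreeAlgebra K ι := (w.map (FreeAlgebra.ι K)).prod

@[simp] theorem word_nil : word K ([] : List ι) = 1 := rfl

@[simp] theorem word_cons (i : ι) (w : List ι) : word K (i :: w) = FreeAlgebra.ι K i * word K w := by
  simp [word]

theorem word_append (v w : List ι) : word K (v ++ w) = word K v * word K w := by
  simp [word]

theorem word_singleton (i : ι) : word K [i] = FreeAlgebra.ι K i := by simp

theorem equivMonoidAlgebraFreeMonoid_word (w : List ι) :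
    FreeAlgebra.equivMonoidAlgebraFreeMonoid (word K w) =
      MonoidAlgebra.single (FreeMonoid.ofList w) (1 : K) := by
  induction w with
  | nil => rw [word_nil, map_one]; rfl
  | cons i w ih =>
    have h : FreeAlgebra.equivMonoidAlgebraFreeMonoid (FreeAlgebra.ι K i) =
        MonoidAlgebra.single (FreeMonoid.of i) (1 : K) := by
      simp [FreeAlgebra.equivMonoidAlgebraFreeMonoid, MonoidAlgebra.of_apply]
    rw [word_cons, map_mul, ih, h, MonoidAlgebra.single_mul_single, mul_one]
    rfl

theorem basisFreeMonoid_apply (w : FreeMonoid ι) :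
    FreeAlgebra.basisFreeMonoid K ι w = word K w.toList := by
  rw [FreeAlgebra.basisFreeMonoid, Module.Basis.map_apply, LinearEquiv.symm_apply_eq,
    LinearEquiv.trans_apply]
  change _ = MonoidAlgebra.coeffLinearEquiv K
    (FreeAlgebra.equivMonoidAlgebraFreeMonoid (word K w.toList))
  rw [equivMonoidAlgebraFreeMonoid_word]
  simp

variable {K}

/-- The linear map on the free algebra with prescribed values on words. -/
def wordLift {V : Type*} [AddCommGroup V] [Module K V] (f : List ι → V) : FreeAlgebra K ι →ₗ[K] V :=
  (FreeAlgebra.basisFreeMonoid K ι).constr K fun w => f w.toList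

@[simp] theorem wordLift_word {V : Type*} [AddCommGroup V] [Module K V] (f : List ι → V)
    (w : List ι) : wordLift (K := K) f (word K w) = f w := by
  have := (FreeAlgebra.basisFreeMonoid K ι).constr_basis K (fun w => f w.toList) (FreeMonoid.ofList w)
  rw [basisFreeMonoid_apply] at this
  exact this

theorem word_ext {V : Type*} [AddCommGroup V] [Module K V] {f g : FreeAlgebra K ι →ₗ[K] V}
    (h : ∀ w, f (word K w) = g (word K w)) : f = g :=
  (FreeAlgebra.basisFreeMonoid K ι).ext fun w => by
    rw [basisFreeMonoid_apply]; exact h _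

open Classical in
/-- The linear map removing a given last letter; words not ending in this letter are sent to zero. -/
def stripLast (i : ι) : FreeAlgebra K ι →ₗ[K] FreeAlgebra K ι :=
  wordLift fun w => if w.getLast? = some i then word K w.dropLast else 0

open Classical in
/-- The linear map removing a given first letter; words not starting with this letter are sent
to zero. -/
def stripFirst (i : ι) : FreeAlgebra K ι →ₗ[K] FreeAlgebra K ι :=
  wordLift fun w => if w.head? = some i then word K w.tail else 0

@[simp] theorem stripLast_one (i : ι) : stripLast i (1 : FreeAlgebra K ι) = 0 := by
  rw [← word_nil, stripLast, wordLift_word]; simp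

theorem stripLast_mul_ι_self (i : ι) (p : FreeAlgebra K ι) :
    stripLast i (p * FreeAlgebra.ι K i) = p := by
  have : stripLast i ∘ₗ LinearMap.mulRight K (FreeAlgebra.ι K i) = LinearMap.id := by
    refine word_ext fun w => ?_
    simp only [comp_apply, LinearMap.mulRight_apply, LinearMap.id_apply]
    rw [← word_singleton, ← word_append, stripLast, wordLift_word]
    simp
  exact LinearMap.congr_fun this p

theorem stripLast_mul_ι_of_ne {i j : ι} (h : j ≠ i) (p : FreeAlgebra K ι) :
    stripLast i (p * FreeAlgebra.ι K j) = 0 := by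
  have : stripLast i ∘ₗ LinearMap.mulRight K (FreeAlgebra.ι K j) = 0 := by
    refine word_ext fun w => ?_
    simp only [comp_apply, LinearMap.mulRight_apply, LinearMap.zero_apply]
    rw [← word_singleton, ← word_append, stripLast, wordLift_word]
    simp [h]
  exact LinearMap.congr_fun this p

theorem stripFirst_ι_self_mul (i : ι) (p : FreeAlgebra K ι) :
    stripFirst i (FreeAlgebra.ι K i * p) = p := by
  have : stripFirst i ∘ₗ LinearMap.mulLeft K (FreeAlgebra.ι K i) = LinearMap.id := by
    refine word_ext fun w => ?_
    simp only [comp_apply, LinearMap.mulLeft_apply, LinearMap.id_apply]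
    rw [← word_cons, stripFirst, wordLift_word]
    simp
  exact LinearMap.congr_fun this p

theorem stripFirst_ι_mul_of_ne {i j : ι} (h : j ≠ i) (p : FreeAlgebra K ι) :
    stripFirst i (FreeAlgebra.ι K j * p) = 0 := by
  have : stripFirst i ∘ₗ LinearMap.mulLeft K (FreeAlgebra.ι K j) = 0 := by
    refine word_ext fun w => ?_
    simp only [comp_apply, LinearMap.mulLeft_apply, LinearMap.zero_apply]
    rw [← word_cons, stripFirst, wordLift_word]
    simp [h]
  exact LinearMap.congr_fun this p

theorem word_concat (w : List ι) (i : ι) : word K (w ++ [i]) = word K w * FreeAlgebra.ι K i := by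
  rw [word_append, word_singleton]

/-- The span of the words that use the letters of `m`, with multiplicity. -/
def wordSpan (m : Multiset ι) : Submodule K (FreeAlgebra K ι) :=
  Submodule.span K {p | ∃ w : List ι, (w : Multiset ι) = m ∧ p = word K w}

theorem word_mem_wordSpan (w : List ι) : word K w ∈ wordSpan (K := K) (w : Multiset ι) :=
  Submodule.subset_span ⟨w, rfl, rfl⟩

theorem mul_mem_wordSpan {m n : Multiset ι} {p q : FreeAlgebra K ι} (hp : p ∈ wordSpan m)
    (hq : q ∈ wordSpan n) : p * q ∈ wordSpan (m + n) := by
  have h := Submodule.mul_mem_mul hp hq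
  rw [wordSpan, wordSpan, Submodule.span_mul_span] at h
  refine Submodule.span_mono ?_ h
  rintro _ ⟨_, ⟨v, rfl, rfl⟩, _, ⟨w, rfl, rfl⟩, rfl⟩
  exact ⟨v ++ w, by simp, (word_append K v w).symm⟩

theorem stripLast_mem_wordSpan {m : Multiset ι} {i : ι} {p : FreeAlgebra K ι}
    (hp : p ∈ wordSpan (i ::ₘ m)) : stripLast i p ∈ wordSpan (K := K) m := by
  refine Submodule.span_induction (p := fun p _ => stripLast i p ∈ wordSpan m) ?_ ?_ ?_ ?_ hp
  · rintro _ ⟨w, hw, rfl⟩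
    rcases List.eq_nil_or_concat w with rfl | ⟨v, j, rfl⟩
    · simp at hw
    · rw [List.concat_eq_append, word_concat]
      by_cases hj : j = i
      · subst hj
        rw [stripLast_mul_ι_self]
        have : m = (v : Multiset ι) := by
          rw [List.concat_eq_append, ← Multiset.coe_add, add_comm] at hw
          rw [Multiset.coe_singleton, Multiset.singleton_add] at hw
          exact ((Multiset.cons_inj_right j).1 hw).symm
        rw [this]; exact word_mem_wordSpan v
      · rw [stripLast_mul_ι_of_ne hj]; exact zero_mem _
  · rw [map_zero]; exact zero_mem _
  · intro p q _ _ hp hq; rw [map_add]; exact add_mem hp hq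
  · intro k p _ hp; rw [map_smul]; exact Submodule.smul_mem _ _ hp

/-- Two linear maps agree on a span of words if they agree on these words. -/
theorem eq_of_mem_wordSpan {V : Type*} [AddCommGroup V] [Module K V] {f g : FreeAlgebra K ι →ₗ[K] V}
    {m : Multiset ι} (h : ∀ w : List ι, (w : Multiset ι) = m → f (word K w) = g (word K w))
    {p : FreeAlgebra K ι} (hp : p ∈ wordSpan m) : f p = g p := by
  refine LinearMap.eqOn_span (f := f) (g := g) ?_ hp
  rintro _ ⟨w, hw, rfl⟩
  exact h w hw

end Words

/-! ### Uncoloured binary trees -/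

/-- Induction on binary trees, phrased with the product. -/
theorem magma_induction {ι : Type} {P : FreeMagma ι → Prop} (hof : ∀ i, P (FreeMagma.of i))
    (hmul : ∀ s t, P s → P t → P (s * t)) (u : FreeMagma ι) : P u :=
  FreeMagma.recOnMul u hof hmul

section Magma

variable {K : Type u} [Field K] {ι κ μ : Type}

/-- The labels of the leaves of a binary tree. -/
def labels : FreeMagma ι → Multiset ι
  | .of i => {i}
  | .mul s t => labels s + labels t

@[simp] theorem labels_of (i : ι) : labels (FreeMagma.of i) = {i} := rfl
@[simp] theorem labels_mul (s t : FreeMagma ι) : labels (s * t) = labels s + labels t := rfl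

/-- Substitution of trees for the leaves of a tree. -/
def subst (f : ι → FreeMagma κ) : FreeMagma ι → FreeMagma κ
  | .of i => f i
  | .mul s t => subst f s * subst f t

@[simp] theorem subst_of (f : ι → FreeMagma κ) (i : ι) : subst f (FreeMagma.of i) = f i := rfl
@[simp] theorem subst_mul (f : ι → FreeMagma κ) (s t : FreeMagma ι) :
    subst f (s * t) = subst f s * subst f t := rfl

/-- Renaming of the leaves of a tree. -/
abbrev rename (f : ι → κ) (u : FreeMagma ι) : FreeMagma κ := subst (fun i => FreeMagma.of (f i)) u

theorem subst_subst (f : ι → FreeMagma κ) (g : κ → FreeMagma μ) (u : FreeMagma ι) :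
    subst g (subst f u) = subst (fun i => subst g (f i)) u := by
  induction u using magma_induction with
  | hof i => rfl
  | hmul s t hs ht => simp [hs, ht]

theorem subst_id (u : FreeMagma ι) : subst FreeMagma.of u = u := by
  induction u using magma_induction with
  | hof i => rfl
  | hmul s t hs ht => simp [hs, ht]

theorem labels_subst (f : ι → FreeMagma κ) (u : FreeMagma ι) :
    labels (subst f u) = (labels u).bind fun i => labels (f i) := by
  induction u using magma_induction with
  | hof i => simp
  | hmul s t hs ht => simp [hs, ht]

theorem labels_rename (f : ι → κ) (u : FreeMagma ι) : labels (rename f u) = (labels u).map f := by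
  rw [rename, labels_subst]; exact Multiset.bind_singleton _ _

variable (K) in
/-- The value of a tree, read as an iterated commutator, in the free associative algebra. -/
def assoc : FreeMagma ι → FreeAlgebra K ι
  | .of i => FreeAlgebra.ι K i
  | .mul s t => assoc s * assoc t - assoc t * assoc s

@[simp] theorem assoc_of (i : ι) : assoc K (FreeMagma.of i) = FreeAlgebra.ι K i := rfl
@[simp] theorem assoc_mul (s t : FreeMagma ι) :
    assoc K (s * t) = assoc K s * assoc K t - assoc K t * assoc K s := rfl

theorem assoc_mem_wordSpan (u : FreeMagma ι) : assoc K u ∈ wordSpan (K := K) (labels u) := by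
  induction u using magma_induction with
  | hof i =>
    rw [assoc_of, ← word_singleton]; exact word_mem_wordSpan [i]
  | hmul s t hs ht =>
    refine sub_mem (mul_mem_wordSpan hs ht) ?_
    rw [labels_mul, add_comm]
    exact mul_mem_wordSpan ht hs

theorem stripLast_mul_assoc (i : ι) (p : FreeAlgebra K ι) (u : FreeMagma ι) :
    stripLast i (p * assoc K u) = p * stripLast i (assoc K u) := by
  induction u using magma_induction generalizing p with
  | hof j =>
    by_cases h : j = i
    · subst h
      have := stripLast_mul_ι_self (K := K) j 1
      rw [one_mul] at this
      rw [assoc_of, stripLast_mul_ι_self, this, mul_one]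
    · have := stripLast_mul_ι_of_ne (K := K) h 1
      rw [one_mul] at this
      rw [assoc_of, stripLast_mul_ι_of_ne h, this, mul_zero]
  | hmul s t hs ht =>
    rw [assoc_mul, mul_sub, map_sub, map_sub, ← mul_assoc, ← mul_assoc, ht, hs, ht, hs, mul_sub,
      mul_assoc, mul_assoc]

theorem stripFirst_assoc_mul (i : ι) (p : FreeAlgebra K ι) (u : FreeMagma ι) :
    stripFirst i (assoc K u * p) = stripFirst i (assoc K u) * p := by
  induction u using magma_induction generalizing p with
  | hof j =>
    by_cases h : j = i
    · subst h
      have := stripFirst_ι_self_mul (K := K) j 1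
      rw [mul_one] at this
      rw [assoc_of, stripFirst_ι_self_mul, this, one_mul]
    · have := stripFirst_ι_mul_of_ne (K := K) h 1
      rw [mul_one] at this
      rw [assoc_of, stripFirst_ι_mul_of_ne h, this, zero_mul]
  | hmul s t hs ht =>
    rw [assoc_mul, sub_mul, map_sub, map_sub, mul_assoc, mul_assoc, ht, hs, ht, hs, sub_mul,
      mul_assoc, mul_assoc]

theorem stripLast_ι_self (i : ι) : stripLast i (FreeAlgebra.ι K i) = 1 := by
  have := stripLast_mul_ι_self (K := K) i 1
  rwa [one_mul] at this

theorem stripLast_assoc_eq_zero {i : ι} {u : FreeMagma ι} (h : i ∉ labels u) :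
    stripLast i (assoc K u) = 0 := by
  induction u using magma_induction with
  | hof j =>
    have := stripLast_mul_ι_of_ne (K := K) (i := i) (j := j) (by rintro rfl; simp at h) 1
    rwa [one_mul] at this
  | hmul s t hs ht =>
    simp only [labels_mul, Multiset.mem_add, not_or] at h
    rw [assoc_mul, map_sub, stripLast_mul_assoc, stripLast_mul_assoc, hs h.1, ht h.2]
    simp

theorem stripFirst_assoc_eq_zero {i : ι} {u : FreeMagma ι} (h : i ∉ labels u) :
    stripFirst i (assoc K u) = 0 := by
  induction u using magma_induction with
  | hof j =>
    have := stripFirst_ι_mul_of_ne (K := K) (i := i) (j := j) (by rintro rfl; simp at h) 1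
    rwa [mul_one] at this
  | hmul s t hs ht =>
    simp only [labels_mul, Multiset.mem_add, not_or] at h
    rw [assoc_mul, map_sub, stripFirst_assoc_mul, stripFirst_assoc_mul, hs h.1, ht h.2]
    simp

/-- The homomorphism of free algebras corresponding to a substitution. -/
def assocSubst (f : ι → FreeMagma κ) : FreeAlgebra K ι →ₐ[K] FreeAlgebra K κ :=
  FreeAlgebra.lift K fun i => assoc K (f i)

@[simp] theorem assocSubst_ι (f : ι → FreeMagma κ) (i : ι) :
    assocSubst f (FreeAlgebra.ι K i) = assoc K (f i) := by simp [assocSubst]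

theorem assoc_subst (f : ι → FreeMagma κ) (u : FreeMagma ι) :
    assoc K (subst f u) = assocSubst f (assoc K u) := by
  induction u using magma_induction with
  | hof i => simp
  | hmul s t hs ht => simp [hs, ht]

theorem assocSubst_assocSubst (f : ι → FreeMagma κ) (g : κ → FreeMagma μ) (p : FreeAlgebra K ι) :
    assocSubst g (assocSubst f p) = assocSubst (fun i => subst g (f i)) p := by
  have : (assocSubst g).comp (assocSubst f) = assocSubst (K := K) (fun i => subst g (f i)) := by
    ext i
    simp [assoc_subst]
  exact DFunLike.congr_fun this p

theorem assocSubst_of (p : FreeAlgebra K ι) : assocSubst FreeMagma.of p = p := by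
  have : assocSubst FreeMagma.of = AlgHom.id K (FreeAlgebra K ι) := by
    ext i; simp
  exact DFunLike.congr_fun this p

/-- If only the tree substituted for `j` contains the letter `i`, then removing a last letter `i`
after the substitution amounts to removing a last letter `j` before it. -/
theorem stripLast_assocSubst (f : ι → FreeMagma κ) {i : κ} {j : ι}
    (h : ∀ o, o ≠ j → i ∉ labels (f o)) (p : FreeAlgebra K ι) : stripLast i (assocSubst f p) =
      assocSubst f (stripLast j p) * stripLast i (assoc K (f j)) := by
  have : stripLast i ∘ₗ (assocSubst (K := K) f).toLinearMap =
      LinearMap.mulRight K (stripLast i (assoc K (f j))) ∘ₗ (assocSubst f).toLinearMap ∘ₗ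
        stripLast j := by
    refine word_ext fun w => ?_
    simp only [comp_apply, AlgHom.toLinearMap_apply, LinearMap.mulRight_apply]
    rcases List.eq_nil_or_concat w with rfl | ⟨v, o, rfl⟩
    · simp
    · rw [List.concat_eq_append, word_concat, map_mul, assocSubst_ι, stripLast_mul_assoc]
      by_cases ho : o = j
      · subst ho; rw [stripLast_mul_ι_self]
      · rw [stripLast_mul_ι_of_ne ho, stripLast_assoc_eq_zero (h o ho)]; simp
  exact LinearMap.congr_fun this p

/-- The right-normed iterated bracket of the letters of a word with a base point. -/
def comb (i : ι) : List ι → FreeMagma ι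
  | [] => FreeMagma.of i
  | j :: w => FreeMagma.of j * comb i w

theorem labels_comb (i : ι) (w : List ι) : labels (comb i w) = i ::ₘ (w : Multiset ι) := by
  induction w with
  | nil => rfl
  | cons j w ih =>
    rw [comb, labels_mul, ih, labels_of, Multiset.singleton_add, Multiset.cons_swap]; rfl

theorem stripLast_assoc_comb {i : ι} {w : List ι} (h : i ∉ w) :
    stripLast i (assoc K (comb i w)) = word K w := by
  induction w with
  | nil => simp [comb, stripLast_ι_self]
  | cons j w ih =>
    simp only [List.mem_cons, not_or] at h
    rw [comb, assoc_mul, map_sub, stripLast_mul_assoc, ih h.2, stripLast_mul_assoc,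
      stripLast_assoc_eq_zero (u := FreeMagma.of j) (by simpa using h.1)]
    simp

end Magma

/-! ### The quadratic dual of `comm⁺` -/

/-- The quadratic dual of `comm⁺`. -/
abbrev commDual (K : Type u) [Field K] : QuadraticData K PairColor := (commPlus K).dual

/-- The Koszul dual cooperad of `comm⁺`. -/
def koszulCoop (K : Type u) [Field K] : GradedCooperad K PairColor := (commPlus K).koszulDual

/-- The component of the Koszul dual cooperad with inputs of colours `c` and output of colour `d`. -/
local notation "Coop" K:max c:max d:max => GradedCooperad.obj (koszulCoop K) c d

section Dual

variable (K : Type u) [Field K]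

theorem PairGen.output_unique {a b d d' : PairColor} (g : PairGen a b d) (g' : PairGen a b d') :
    d = d' := by cases g <;> cases g' <;> rfl

/-- The colours of the inputs and of the output determine the monomial. -/
instance (a b c d : PairColor) (ε : ℤˣ) : Subsingleton ((PairGen.generators ε).Mono a b c d) := by
  refine ⟨?_⟩
  rintro ⟨e, g, h⟩ ⟨e', g', h'⟩
  obtain rfl : e = e' := PairGen.output_unique h h'
  obtain rfl : g = g' := Subsingleton.elim (α := PairGen _ _ _) _ _
  obtain rfl : h = h' := Subsingleton.elim (α := PairGen _ _ _) _ _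
  rfl

theorem PairGen.nonempty_mono_rot {a b c d : PairColor} {ε : ℤˣ}
    (m : (PairGen.generators ε).Mono a b c d) : Nonempty ((PairGen.generators ε).Mono b c a d) := by
  obtain ⟨e, g, h⟩ := m
  change PairGen e c d at g
  change PairGen a b e at h
  cases h <;> cases g
  · exact ⟨⟨.algebra, PairGen.product, PairGen.product⟩⟩
  · exact ⟨⟨.module, PairGen.actionSwap, PairGen.action⟩⟩
  · exact ⟨⟨.module, PairGen.actionSwap, PairGen.actionSwap⟩⟩
  · exact ⟨⟨.algebra, PairGen.action, PairGen.product⟩⟩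

theorem PairGen.card_mono_rot (a b c d : PairColor) (ε : ℤˣ) :
    Fintype.card ((PairGen.generators ε).Mono b c a d) =
      Fintype.card ((PairGen.generators ε).Mono a b c d) := by
  by_cases h : Nonempty ((PairGen.generators ε).Mono a b c d)
  · obtain ⟨m⟩ := h
    obtain ⟨m'⟩ := PairGen.nonempty_mono_rot m
    rw [Fintype.card_eq_one_iff_nonempty_unique.2 ⟨⟨⟨m⟩, fun _ => Subsingleton.elim _ _⟩⟩,
      Fintype.card_eq_one_iff_nonempty_unique.2 ⟨⟨⟨m'⟩, fun _ => Subsingleton.elim _ _⟩⟩]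
  · have h' : ¬ Nonempty ((PairGen.generators ε).Mono b c a d) := by
      rintro ⟨m⟩
      obtain ⟨m⟩ := PairGen.nonempty_mono_rot m
      exact h (PairGen.nonempty_mono_rot m)
    rw [not_nonempty_iff] at h h'
    rw [Fintype.card_eq_zero, Fintype.card_eq_zero]

theorem PairGen.sum_mono_eq {ε : ℤˣ} {a b c d : PairColor}
    (f : (PairGen.generators ε).Mono a b c d → K) (m : (PairGen.generators ε).Mono a b c d) :
    ∑ m, f m = f m :=
  Fintype.sum_subsingleton f m

/-- The relations of the quadratic dual of `comm⁺` are the multiples of the Jacobi identity. -/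
theorem commDual_rel (a b c d : PairColor) :
    (commDual K).Rel a b c d = Submodule.span K {(fun _ => 1, fun _ => 1, fun _ => 1)} := by
  ext w
  rw [Submodule.mem_span_singleton]
  constructor
  · intro hw
    by_cases h : Nonempty ((PairGen.generators 1).Mono a b c d)
    · obtain ⟨m⟩ := h
      obtain ⟨m'⟩ := PairGen.nonempty_mono_rot m
      obtain ⟨m''⟩ := PairGen.nonempty_mono_rot m'
      have hs {a b c d} (m : (PairGen.generators 1).Mono a b c d) (f) := PairGen.sum_mono_eq K f m
      -- The differences of two of the three monomials are relations of `comm⁺`.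
      have h₁ := hw ((fun _ => 1, fun _ => -1, fun _ => 0) : (commPlus K).Weight2 K a b c d) (by
        change ∑ _, (1 : K) + ∑ _, (-1 : K) + ∑ _, (0 : K) = 0
        rw [hs m, hs m', hs m'']; ring)
      have h₂ := hw ((fun _ => 0, fun _ => 1, fun _ => -1) : (commPlus K).Weight2 K a b c d) (by
        change ∑ _, (0 : K) + ∑ _, (1 : K) + ∑ _, (-1 : K) = 0
        rw [hs m, hs m', hs m'']; ring)
      simp only [Generators.Weight2.pairing] at h₁ h₂
      erw [hs m, hs m', hs m''] at h₁ h₂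
      refine ⟨w.1 m, ?_⟩
      refine Prod.ext (funext fun n => ?_) (Prod.ext (funext fun n => ?_) (funext fun n => ?_))
      · rw [show n = m from Subsingleton.elim (α := (PairGen.generators 1).Mono a b c d) _ _]
        exact mul_one _
      · rw [show n = m' from Subsingleton.elim (α := (PairGen.generators 1).Mono b c a d) _ _]
        change w.1 m * 1 = _
        linear_combination h₁
      · rw [show n = m'' from Subsingleton.elim (α := (PairGen.generators 1).Mono c a b d) _ _]
        change w.1 m * 1 = _
        linear_combination h₁ + h₂
    · have h' : ¬ Nonempty ((PairGen.generators 1).Mono b c a d) := by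
        rintro ⟨m⟩
        obtain ⟨m⟩ := PairGen.nonempty_mono_rot m
        exact h (PairGen.nonempty_mono_rot m)
      have h'' : ¬ Nonempty ((PairGen.generators 1).Mono c a b d) := fun ⟨m⟩ =>
        h (PairGen.nonempty_mono_rot m)
      refine ⟨0, Prod.ext (funext fun n => (h ⟨n⟩).elim)
        (Prod.ext (funext fun n => (h' ⟨n⟩).elim) (funext fun n => (h'' ⟨n⟩).elim))⟩
  · rintro ⟨k, rfl⟩ r hr
    refine (Generators.Weight2.pairing_smul (E := (commPlus K).toGenerators) k
      (fun _ => 1, fun _ => 1, fun _ => 1) r).trans ?_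
    change ∑ m, r.1 m + ∑ m, r.2.1 m + ∑ m, r.2.2 m = 0 at hr
    have : Generators.Weight2.pairing (E := (commPlus K).toGenerators)
      ((fun _ => 1, fun _ => 1, fun _ => 1) : (commPlus K).twistedDual.Weight2 K a b c d) r = 0 := by
      simp only [Generators.Weight2.pairing, one_mul]
      exact hr
    rw [this, mul_zero]

/-- The quadratic dual of `comm⁺` is `lie⁺`. -/
theorem commDual_eq_liePlus : (commDual K) = liePlus K := by
  have h := commDual_rel K
  have key : ∀ (R R' : ∀ a b c d : PairColor, Submodule K ((PairGen.generators (-1)).Weight2 K a b c d))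
      (_ : R = R') h₁ h₂ h₁' h₂',
      (⟨PairGen.generators (-1), R, h₁, h₂⟩ : QuadraticData K PairColor) =
        ⟨PairGen.generators (-1), R', h₁', h₂'⟩ := by
    rintro R _ rfl _ _ _ _; rfl
  exact key _ _ (funext fun a => funext fun b => funext fun c => funext fun d => h a b c d) _ _ _ _

end Dual

/-! ### Colours of binary trees -/

section Color

variable {K : Type u} [Field K] {ι κ : Type}

/-- A binary tree with leaves of colours `c` can be decorated by the generators for pairs of an
algebra and a module, with output of colour `d`. The decoration is then unique. -/
def HasColor (c : ι → PairColor) : FreeMagma ι → PairColor → Prop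
  | .of i, d => c i = d
  | .mul s t, d => ∃ a b, Nonempty (PairGen a b d) ∧ HasColor c s a ∧ HasColor c t b

@[simp] theorem hasColor_of {c : ι → PairColor} {i : ι} {d : PairColor} :
    HasColor c (FreeMagma.of i) d ↔ c i = d := Iff.rfl

@[simp] theorem hasColor_mul {c : ι → PairColor} {s t : FreeMagma ι} {d : PairColor} :
    HasColor c (s * t) d ↔ ∃ a b, Nonempty (PairGen a b d) ∧ HasColor c s a ∧ HasColor c t b :=
  Iff.rfl

theorem hasColor_subst {c : ι → PairColor} {c' : κ → PairColor} {f : ι → FreeMagma κ}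
    (hf : ∀ i, HasColor c' (f i) (c i)) {u : FreeMagma ι} {d : PairColor} (hu : HasColor c u d) :
    HasColor c' (subst f u) d := by
  induction u using magma_induction generalizing d with
  | hof i => rw [hasColor_of] at hu; subst hu; exact hf i
  | hmul s t hs ht =>
    obtain ⟨a, b, g, h₁, h₂⟩ := hu
    exact ⟨a, b, g, hs h₁, ht h₂⟩

/-- Each label is used exactly once. -/
def IsML (u : FreeMagma ι) : Prop := (labels u).Nodup ∧ ∀ i, i ∈ labels u

/-- The admissible trees: multilinear trees that can be coloured. -/
def Adm (c : ι → PairColor) (d : PairColor) (u : FreeMagma ι) : Prop := HasColor c u d ∧ IsML u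

/-- The binary tree underlying a decorated tree. -/
def erase {c : ι → PairColor} : ∀ {d : PairColor}, (commDual K).Tree c d → FreeMagma ι
  | _, .leaf i => FreeMagma.of i
  | _, .node _ s t => erase s * erase t

theorem labels_erase {c : ι → PairColor} {d : PairColor} (t : (commDual K).Tree c d) :
    labels (erase t) = t.leaves := by
  induction t with
  | leaf i => rfl
  | node g s t hs ht => simp [erase, QuadraticData.Tree.leaves, hs, ht]

theorem hasColor_erase {c : ι → PairColor} {d : PairColor} (t : (commDual K).Tree c d) :
    HasColor c (erase t) d := by
  induction t with
  | leaf i => rfl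
  | node g s t hs ht => exact ⟨_, _, ⟨g⟩, hs, ht⟩

theorem exists_erase_eq {c : ι → PairColor} {u : FreeMagma ι} {d : PairColor}
    (h : HasColor c u d) : ∃ t : (commDual K).Tree c d, erase t = u := by
  induction u using magma_induction generalizing d with
  | hof i => rw [hasColor_of] at h; subst h; exact ⟨.leaf i, rfl⟩
  | hmul s t hs ht =>
    obtain ⟨a, b, ⟨g⟩, h₁, h₂⟩ := h
    obtain ⟨s', rfl⟩ := hs h₁
    obtain ⟨t', rfl⟩ := ht h₂
    exact ⟨.node (Q := commDual K) g s' t', rfl⟩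

theorem erase_injective_aux {c : ι → PairColor} {d : PairColor} (s : (commDual K).Tree c d) :
    ∀ {d' : PairColor} (t : (commDual K).Tree c d'), erase s = erase t → d = d' ∧ s ≍ t := by
  induction s with
  | leaf i =>
    intro d' t h
    cases t with
    | leaf j => obtain rfl : i = j := by injection h
                exact ⟨rfl, HEq.rfl⟩
    | node g s t => cases h
  | node g s₁ s₂ h₁ h₂ =>
    intro d' t h
    cases t with
    | leaf j => cases h
    | node g' t₁ t₂ =>
      change FreeMagma.mul _ _ = FreeMagma.mul _ _ at h
      injection h with h h'
      obtain ⟨rfl, e₁⟩ := h₁ t₁ h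
      obtain ⟨rfl, e₂⟩ := h₂ t₂ h'
      obtain rfl := PairGen.output_unique g g'
      obtain rfl : g = g' := Subsingleton.elim (α := PairGen _ _ _) _ _
      rw [eq_of_heq e₁, eq_of_heq e₂]
      exact ⟨rfl, HEq.rfl⟩

theorem erase_injective {c : ι → PairColor} {d : PairColor} {s t : (commDual K).Tree c d}
    (h : erase s = erase t) : s = t := eq_of_heq (erase_injective_aux s t h).2

theorem erase_bind {c : ι → PairColor} {c' : κ → PairColor}
    (f : ∀ i, (commDual K).Tree c' (c i)) {d : PairColor} (t : (commDual K).Tree c d) :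
    erase (t.bind f) = subst (fun i => erase (f i)) (erase t) := by
  induction t with
  | leaf i => rfl
  | node g s t hs ht => simp [erase, QuadraticData.Tree.bind, hs, ht]

theorem adm_erase {c : ι → PairColor} {d : PairColor} (t : (commDual K).MTree c d) :
    Adm c d (erase t.1) :=
  ⟨hasColor_erase t.1, by rw [IsML, labels_erase]; exact t.2⟩

theorem Adm.exists_mTree {c : ι → PairColor} {d : PairColor} {u : FreeMagma ι} (h : Adm c d u) :
    ∃ t : (commDual K).MTree c d, erase t.1 = u := by
  obtain ⟨t, rfl⟩ := exists_erase_eq (K := K) h.1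
  exact ⟨⟨t, by have := h.2; rwa [IsML, labels_erase] at this⟩, rfl⟩

/-- The substitution in a tree with a new input of a tree with inputs in `J`. -/
def graftAt {J : Finset ι} (u : FreeMagma (Contract J)) (v : FreeMagma J) : FreeMagma ι :=
  subst (fun o => match o with
    | .new => rename Subtype.val v
    | .old i => FreeMagma.of (i : ι)) u

theorem erase_graft {J : Finset ι} {c : ι → PairColor} {d e : PairColor}
    (s : (commDual K).Tree (color c J e) d) (t : (commDual K).Tree (restrictColor c J) e) :
    erase (s.graft t) = graftAt (erase s) (erase t) := by
  rw [QuadraticData.Tree.graft, erase_bind, graftAt]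
  congr 1
  funext o
  cases o with
  | new => exact erase_bind _ _
  | old i => rfl

end Color

/-! ### Evaluation of elements of the cooperad at trees -/

section Val

variable {K : Type u} [Field K]

section

variable {ι : Type} [Fintype ι] [LinearOrder ι] {c : ι → PairColor} {d : PairColor}

/-- An element of the cooperad, as a linear form on the dual operad. -/
def toDual : Coop K c d ≃ₗ[K] Module.Dual K ((commDual K).Op c d) :=
  LinearEquiv.refl K (Module.Dual K ((commDual K).Op c d))

open Classical in
/-- The value of an element of the cooperad at a binary tree; it is zero if the tree is not
admissible. -/
def val (x : Coop K c d) (u : FreeMagma ι) : K :=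
  if h : Adm c d u then toDual x ((commDual K).treeClass h.exists_mTree.choose) else 0

theorem val_erase (x : Coop K c d) (t : (commDual K).MTree c d) :
    val x (erase t.1) = toDual x ((commDual K).treeClass t) := by
  rw [val, dif_pos (adm_erase t)]
  congr 2
  exact Subtype.ext (erase_injective (adm_erase t).exists_mTree.choose_spec)

theorem val_of_not_adm (x : Coop K c d) {u : FreeMagma ι} (h : ¬ Adm c d u) :
    val x u = 0 := dif_neg h

theorem val_add (x y : Coop K c d) (u : FreeMagma ι) : val (x + y) u = val x u + val y u := by
  by_cases h : Adm c d u
  · simp [val, h]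
  · simp [val, h]

theorem val_smul (k : K) (x : Coop K c d) (u : FreeMagma ι) : val (k • x) u = k * val x u := by
  by_cases h : Adm c d u
  · simp [val, h]
  · simp [val, h]

/-- The value at a tree, as a linear form. -/
def valAt (u : FreeMagma ι) : Coop K c d →ₗ[K] K where
  toFun x := val x u
  map_add' x y := val_add x y u
  map_smul' k x := val_smul k x u

@[simp] theorem valAt_apply (u : FreeMagma ι) (x : Coop K c d) :
    valAt u x = val x u := rfl

theorem obj_ext {x y : Coop K c d} (h : ∀ u, Adm c d u → val x u = val y u) : x = y := by
  apply toDual.injective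
  apply LinearMap.ext
  intro z
  obtain ⟨f, rfl⟩ := Submodule.Quotient.mk_surjective _ z
  induction f using Finsupp.induction_linear with
  | zero => rw [Submodule.Quotient.mk_zero, map_zero, map_zero]
  | add f g hf hg => rw [Submodule.Quotient.mk_add, map_add, map_add, hf, hg]
  | single t k =>
    have h' := h _ (adm_erase t)
    rw [val_erase, val_erase] at h'
    have e : (Finsupp.single t k : (commDual K).MTree c d →₀ K) = k • Finsupp.single t 1 := by simp
    rw [e, Submodule.Quotient.mk_smul, map_smul, map_smul]
    exact congrArg _ h'

end

theorem koszulCoop_deg {ι : Type} [Fintype ι] [LinearOrder ι] (c : ι → PairColor) (d : PairColor) :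
    (koszulCoop K).deg c d = 1 - (Fintype.card ι : ℤ) := by
  change 1 - (Fintype.card ι : ℤ) + 0 = _
  rw [add_zero]

/-- The action of a bijection that is compatible with given colours, before the suspension. -/
def pull₀ {ι κ : Type} [Fintype ι] [LinearOrder ι] [Fintype κ] [LinearOrder κ] (σ : ι ≃ κ)
    {c : ι → PairColor} {c' : κ → PairColor} (h : ∀ i, c i = c' (σ i)) (d : PairColor) :
    Coop K c' d →ₗ[K] Coop K c d :=
  (show c' ∘ σ = c from funext fun i => (h i).symm) ▸ (commDual K).dualCooperad.pull σ c' d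

theorem adm_rename_iff {ι κ : Type} (σ : ι ≃ κ) {c : ι → PairColor} {c' : κ → PairColor}
    (h : ∀ i, c i = c' (σ i)) {d : PairColor} {u : FreeMagma ι} :
    Adm c' d (rename σ u) ↔ Adm c d u := by
  have key : ∀ {ι κ : Type} (σ : ι ≃ κ) {c : ι → PairColor} {c' : κ → PairColor}
      (_ : ∀ i, c i = c' (σ i)) {u : FreeMagma ι}, Adm c d u → Adm c' d (rename σ u) := by
    intro ι κ σ c c' h u hu
    refine ⟨hasColor_subst (fun i => show HasColor c' (FreeMagma.of (σ i)) (c i) from (h i).symm)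
      hu.1, ?_⟩
    rw [IsML, labels_rename]
    refine ⟨hu.2.1.map σ.injective, fun k => Multiset.mem_map.2 ⟨σ.symm k, hu.2.2 _, by simp⟩⟩
  refine ⟨fun hu => ?_, key σ h⟩
  have := key σ.symm (c' := c) (fun i => by simp [h]) hu
  rwa [rename, rename, subst_subst, show (fun i => subst (fun i => FreeMagma.of (σ.symm i))
    (FreeMagma.of (σ i))) = FreeMagma.of from funext fun i => by simp, subst_id] at this

theorem val_pull₀ {ι κ : Type} [Fintype ι] [LinearOrder ι] [Fintype κ] [LinearOrder κ] (σ : ι ≃ κ)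
    {c : ι → PairColor} {c' : κ → PairColor} (h : ∀ i, c i = c' (σ i)) (d : PairColor)
    (x : Coop K c' d) (u : FreeMagma ι) : val (pull₀ σ h d x) u = val x (rename σ u) := by
  obtain rfl : c = c' ∘ σ := funext h
  by_cases hu : Adm (c' ∘ σ) d u
  · obtain ⟨t, rfl⟩ := hu.exists_mTree (K := K)
    have hm := (adm_rename_iff σ h).2 hu
    rw [val_erase]
    have e : rename σ (erase t.1) = erase (t.1.bind fun i => .leaf (c := c') (σ i)) := by
      rw [erase_bind]; rfl
    have ht : (t.1.bind fun i => .leaf (c := c') (σ i)).IsMultilinear := by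
      rw [QuadraticData.Tree.IsMultilinear, ← labels_erase, ← e]; exact hm.2
    rw [e, val_erase x ⟨_, ht⟩]
    change toDual x ((commDual K).relabel σ c' d ((commDual K).treeClass t)) = _
    congr 1
    simp [QuadraticData.relabel, QuadraticData.substitution, QuadraticData.treeClass,
      Submodule.mapQ_apply]
  · rw [val_of_not_adm _ hu, val_of_not_adm _ (mt (adm_rename_iff σ h).1 hu)]

theorem koszulCoop_pull {ι κ : Type} [Fintype ι] [LinearOrder ι] [Fintype κ] [LinearOrder κ]
    (σ : ι ≃ κ) (c' : κ → PairColor) (d : PairColor) (x : Coop K c' d) :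
    (koszulCoop K).pull σ c' d x =
      koszulSign σ (fun _ => 1) • pull₀ σ (c := c' ∘ σ) (fun _ => rfl) d x := rfl

/-- The partial cocomposition before the suspension. -/
def dec {ι : Type} [Fintype ι] [LinearOrder ι] (c : ι → PairColor) (J : Finset ι) (d e : PairColor) :
    Coop K c d →ₗ[K] Coop K (color c J e) d ⊗[K] Coop K (restrictColor c J) e :=
  (commDual K).dualCooperad.decomp c J d e

theorem koszulCoop_decomp {ι : Type} [Fintype ι] [LinearOrder ι] (c : ι → PairColor) (J : Finset ι)
    (d e : PairColor) (x : Coop K c d) :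
    (koszulCoop K).decomp c J d e x = frontSign J (fun _ => 1) • dec c J d e x := by
  change (frontSign J (fun _ => 1) * ((1 - (J.card : ℤ)) * 0).negOnePow) • dec c J d e x = _
  rw [mul_zero, Int.negOnePow_zero, mul_one]

/-- The value of a tensor at a pair of trees. -/
def valAt₂ {ι κ : Type} [Fintype ι] [LinearOrder ι] [Fintype κ] [LinearOrder κ]
    {c : ι → PairColor} {c' : κ → PairColor} {d d' : PairColor} (u : FreeMagma ι) (v : FreeMagma κ) :
    Coop K c d ⊗[K] Coop K c' d' →ₗ[K] K :=
  TensorProduct.dualDistrib K _ _ (valAt u ⊗ₜ valAt v)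

theorem valAt₂_tmul {ι κ : Type} [Fintype ι] [LinearOrder ι] [Fintype κ] [LinearOrder κ]
    {c : ι → PairColor} {c' : κ → PairColor} {d d' : PairColor} (u : FreeMagma ι) (v : FreeMagma κ)
    (x : Coop K c d) (y : Coop K c' d') : valAt₂ u v (x ⊗ₜ[K] y) = val x u * val y v :=
  TensorProduct.dualDistrib_apply _ _ _ _

theorem valAt₂_dec {ι : Type} [Fintype ι] [LinearOrder ι] {c : ι → PairColor} {J : Finset ι}
    {d e : PairColor} (x : Coop K c d) {u : FreeMagma (Contract J)} {v : FreeMagma J}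
    (hu : Adm (color c J e) d u) (hv : Adm (restrictColor c J) e v) :
    valAt₂ u v (dec c J d e x) = val x (graftAt u v) := by
  obtain ⟨s, rfl⟩ := hu.exists_mTree (K := K)
  obtain ⟨t, rfl⟩ := hv.exists_mTree (K := K)
  have key : ∀ τ : Coop K (color c J e) d ⊗[K]
      Coop K (restrictColor c J) e, valAt₂ (erase s.1) (erase t.1) τ =
      TensorProduct.dualDistribEquiv K ((commDual K).Op (color c J e) d)
        ((commDual K).Op (restrictColor c J) e) τ
        ((commDual K).treeClass s ⊗ₜ (commDual K).treeClass t) := by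
    have h : valAt₂ (erase s.1) (erase t.1) = (LinearMap.applyₗ
        ((commDual K).treeClass s ⊗ₜ[K] (commDual K).treeClass t)).comp
        (TensorProduct.dualDistribEquiv K ((commDual K).Op (color c J e) d)
          ((commDual K).Op (restrictColor c J) e)).toLinearMap :=
      TensorProduct.ext' fun x y => by
        refine (valAt₂_tmul _ _ x y).trans ?_
        rw [val_erase, val_erase]
        exact (TensorProduct.dualDistrib_apply (R := K) (toDual x) (toDual y) _ _).symm
    exact fun τ => LinearMap.congr_fun h τ
  rw [key, dec]
  change (TensorProduct.dualDistribEquiv K ((commDual K).Op (color c J e) d)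
        ((commDual K).Op (restrictColor c J) e) ((TensorProduct.dualDistribEquiv K _ _).symm _)) _ = _
  rw [LinearEquiv.apply_symm_apply, ← erase_graft,
    show s.1.graft t.1 = ((commDual K).graftM s t).1 from rfl, val_erase]
  change toDual x ((commDual K).comp c J d e ((commDual K).treeClass s) ((commDual K).treeClass t)) = _
  congr 1
  simp [QuadraticData.comp, QuadraticData.treeClass, QuadraticData.compTree, Submodule.mapQ_apply]

/-- A tensor is determined by its values at pairs of elements of separating families of
linear forms. -/
theorem tensor_ext {V W α β : Type*} [AddCommGroup V] [Module K V] [AddCommGroup W] [Module K W]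
    (f : α → Module.Dual K V) (g : β → Module.Dual K W) (hf : ∀ v, (∀ a, f a v = 0) → v = 0)
    (hg : ∀ w, (∀ b, g b w = 0) → w = 0) {τ : V ⊗[K] W}
    (h : ∀ a b, TensorProduct.dualDistrib K V W (f a ⊗ₜ g b) τ = 0) : τ = 0 := by
  have key : ∀ a, (TensorProduct.lid K W) (TensorProduct.map (f a) LinearMap.id τ) = 0 := by
    intro a
    refine hg _ fun b => ?_
    have e : g b ∘ₗ (TensorProduct.lid K W).toLinearMap ∘ₗ TensorProduct.map (f a) LinearMap.id =
        TensorProduct.dualDistrib K V W (f a ⊗ₜ g b) := TensorProduct.ext' fun v w => by simp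
    exact (LinearMap.congr_fun e τ).trans (h a b)
  classical
  let B := Module.Basis.ofVectorSpace K W
  apply (TensorProduct.equivFinsuppOfBasisRight (M := V) B).injective
  rw [map_zero]
  ext i
  refine hf _ fun a => ?_
  have e : f a ∘ₗ Finsupp.lapply i ∘ₗ (TensorProduct.equivFinsuppOfBasisRight (M := V) B).toLinearMap =
      B.coord i ∘ₗ (TensorProduct.lid K W).toLinearMap ∘ₗ TensorProduct.map (f a) LinearMap.id :=
    TensorProduct.ext' fun v w => by simp [mul_comm]
  refine (LinearMap.congr_fun e τ).trans ?_
  simp [key a]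

end Val

/-! ### Multilinear identities in free algebras -/

namespace QuadraticData

variable {K : Type u} [Field K] {C : Type} [Fintype C] (Q : QuadraticData K C)

/-- The class of a tree in the free algebra. -/
def cls {ι : Type} {c : ι → C} {d : C} (t : Q.Tree c d) : Q.FreeAlg c d :=
  Submodule.Quotient.mk (Finsupp.single t 1)

variable {Q}

theorem freeAlg_induction {ι : Type} {c : ι → C} {d : C} {P : Q.FreeAlg c d → Prop}
    (hcls : ∀ t, P (Q.cls t)) (hadd : ∀ x y, P x → P y → P (x + y)) (hsmul : ∀ (k : K) x, P x → P (k • x))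
    (h0 : P 0) (x : Q.FreeAlg c d) : P x := by
  obtain ⟨f, rfl⟩ := Submodule.Quotient.mk_surjective _ x
  induction f using Finsupp.induction_linear with
  | zero => exact h0
  | add f g hf hg => exact hadd _ _ hf hg
  | single t k =>
    have h := hsmul k _ (hcls t)
    rwa [cls, ← Submodule.Quotient.mk_smul, Finsupp.smul_single, smul_eq_mul, mul_one] at h

theorem freeAlg_hom_ext {ι : Type} {c : ι → C} {d : C} {V : Type*} [AddCommGroup V] [Module K V]
    {f g : Q.FreeAlg c d →ₗ[K] V} (h : ∀ t, f (Q.cls t) = g (Q.cls t)) : f = g := by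
  ext x
  exact h _

@[simp] theorem act_cls {ι : Type} {c : ι → C} {a b d : C} (g : Q.Gen a b d) (s : Q.Tree c a)
    (t : Q.Tree c b) : Q.act g (Q.cls s) (Q.cls t) = Q.cls (.node g s t) := by
  simp [act, actTree, cls, Submodule.mapQ_apply]

theorem act_swap {ι : Type} {c : ι → C} {a b d : C} (g : Q.Gen a b d) (x : Q.FreeAlg c a)
    (y : Q.FreeAlg c b) : Q.act g x y = Q.sign g • Q.act (Q.swap g) y x := by
  have : Q.act g = Q.sign g • (Q.act (c := c) (Q.swap g)).flip := by
    refine freeAlg_hom_ext fun s => freeAlg_hom_ext fun t => ?_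
    have h : Submodule.Quotient.mk (p := Q.relations c d) _ = 0 := (Submodule.Quotient.mk_eq_zero _).2
      (Submodule.subset_span (R := K) (IsRelation.symm (c := c) g s t))
    rw [Submodule.Quotient.mk_sub, sub_eq_zero] at h
    change Q.act g (Q.cls s) (Q.cls t) = Q.sign g • Q.act (Q.swap g) (Q.cls t) (Q.cls s)
    rw [act_cls, act_cls]
    refine h.trans ?_
    rw [Units.smul_def, Units.smul_def]
    exact map_zsmul (Q.relations c d).mkQ _ _
  exact LinearMap.congr_fun (LinearMap.congr_fun this x) y

/-- The quadratic relations hold for arbitrary arguments. -/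
theorem act_rel {ι : Type} {c : ι → C} {a₁ a₂ a₃ d : C} {w : Q.Weight2 K a₁ a₂ a₃ d}
    (hw : w ∈ Q.Rel a₁ a₂ a₃ d) (x : Q.FreeAlg c a₁) (y : Q.FreeAlg c a₂) (z : Q.FreeAlg c a₃) :
    ∑ m, w.1 m • Q.act m.2.1 (Q.act m.2.2 x y) z + ∑ m, w.2.1 m • Q.act m.2.1 (Q.act m.2.2 y z) x +
      ∑ m, w.2.2 m • Q.act m.2.1 (Q.act m.2.2 z x) y = 0 := by
  induction x using freeAlg_induction with
  | h0 => simp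
  | hsmul k x hx =>
    simp only [map_smul, LinearMap.smul_apply, smul_comm _ k, ← Finset.smul_sum, ← smul_add, hx,
      smul_zero]
  | hadd x x' hx hx' =>
    rw [← add_zero 0]
    nth_rw 1 [← hx]
    rw [← hx']
    simp only [map_add, LinearMap.add_apply, smul_add, Finset.sum_add_distrib]
    abel
  | hcls x =>
  induction y using freeAlg_induction with
  | h0 => simp
  | hsmul k y hy =>
    simp only [map_smul, LinearMap.smul_apply, smul_comm _ k, ← Finset.smul_sum, ← smul_add, hy,
      smul_zero]
  | hadd y y' hy hy' =>
    rw [← add_zero 0]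
    nth_rw 1 [← hy]
    rw [← hy']
    simp only [map_add, LinearMap.add_apply, smul_add, Finset.sum_add_distrib]
    abel
  | hcls y =>
  induction z using freeAlg_induction with
  | h0 => simp
  | hsmul k z hz =>
    simp only [map_smul, LinearMap.smul_apply, smul_comm _ k, ← Finset.smul_sum, ← smul_add, hz,
      smul_zero]
  | hadd z z' hz hz' =>
    rw [← add_zero 0]
    nth_rw 1 [← hz]
    rw [← hz']
    simp only [map_add, LinearMap.add_apply, smul_add, Finset.sum_add_distrib]
    abel
  | hcls z =>
    have h : Submodule.Quotient.mk (p := Q.relations c d) (Q.relator w x y z) = 0 :=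
      (Submodule.Quotient.mk_eq_zero _).2 (Submodule.subset_span (R := K) (IsRelation.quad (c := c) w hw x y z))
    have hs : ∀ {d : C} (k : K) (t : Q.Tree c d),
        Submodule.Quotient.mk (p := Q.relations c d) (Finsupp.single t k) = k • Q.cls t := by
      intro d k t
      rw [cls, ← Submodule.Quotient.mk_smul, Finsupp.smul_single, smul_eq_mul, mul_one]
    have hm : ∀ {d : C} (f : Q.Tree c d →₀ K),
        Submodule.Quotient.mk (p := Q.relations c d) f = (Q.relations c d).mkQ f := fun _ => rfl
    simp only [relator, hm, map_add, map_sum] at h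
    simp only [← hm, hs] at h
    simpa only [act_cls] using h

theorem toFreeAlg_treeClass {ι : Type} {c : ι → C} {d : C} (t : Q.MTree c d) :
    Q.toFreeAlg c d (Q.treeClass t) = Q.cls t.1 := by
  change Submodule.Quotient.mk (p := Q.relations c d)
    (Finsupp.lmapDomain K K Subtype.val (Finsupp.single t 1)) = _
  rw [Finsupp.lmapDomain_apply, Finsupp.mapDomain_single]
  rfl

theorem toFreeAlg_injective {ι : Type} (c : ι → C) (d : C) :
    Function.Injective (Q.toFreeAlg c d) := by
  intro x y h
  obtain ⟨f, rfl⟩ := Submodule.Quotient.mk_surjective _ x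
  obtain ⟨g, rfl⟩ := Submodule.Quotient.mk_surjective _ y
  change Submodule.Quotient.mk (p := Q.relations c d) (Finsupp.lmapDomain K K Subtype.val f) =
    Submodule.Quotient.mk (Finsupp.lmapDomain K K Subtype.val g) at h
  rw [Submodule.Quotient.eq, ← map_sub] at h
  exact (Submodule.Quotient.eq _).2 h

end QuadraticData

/-! ### Functionals on words -/

section OfAssoc

variable {K : Type u} [Field K] {ι : Type} {c : ι → PairColor}

/-- The value of formal sums of trees in the free associative algebra. -/
def assocTree (c : ι → PairColor) (d : PairColor) :
    ((commDual K).Tree c d →₀ K) →ₗ[K] FreeAlgebra K ι :=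
  Finsupp.lift _ K _ fun t => assoc K (erase t)

@[simp] theorem assocTree_single {d : PairColor} (t : (commDual K).Tree c d) (k : K) :
    assocTree c d (Finsupp.single t k) = k • assoc K (erase t) := by
  simp [assocTree]

theorem assocTree_eq_zero {d : PairColor} {f : (commDual K).Tree c d →₀ K}
    (hf : (commDual K).IsRelation c f) : assocTree c d f = 0 := by
  induction hf with
  | symm g s t =>
    have hs : (commDual K).sign g = -1 := rfl
    rw [hs, Units.neg_smul, one_smul, sub_neg_eq_add, map_add, assocTree_single, assocTree_single]
    simp [erase]
  | @quad a₁ a₂ a₃ d w hw x y z =>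
    rw [commDual_rel, Submodule.mem_span_singleton] at hw
    obtain ⟨k, rfl⟩ := hw
    have key : ∀ {a₁ a₂ a₃ : PairColor} (x : (commDual K).Tree c a₁) (y : (commDual K).Tree c a₂)
        (z : (commDual K).Tree c a₃), assocTree c d (∑ m : (commDual K).Mono a₁ a₂ a₃ d,
          Finsupp.single (.node m.2.1 (.node m.2.2 x y) z) (k * 1)) =
        Fintype.card ((PairGen.generators 1).Mono a₁ a₂ a₃ d) •
          (k • assoc K (erase x * erase y * erase z)) := by
      intro a₁ a₂ a₃ x y z
      rw [map_sum]
      simp only [assocTree_single, mul_one]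
      rw [← Finset.card_univ, ← Finset.sum_const]
      rfl
    have h : (commDual K).relator (k • ((fun _ => 1, fun _ => 1, fun _ => 1) :
        (commDual K).Weight2 K a₁ a₂ a₃ d)) x y z =
        ∑ m : (commDual K).Mono a₁ a₂ a₃ d,
          Finsupp.single (.node m.2.1 (.node m.2.2 x y) z) (k * 1) +
        ∑ m : (commDual K).Mono a₂ a₃ a₁ d,
          Finsupp.single (.node m.2.1 (.node m.2.2 y z) x) (k * 1) +
        ∑ m : (commDual K).Mono a₃ a₁ a₂ d,
          Finsupp.single (.node m.2.1 (.node m.2.2 z x) y) (k * 1) := rfl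
    rw [h, map_add, map_add, key, key, key, PairGen.card_mono_rot a₂ a₃ a₁ d,
      PairGen.card_mono_rot a₁ a₂ a₃ d, ← smul_add, ← smul_add, ← smul_add, ← smul_add]
    -- The commutator of a free associative algebra satisfies the Jacobi identity.
    have jac : assoc K (erase x * erase y * erase z) + assoc K (erase y * erase z * erase x) +
        assoc K (erase z * erase x * erase y) = 0 := by
      simp only [assoc_mul]; noncomm_ring
    rw [jac, smul_zero, smul_zero]
  | @left a b d g f t _ ih =>
    have h : assocTree c d ∘ₗ Finsupp.lmapDomain K K (fun s => .node (Q := commDual K) g s t) =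
        (LinearMap.mulRight K (assoc K (erase t)) - LinearMap.mulLeft K (assoc K (erase t))) ∘ₗ
          assocTree c a := by
      ext s
      simp [erase]
    refine (LinearMap.congr_fun h f).trans ?_
    simp [ih]
  | @right a b d g s f _ ih =>
    have h : assocTree c d ∘ₗ Finsupp.lmapDomain K K (fun t => .node (Q := commDual K) g s t) =
        (LinearMap.mulLeft K (assoc K (erase s)) - LinearMap.mulRight K (assoc K (erase s))) ∘ₗ
          assocTree c b := by
      ext t
      simp [erase]
    refine (LinearMap.congr_fun h f).trans ?_
    simp [ih]

variable [Fintype ι] [LinearOrder ι]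

/-- The element of the cooperad defined by a linear form on the free associative algebra. -/
def ofAssoc (c : ι → PairColor) (d : PairColor) (φ : FreeAlgebra K ι →ₗ[K] K) : Coop K c d :=
  toDual.symm (Submodule.liftQ _ (φ ∘ₗ assocTree c d ∘ₗ Finsupp.lmapDomain K K Subtype.val) (by
    have h : (commDual K).relations c d ≤ LinearMap.ker (assocTree c d) :=
      Submodule.span_le.2 fun f hf => assocTree_eq_zero hf
    intro f hf
    have h' := h hf
    rw [LinearMap.mem_ker] at h' ⊢
    rw [comp_apply, comp_apply, h', map_zero]))

theorem val_ofAssoc {d : PairColor} (φ : FreeAlgebra K ι →ₗ[K] K) {u : FreeMagma ι}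
    (hu : Adm c d u) : val (ofAssoc c d φ) u = φ (assoc K u) := by
  obtain ⟨t, rfl⟩ := hu.exists_mTree (K := K)
  rw [val_erase, ofAssoc, LinearEquiv.apply_symm_apply, QuadraticData.treeClass]
  simp

end OfAssoc

/-! ### The expansion of Lie elements with respect to a base point -/

section Based

variable {K : Type u} [Field K] {ι : Type} {c : ι → PairColor}

/-- The input `i` has the colour `d` of the output, and all others belong to the algebra. -/
def Based (c : ι → PairColor) (d : PairColor) (i : ι) : Prop :=
  c i = d ∧ ∀ j, j ≠ i → c j = .algebra

open QuadraticData

/-- The action of a generator on the free algebra over the dual operad. -/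
def lieAct {a b d : PairColor} (g : PairGen a b d) :
    (commDual K).FreeAlg c a →ₗ[K] (commDual K).FreeAlg c b →ₗ[K] (commDual K).FreeAlg c d :=
  (commDual K).act (a := a) (b := b) (d := d) g

theorem lieAct_cls {a b d : PairColor} (g : PairGen a b d) (s : (commDual K).Tree c a)
    (t : (commDual K).Tree c b) : lieAct g ((commDual K).cls s) ((commDual K).cls t) =
      (commDual K).cls (.node (Q := commDual K) g s t) :=
  act_cls (Q := commDual K) g s t

theorem lieAct_swap {a b d : PairColor} (g : PairGen a b d) (x : (commDual K).FreeAlg c b)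
    (y : (commDual K).FreeAlg c a) : lieAct g.swap x y = - lieAct g y x := by
  have e : - lieAct g y x = (-1 : ℤˣ) • lieAct g y x := by rw [Units.neg_smul, one_smul]
  rw [e]
  refine (act_swap (Q := commDual K) (a := b) (b := a) (d := d) g.swap x y).trans ?_
  have e : g.swap.swap = g := (PairGen.generators 1).swap_swap g
  change (-1 : ℤˣ) • lieAct g.swap.swap y x = _
  rw [e]

theorem lieAct_jacobi {d : PairColor} (g : PairGen .algebra d d)
    (x y : (commDual K).FreeAlg c .algebra) (z : (commDual K).FreeAlg c d) :
    lieAct g (lieAct PairGen.product x y) z =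
      lieAct g x (lieAct g y z) - lieAct g y (lieAct g x z) := by
  have hw : ((fun _ => 1, fun _ => 1, fun _ => 1) : (commDual K).Weight2 K .algebra .algebra d d) ∈
      (commDual K).Rel .algebra .algebra d d := by
    rw [commDual_rel]; exact Submodule.mem_span_singleton_self _
  have h := act_rel hw x y z
  simp only [one_smul] at h
  have s₁ := Fintype.sum_subsingleton (fun m : (PairGen.generators 1).Mono .algebra .algebra d d =>
    (commDual K).act m.2.1 ((commDual K).act m.2.2 x y) z) ⟨.algebra, g, PairGen.product⟩
  have s₂ := Fintype.sum_subsingleton (fun m : (PairGen.generators 1).Mono .algebra d .algebra d =>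
    (commDual K).act m.2.1 ((commDual K).act m.2.2 y z) x) ⟨d, g.swap, g⟩
  have s₃ := Fintype.sum_subsingleton (fun m : (PairGen.generators 1).Mono d .algebra .algebra d =>
    (commDual K).act m.2.1 ((commDual K).act m.2.2 z x) y) ⟨d, g.swap, g.swap⟩
  have h' : lieAct g (lieAct PairGen.product x y) z + lieAct g.swap (lieAct g y z) x +
    lieAct g.swap (lieAct g.swap z x) y = 0 :=
    (congrArg₂ (· + ·) (congrArg₂ (· + ·) s₁ s₂) s₃).symm.trans h
  rw [lieAct_swap, lieAct_swap, lieAct_swap, map_neg, neg_neg, add_assoc,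
    add_eq_zero_iff_eq_neg] at h'
  rw [h']
  abel

/-- The action of the free associative algebra on the colour `d` part of the free algebra. -/
def assocAct (c : ι → PairColor) (d : PairColor) :
    FreeAlgebra K ι →ₐ[K] Module.End K ((commDual K).FreeAlg c d) :=
  FreeAlgebra.lift K fun i => ∑ g : PairGen (c i) d d, lieAct g ((commDual K).cls (.leaf i))

theorem assocAct_ι {d : PairColor} (i : ι) (g : PairGen (c i) d d) :
    assocAct c d (FreeAlgebra.ι K i) = lieAct g ((commDual K).cls (.leaf i)) := by
  rw [assocAct, FreeAlgebra.lift_ι_apply]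
  exact Fintype.sum_subsingleton (fun g : PairGen (c i) d d =>
    lieAct g ((commDual K).cls (.leaf i))) g

theorem lieAct_cls_eq_assocAct {d e : PairColor} (s : (commDual K).Tree c e) (g : PairGen e d d) :
    lieAct g ((commDual K).cls s) = assocAct c d (assoc K (erase s)) := by
  induction s with
  | leaf i => exact (assocAct_ι i g).symm
  | @node a b e g' s t hs ht =>
    rw [erase, assoc_mul]
    change PairGen _ _ _ at g'
    obtain rfl : e = PairColor.algebra := by
      cases e <;> cases d <;> first | rfl | (cases g)
    cases g'
    rw [← lieAct_cls PairGen.product, map_sub, map_mul, map_mul, ← hs g, ← ht g]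
    refine LinearMap.ext fun z => ?_
    exact lieAct_jacobi g _ _ z

theorem HasColor.eq_algebra {u : FreeMagma ι} {a : PairColor} (h : HasColor c u a)
    (hu : ∀ i ∈ labels u, c i = .algebra) : a = .algebra := by
  induction u using magma_induction generalizing a with
  | hof i => rw [← hu i (by simp)]; exact h.symm
  | hmul s t hs ht =>
    obtain ⟨a', b', ⟨g⟩, h₁, h₂⟩ := h
    have := hs h₁ fun i hi => hu i (by simp [hi])
    have := ht h₂ fun i hi => hu i (by simp [hi])
    subst_vars
    cases g; rfl

/-- The class of a tree is obtained from its base point by the action of the words in its expansion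
that end in the base point. -/
theorem cls_eq_assocAct {i : ι} (hi : ∀ j, j ≠ i → c j = .algebra) {e : PairColor}
    (t : (commDual K).Tree c e) (h : c i = e) (hn : (labels (erase t)).Nodup)
    (hm : i ∈ labels (erase t)) :
    (commDual K).cls t = assocAct c e (stripLast i (assoc K (erase t)))
      (h ▸ (commDual K).cls (.leaf i)) := by
  induction t with
  | leaf j =>
    obtain rfl : i = j := by simpa [erase] using hm
    rw [erase, assoc_of, stripLast_ι_self, map_one]
    rfl
  | @node a b e g s t hs ht =>
    rw [erase, assoc_mul]
    change PairGen _ _ _ at g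
    simp only [erase, labels_mul, Multiset.nodup_add, Multiset.mem_add] at hn hm
    have alg : ∀ {a : PairColor} {s : (commDual K).Tree c a}, i ∉ labels (erase s) → a = .algebra :=
      fun {a s} his => (hasColor_erase s).eq_algebra fun j hj => hi j (by rintro rfl; exact his hj)
    rw [map_sub, stripLast_mul_assoc, stripLast_mul_assoc, ← lieAct_cls g]
    rcases hm with his | hit
    · have hit : i ∉ labels (erase t) := fun hit => Multiset.disjoint_left.1 hn.2.2 his hit
      obtain rfl := alg hit
      obtain rfl : e = a := by cases g <;> rfl
      rw [stripLast_assoc_eq_zero hit, mul_zero, zero_sub, map_neg, map_mul,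
        ← lieAct_cls_eq_assocAct t g.swap, LinearMap.neg_apply, Module.End.mul_apply,
        ← hs h hn.1 his, lieAct_swap, neg_neg]
    · have his : i ∉ labels (erase s) := fun his => Multiset.disjoint_left.1 hn.2.2 his hit
      obtain rfl := alg his
      obtain rfl : e = b := by cases g <;> rfl
      rw [stripLast_assoc_eq_zero his, mul_zero, sub_zero, map_mul,
        ← lieAct_cls_eq_assocAct s g, Module.End.mul_apply, ← ht h hn.2.1 hit]

theorem hasColor_comb {i : ι} (hi : ∀ j, j ≠ i → c j = .algebra) {w : List ι} (hw : i ∉ w) :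
    HasColor c (comb i w) (c i) := by
  induction w with
  | nil => rfl
  | cons j w ih =>
    simp only [List.mem_cons, not_or] at hw
    refine ⟨.algebra, c i, ?_, hi j (Ne.symm hw.1), ih hw.2⟩
    cases c i
    · exact ⟨.product⟩
    · exact ⟨.action⟩

theorem isML_comb {i : ι} {w : List ι} (hw : (i ::ₘ (w : Multiset ι)).Nodup)
    (hw' : ∀ j, j ∈ i ::ₘ (w : Multiset ι)) : IsML (comb i w) := by
  rw [IsML, labels_comb]; exact ⟨hw, hw'⟩

variable [Fintype ι] [LinearOrder ι] {d : PairColor}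

/-- The coefficients of an element of the cooperad at the words with base point `i`. -/
def wordForm (i : ι) (x : Coop K c d) : FreeAlgebra K ι →ₗ[K] K :=
  wordLift fun w => val x (comb i w)

@[simp] theorem wordForm_word (i : ι) (x : Coop K c d) (w : List ι) :
    wordForm i x (word K w) = val x (comb i w) := wordLift_word _ _

/-- An element of the cooperad is determined by its coefficients at words with a base point. -/
theorem val_eq_wordForm {i : ι} (h : Based c d i) (x : Coop K c d) {u : FreeMagma ι}
    (hu : Adm c d u) : val x u = wordForm i x (stripLast i (assoc K u)) := by
  obtain ⟨π, hπ⟩ := ((commDual K).toFreeAlg c d).exists_leftInverse_of_injective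
    (LinearMap.ker_eq_bot.2 (toFreeAlg_injective c d))
  have hval : ∀ t : (commDual K).MTree c d, val x (erase t.1) =
      toDual x (π ((commDual K).cls t.1)) := by
    intro t
    rw [val_erase, ← toFreeAlg_treeClass]
    exact congrArg _ (LinearMap.congr_fun hπ _).symm
  obtain ⟨m, hm⟩ := Multiset.exists_cons_of_mem (hu.2.2 i)
  have him : i ∉ m := by
    have := hu.2.1; rw [hm, Multiset.nodup_cons] at this; exact this.1
  have key : ∀ v : FreeMagma ι, Adm c d v → val x v = (toDual x ∘ₗ π ∘ₗ
      LinearMap.applyₗ (h.1 ▸ (commDual K).cls (.leaf i)) ∘ₗ (assocAct c d).toLinearMap)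
        (stripLast i (assoc K v)) := by
    intro v hv
    obtain ⟨t, rfl⟩ := hv.exists_mTree (K := K)
    rw [hval, cls_eq_assocAct h.2 t.1 h.1 hv.2.1 (hv.2.2 i)]
    rfl
  rw [key u hu]
  refine eq_of_mem_wordSpan (m := m) (fun w hw => ?_)
    (stripLast_mem_wordSpan (by rw [← hm]; exact assoc_mem_wordSpan u))
  have hiw : i ∉ w := by rw [← hw] at him; exact him
  rw [wordForm_word, key (comb i w), stripLast_assoc_comb hiw]
  refine ⟨?_, isML_comb (by rw [hw, ← hm]; exact hu.2.1) (by rw [hw, ← hm]; exact hu.2.2)⟩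
  have := hasColor_comb h.2 hiw
  rwa [h.1] at this

end Based

/-! ### Koszul signs -/

section

variable {ι : Type} [LinearOrder ι] {J : Finset ι}

theorem Contract.new_lt_old (i : {i // i ∉ J}) : (new : Contract J) < old i :=
  WithBot.bot_lt_coe _

theorem Contract.old_lt_old {i j : {i // i ∉ J}} :
    (old i : Contract J) < old j ↔ (i : ι) < j := WithBot.coe_lt_coe

theorem Contract.not_old_lt_new (i : {i // i ∉ J}) :
    ¬ (old i : Contract J) < new := (new_lt_old i).not_gt

end

open Contract (old_lt_old new_lt_old not_old_lt_new)

section Signs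

open Finset

variable {ι κ : Type} [Fintype ι] [LinearOrder ι] [Fintype κ] [LinearOrder κ]

/-- Two products over ordered pairs agree if the contributions of each unordered pair do. -/
theorem prod_pair_ext {F G : ι → ι → ℤˣ} (hd : ∀ a, F a a = G a a)
    (h : ∀ a b, a < b → F a b * F b a = G a b * G b a) : ∏ a, ∏ b, F a b = ∏ a, ∏ b, G a b := by
  have key : ∀ F : ι → ι → ℤˣ, ∏ a, ∏ b, F a b =
      (∏ a, F a a) * ∏ a, ∏ b, if a < b then F a b * F b a else 1 := by
    intro F
    have h₁ : ∀ a b, F a b = (if a = b then F a b else 1) *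
        ((if a < b then F a b else 1) * (if b < a then F a b else 1)) := by
      intro a b
      rcases lt_trichotomy a b with h | h | h
      · simp [h, h.ne, h.le]
      · simp [h]
      · simp [h, h.ne', h.le]
    have h₂ : ∏ a, ∏ b, (if b < a then F a b else (1 : ℤˣ)) =
        ∏ a, ∏ b, (if a < b then F b a else 1) :=
      Finset.prod_comm
    calc ∏ a, ∏ b, F a b = ∏ a, ∏ b, ((if a = b then F a b else 1) *
        ((if a < b then F a b else 1) * (if b < a then F a b else 1))) :=
          prod_congr rfl fun a _ => prod_congr rfl fun b _ => h₁ a b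
      _ = (∏ a, F a a) * ((∏ a, ∏ b, if a < b then F a b else 1) *
            ∏ a, ∏ b, if a < b then F b a else 1) := by
          simp only [prod_mul_distrib, h₂]
          simp
      _ = _ := by
          rw [← prod_mul_distrib]
          refine congrArg _ (prod_congr rfl fun a _ => ?_)
          rw [← prod_mul_distrib]
          refine prod_congr rfl fun b _ => ?_
          split_ifs <;> simp
  rw [key F, key G]
  congr 1
  · exact prod_congr rfl fun a _ => hd a
  · refine prod_congr rfl fun a _ => prod_congr rfl fun b _ => ?_
    split_ifs with hab
    · exact h a b hab
    · rfl

omit [Fintype κ] in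
theorem koszulSign_eq (σ : ι ≃ κ) (n : κ → ℤ) : koszulSign σ n =
    ∏ a, ∏ b, if a < b ∧ σ b < σ a then (n (σ a) * n (σ b)).negOnePow else 1 := by
  rw [koszulSign, prod_filter, Fintype.prod_prod_type]

theorem frontSign_eq (J : Finset ι) (n : ι → ℤ) : frontSign J n =
    ∏ a, ∏ b, if a < b ∧ a ∉ J ∧ b ∈ J then (n a * n b).negOnePow else 1 := by
  rw [frontSign, prod_filter, Fintype.prod_prod_type]

/-- The sign by which a vertex of the cobar construction is normalised, where `N i` is the
degree of the `i`-th branch plus one. After this normalisation all signs are those of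
graded symmetric operations of degree one on the branches in the shifted degrees. -/
def rootSign (N : ι → ℤ) : ℤˣ :=
  ((Fintype.card ι : ℤ) - 1).negOnePow * ∏ a, ∏ b, if a < b then (N a).negOnePow else 1

theorem negOnePow_sum {α : Type*} (s : Finset α) (f : α → ℤ) :
    (∑ i ∈ s, f i).negOnePow = ∏ i ∈ s, (f i).negOnePow := by
  classical
  induction s using Finset.induction_on with
  | empty => simp
  | insert a s ha ih => rw [sum_insert ha, prod_insert ha, Int.negOnePow_add, ih]

theorem negOnePow_mul_congr {a b : ℤ} (h : a.negOnePow = b.negOnePow) (m : ℤ) :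
    (a * m).negOnePow = (b * m).negOnePow := by
  rw [Int.negOnePow_eq_iff] at h ⊢
  rw [← sub_mul]; exact h.mul_right m

theorem rootSign_perm (σ : ι ≃ κ) (N : κ → ℤ) :
    koszulSign σ (fun k => N k - 1) * koszulSign σ (fun _ => 1) * rootSign (fun i => N (σ i)) =
      koszulSign σ N * rootSign N := by
  have hc : Fintype.card ι = Fintype.card κ := Fintype.card_congr σ
  have h₁ : ∏ a : κ, ∏ b : κ, (if a < b then (N a).negOnePow else 1) =
      ∏ a : ι, ∏ b : ι, if σ a < σ b then (N (σ a)).negOnePow else 1 := by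
    rw [← Equiv.prod_comp σ]
    exact prod_congr rfl fun a _ => (Equiv.prod_comp σ _).symm
  rw [rootSign, rootSign, h₁, hc, mul_left_comm, mul_left_comm (koszulSign σ N)]
  congr 1
  rw [koszulSign_eq, koszulSign_eq, koszulSign_eq]
  simp only [← prod_mul_distrib]
  refine prod_pair_ext (fun a => by simp) fun a b hab => ?_
  rcases (σ.injective.ne hab.ne).lt_or_gt with h | h
  · simp [hab, hab.not_gt, h, h.not_gt]
  · simp only [hab, hab.not_gt, h, h.not_gt, true_and, false_and, if_true, if_false,
      sub_mul, mul_sub, mul_one, one_mul, Int.negOnePow_sub, Int.negOnePow_one]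
    rcases Int.units_eq_one_or (N (σ a)).negOnePow with h₁ | h₁ <;>
    rcases Int.units_eq_one_or (N (σ b)).negOnePow with h₂ | h₂ <;> simp [h₁, h₂]

theorem koszulSign_strictMono (σ : ι ≃ κ) (h : StrictMono σ) (N : κ → ℤ) : koszulSign σ N = 1 := by
  rw [koszulSign_eq]
  refine prod_eq_one fun a _ => prod_eq_one fun b _ => ?_
  rw [if_neg]
  rintro ⟨h₁, h₂⟩
  exact absurd (h h₁) h₂.not_gt

section Contract

variable {J : Finset ι}

omit [LinearOrder ι] in
theorem prod_subtype_dite {M : Type*} [CommMonoid M] {p : ι → Prop} [DecidablePred p]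
    [Fintype (Subtype p)] (f : Subtype p → M) :
    ∏ i, f i = ∏ i, if h : p i then f ⟨i, h⟩ else 1 := by
  rename_i inst
  obtain rfl : inst = Subtype.fintype p := Subsingleton.elim _ _
  rw [Fintype.prod_dite (fun i h => f ⟨i, h⟩) fun _ _ => 1, prod_const_one, mul_one]

theorem prod_contract {M : Type*} [CommMonoid M] (f : Contract J → M) :
    ∏ o, f o = f .new * ∏ i, if h : i ∉ J then f (.old ⟨i, h⟩) else 1 := by
  rw [← Equiv.prod_comp Contract.equivOption.symm, Fintype.prod_option, prod_subtype_dite]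
  rfl

theorem card_contract (J : Finset ι) :
    (Fintype.card (Contract J) : ℤ) = Fintype.card ι - J.card + 1 := by
  rw [Fintype.card_congr Contract.equivOption, Fintype.card_option, Fintype.card_subtype_compl,
    Fintype.card_coe, Nat.cast_add, Nat.cast_sub (Finset.card_le_univ J)]
  rfl

/-- The bijection of contracted sets of inputs induced by a bijection of sets of inputs. -/
def Contract.congr {J' : Finset κ} (σ : ι ≃ κ) (h : ∀ i, σ i ∈ J' ↔ i ∈ J) :
    Contract J ≃ Contract J' where
  toFun o := match o with
    | .new => .new
    | .old i => .old ⟨σ i, fun hi => i.2 ((h i).1 hi)⟩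
  invFun o := match o with
    | .new => .new
    | .old k => .old ⟨σ.symm k, fun hk => k.2 (by rw [← h] at hk; simpa using hk)⟩
  left_inv o := by cases o <;> simp
  right_inv o := by cases o <;> simp

/-- The restriction of a bijection of sets of inputs to corresponding subsets. -/
def restrictEquiv {J' : Finset κ} (σ : ι ≃ κ) (h : ∀ i, σ i ∈ J' ↔ i ∈ J) : J ≃ J' where
  toFun i := ⟨σ i, (h i).2 i.2⟩
  invFun k := ⟨σ.symm k, (h _).1 (by simp)⟩
  left_inv i := by simp
  right_inv k := by simp

theorem koszulSign_congr {J' : Finset κ} (σ : ι ≃ κ) (h : ∀ i, σ i ∈ J' ↔ i ∈ J) (N : κ → ℤ)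
    (ν : ℤ) : koszulSign (Contract.congr σ h) (color N J' ν) =
      ∏ a, ∏ b, if a < b ∧ σ b < σ a ∧ a ∉ J ∧ b ∉ J then (N (σ a) * N (σ b)).negOnePow else 1 := by
  rw [koszulSign_eq, prod_contract]
  have h₁ : ∏ b, (if new < b ∧ Contract.congr σ h b < Contract.congr σ h new then
      (color N J' ν (Contract.congr σ h new) *
        color N J' ν (Contract.congr σ h b)).negOnePow else 1) = 1 := by
    refine prod_eq_one fun o _ => if_neg fun ho => ?_
    cases o with
    | new => exact lt_irrefl _ ho.1
    | old i => exact not_old_lt_new _ ho.2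
  rw [h₁, one_mul]
  refine prod_congr rfl fun a _ => ?_
  by_cases ha : a ∈ J
  · simp [ha]
  · rw [dif_pos ha, prod_contract, if_neg (fun ho => not_old_lt_new _ ho.1), one_mul]
    refine prod_congr rfl fun b _ => ?_
    by_cases hb : b ∈ J
    · simp [hb]
    · simp [hb, ha, old_lt_old, Contract.congr, color]

theorem koszulSign_restrictEquiv {J' : Finset κ} (σ : ι ≃ κ) (h : ∀ i, σ i ∈ J' ↔ i ∈ J)
    (N : κ → ℤ) : koszulSign (restrictEquiv σ h) (fun k => N k) =
      ∏ a, ∏ b, if a < b ∧ σ b < σ a ∧ a ∈ J ∧ b ∈ J then (N (σ a) * N (σ b)).negOnePow else 1 := by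
  rw [koszulSign_eq, prod_subtype_dite]
  refine prod_congr rfl fun a _ => ?_
  by_cases ha : a ∈ J
  · rw [dif_pos ha, prod_subtype_dite]
    refine prod_congr rfl fun b _ => ?_
    by_cases hb : b ∈ J
    · simp [ha, hb, restrictEquiv]
    · simp [hb]
  · simp [ha]

/-- Moving inputs to the front is compatible with permutations of the inputs. -/
theorem frontSign_perm {J' : Finset κ} (σ : ι ≃ κ) (h : ∀ i, σ i ∈ J' ↔ i ∈ J) (N : κ → ℤ)
    (ν : ℤ) : frontSign J (fun i => N (σ i)) * (koszulSign (Contract.congr σ h) (color N J' ν) *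
        koszulSign (restrictEquiv σ h) (fun k => N k)) = koszulSign σ N * frontSign J' N := by
  have h₁ : frontSign J' N =
      ∏ a : ι, ∏ b : ι, if σ a < σ b ∧ a ∉ J ∧ b ∈ J then (N (σ a) * N (σ b)).negOnePow else 1 := by
    rw [frontSign_eq, ← Equiv.prod_comp σ]
    refine prod_congr rfl fun a _ => ?_
    rw [← Equiv.prod_comp σ]
    simp only [h]
  rw [h₁, koszulSign_congr, koszulSign_restrictEquiv, frontSign_eq, koszulSign_eq]
  simp only [← prod_mul_distrib]
  refine prod_pair_ext (fun a => by simp) fun a b hab => ?_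
  rcases (σ.injective.ne hab.ne).lt_or_gt with h' | h' <;> by_cases ha : a ∈ J <;>
    by_cases hb : b ∈ J <;>
    simp [hab, hab.not_gt, h', h'.not_gt, ha, hb, mul_comm]

theorem rootSign_contract (N : ι → ℤ) (ν : ℤ) : rootSign (color N J ν) =
    ((Fintype.card ι : ℤ) - J.card).negOnePow * ((∏ b, if b ∉ J then ν.negOnePow else 1) *
      ∏ a, ∏ b, if a < b ∧ a ∉ J ∧ b ∉ J then (N a).negOnePow else 1) := by
  rw [rootSign, card_contract, add_sub_cancel_right, prod_contract, prod_contract,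
    if_neg (lt_irrefl _), one_mul]
  refine congrArg₂ _ rfl (congrArg₂ _ ?_ ?_)
  · refine prod_congr rfl fun b _ => ?_
    by_cases hb : b ∈ J
    · simp [hb]
    · simp [hb, new_lt_old, color]
  · refine prod_congr rfl fun a _ => ?_
    by_cases ha : a ∈ J
    · simp [ha]
    · rw [dif_pos ha, prod_contract, if_neg (not_old_lt_new _), one_mul]
      refine prod_congr rfl fun b _ => ?_
      by_cases hb : b ∈ J
      · simp [hb]
      · simp [hb, ha, old_lt_old, color]

theorem rootSign_restrict (N : ι → ℤ) : rootSign (fun j : J => N j) = ((J.card : ℤ) - 1).negOnePow *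
      ∏ a, ∏ b, if a < b ∧ a ∈ J ∧ b ∈ J then (N a).negOnePow else 1 := by
  rw [rootSign, Fintype.card_coe, prod_subtype_dite]
  congr 1
  refine prod_congr rfl fun a _ => ?_
  by_cases ha : a ∈ J
  · rw [dif_pos ha, prod_subtype_dite]
    refine prod_congr rfl fun b _ => ?_
    by_cases hb : b ∈ J
    · simp [ha, hb]
    · simp [hb]
  · simp [ha]

/-- A product over the inputs of the branch created by contracting `J`. -/
theorem negOnePow_new {ν : ℤ} {N : ι → ℤ} (hν : ν.negOnePow = (1 + ∑ j ∈ J, N j).negOnePow) (m : ℤ) :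
    (ν * m).negOnePow = m.negOnePow * ∏ j, if j ∈ J then (N j * m).negOnePow else 1 := by
  rw [negOnePow_mul_congr hν, add_mul, one_mul, Int.negOnePow_add, sum_mul, negOnePow_sum]
  congr 1
  rw [prod_ite_mem, univ_inter]

/-- The sign of the differential in the definition of the cobar construction, in terms of normalised
trees, is the sign of moving `J` to the front in the shifted degrees. -/
theorem decomp_sign (N : ι → ℤ) {ν : ℤ} (hν : ν.negOnePow = (1 + ∑ j ∈ J, N j).negOnePow) :
    ((J.card : ℤ) - Fintype.card ι).negOnePow * frontSign J (fun i => N i - 1) *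
        frontSign J (fun _ => 1) * rootSign N =
      frontSign J N * (rootSign (color N J ν) * rootSign (fun j : J => N j)) := by
  have h₁ := negOnePow_new hν 1
  simp only [mul_one, Int.negOnePow_one] at h₁
  have h₂ : ∏ b, (if b ∉ J then ν.negOnePow else 1) = ((Fintype.card ι : ℤ) - J.card).negOnePow *
      ∏ a, ∏ b, if a ∈ J ∧ b ∉ J then (N a).negOnePow else 1 := by
    have h₃ : ∀ b, (if b ∉ J then ν.negOnePow else 1) = (if b ∉ J then -1 else 1) *
        ∏ a, if a ∈ J ∧ b ∉ J then (N a).negOnePow else 1 := by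
      intro b
      by_cases hb : b ∈ J <;> simp [hb, h₁]
    simp only [h₃, prod_mul_distrib]
    congr 1
    · rw [← prod_filter, prod_const, ← Int.negOnePow_one]
      have : ((Fintype.card ι : ℤ) - J.card) = ((univ.filter fun b => b ∉ J).card : ℤ) := by
        have h₄ : (univ.filter fun b => b ∉ J) = Jᶜ := by ext; simp
        rw [h₄, card_compl, Nat.cast_sub (card_le_univ J)]
      rw [this]
      rfl
    · exact prod_comm
  rw [rootSign_contract, rootSign_restrict, h₂, rootSign, frontSign_eq, frontSign_eq, frontSign_eq]
  have h₅ : ((J.card : ℤ) - Fintype.card ι).negOnePow * ((Fintype.card ι : ℤ) - 1).negOnePow =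
      ((J.card : ℤ) - 1).negOnePow := by
    rw [← Int.negOnePow_add]; congr 1; ring
  have h₆ : ((Fintype.card ι : ℤ) - J.card).negOnePow * ((Fintype.card ι : ℤ) - J.card).negOnePow = 1 :=
    Int.units_mul_self _
  have key : ∀ A B C P Q R S T U V : ℤˣ, A * B = C → P * P = 1 → Q * R * S = T * (U * V) * 1 →
      A * Q * R * (B * S) = T * (P * (P * U) * (C * V)) := by
    intro A B C P Q R S T U V h h' h''
    calc A * Q * R * (B * S) = (A * B) * (Q * R * S) := by ac_rfl
      _ = C * (T * (U * V)) := by rw [h, h'', mul_one]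
      _ = T * ((P * P) * U * (C * V)) := by rw [h', one_mul]; ac_rfl
      _ = _ := by ac_rfl
  have h₇ := key _ _ _ _ (∏ a, ∏ b, if a < b ∧ a ∉ J ∧ b ∈ J then ((N a - 1) * (N b - 1)).negOnePow else 1)
    (∏ a, ∏ b, if a < b ∧ a ∉ J ∧ b ∈ J then ((1 : ℤ) * 1).negOnePow else 1)
    (∏ a, ∏ b, if a < b then (N a).negOnePow else 1)
    (∏ a, ∏ b, if a < b ∧ a ∉ J ∧ b ∈ J then (N a * N b).negOnePow else 1)
    ((∏ a, ∏ b, if a ∈ J ∧ b ∉ J then (N a).negOnePow else 1) *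
      ∏ a, ∏ b, if a < b ∧ a ∉ J ∧ b ∉ J then (N a).negOnePow else 1)
    (∏ a, ∏ b, if a < b ∧ a ∈ J ∧ b ∈ J then (N a).negOnePow else 1) h₅ h₆ ?_
  · rw [h₇]; simp only [mul_assoc]
  · simp only [← prod_mul_distrib, mul_one]
    refine prod_pair_ext (fun a => by simp) fun a b hab => ?_
    by_cases ha : a ∈ J <;> by_cases hb : b ∈ J <;>
      simp only [hab, hab.not_gt, ha, hb, not_true, not_false_iff, and_true, true_and, and_false,
        false_and, if_true, if_false, mul_one, one_mul, sub_mul, mul_sub, Int.negOnePow_sub,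
        Int.negOnePow_one]
    rcases Int.units_eq_one_or (N a).negOnePow with h₁ | h₁ <;>
    rcases Int.units_eq_one_or (N b).negOnePow with h₂ | h₂ <;> simp [h₁, h₂]

end Contract

section Iterated

variable {I J : Finset ι} (N : ι → ℤ)

theorem frontSign_contract_of_notMem {J₂ : Finset (Contract I)} (hnew : new ∉ J₂)
    (hold : ∀ i, old i ∈ J₂ ↔ (i : ι) ∈ J) (hd : Disjoint I J) (ν : ℤ) :
    frontSign J₂ (color N I ν) = (∏ b, if b ∈ J then (ν * N b).negOnePow else 1) *
      ∏ a, ∏ b, if a < b ∧ a ∉ I ∧ a ∉ J ∧ b ∈ J then (N a * N b).negOnePow else 1 := by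
  have hI : ∀ b ∈ J, b ∉ I := fun b hb hb' => Finset.disjoint_left.1 hd hb' hb
  rw [frontSign_eq, prod_contract, prod_contract, if_neg (fun h => lt_irrefl _ h.1), one_mul]
  congr 1
  · refine prod_congr rfl fun b _ => ?_
    by_cases hb : b ∈ I
    · simp [hb, show b ∉ J from fun h => hI b h hb]
    · simp [hb, new_lt_old, color, hnew, hold]
  · refine prod_congr rfl fun a _ => ?_
    by_cases ha : a ∈ I
    · simp [ha]
    · rw [dif_pos ha, prod_contract, if_neg (fun h => not_old_lt_new _ h.1), one_mul]
      refine prod_congr rfl fun b _ => ?_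
      by_cases hb : b ∈ I
      · simp [hb, show b ∉ J from fun h => hI b h hb]
      · simp [hb, ha, old_lt_old, color, hold]

theorem frontSign_contract_of_mem {J₂ : Finset (Contract I)} (hnew : new ∈ J₂)
    (hold : ∀ i, old i ∈ J₂ ↔ (i : ι) ∈ J) (hd : I ⊆ J) (ν : ℤ) : frontSign J₂ (color N I ν) =
      ∏ a, ∏ b, if a < b ∧ a ∉ J ∧ b ∈ J ∧ b ∉ I then (N a * N b).negOnePow else 1 := by
  rw [frontSign_eq, prod_contract]
  rw [prod_eq_one fun b _ => if_neg (fun h => h.2.1 hnew), one_mul]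
  refine prod_congr rfl fun a _ => ?_
  by_cases ha : a ∈ I
  · simp [ha, hd ha]
  · rw [dif_pos ha, prod_contract, if_neg (fun h => not_old_lt_new _ h.1), one_mul]
    refine prod_congr rfl fun b _ => ?_
    by_cases hb : b ∈ I
    · simp [hb]
    · simp [hb, old_lt_old, color, hold]

theorem frontSign_restrict {I' : Finset J} (h : ∀ j, j ∈ I' ↔ (j : ι) ∈ I) (hd : I ⊆ J) :
    frontSign I' (fun j => N j) =
      ∏ a, ∏ b, if a < b ∧ a ∈ J ∧ a ∉ I ∧ b ∈ I then (N a * N b).negOnePow else 1 := by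
  rw [frontSign_eq, prod_subtype_dite]
  refine prod_congr rfl fun a _ => ?_
  by_cases ha : a ∈ J
  · rw [dif_pos ha, prod_subtype_dite]
    refine prod_congr rfl fun b _ => ?_
    by_cases hb : b ∈ J
    · simp [ha, hb, h]
    · simp [hb, show b ∉ I from fun h => hb (hd h)]
  · simp [ha]

/-- The signs of the two ways of contracting nested subsets agree. -/
theorem frontSign_nested {J₂ : Finset (Contract I)} (hnew : new ∈ J₂)
    (hold : ∀ i, old i ∈ J₂ ↔ (i : ι) ∈ J) {I' : Finset J}
    (h : ∀ j, j ∈ I' ↔ (j : ι) ∈ I) (hd : I ⊆ J) (ν : ℤ) :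
    frontSign I N * frontSign J₂ (color N I ν) = frontSign J N * frontSign I' (fun j => N j) := by
  rw [frontSign_contract_of_mem N hnew hold hd, frontSign_restrict N h hd, frontSign_eq,
    frontSign_eq]
  simp only [← prod_mul_distrib]
  refine prod_congr rfl fun a _ => prod_congr rfl fun b _ => ?_
  have ha := @hd a
  have hb := @hd b
  by_cases ha' : a ∈ I <;> by_cases ha'' : a ∈ J <;> by_cases hb' : b ∈ I <;>
    by_cases hb'' : b ∈ J <;> simp_all

/-- The signs of the two ways of contracting disjoint subsets are opposite, up to the sign of
the transposition of the two new branches. -/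
theorem frontSign_disjoint {J₂ : Finset (Contract I)} (hnew : new ∉ J₂)
    (hold : ∀ i, old i ∈ J₂ ↔ (i : ι) ∈ J) {I₂ : Finset (Contract J)}
    (hnew' : new ∉ I₂) (hold' : ∀ i, old i ∈ I₂ ↔ (i : ι) ∈ I)
    (hd : Disjoint I J) {ν μ : ℤ} (hν : ν.negOnePow = (1 + ∑ j ∈ I, N j).negOnePow)
    (hμ : μ.negOnePow = (1 + ∑ j ∈ J, N j).negOnePow) :
    frontSign I N * frontSign J₂ (color N I ν) * (ν * μ).negOnePow =
      - (frontSign J N * frontSign I₂ (color N J μ)) := by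
  have hIJ : ∀ a ∈ I, a ∉ J := fun a ha => Finset.disjoint_left.1 hd ha
  rw [frontSign_contract_of_notMem N hnew hold hd, frontSign_contract_of_notMem N hnew' hold' hd.symm]
  have e₁ : ∏ b, (if b ∈ J then (ν * N b).negOnePow else 1) =
      (∏ b, if b ∈ J then (N b).negOnePow else 1) *
        ∏ a, ∏ b, if a ∈ I ∧ b ∈ J then (N a * N b).negOnePow else 1 := by
    rw [prod_comm (γ := ι), ← prod_mul_distrib]
    refine prod_congr rfl fun b _ => ?_
    by_cases hb : b ∈ J <;> simp [hb, negOnePow_new hν]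
  have e₂ : ∏ b, (if b ∈ I then (μ * N b).negOnePow else 1) =
      (∏ b, if b ∈ I then (N b).negOnePow else 1) *
        ∏ a, ∏ b, if a ∈ I ∧ b ∈ J then (N a * N b).negOnePow else 1 := by
    rw [← prod_mul_distrib]
    refine prod_congr rfl fun b _ => ?_
    by_cases hb : b ∈ I <;> simp [hb, negOnePow_new hμ, mul_comm]
  have e₃ : (ν * μ).negOnePow = - ((∏ b, if b ∈ J then (N b).negOnePow else 1) *
      ((∏ b, if b ∈ I then (N b).negOnePow else 1) *
        ∏ a, ∏ b, if a ∈ I ∧ b ∈ J then (N a * N b).negOnePow else 1)) := by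
    have h₁ : ∏ b, (if b ∈ J then (N b).negOnePow else 1) = ∏ b ∈ J, (N b).negOnePow := by
      rw [prod_ite_mem, univ_inter]
    rw [← e₂, negOnePow_new hν, hμ, Int.negOnePow_add, Int.negOnePow_one, negOnePow_sum, h₁]
    simp only [mul_comm _ μ, neg_mul, one_mul]
  rw [e₁, e₂, e₃, frontSign_eq, frontSign_eq]
  set A := ∏ b, if b ∈ J then (N b).negOnePow else 1
  set B := ∏ b, if b ∈ I then (N b).negOnePow else 1
  set X := ∏ a, ∏ b, if a ∈ I ∧ b ∈ J then (N a * N b).negOnePow else 1 with hX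
  set P := ∏ a, ∏ b, if a < b ∧ a ∉ I ∧ b ∈ I then (N a * N b).negOnePow else 1 with hP
  set Q := ∏ a, ∏ b, if a < b ∧ a ∉ J ∧ b ∈ J then (N a * N b).negOnePow else 1 with hQ
  set R := ∏ a, ∏ b, if a < b ∧ a ∉ I ∧ a ∉ J ∧ b ∈ J then (N a * N b).negOnePow else 1 with hR
  set S := ∏ a, ∏ b, if a < b ∧ a ∉ J ∧ a ∉ I ∧ b ∈ I then (N a * N b).negOnePow else 1 with hS
  -- Both sides are products over ordered pairs of inputs, compared on each unordered pair.
  have key : P * R * X = Q * S := by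
    rw [hP, hQ, hR, hS, hX]
    simp only [← prod_mul_distrib]
    refine prod_pair_ext (fun a => ?_) fun a b hab => ?_
    · have ha := hIJ a
      by_cases ha' : a ∈ I <;> simp_all
    · have ha := hIJ a
      have hb := hIJ b
      by_cases ha' : a ∈ I <;> by_cases ha'' : a ∈ J <;> by_cases hb' : b ∈ I <;>
        by_cases hb'' : b ∈ J <;> simp_all [hab.not_gt, mul_comm]
  calc P * (A * X * R) * -(A * (B * X)) = - ((A * A) * (P * R * X) * B * X) := by
        rw [mul_neg]; congr 1; ac_rfl
    _ = - (Q * (B * X * S)) := by rw [Int.units_mul_self, one_mul, key]; congr 1; ac_rfl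

/-- The sign of contracting a subset in the presence of an additional first branch. -/
theorem frontSign_contract_empty {J₂ : Finset (Contract (∅ : Finset ι))} (hnew : new ∉ J₂)
    (hold : ∀ i, old i ∈ J₂ ↔ (i : ι) ∈ J) {ν μ : ℤ}
    (hμ : μ.negOnePow = (1 + ∑ j ∈ J, N j).negOnePow) :
    frontSign J₂ (color N ∅ ν) * (ν * μ).negOnePow = ν.negOnePow * frontSign J N := by
  rw [frontSign_contract_of_notMem N hnew hold (disjoint_empty_left J), mul_comm ν μ,
    negOnePow_new hμ, frontSign_eq]
  simp only [notMem_empty, not_false_iff, true_and]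
  rw [show ∏ j, (if j ∈ J then (N j * ν).negOnePow else 1) =
    ∏ j, (if j ∈ J then (ν * N j).negOnePow else 1) by simp only [mul_comm]]
  set A := ∏ j, (if j ∈ J then (ν * N j).negOnePow else 1)
  calc _ = (A * A) * (ν.negOnePow * ∏ a, ∏ b, if a < b ∧ a ∉ J ∧ b ∈ J then (N a * N b).negOnePow else 1) := by
        ac_rfl
    _ = _ := by rw [Int.units_mul_self, one_mul]

end Iterated

section Branch

/-- The Koszul sign of an operator of degree one passing the branches before `i`. -/
def passSign (N : ι → ℤ) (i : ι) : ℤˣ := ∏ j, if j < i then (N j).negOnePow else 1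

/-- The degrees after raising the degree of the branch at `i` by one. -/
abbrev raise (N : ι → ℤ) (i : ι) : ι → ℤ := update N i (N i + 1)

theorem negOnePow_raise_mul (N : ι → ℤ) (i a b : ι) (hab : a ≠ b) :
    (raise N i a * raise N i b).negOnePow = (N a * N b).negOnePow *
      ((if a = i then (N b).negOnePow else 1) * if b = i then (N a).negOnePow else 1) := by
  by_cases ha : a = i
  · subst ha
    simp [raise, hab.symm, add_mul, Int.negOnePow_add]
  · by_cases hb : b = i
    · subst hb
      simp [raise, ha, mul_add, Int.negOnePow_add]
    · simp [raise, ha, hb]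

theorem prod_ite_eq_pair (i : ι) (p : ι → Prop) [DecidablePred p] (f : ι → ℤˣ) :
    ∏ a, ∏ b, (if a = i ∧ p b then f b else 1) = ∏ b, if p b then f b else 1 := by
  rw [prod_comm]
  refine prod_congr rfl fun b _ => ?_
  by_cases hb : p b <;> simp [hb]

/-- The sign of the differential at the branch `i`, in terms of normalised trees. -/
theorem rootSign_raise (N : ι → ℤ) (i : ι) :
    ((Fintype.card ι : ℤ) + ∑ j with j < i, (N j - 1)).negOnePow * rootSign N =
      - passSign N i * rootSign (raise N i) := by
  have h₁ : ∏ a, ∏ b, (if a < b then (raise N i a).negOnePow else 1) =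
      (∏ a, ∏ b, if a < b then (N a).negOnePow else 1) * ∏ b, if i < b then (-1 : ℤˣ) else 1 := by
    rw [← prod_ite_eq_pair i (fun b => i < b) fun _ => -1, ← prod_mul_distrib]
    refine prod_congr rfl fun a _ => ?_
    rw [← prod_mul_distrib]
    refine prod_congr rfl fun b _ => ?_
    by_cases hab : a < b
    · by_cases ha : a = i
      · subst ha; simp [raise, hab, Int.negOnePow_succ]
      · simp [raise, hab, ha]
    · by_cases ha : a = i
      · subst ha; simp [hab]
      · simp [hab, ha]
  have h₂ : (∑ j with j < i, (N j - 1)).negOnePow = passSign N i * ∏ j, if j < i then (-1 : ℤˣ) else 1 := by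
    rw [negOnePow_sum, passSign, ← prod_mul_distrib, prod_filter]
    refine prod_congr rfl fun j _ => ?_
    by_cases h : j < i <;> simp [h, Int.negOnePow_sub]
  have h₃ : (Fintype.card ι : ℤ).negOnePow = - ((∏ j, if j < i then (-1 : ℤˣ) else 1) *
      ∏ b, if i < b then (-1 : ℤˣ) else 1) := by
    have : ∏ _j : ι, (-1 : ℤˣ) = (∏ j, if j < i then (-1 : ℤˣ) else 1) *
        (∏ b, if i < b then (-1 : ℤˣ) else 1) * ∏ b, if b = i then (-1 : ℤˣ) else 1 := by
      simp only [← prod_mul_distrib]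
      refine prod_congr rfl fun j _ => ?_
      rcases lt_trichotomy j i with h | h | h
      · simp [h, h.not_gt, h.ne]
      · simp [h]
      · simp [h, h.not_gt, h.ne']
    rw [prod_const, card_univ] at this
    rw [Finset.prod_ite_eq' univ i, if_pos (mem_univ i), mul_neg, mul_one] at this
    exact this
  rw [rootSign, rootSign, h₁, Int.negOnePow_add, h₂, h₃]
  set A := ∏ j, if j < i then (-1 : ℤˣ) else 1
  set B := ∏ b, if i < b then (-1 : ℤˣ) else 1
  set X := ∏ a, ∏ b, if a < b then (N a).negOnePow else 1
  set Y := ((Fintype.card ι : ℤ) - 1).negOnePow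
  calc -(A * B) * (passSign N i * A) * (Y * X) = (A * A) * (- passSign N i * (Y * (X * B))) := by
        simp only [neg_mul, mul_neg]; congr 1; ac_rfl
    _ = _ := by rw [Int.units_mul_self, one_mul]

theorem koszulSign_raise (σ : ι ≃ κ) (N : κ → ℤ) (i : ι) :
    passSign (fun i => N (σ i)) i * koszulSign σ (raise N (σ i)) =
      koszulSign σ N * passSign N (σ i) := by
  have h₁ : passSign N (σ i) = ∏ j, if σ j < σ i then (N (σ j)).negOnePow else 1 := by
    rw [passSign, ← Equiv.prod_comp σ]
  have h₂ : koszulSign σ (raise N (σ i)) = koszulSign σ N *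
      ((∏ j, if i < j ∧ σ j < σ i then (N (σ j)).negOnePow else 1) *
        ∏ j, if j < i ∧ σ i < σ j then (N (σ j)).negOnePow else 1) := by
    rw [← prod_ite_eq_pair i (fun j => i < j ∧ σ j < σ i) fun j => (N (σ j)).negOnePow,
      ← prod_ite_eq_pair i (fun j => j < i ∧ σ i < σ j) fun j => (N (σ j)).negOnePow,
      koszulSign_eq, koszulSign_eq]
    nth_rw 4 [prod_comm]
    simp only [← prod_mul_distrib]
    refine prod_congr rfl fun a _ => prod_congr rfl fun b _ => ?_
    by_cases h : a < b ∧ σ b < σ a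
    · rw [if_pos h, if_pos h, negOnePow_raise_mul _ _ _ _ (σ.injective.ne h.1.ne)]
      by_cases ha : a = i
      · subst ha
        have hb : b ≠ a := h.1.ne'
        simp [h, hb]
      · by_cases hb : b = i
        · subst hb; simp [h, ha]
        · simp [ha, hb]
    · rw [if_neg h, if_neg h, one_mul]
      have h' : ¬ (a = i ∧ i < b ∧ σ b < σ i) := by rintro ⟨rfl, h'⟩; exact h h'
      have h'' : ¬ (b = i ∧ a < i ∧ σ i < σ a) := by rintro ⟨rfl, h'⟩; exact h h'
      rw [if_neg h', if_neg h'', one_mul]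
  rw [h₁, h₂, passSign, mul_left_comm]
  congr 1
  simp only [← prod_mul_distrib]
  refine prod_congr rfl fun j _ => ?_
  rcases lt_trichotomy i j with h | h | h
  · rcases (σ.injective.ne h.ne).lt_or_gt with h' | h' <;> simp [h, h.not_gt, h', h'.not_gt]
  · simp [h]
  · rcases (σ.injective.ne h.ne').lt_or_gt with h' | h' <;>
      simp [h, h.not_gt, h', h'.not_gt]

variable {J : Finset ι}

theorem frontSign_raise (N : ι → ℤ) (i : ι) : frontSign J (raise N i) = frontSign J N *
    if i ∈ J then (∏ j, if j < i ∧ j ∉ J then (N j).negOnePow else 1)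
      else ∏ j, if i < j ∧ j ∈ J then (N j).negOnePow else 1 := by
  have h₁ : frontSign J (raise N i) = frontSign J N *
      ((∏ j, if i < j ∧ i ∉ J ∧ j ∈ J then (N j).negOnePow else 1) *
        ∏ j, if j < i ∧ j ∉ J ∧ i ∈ J then (N j).negOnePow else 1) := by
    rw [← prod_ite_eq_pair i (fun j => i < j ∧ i ∉ J ∧ j ∈ J) fun j => (N j).negOnePow,
      ← prod_ite_eq_pair i (fun j => j < i ∧ j ∉ J ∧ i ∈ J) fun j => (N j).negOnePow,
      frontSign_eq, frontSign_eq]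
    nth_rw 4 [prod_comm]
    simp only [← prod_mul_distrib]
    refine prod_congr rfl fun a _ => prod_congr rfl fun b _ => ?_
    by_cases h : a < b ∧ a ∉ J ∧ b ∈ J
    · rw [if_pos h, if_pos h, negOnePow_raise_mul _ _ _ _ h.1.ne]
      by_cases ha : a = i
      · subst ha
        have hb : b ≠ a := h.1.ne'
        simp [h, hb]
      · by_cases hb : b = i
        · subst hb; simp [h, ha]
        · simp [ha, hb]
    · rw [if_neg h, if_neg h, one_mul]
      have h' : ¬ (a = i ∧ i < b ∧ i ∉ J ∧ b ∈ J) := by rintro ⟨rfl, h'⟩; exact h h'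
      have h'' : ¬ (b = i ∧ a < i ∧ a ∉ J ∧ i ∈ J) := by rintro ⟨rfl, h'⟩; exact h h'
      rw [if_neg h', if_neg h'', one_mul]
  rw [h₁]
  by_cases hi : i ∈ J <;> simp [hi]

/-- The sign of a differential at a branch outside `J`, before and after contracting `J`. -/
theorem passSign_contract_old (N : ι → ℤ) {ν : ℤ}
    (hν : ν.negOnePow = (1 + ∑ j ∈ J, N j).negOnePow) (i : {i // i ∉ J}) :
    frontSign J N * passSign (color N J ν) (.old i) =
      - (passSign N i * frontSign J (raise N i)) := by
  have h₁ := negOnePow_new hν 1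
  simp only [mul_one, Int.negOnePow_one] at h₁
  have h₂ : passSign (color N J ν) (.old i) =
      - ((∏ j : ι, if j ∈ J then (N j).negOnePow else 1) *
        ∏ j : ι, if j < i ∧ j ∉ J then (N j).negOnePow else 1) := by
    rw [passSign, prod_contract, if_pos (new_lt_old i)]
    change ν.negOnePow * _ = _
    rw [h₁, neg_mul, one_mul, neg_mul]
    congr 2
    refine prod_congr rfl fun j _ => ?_
    by_cases hj : j ∈ J
    · simp [hj]
    · simp [hj, old_lt_old, color]
  rw [h₂, frontSign_raise, if_neg i.2, mul_neg, mul_left_comm (passSign N i), passSign,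
    ← prod_mul_distrib, ← prod_mul_distrib]
  refine congrArg _ (congrArg _ (prod_congr rfl fun j _ => ?_))
  by_cases hj : j ∈ J
  · have : j ≠ i := fun h => i.2 (h ▸ hj)
    rcases this.lt_or_gt with h | h <;> simp [hj, h, h.not_gt]
  · simp [hj]

/-- The sign of a differential at a branch in `J`, before and after contracting `J`. -/
theorem passSign_restrict (N : ι → ℤ) (i : J) :
    frontSign J N * passSign (fun j : J => N j) i = passSign N i * frontSign J (raise N i) := by
  rw [frontSign_raise, if_pos i.2, passSign, passSign, prod_subtype_dite, mul_left_comm]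
  congr 1
  simp only [← prod_mul_distrib]
  refine prod_congr rfl fun j _ => ?_
  by_cases hj : j ∈ J
  · by_cases h : j < i <;> simp [hj, h, ← Subtype.coe_lt_coe]
  · by_cases h : j < i <;> simp [hj, h]

theorem passSign_raise_of_lt (N : ι → ℤ) {i j : ι} (h : i < j) :
    passSign (raise N i) j = - passSign N j := by
  rw [passSign, passSign]
  have : ∀ k, (if k < j then (raise N i k).negOnePow else 1) =
      (if k < j then (N k).negOnePow else 1) * if k = i then -1 else 1 := by
    intro k
    by_cases hk : k = i
    · subst hk; simp [h, raise, Int.negOnePow_succ]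
    · simp [raise, hk]
  simp only [this, prod_mul_distrib]
  simp

theorem passSign_raise_of_not_lt (N : ι → ℤ) {i j : ι} (h : ¬ i < j) :
    passSign (raise N i) j = passSign N j := by
  rw [passSign, passSign]
  refine prod_congr rfl fun k _ => ?_
  by_cases hk : k = i
  · subst hk; simp [h]
  · simp [raise, hk]

end Branch

end Signs

section

/-! ### Trees in the cobar construction -/

theorem map_units_smul {K V W : Type*} [Ring K] [AddCommGroup V] [AddCommGroup W] [Module K V]
    [Module K W] (f : V →ₗ[K] W) (ε : ℤˣ) (v : V) : f (ε • v) = ε • f v := by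
  rw [Units.smul_def, Units.smul_def, map_zsmul]

variable {K : Type u} [Field K] {κ : Type} {b : κ → PairColor} {d e : PairColor}

/-- Trees decorated by the Koszul dual cooperad of `comm⁺`. -/
abbrev CTree (K : Type u) [Field K] {κ : Type} (b : κ → PairColor) (d : PairColor) :=
  CobarTree (koszulCoop K) b d

/-- A tree with output of colour `c i` for each `i`. -/
abbrev Branches (K : Type u) [Field K] {κ ι : Type} (b : κ → PairColor) (c : ι → PairColor) :=
  ∀ i, CTree K b (c i)

/-- The free algebra over the cobar construction of the Koszul dual cooperad of `comm⁺`. -/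
abbrev CAlg (K : Type u) [Field K] {κ : Type} (b : κ → PairColor) (d : PairColor) :=
  Cobar (koszulCoop K) b d

namespace CobarTree

theorem deg_node {ι : Type} [Fintype ι] [LinearOrder ι] (hι : 2 ≤ Fintype.card ι)
    {c : ι → PairColor} (x : Coop K c d) (ts : Branches K b c) :
    (node hι x ts).deg = 2 - Fintype.card ι + ∑ i, (ts i).deg := by
  rw [deg, koszulCoop_deg]; ring

theorem deg_node_congr {ι ι' : Type} [Fintype ι] [LinearOrder ι] [Fintype ι'] [LinearOrder ι']
    {hι : 2 ≤ Fintype.card ι} {hι' : 2 ≤ Fintype.card ι'} (σ : ι ≃ ι') {c : ι → PairColor}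
    {c' : ι' → PairColor} {x : Coop K c d} {x' : Coop K c' d} {ts : Branches K b c}
    {ts' : Branches K b c'} (h : ∀ i, (ts i).deg = (ts' (σ i)).deg) :
    (node hι x ts).deg = (node hι' x' ts').deg := by
  rw [deg_node, deg_node, Fintype.card_congr σ, Fintype.sum_equiv σ _ (fun i => (ts' i).deg) h]

theorem IsRelation.homogeneous {f : CTree K b d →₀ K} (hf : IsRelation f) :
    ∃ n m, f ∈ Finsupp.supported K K {t : CTree K b d | t.deg = n ∧ t.leaves = m} := by
  induction hf with
  | add hι x y ts =>
    refine ⟨_, _, Submodule.sub_mem _ (Submodule.sub_mem _ (Finsupp.single_mem_supported K _ ⟨rfl, rfl⟩)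
      (Finsupp.single_mem_supported K _ ⟨rfl, rfl⟩)) (Finsupp.single_mem_supported K _ ⟨rfl, rfl⟩)⟩
  | smul hι r x ts =>
    exact ⟨_, _, Submodule.sub_mem _ (Finsupp.single_mem_supported K _ ⟨rfl, rfl⟩)
      (Finsupp.single_mem_supported K _ ⟨rfl, rfl⟩)⟩
  | @perm _ _ _ _ _ _ hι hι' σ c d x ts =>
    refine ⟨(node hι ((koszulCoop K).pull σ c d x) fun i => ts (σ i)).deg,
      (node hι ((koszulCoop K).pull σ c d x) fun i => ts (σ i)).leaves,
      Submodule.sub_mem _ ?_ ?_⟩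
    · exact Finsupp.single_mem_supported K _ ⟨rfl, rfl⟩
    rw [Units.smul_def]
    refine zsmul_mem ?_ _
    refine Finsupp.single_mem_supported K _ ⟨?_, ?_⟩
    · exact (deg_node_congr σ fun _ => rfl).symm
    · exact (Equiv.sum_comp σ fun i => (ts i).leaves).symm
  | @plug ι _ _ hι c d x ts i f hf ih =>
    obtain ⟨n, m, h⟩ := ih
    refine ⟨2 - Fintype.card ι + ∑ j, update (fun j => (ts j).deg) i n j,
      ∑ j, update (fun j => (ts j).leaves) i m j, ?_⟩
    have h' := Submodule.mem_map_of_mem (f := Finsupp.lmapDomain K K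
      fun t => node hι x (update ts i t)) h
    rw [Finsupp.lmapDomain_supported] at h'
    refine Finsupp.supported_mono ?_ h'
    rintro _ ⟨t, ⟨rfl, rfl⟩, rfl⟩
    refine ⟨?_, ?_⟩
    · rw [deg_node]
      exact congrArg _ (Finset.sum_congr rfl fun j _ =>
        Function.apply_update (fun j (t : CTree K b (c j)) => t.deg) ts i t j)
    · exact Finset.sum_congr rfl fun j _ =>
        Function.apply_update (fun j (t : CTree K b (c j)) => t.leaves) ts i t j

end CobarTree

namespace Cobar

open CobarTree

theorem mk_surjective_span (d : PairColor) :
    Submodule.span K (Set.range (mk : CTree K b d → CAlg K b d)) = ⊤ := by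
  rw [eq_top_iff]
  rintro z -
  obtain ⟨f, rfl⟩ := Submodule.Quotient.mk_surjective _ z
  induction f using Finsupp.induction_linear with
  | zero => exact zero_mem _
  | add f g hf hg => exact add_mem hf hg
  | single t k =>
    have : (Submodule.Quotient.mk (Finsupp.single t k) : CAlg K b d) = k • mk t := by
      rw [mk, ← Submodule.Quotient.mk_smul, Finsupp.smul_single, smul_eq_mul, mul_one]
    rw [this]
    exact Submodule.smul_mem _ _ (Submodule.subset_span ⟨t, rfl⟩)

theorem linearCombination_mk (f : CTree K b d →₀ K) :
    Finsupp.linearCombination K (mk : CTree K b d → CAlg K b d) f = Submodule.Quotient.mk f := by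
  induction f using Finsupp.induction_linear with
  | zero => rw [map_zero]; rfl
  | add f g hf hg => rw [map_add, hf, hg]; rfl
  | single t k =>
    rw [Finsupp.linearCombination_single, mk, ← Submodule.Quotient.mk_smul, Finsupp.smul_single,
      smul_eq_mul, mul_one]

theorem hom_ext {V : Type*} [AddCommGroup V] [Module K V] {F G : CAlg K b d →ₗ[K] V}
    (h : ∀ t, F (mk t) = G (mk t)) : F = G :=
  LinearMap.ext_on_range (mk_surjective_span d) h

/-- The relation for permutations of the inputs of a vertex, as an identity of classes. -/
theorem mk_node_pull {ι ι' : Type} [Fintype ι] [LinearOrder ι] [Fintype ι'] [LinearOrder ι']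
    (hι : 2 ≤ Fintype.card ι) (hι' : 2 ≤ Fintype.card ι') (σ : ι ≃ ι') {c : ι' → PairColor}
    (x : Coop K c d) (ts : Branches K b c) :
    (mk (node hι ((koszulCoop K).pull σ c d x) fun i => ts (σ i)) : CAlg K b d) =
      koszulSign σ (fun i => (ts i).deg) • mk (node hι' x ts) := by
  have h := (Submodule.Quotient.mk_eq_zero _).2 (Submodule.subset_span (R := K)
    (CobarTree.IsRelation.perm hι hι' σ x ts))
  rw [Submodule.Quotient.mk_sub, sub_eq_zero] at h
  exact h

/-- A function on trees that is compatible with the relations at the root, and that depends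
linearly on each branch of the root, by means of the class of the branch and of the value of
the function at the branch, is compatible with all relations. -/
theorem linearCombination_eq_zero {V : PairColor → Type*} [∀ d, AddCommGroup (V d)]
    [∀ d, Module K (V d)] (F : ∀ {d}, CTree K b d → V d)
    (hadd : ∀ {ι : Type} [Fintype ι] [LinearOrder ι] (hι : 2 ≤ Fintype.card ι) {c : ι → PairColor}
      {d : PairColor} (x y : Coop K c d) (ts : Branches K b c),
      F (node hι (x + y) ts) = F (node hι x ts) + F (node hι y ts))
    (hsmul : ∀ {ι : Type} [Fintype ι] [LinearOrder ι] (hι : 2 ≤ Fintype.card ι) {c : ι → PairColor}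
      {d : PairColor} (r : K) (x : Coop K c d) (ts : Branches K b c),
      F (node hι (r • x) ts) = r • F (node hι x ts))
    (hperm : ∀ {ι ι' : Type} [Fintype ι] [LinearOrder ι] [Fintype ι'] [LinearOrder ι']
      (hι : 2 ≤ Fintype.card ι) (hι' : 2 ≤ Fintype.card ι') (σ : ι ≃ ι') {c : ι' → PairColor}
      {d : PairColor} (x : Coop K c d) (ts : Branches K b c),
      F (node hι ((koszulCoop K).pull σ c d x) fun i => ts (σ i)) =
        koszulSign σ (fun i => (ts i).deg) • F (node hι' x ts))
    (hplug : ∀ {ι : Type} [Fintype ι] [LinearOrder ι] (hι : 2 ≤ Fintype.card ι) {c : ι → PairColor}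
      {d : PairColor} (x : Coop K c d) (ts : Branches K b c) (i : ι) (n : ℤ)
      (m : Multiset κ), ∃ (G : CAlg K b (c i) →ₗ[K] V d) (H : V (c i) →ₗ[K] V d),
        ∀ t, t.deg = n → t.leaves = m → F (node hι x (update ts i t)) = G (mk t) + H (F t))
    {d : PairColor} {f : CTree K b d →₀ K} (hf : IsRelation f) :
    Finsupp.linearCombination K (F : CTree K b d → V d) f = 0 := by
  induction hf with
  | add hι x y ts => simp [hadd]
  | smul hι r x ts => simp [hsmul]
  | perm hι hι' σ x ts =>
    rw [map_sub, map_units_smul, Finsupp.linearCombination_single, Finsupp.linearCombination_single,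
      one_smul, one_smul, hperm hι hι', sub_self]
  | @plug ι _ _ hι c d x ts i f hf ih =>
    obtain ⟨n, m, h⟩ := hf.homogeneous
    obtain ⟨G, H, hG⟩ := hplug hι x ts i n m
    have key : ∀ g ∈ Finsupp.supported K K {t : CTree K b (c i) | t.deg = n ∧ t.leaves = m},
        Finsupp.linearCombination K (F : CTree K b d → V d) (Finsupp.lmapDomain K K
          (fun t => node hι x (update ts i t)) g) =
        G (Submodule.Quotient.mk g) +
          H (Finsupp.linearCombination K (F : CTree K b (c i) → V (c i)) g) := by
      intro g hg
      rw [Finsupp.lmapDomain_apply, Finsupp.linearCombination_mapDomain, ← linearCombination_mk,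
        Finsupp.linearCombination_apply, Finsupp.linearCombination_apply,
        Finsupp.linearCombination_apply, map_finsuppSum, map_finsuppSum, ← Finsupp.sum_add]
      refine Finsupp.sum_congr fun t ht => ?_
      have := (Finsupp.mem_supported K g).1 hg ht
      rw [map_smul, map_smul, ← smul_add, Function.comp_apply, hG t this.1 this.2]
    rw [key f h, ih, (Submodule.Quotient.mk_eq_zero _).2 (Submodule.subset_span hf), map_zero,
      map_zero, add_zero]

/-- The linear map determined by a function on trees that is compatible with the relations. -/
def liftTree {V : Type*} [AddCommGroup V] [Module K V] (F : CTree K b d → V)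
    (hF : ∀ f : CTree K b d →₀ K, IsRelation f → Finsupp.linearCombination K F f = 0) :
    CAlg K b d →ₗ[K] V :=
  Submodule.liftQ _ (Finsupp.linearCombination K F) (Submodule.span_le.2 hF)

theorem liftTree_mk {V : Type*} [AddCommGroup V] [Module K V] (F : CTree K b d → V)
    (hF : ∀ f : CTree K b d →₀ K, IsRelation f → Finsupp.linearCombination K F f = 0)
    (t : CTree K b d) : liftTree F hF (mk t) = F t := by
  simp [liftTree, mk]

/-- The span of the trees of degree `n`. -/
def homog (K : Type u) [Field K] {κ : Type} (b : κ → PairColor) (d : PairColor) (n : ℤ) :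
    Submodule K (CAlg K b d) := Submodule.span K (mk '' {t | t.deg = n})

theorem mk_mem_homog {t : CTree K b d} {n : ℤ} (h : t.deg = n) : mk t ∈ homog K b d n :=
  Submodule.subset_span ⟨t, h, rfl⟩

theorem eq_of_mem_homog {V : Type*} [AddCommGroup V] [Module K V] {F G : CAlg K b d →ₗ[K] V} {n : ℤ}
    (h : ∀ t : CTree K b d, t.deg = n → F (mk t) = G (mk t)) {z : CAlg K b d}
    (hz : z ∈ homog K b d n) : F z = G z :=
  LinearMap.eqOn_span (by rintro _ ⟨t, ht, rfl⟩; exact h t ht) hz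

theorem map_mem_of_homog {V : Type*} [AddCommGroup V] [Module K V] {F : CAlg K b d →ₗ[K] V} {n : ℤ}
    {S : Submodule K V} (h : ∀ t : CTree K b d, t.deg = n → F (mk t) ∈ S) {z : CAlg K b d}
    (hz : z ∈ homog K b d n) : F z ∈ S := by
  have : homog K b d n ≤ S.comap F := by
    refine Submodule.span_le.2 ?_
    rintro _ ⟨t, ht, rfl⟩
    exact h t ht
  exact this hz

variable {ι : Type} [Fintype ι] [LinearOrder ι] {c : ι → PairColor}

/-- The degrees of branches, shifted by one. -/
abbrev pars (ts : Branches K b c) : ι → ℤ := fun i => (ts i).deg + 1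

variable (hι : 2 ≤ Fintype.card ι) (x : Coop K c d) (ts : Branches K b c)

/-- The class of a tree, normalised by a sign. -/
def nd : CAlg K b d := rootSign (pars ts) • mk (node hι x ts)

theorem nd_add (hι : 2 ≤ Fintype.card ι) (x y : Coop K c d)
    (ts : Branches K b c) : nd hι (x + y) ts = nd hι x ts + nd hι y ts := by
  rw [nd, mk_node_add, smul_add]; rfl

theorem nd_smul (hι : 2 ≤ Fintype.card ι) (r : K) (x : Coop K c d)
    (ts : Branches K b c) : nd hι (r • x) ts = r • nd hι x ts := by
  rw [nd, mk_node_smul, smul_comm]; rfl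

/-- The linear dependence of a tree on the decoration of its root. -/
def ndLin (hι : 2 ≤ Fintype.card ι) (ts : Branches K b c) (d : PairColor) :
    Coop K c d →ₗ[K] CAlg K b d where
  toFun x := nd hι x ts
  map_add' x y := nd_add hι x y ts
  map_smul' r x := nd_smul hι r x ts

theorem mk_node : mk (node hι x ts) = rootSign (pars ts) • nd hι x ts := by
  rw [nd, smul_smul, Int.units_mul_self, one_smul]

/-- With the normalisation of signs by `nd`, permuting the inputs of the root has the effect of a
graded symmetric operation of the branches in their shifted degrees. -/
theorem nd_perm {ι' : Type} [Fintype ι'] [LinearOrder ι'] (hι : 2 ≤ Fintype.card ι)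
    (hι' : 2 ≤ Fintype.card ι') (σ : ι ≃ ι') {c' : ι' → PairColor} (hc : ∀ i, c i = c' (σ i))
    {x : Coop K c d} {x' : Coop K c' d} (hx : ∀ u, Adm c d u → val x u = val x' (rename σ u))
    {ts : Branches K b c} {ts' : Branches K b c'} (hts : ∀ i, ts i ≍ ts' (σ i)) :
    nd hι x ts = koszulSign σ (pars ts') • nd hι' x' ts' := by
  obtain rfl : c = c' ∘ σ := funext hc
  obtain rfl : ts = fun i => ts' (σ i) := funext fun i => eq_of_heq (hts i)
  obtain rfl : x = pull₀ σ (fun _ => rfl) d x' :=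
    obj_ext fun u hu => by rw [hx u hu, val_pull₀]
  have h := mk_node_pull hι hι' σ x' ts'
  rw [koszulCoop_pull, Units.smul_def, ← Int.cast_smul_eq_zsmul K, mk_node_smul,
    Int.cast_smul_eq_zsmul, ← Units.smul_def] at h
  have h' : (mk (node hι (pull₀ σ (c := c' ∘ σ) (fun _ => rfl) d x') fun i => ts' (σ i)) :
      CAlg K b d) = (koszulSign σ (fun i => (ts' i).deg) * koszulSign σ fun _ => 1) •
        mk (node hι' x' ts') := by
    rw [mul_comm, mul_smul, ← h, smul_smul, Int.units_mul_self, one_smul]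
  have h'' := rootSign_perm σ (pars ts')
  simp only [pars, add_sub_cancel_right] at h''
  rw [nd, nd]
  change rootSign (fun i => pars ts' (σ i)) • mk (node hι (pull₀ σ (c := c' ∘ σ) (fun _ => rfl) d x')
    fun i => ts' (σ i)) = _
  rw [h', smul_smul, smul_smul, mul_comm, h'']

theorem nd_pull₀ {ι' : Type} [Fintype ι'] [LinearOrder ι'] (hι : 2 ≤ Fintype.card ι)
    (hι' : 2 ≤ Fintype.card ι') {σ : ι ≃ ι'} {c' : ι' → PairColor} (hc : ∀ i, c i = c' (σ i))
    (x : Coop K c' d) (ts : Branches K b c) (ts' : Branches K b c') (hts : ∀ i, ts i ≍ ts' (σ i)) :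
    nd hι (pull₀ σ hc d x) ts = koszulSign σ (pars ts') • nd hι' x ts' :=
  nd_perm hι hι' σ hc (fun _ _ => val_pull₀ _ _ _ _ _) hts

/-- Monotone bijections of the inputs cause no sign. -/
theorem nd_pull₀_of_strictMono {ι' : Type} [Fintype ι'] [LinearOrder ι'] (hι : 2 ≤ Fintype.card ι)
    (hι' : 2 ≤ Fintype.card ι') {σ : ι ≃ ι'} (hσ : StrictMono σ) {c' : ι' → PairColor}
    (hc : ∀ i, c i = c' (σ i)) (x : Coop K c' d) (ts : Branches K b c)
    (ts' : Branches K b c') (hts : ∀ i, ts i ≍ ts' (σ i)) :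
    nd hι (pull₀ σ hc d x) ts = nd hι' x ts' := by
  rw [nd_pull₀ hι hι' hc x ts ts' hts, koszulSign_strictMono _ hσ, one_smul]

theorem pars_update (ts : Branches K b c) (i : ι) (t : CTree K b (c i)) :
    pars (update ts i t) = update (pars ts) i (t.deg + 1) :=
  funext fun j => Function.apply_update (fun _ t => t.deg + 1) ts i t j

theorem pars_update_succ (ts : Branches K b c) (i : ι) (t : CTree K b (c i))
    (ht : t.deg = (ts i).deg + 1) : pars (update ts i t) = raise (pars ts) i := by
  rw [pars_update, ht]

theorem pars_contractBranches {J : Finset ι} (t : CTree K b e) (ts : Branches K b c) :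
    pars (contractBranches (J := J) t ts) = color (pars ts) J (t.deg + 1) := by
  funext o; cases o <;> rfl

/-- Replacing a branch by an element whose degree is one higher. -/
def plugSucc (i : ι) : CAlg K b (c i) →ₗ[K] CAlg K b d :=
  ((rootSign (raise (pars ts) i) : ℤ) : K) • plug hι x ts i

theorem plugSucc_apply (i : ι) (z : CAlg K b (c i)) :
    plugSucc hι x ts i z = rootSign (raise (pars ts) i) • plug hι x ts i z := by
  rw [plugSucc, LinearMap.smul_apply, Int.cast_smul_eq_zsmul, Units.smul_def]

theorem plugSucc_mk (i : ι) {t : CTree K b (c i)} (ht : t.deg = (ts i).deg + 1) :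
    plugSucc hι x ts i (mk t) = nd hι x (update ts i t) := by
  rw [plugSucc_apply, plug_mk, nd, pars_update_succ ts i t ht]

theorem plug_mem_homog (i : ι) {z : CAlg K b (c i)} {n : ℤ} (hz : z ∈ homog K b (c i) n) :
    plug hι x ts i z ∈ homog K b d (2 - Fintype.card ι + ∑ j, (ts j).deg - (ts i).deg + n) := by
  refine map_mem_of_homog (fun t ht => ?_) hz
  rw [plug_mk]
  refine mk_mem_homog ?_
  rw [deg_node]
  have : ∀ j, (update ts i t j).deg = update (fun j => (ts j).deg) i t.deg j :=
    Function.apply_update (fun j (t : CTree K b (c j)) => t.deg) ts i t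
  simp only [this]
  rw [Finset.sum_update_of_mem (Finset.mem_univ i), ht,
    ← Finset.add_sum_erase _ (fun j => (ts j).deg) (Finset.mem_univ i), Finset.sdiff_singleton_eq_erase]
  ring

/-- Replacing the first branch. -/
theorem nd_contractBranches_congr {J : Finset ι} (hJ : 2 ≤ Fintype.card (Contract J))
    (x : Coop K (color c J e) d) (ts : Branches K b c) {t t' : CTree K b e}
    (hd : t.deg = t'.deg) {ε ε' : ℤˣ} (h : ε • (mk t : CAlg K b e) = ε' • mk t') :
    ε • nd hJ x (contractBranches t ts) = ε' • nd hJ x (contractBranches t' ts) := by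
  obtain ⟨L, hL⟩ := exists_mk_contractBranches hJ x ts t
  have h' := congrArg L h
  rw [map_units_smul, map_units_smul] at h'
  rw [nd, nd, pars_contractBranches, pars_contractBranches, hd, hL, hL, smul_comm, smul_comm ε', h']

end Cobar

end

section

/-! ### The differential -/

section TensorExt

variable {K : Type u} [Field K] {ι ι' κ κ' : Type} [Fintype ι] [LinearOrder ι] [Fintype ι']
  [LinearOrder ι'] [Fintype κ] [LinearOrder κ] [Fintype κ'] [LinearOrder κ'] {c : ι → PairColor}
  {c₁ : ι' → PairColor} {c' : κ → PairColor} {c₁' : κ' → PairColor} {d d₁ d' d₁' : PairColor}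

theorem eq_zero_of_val {x : Coop K c d} (h : ∀ u, Adm c d u → val x u = 0) : x = 0 :=
  obj_ext fun u hu => by rw [h u hu]; exact (map_zero (valAt u)).symm

/-- Elements of a tensor product of components are determined by their values at pairs of
admissible trees. -/
theorem tensor_ext_val {τ τ' : Coop K c d ⊗[K] Coop K c' d'}
    (h : ∀ u v, Adm c d u → Adm c' d' v → valAt₂ u v τ = valAt₂ u v τ') : τ = τ' := by
  rw [← sub_eq_zero]
  refine tensor_ext (α := {u // Adm c d u}) (β := {v // Adm c' d' v}) (fun u => valAt u.1)
    (fun v => valAt v.1) (fun x hx => eq_zero_of_val fun u hu => hx ⟨u, hu⟩)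
    (fun x hx => eq_zero_of_val fun u hu => hx ⟨u, hu⟩) fun u v => ?_
  rw [map_sub, sub_eq_zero]
  exact h u.1 v.1 u.2 v.2

theorem valAt₂_map {f : Coop K c d →ₗ[K] Coop K c₁ d₁}
    {g : Coop K c' d' →ₗ[K] Coop K c₁' d₁'} {u : FreeMagma ι'}
    {v : FreeMagma κ'} {u' : FreeMagma ι} {v' : FreeMagma κ} (hf : ∀ x, val (f x) u = val x u')
    (hg : ∀ x, val (g x) v = val x v') (τ : Coop K c d ⊗[K] Coop K c' d') :
    valAt₂ u v (TensorProduct.map f g τ) = valAt₂ u' v' τ := by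
  induction τ with
  | zero => simp
  | add x y hx hy => rw [map_add, map_add, hx, hy, map_add]
  | tmul x y => rw [TensorProduct.map_tmul, valAt₂_tmul, valAt₂_tmul, hf, hg]

theorem Contract.color_congr {J : Finset ι} {J' : Finset κ} (σ : ι ≃ κ)
    (hJ : ∀ i, σ i ∈ J' ↔ i ∈ J) (h : ∀ i, c i = c' (σ i)) (e : PairColor) (o : Contract J) :
    color c J e o = color c' J' e (Contract.congr σ hJ o) := by
  cases o with
  | new => rfl
  | old i => exact h i

theorem restrictColor_congr {J : Finset ι} {J' : Finset κ} (σ : ι ≃ κ)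
    (hJ : ∀ i, σ i ∈ J' ↔ i ∈ J) (h : ∀ i, c i = c' (σ i)) (j : J) :
    restrictColor c J j = restrictColor c' J' (restrictEquiv σ hJ j) := h j

theorem graftAt_rename {J : Finset ι} {J' : Finset κ} (σ : ι ≃ κ)
    (hJ : ∀ i, σ i ∈ J' ↔ i ∈ J) (u : FreeMagma (Contract J)) (v : FreeMagma J) :
    graftAt (rename (Contract.congr σ hJ) u) (rename (restrictEquiv σ hJ) v) =
      rename σ (graftAt u v) := by
  refine (subst_subst _ _ _).trans (Eq.trans ?_ (subst_subst _ _ _).symm)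
  congr 1
  funext o
  cases o with
  | new =>
    exact (subst_subst _ _ _).trans
      (subst_subst (fun j : J => FreeMagma.of (j : ι)) (fun i => FreeMagma.of (σ i)) v).symm
  | old i => rfl

theorem dec_pull₀ {J : Finset ι} {J' : Finset κ} (σ : ι ≃ κ) (hJ : ∀ i, σ i ∈ J' ↔ i ∈ J)
    (h : ∀ i, c i = c' (σ i)) (d e : PairColor) (x : Coop K c' d) : dec c J d e (pull₀ σ h d x) =
      TensorProduct.map (pull₀ (Contract.congr σ hJ) (Contract.color_congr σ hJ h e) d)
        (pull₀ (restrictEquiv σ hJ) (restrictColor_congr σ hJ h) e) (dec c' J' d e x) := by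
  refine tensor_ext_val fun u v hu hv => ?_
  rw [valAt₂_dec _ hu hv, val_pull₀, valAt₂_map (fun _ => val_pull₀ _ _ _ _ _)
    (fun _ => val_pull₀ _ _ _ _ _), valAt₂_dec, graftAt_rename]
  · exact (adm_rename_iff _ (Contract.color_congr σ hJ h e)).2 hu
  · exact (adm_rename_iff _ (restrictColor_congr σ hJ h)).2 hv

end TensorExt

variable {K : Type u} [Field K] {κ : Type} {b : κ → PairColor} {d e : PairColor}

namespace Cobar

open CobarTree Finset

variable {ι : Type} [Fintype ι] [LinearOrder ι] {c : ι → PairColor} {J : Finset ι}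

/-- The subsets of the inputs of a vertex along which it can be split in two vertices. -/
def Splits (J : Finset ι) : Prop := 2 ≤ J.card ∧ J.card < Fintype.card ι

theorem Splits.two_le_card (hJ : Splits J) : 2 ≤ Fintype.card J := by
  rw [Fintype.card_coe]; exact hJ.1

/-- The tree with root decorated by `y` and with the branches in `J`. -/
abbrev upper (hJ : Splits J) (y : Coop K (restrictColor c J) e)
    (ts : Branches K b c) : CTree K b e :=
  node (c := restrictColor c J) hJ.two_le_card y fun j => ts j

/-- The shifted degree of the tree `upper`. -/
def upperPar (ts : Branches K b c) (J : Finset ι) (e : PairColor) : ℤ :=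
  (koszulCoop K).deg (restrictColor c J) e + 1 + ∑ j : J, (ts j).deg + 1

theorem deg_upper (hJ : Splits J) (y : Coop K (restrictColor c J) e)
    (ts : Branches K b c) : (upper hJ y ts).deg + 1 = upperPar ts J e := rfl

theorem negOnePow_upperPar (ts : Branches K b c) (J : Finset ι) (e : PairColor) :
    (upperPar ts J e).negOnePow = (1 + ∑ j ∈ J, pars ts j).negOnePow := by
  rw [upperPar, koszulCoop_deg, Int.negOnePow_eq_iff, sum_add_distrib, sum_const, Fintype.card_coe,
    sum_coe_sort J fun j => (ts j).deg]
  exact ⟨1 - J.card, by simp; ring⟩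

open Classical in
/-- The linear map `Cobar.split`, normalised by a sign, and extended by zero to all subsets. -/
def splitN (ts : Branches K b c) (J : Finset ι) (d e : PairColor) :
    Coop K (color c J e) d ⊗[K] Coop K (restrictColor c J) e →ₗ[K] CAlg K b d :=
  if hJ : Splits J then
    (rootSign (color (pars ts) J (upperPar ts J e)) * rootSign fun j : J => pars ts j) •
      split d ts J e hJ.1 hJ.2
  else 0

theorem splitN_of_not (ts : Branches K b c) (hJ : ¬ Splits J) : splitN ts J d e = 0 := dif_neg hJ

theorem splitN_of (ts : Branches K b c) (hJ : Splits J)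
    (τ : Coop K (color c J e) d ⊗[K] Coop K (restrictColor c J) e) : splitN ts J d e τ =
      (rootSign (color (pars ts) J (upperPar ts J e)) * rootSign fun j : J => pars ts j) •
      split d ts J e hJ.1 hJ.2 τ := by
  rw [splitN, dif_pos hJ]; rfl

theorem splitN_tmul (ts : Branches K b c) (hJ : Splits J)
    (y : Coop K (color c J e) d) (z : Coop K (restrictColor c J) e) :
    splitN ts J d e (y ⊗ₜ z) = rootSign (fun j : J => pars ts j) •
      nd (two_le_card_contract hJ.2) y (contractBranches (upper hJ z ts) ts) := by
  rw [splitN_of ts hJ, nd, pars_contractBranches, mul_comm, mul_smul]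
  rfl

/-- The part of the differential that splits the root. -/
def rootPart (ts : Branches K b c) (d : PairColor) : Coop K c d →ₗ[K] CAlg K b d :=
  ∑ J, ∑ e, frontSign J (pars ts) • splitN ts J d e ∘ₗ dec c J d e

theorem rootPart_apply (ts : Branches K b c) (x : Coop K c d) :
    rootPart ts d x = ∑ J, ∑ e, frontSign J (pars ts) • splitN ts J d e (dec c J d e x) := by
  rw [rootPart, LinearMap.sum_apply]
  refine sum_congr rfl fun J _ => ?_
  rw [LinearMap.sum_apply]
  rfl

/-- The differential of a tree. -/
def treeD : ∀ {d : PairColor}, CTree K b d → CAlg K b d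
  | _, leaf _ => 0
  | _, node (ι := ι) (c := c) (d := d) hι x ts =>
    ∑ J : {J : Finset ι // 2 ≤ J.card ∧ J.card < Fintype.card ι}, ∑ e : PairColor,
      (((koszulCoop K).deg (color c J.1 e) d).negOnePow *
          frontSign J.1 fun i => (ts i).deg) •
        split d ts J.1 e J.2.1 J.2.2 ((koszulCoop K).decomp c J.1 d e x) +
    ∑ i, ((koszulCoop K).deg c d + 1 + ∑ j with j < i, (ts j).deg).negOnePow •
      plug hι x ts i (treeD (ts i))

variable (hι : 2 ≤ Fintype.card ι) (x : Coop K c d) (ts : Branches K b c)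

/-- The differential, with normalised signs. -/
theorem rootSign_smul_treeD : rootSign (pars ts) • treeD (node hι x ts) =
      rootPart ts d x - ∑ i, passSign (pars ts) i • plugSucc hι x ts i (treeD (ts i)) := by
  classical
  have hdeg : (fun i => pars ts i - 1) = fun i => (ts i).deg := by funext i; simp [pars]
  rw [treeD, smul_add, sub_eq_add_neg]
  congr 1
  · rw [rootPart_apply, smul_sum]
    symm
    refine (sum_subset (subset_univ (univ.filter fun J : Finset ι => Splits J)) fun J _ hJ => ?_).symm.trans ?_
    · simp only [mem_filter, mem_univ, true_and] at hJ
      exact sum_eq_zero fun e _ => by rw [splitN_of_not ts hJ, LinearMap.zero_apply, smul_zero]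
    · refine (sum_subtype _ (p := fun J => 2 ≤ J.card ∧ J.card < Fintype.card ι)
        (fun J => by
          rw [mem_filter]; exact ⟨fun h => h.2, fun h => ⟨mem_univ _, h⟩⟩) _).trans (sum_congr rfl fun J _ => ?_)
      rw [smul_sum]
      refine sum_congr rfl fun e _ => ?_
      rw [splitN_of ts J.2, koszulCoop_decomp, map_units_smul, smul_smul, smul_smul, smul_smul]
      congr 1
      have h := decomp_sign (J := J.1) (pars ts) (negOnePow_upperPar ts J.1 e)
      rw [hdeg] at h
      rw [← h, koszulCoop_deg, card_contract]
      rw [show (1 : ℤ) - (Fintype.card ι - J.1.card + 1) = J.1.card - Fintype.card ι by ring]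
      ac_rfl
  · rw [smul_sum, ← sum_neg_distrib]
    refine sum_congr rfl fun i _ => ?_
    have h := rootSign_raise (pars ts) i
    rw [show (fun j => pars ts j - 1) = fun j => (ts j).deg from hdeg] at h
    rw [plugSucc_apply, smul_smul, smul_smul, ← Units.neg_smul, ← neg_mul, ← h, mul_comm]
    congr 2
    rw [koszulCoop_deg, Int.negOnePow_eq_iff]
    exact ⟨1 - Fintype.card ι, by ring⟩

theorem splits_congr {ι' : Type} [Fintype ι'] [LinearOrder ι'] {J' : Finset ι'} (σ : ι ≃ ι')
    (hJ : ∀ i, σ i ∈ J' ↔ i ∈ J) : Splits J' ↔ Splits J := by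
  rw [Splits, Splits, Fintype.card_congr σ, ← Fintype.card_coe J, ← Fintype.card_coe J',
    Fintype.card_congr (restrictEquiv σ hJ)]

theorem splitN_perm {ι' : Type} [Fintype ι'] [LinearOrder ι'] {J' : Finset ι'} (σ : ι ≃ ι')
    (hJ : ∀ i, σ i ∈ J' ↔ i ∈ J) {c' : ι' → PairColor} (ts : Branches K b c')
    (τ : Coop K (color c' J' e) d ⊗[K] Coop K (restrictColor c' J') e) :
    splitN (c := c' ∘ σ) (fun i => ts (σ i)) J d e
      (TensorProduct.map (pull₀ (Contract.congr σ hJ) (Contract.color_congr σ hJ (fun _ => rfl) e) d)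
        (pull₀ (restrictEquiv σ hJ) (restrictColor_congr σ hJ (fun _ => rfl)) e) τ) =
      (koszulSign (Contract.congr σ hJ) (color (pars ts) J' (upperPar ts J' e)) *
        koszulSign (restrictEquiv σ hJ) fun k => pars ts k) • splitN ts J' d e τ := by
  by_cases h' : Splits J'
  swap
  · rw [splitN_of_not _ h', splitN_of_not _ (by rwa [splits_congr σ hJ] at h')]
    rw [LinearMap.zero_apply, LinearMap.zero_apply, smul_zero]
  have h := (splits_congr σ hJ).1 h'
  induction τ with
  | zero => simp
  | add x y hx hy => rw [map_add, map_add, hx, hy, map_add, smul_add]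
  | tmul y z =>
    rw [TensorProduct.map_tmul, splitN_tmul _ h, splitN_tmul _ h']
    have h₁ := nd_pull₀ h.two_le_card h'.two_le_card
      (restrictColor_congr (c := c' ∘ σ) σ hJ fun _ => rfl) z (fun j => ts (σ j)) (fun j => ts j)
      (fun _ => HEq.rfl)
    rw [nd, nd, smul_smul] at h₁
    have h₂ : (upper (c := c' ∘ σ) h (pull₀ (restrictEquiv σ hJ) (restrictColor_congr σ hJ (fun _ => rfl)) e z)
        fun i => ts (σ i)).deg = (upper h' z ts).deg :=
      deg_node_congr (restrictEquiv σ hJ) fun _ => rfl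
    refine (nd_contractBranches_congr _ _ _ h₂ h₁).trans ?_
    have h₃ := nd_pull₀ (two_le_card_contract h.2) (two_le_card_contract h'.2)
      (Contract.color_congr (c := c' ∘ σ) σ hJ (fun _ => rfl) e) y
      (contractBranches (upper h' z ts) fun i => ts (σ i)) (contractBranches (upper h' z ts) ts)
      (fun o => by cases o <;> rfl)
    rw [h₃, smul_smul, smul_smul, pars_contractBranches, deg_upper]
    congr 1
    ac_rfl

theorem rootPart_perm {ι' : Type} [Fintype ι'] [LinearOrder ι'] (σ : ι ≃ ι')
    {c' : ι' → PairColor} (ts : Branches K b c') (x : Coop K c' d) :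
    rootPart (c := c' ∘ σ) (fun i => ts (σ i)) d (pull₀ σ (fun _ => rfl) d x) =
      koszulSign σ (pars ts) • rootPart ts d x := by
  rw [rootPart_apply, rootPart_apply, smul_sum]
  refine Fintype.sum_equiv (Equiv.finsetCongr σ) _ _ fun J => ?_
  rw [smul_sum]
  refine sum_congr rfl fun e _ => ?_
  have hJ : ∀ i, σ i ∈ Equiv.finsetCongr σ J ↔ i ∈ J := fun i => by simp
  rw [dec_pull₀ σ hJ, splitN_perm σ hJ, smul_smul, smul_smul]
  congr 1
  exact frontSign_perm σ hJ (pars ts) _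

theorem plugSucc_perm {ι' : Type} [Fintype ι'] [LinearOrder ι'] (hι : 2 ≤ Fintype.card ι)
    (hι' : 2 ≤ Fintype.card ι') (σ : ι ≃ ι') {c' : ι' → PairColor} (ts : Branches K b c')
    (x : Coop K c' d) (i : ι) {z : CAlg K b (c' (σ i))}
    (hz : z ∈ homog K b (c' (σ i)) ((ts (σ i)).deg + 1)) :
    plugSucc (c := c' ∘ σ) hι (pull₀ σ (fun _ => rfl) d x) (fun i => ts (σ i)) i z =
      koszulSign σ (raise (pars ts) (σ i)) • plugSucc hι' x ts (σ i) z := by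
  have : ∀ ε : ℤˣ, ε • plugSucc hι' x ts (σ i) z = (ε • plugSucc hι' x ts (σ i)) z := fun _ => rfl
  rw [this]
  refine eq_of_mem_homog (fun t ht => ?_) hz
  change _ = koszulSign σ (raise (pars ts) (σ i)) • plugSucc hι' x ts (σ i) (mk t)
  rw [plugSucc_mk _ _ _ _ ht, plugSucc_mk hι' x ts (σ i) ht, ← pars_update_succ _ _ _ ht]
  refine nd_perm hι hι' σ (fun _ => rfl) (fun u _ => val_pull₀ _ _ _ _ _) fun j => ?_
  by_cases h : j = i
  · subst h
    rw [update_self, update_self]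
  · rw [update_of_ne h, update_of_ne (σ.injective.ne h)]

omit [Fintype ι] in
theorem contractBranches_update_of_mem {i : ι} (hi : i ∈ J) (s : CTree K b e)
    (ts : Branches K b c) (t : CTree K b (c i)) :
    contractBranches (J := J) s (update ts i t) = contractBranches s ts := by
  funext o
  cases o with
  | new => rfl
  | old j => exact update_of_ne (fun h => j.2 (by rw [h]; exact hi)) _ _

omit [Fintype ι] in
theorem contractBranches_update_of_notMem {i : ι} (hi : i ∉ J) (s : CTree K b e)
    (ts : Branches K b c) (t : CTree K b (c i)) : contractBranches (J := J) s (update ts i t) =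
      update (contractBranches s ts) (old ⟨i, hi⟩) t := by
  funext o
  cases o with
  | new =>
    exact (update_of_ne (β := fun o => CTree K b (color c J e o))
      (a := new) (a' := old ⟨i, hi⟩) (by simp) t (contractBranches s ts)).symm
  | old j =>
    by_cases h : (j : ι) = i
    · obtain ⟨j, hj⟩ := j
      obtain rfl : j = i := h
      exact (update_self j t ts).trans (update_self
        (β := fun o => CTree K b (color c J e o)) (old ⟨j, hi⟩) t _).symm
    · exact (update_of_ne h t ts).trans (update_of_ne
        (β := fun o => CTree K b (color c J e o)) (a := old j)
        (a' := old ⟨i, hi⟩) (fun h' => h (by injection h' with h'; rw [h']))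
        t (contractBranches s ts)).symm

omit [Fintype ι] in
theorem restrict_update_of_mem {i : ι} (hi : i ∈ J) (ts : Branches K b c)
    (t : CTree K b (c i)) : (fun j : J => update ts i t j) =
      update (fun j : J => ts j) ⟨i, hi⟩ t := by
  funext j
  by_cases h : (j : ι) = i
  · obtain ⟨j, hj⟩ := j
    obtain rfl : j = i := h
    exact (update_self j t ts).trans (update_self
      (β := fun j : J => CTree K b (c j)) (⟨j, hi⟩ : J) t fun j : J => ts j).symm
  · exact (update_of_ne h t ts).trans (update_of_ne
      (β := fun j : J => CTree K b (c j)) (a := j) (a' := ⟨i, hi⟩)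
      (fun h' => h (congrArg Subtype.val h')) t fun j : J => ts j).symm

omit [Fintype ι] in
theorem restrict_update_of_notMem {i : ι} (hi : i ∉ J) (ts : Branches K b c)
    (t : CTree K b (c i)) : (fun j : J => update ts i t j) = fun j : J => ts j :=
  funext fun j => update_of_ne (fun h => hi (by rw [← h]; exact j.2)) _ _

/-- Grafting an element at the first input of the root. -/
theorem exists_splitN_update (ts : Branches K b c) (i : ι) (n : ℤ)
    (τ : Coop K (color c J e) d ⊗[K] Coop K (restrictColor c J) e) :
    ∃ G : CAlg K b (c i) →ₗ[K] CAlg K b d, ∀ t, t.deg = n →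
      splitN (update ts i t) J d e τ = G (mk t) := by
  by_cases hJ : Splits J
  swap
  · exact ⟨0, fun t _ => by rw [splitN_of_not _ hJ]; rfl⟩
  induction τ with
  | zero => exact ⟨0, fun t _ => by rw [map_zero]; rfl⟩
  | add x y hx hy =>
    obtain ⟨G, hG⟩ := hx
    obtain ⟨H, hH⟩ := hy
    exact ⟨G + H, fun t ht => by rw [map_add, hG t ht, hH t ht]; rfl⟩
  | tmul y z =>
    by_cases ht : ∃ t : CTree K b (c i), t.deg = n
    swap
    · exact ⟨0, fun t h => absurd ⟨t, h⟩ ht⟩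
    obtain ⟨t₀, ht₀⟩ := ht
    have hp : ∀ t : CTree K b (c i), t.deg = n →
        pars (update ts i t) = pars (update ts i t₀) := by
      intro t ht
      rw [pars_update, pars_update, ht, ht₀]
    have hu : ∀ t : CTree K b (c i), t.deg = n →
        upperPar (update ts i t) J e = upperPar (update ts i t₀) J e := by
      intro t ht
      have : ∀ j, (update ts i t j).deg = (update ts i t₀ j).deg := fun j => by
        have := congrFun (hp t ht) j
        simpa [pars] using this
      simp only [upperPar, this]
    suffices h : ∃ G : CAlg K b (c i) →ₗ[K] CAlg K b d, ∀ t, t.deg = n →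
        split d (update ts i t) J e hJ.1 hJ.2 (y ⊗ₜ z) = G (mk t) by
      obtain ⟨G, hG⟩ := h
      refine ⟨(rootSign (color (pars (update ts i t₀)) J
        (upperPar (update ts i t₀) J e)) *
          rootSign fun j : J => pars (update ts i t₀) j) • G, fun t ht => ?_⟩
      rw [splitN_of _ hJ, hG t ht, hp t ht, hu t ht]
      rfl
    by_cases hi : i ∈ J
    · obtain ⟨L, hL⟩ := exists_mk_contractBranches (two_le_card_contract hJ.2) y ts
        (upper hJ z (update ts i t₀))
      refine ⟨L ∘ₗ plug (c := restrictColor c J) hJ.two_le_card z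
        (fun j => ts j) ⟨i, hi⟩, fun t _ => ?_⟩
      change mk (node _ y (contractBranches (upper hJ z (update ts i t))
        (update ts i t))) = L (plug (c := restrictColor c J) _ z _ ⟨i, hi⟩ (mk t))
      rw [contractBranches_update_of_mem hi, hL, plug_mk, upper, restrict_update_of_mem hi]
      rfl
    · refine ⟨plug (two_le_card_contract hJ.2) y (contractBranches (upper hJ z ts) ts)
        (old ⟨i, hi⟩), fun t _ => ?_⟩
      change mk (node _ y (contractBranches (upper hJ z (update ts i t))
        (update ts i t))) = _
      rw [contractBranches_update_of_notMem hi, upper, restrict_update_of_notMem hi]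
      exact (plug_mk (two_le_card_contract hJ.2) y (contractBranches (upper hJ z ts) ts)
        (old ⟨i, hi⟩) t).symm

theorem plug_update_self (i : ι) (t : CTree K b (c i)) :
    plug hι x (update ts i t) i = plug hι x ts i :=
  hom_ext fun s => by rw [plug_mk, plug_mk, Function.update_idem]

/-- Replacing two branches. -/
def plug₂ {i j : ι} (hij : j ≠ i) : CAlg K b (c i) →ₗ[K] CAlg K b (c j) →ₗ[K] CAlg K b d :=
  liftTree (fun t => plug hι x (update ts i t) j) fun f hf => by
    refine hom_ext fun s => ?_
    have h₁ : ∀ t, plug hι x (update ts i t) j (mk s) =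
        plug hι x (update ts j s) i (mk t) := fun t => by
      rw [plug_mk, plug_mk, update_comm hij]
    have h₂ := congrArg (plug hι x (update ts j s) i) (linearCombination_mk f)
    rw [(Submodule.Quotient.mk_eq_zero _).2 (Submodule.subset_span hf), map_zero,
      Finsupp.linearCombination_apply, map_finsuppSum] at h₂
    rw [Finsupp.linearCombination_apply, Finsupp.sum, LinearMap.sum_apply, LinearMap.zero_apply, ← h₂]
    exact sum_congr rfl fun t _ => by
      rw [LinearMap.smul_apply, h₁]; exact (map_smul _ _ _).symm

theorem plug₂_mk {i j : ι} (hij : j ≠ i) (t : CTree K b (c i)) :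
    plug₂ hι x ts hij (mk t) = plug hι x (update ts i t) j := liftTree_mk _ _ t

theorem plug₂_comm {i j : ι} (hij : j ≠ i) (z : CAlg K b (c i)) (w : CAlg K b (c j)) :
    plug₂ hι x ts hij z w = plug₂ hι x ts hij.symm w z := by
  have : plug₂ hι x ts hij = (plug₂ hι x ts hij.symm).flip := hom_ext fun t => hom_ext fun s => by
    rw [LinearMap.flip_apply, plug₂_mk, plug₂_mk, plug_mk, plug_mk, update_comm hij]
  rw [this, LinearMap.flip_apply]

theorem splitN_mem_homog (ts : Branches K b c) {n : ℤ}
    (hn : n = 3 - Fintype.card ι + ∑ i, (ts i).deg)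
    (τ : Coop K (color c J e) d ⊗[K] Coop K (restrictColor c J) e) :
    splitN ts J d e τ ∈ homog K b d n := by
  by_cases hJ : Splits J
  swap
  · rw [splitN_of_not _ hJ]; exact zero_mem _
  induction τ with
  | zero => rw [map_zero]; exact zero_mem _
  | add x y hx hy => rw [map_add]; exact add_mem hx hy
  | tmul y z =>
    rw [splitN_tmul _ hJ, nd, smul_smul, Units.smul_def]
    refine zsmul_mem (mk_mem_homog ?_) _
    have h₁ : ∑ o, (contractBranches (J := J) (upper hJ z ts) ts o).deg =
        (upper hJ z ts).deg + ∑ i : {i // i ∉ J}, (ts i).deg := by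
      rw [← Equiv.sum_comp Contract.equivOption.symm, Fintype.sum_option]
      rfl
    have h₂ : ∑ i, (ts i).deg = ∑ j : J, (ts j).deg + ∑ i : {i // i ∉ J}, (ts i).deg := by
      rw [sum_coe_sort J fun j => (ts j).deg, ← sum_compl_add_sum J, add_comm]
      congr 1
      exact sum_subtype Jᶜ (fun i => by simp) _
    rw [deg_node, h₁, deg_node, card_contract, Fintype.card_coe, hn, h₂]
    ring

theorem plugSucc_mem_homog (i : ι) {z : CAlg K b (c i)}
    (hz : z ∈ homog K b (c i) ((ts i).deg + 1)) :
    plugSucc hι x ts i z ∈ homog K b d ((node hι x ts).deg + 1) := by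
  rw [plugSucc_apply, Units.smul_def]
  refine zsmul_mem ?_ _
  have := plug_mem_homog hι x ts i hz
  rw [deg_node]
  convert this using 2
  ring

theorem treeD_mem_homog (t : CTree K b d) : treeD t ∈ homog K b d (t.deg + 1) := by
  induction t with
  | leaf k => exact zero_mem _
  | @node ι _ _ hι c d x ts ih =>
    have h := rootSign_smul_treeD hι x ts
    have h' : treeD (node hι x ts) = rootSign (pars ts) • (rootPart ts d x -
        ∑ i, passSign (pars ts) i • plugSucc hι x ts i (treeD (ts i))) := by
      rw [← h, smul_smul, Int.units_mul_self, one_smul]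
    rw [h', Units.smul_def, rootPart_apply]
    refine zsmul_mem (sub_mem (sum_mem fun J _ => sum_mem fun e _ => ?_) (sum_mem fun i _ => ?_)) _
    · rw [Units.smul_def]
      refine zsmul_mem (splitN_mem_homog ts ?_ _) _
      rw [deg_node]; ring
    · rw [Units.smul_def]
      exact zsmul_mem (plugSucc_mem_homog hι x ts i (ih i)) _

end Cobar

end

section

variable {K : Type u} [Field K] {κ : Type} {b : κ → PairColor} {d e : PairColor}

namespace Cobar

open CobarTree Finset

variable {ι : Type} [Fintype ι] [LinearOrder ι] {c : ι → PairColor} {J : Finset ι}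

variable (hι : 2 ≤ Fintype.card ι) (x : Coop K c d) (ts : Branches K b c)

theorem treeD_node : treeD (node hι x ts) = rootSign (pars ts) •
      (rootPart ts d x - ∑ i, passSign (pars ts) i • plugSucc hι x ts i (treeD (ts i))) := by
  rw [← rootSign_smul_treeD, smul_smul, Int.units_mul_self, one_smul]

theorem plug_add (hι : 2 ≤ Fintype.card ι) (x y : Coop K c d)
    (ts : Branches K b c) (i : ι) : plug hι (x + y) ts i = plug hι x ts i + plug hι y ts i :=
  hom_ext fun t => by rw [LinearMap.add_apply, plug_mk, plug_mk, plug_mk, mk_node_add]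

theorem plug_smul (hι : 2 ≤ Fintype.card ι) (r : K) (x : Coop K c d)
    (ts : Branches K b c) (i : ι) : plug hι (r • x) ts i = r • plug hι x ts i :=
  hom_ext fun t => by rw [LinearMap.smul_apply, plug_mk, plug_mk, mk_node_smul]

theorem plugSucc_add (hι : 2 ≤ Fintype.card ι) (x y : Coop K c d)
    (ts : Branches K b c) (i : ι) (z : CAlg K b (c i)) :
    plugSucc hι (x + y) ts i z = plugSucc hι x ts i z + plugSucc hι y ts i z := by
  rw [plugSucc_apply, plugSucc_apply, plugSucc_apply, plug_add, LinearMap.add_apply, smul_add]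

theorem plugSucc_smul (hι : 2 ≤ Fintype.card ι) (r : K) (x : Coop K c d)
    (ts : Branches K b c) (i : ι) (z : CAlg K b (c i)) :
    plugSucc hι (r • x) ts i z = r • plugSucc hι x ts i z := by
  rw [plugSucc_apply, plugSucc_apply, plug_smul, LinearMap.smul_apply, smul_comm]

theorem treeD_perm {ι' : Type} [Fintype ι'] [LinearOrder ι'] (hι : 2 ≤ Fintype.card ι)
    (hι' : 2 ≤ Fintype.card ι') (σ : ι ≃ ι') {c' : ι' → PairColor} (x : Coop K c' d)
    (ts : Branches K b c') : treeD (node hι ((koszulCoop K).pull σ c' d x) fun i => ts (σ i)) =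
      koszulSign σ (fun i => (ts i).deg) • treeD (node hι' x ts) := by
  have h₀ : ∀ y : Coop K (c' ∘ σ) d, ∀ ε : ℤˣ,
      treeD (node hι (ε • y) fun i => ts (σ i)) = ε • treeD (node hι y fun i => ts (σ i)) := by
    intro y ε
    have hk : ∃ k : K, ε • y = k • y ∧ ∀ z : CAlg K b d, ε • z = k • z := by
      refine ⟨((ε : ℤ) : K), ?_, fun z => ?_⟩ <;> rw [Units.smul_def, Int.cast_smul_eq_zsmul]
    obtain ⟨k, hy, hz⟩ := hk
    rw [treeD_node, treeD_node, hy, hz, map_smul]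
    simp only [plugSucc_smul, smul_sub, smul_sum, smul_comm k]
  rw [koszulCoop_pull, h₀, treeD_node, treeD_node, rootPart_perm]
  have h₁ : ∑ i, passSign (pars fun i => ts (σ i)) i •
      plugSucc (c := c' ∘ σ) hι (pull₀ σ (fun _ => rfl) d x) (fun i => ts (σ i)) i (treeD (ts (σ i))) =
      koszulSign σ (pars ts) • ∑ i, passSign (pars ts) i • plugSucc hι' x ts i (treeD (ts i)) := by
    rw [smul_sum]
    refine Fintype.sum_equiv σ _ _ fun i => ?_
    refine (congrArg _ (plugSucc_perm hι hι' σ ts x i (treeD_mem_homog _))).trans ?_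
    rw [smul_smul, smul_smul]
    congr 1
    exact koszulSign_raise σ (pars ts) i
  refine (congrArg (fun z => _ • _ • (_ - z)) h₁).trans ?_
  rw [← smul_sub, smul_smul, smul_smul, smul_smul]
  congr 1
  have h₂ := rootSign_perm σ (pars ts)
  have h₃ : (fun k => pars ts k - 1) = fun k => (ts k).deg := by funext k; simp [pars]
  rw [h₃] at h₂
  change koszulSign σ (fun _ => 1) * rootSign (fun i => pars ts (σ i)) * koszulSign σ (pars ts) = _
  have h₄ : ∀ a b c e f : ℤˣ, a * b * c = e * f → b * c * e = a * f := by
    intro a b c e f h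
    calc b * c * e = (a * a) * (b * c * e) := by rw [Int.units_mul_self, one_mul]
      _ = a * e * (a * b * c) := by ac_rfl
      _ = (e * e) * (a * f) := by rw [h]; ac_rfl
      _ = _ := by rw [Int.units_mul_self, one_mul]
  exact h₄ _ _ _ _ _ h₂

theorem exists_treeD_update (i : ι) (n : ℤ) :
    ∃ (G : CAlg K b (c i) →ₗ[K] CAlg K b d) (H : CAlg K b (c i) →ₗ[K] CAlg K b d),
      ∀ t, t.deg = n → treeD (node hι x (update ts i t)) = G (mk t) + H (treeD t) := by
  choose G₁ hG₁ using fun (J : Finset ι) (e : PairColor) =>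
    exists_splitN_update ts i n (dec c J d e x)
  have h₂ : ∀ j, ∃ (G : CAlg K b (c i) →ₗ[K] CAlg K b d) (H : CAlg K b (c i) →ₗ[K] CAlg K b d),
      ∀ t, plug hι x (update ts i t) j (treeD (update ts i t j)) =
        G (mk t) + H (treeD t) := by
    intro j
    by_cases hj : j = i
    · subst hj
      refine ⟨0, plug hι x ts j, fun t => ?_⟩
      rw [plug_update_self, update_self, LinearMap.zero_apply, zero_add]
    · refine ⟨(plug₂ hι x ts hj).flip (treeD (ts j)), 0, fun t => ?_⟩
      rw [update_of_ne hj, LinearMap.flip_apply, plug₂_mk, LinearMap.zero_apply, add_zero]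
  choose G₂ H₂ hG₂ using h₂
  set N := update (pars ts) i (n + 1) with hN
  refine ⟨rootSign N • (∑ J, ∑ e, frontSign J N • G₁ J e - ∑ j, (passSign N j *
    rootSign (raise N j)) • G₂ j), - (rootSign N • ∑ j, (passSign N j * rootSign (raise N j)) • H₂ j),
    fun t ht => ?_⟩
  have hp : pars (update ts i t) = N := by rw [pars_update, ht]
  simp only [treeD_node, rootPart_apply, plugSucc_apply, hp, hG₁ _ _ t ht, hG₂, smul_smul]
  have hs : ∀ (ε : ℤˣ) (L : CAlg K b (c i) →ₗ[K] CAlg K b d) (z : CAlg K b (c i)),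
      (ε • L) z = ε • L z := fun _ _ _ => rfl
  simp only [LinearMap.neg_apply, hs, LinearMap.sub_apply, LinearMap.sum_apply, smul_add,
    sum_add_distrib, smul_sub]
  abel

/-- The differential of the cobar construction. -/
def D (d : PairColor) : CAlg K b d →ₗ[K] CAlg K b d :=
  liftTree treeD fun _ hf => linearCombination_eq_zero (V := fun d => CAlg K b d) treeD
    (fun hι c d x y ts => by
      simp only [treeD_node, map_add, plugSucc_add, smul_add, sum_add_distrib, smul_sub]
      abel)
    (fun hι c d r x ts => by
      simp only [treeD_node, map_smul, plugSucc_smul, smul_sub, smul_sum, smul_comm r])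
    (fun hι hι' σ c d x ts => treeD_perm hι hι' σ x ts)
    (fun hι c d x ts i n m => by
      obtain ⟨G, H, h⟩ := exists_treeD_update hι x ts i n
      exact ⟨G, H, fun t ht _ => h t ht⟩) hf

theorem D_mk (t : CTree K b d) : D d (mk t) = treeD t := liftTree_mk _ _ t

theorem isDifferential_D : IsDifferential (D : ∀ d, CAlg K b d →ₗ[K] CAlg K b d) where
  leaf k := D_mk _
  node hι c d x ts := by
    rw [D_mk, treeD]
    simp only [D_mk]

theorem D_mem_homog {n : ℤ} {z : CAlg K b d} (hz : z ∈ homog K b d n) :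
    D d z ∈ homog K b d (n + 1) := by
  refine map_mem_of_homog (fun t ht => ?_) hz
  rw [D_mk, ← ht]
  exact treeD_mem_homog t

/-- The differential of a tree, with normalised signs. -/
theorem D_nd : D d (nd hι x ts) =
      rootPart ts d x - ∑ i, passSign (pars ts) i • plugSucc hι x ts i (D (c i) (mk (ts i))) := by
  simp only [nd, map_units_smul, D_mk, rootSign_smul_treeD]

end Cobar

end

/-! ### Coassociativity of the Koszul dual cooperad -/

section Iterated

open Finset

theorem adm_graftAt {ι : Type} {c : ι → PairColor} {J : Finset ι} {d e : PairColor}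
    {u : FreeMagma (Contract J)} {v : FreeMagma J} (hu : Adm (color c J e) d u)
    (hv : Adm (restrictColor c J) e v) : Adm c d (graftAt u v) := by
  obtain ⟨s, rfl⟩ := hu.exists_mTree (K := ℚ)
  obtain ⟨t, rfl⟩ := hv.exists_mTree (K := ℚ)
  rw [← erase_graft]
  exact adm_erase ((commDual ℚ).graftM s t)

/-- The associativity of the tensor product. -/
def tensorAssoc (K : Type*) [Field K] (V₁ V₂ V₃ : Type*) [AddCommGroup V₁] [AddCommGroup V₂]
    [AddCommGroup V₃] [Module K V₁] [Module K V₂] [Module K V₃] :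
    V₁ ⊗[K] (V₂ ⊗[K] V₃) →ₗ[K] (V₁ ⊗[K] V₂) ⊗[K] V₃ := (TensorProduct.assoc K V₁ V₂ V₃).symm

theorem tensorAssoc_tmul {K V₁ V₂ V₃ : Type*} [Field K] [AddCommGroup V₁] [AddCommGroup V₂]
    [AddCommGroup V₃] [Module K V₁] [Module K V₂] [Module K V₃] (x : V₁) (y : V₂) (z : V₃) :
    tensorAssoc K V₁ V₂ V₃ (x ⊗ₜ (y ⊗ₜ z)) = (x ⊗ₜ y) ⊗ₜ z := TensorProduct.assoc_symm_tmul x y z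

section Triple

variable {K : Type u} [Field K] {ι₁ ι₂ ι₃ κ₁ κ₂ κ₃ : Type} [Fintype ι₁] [LinearOrder ι₁] [Fintype ι₂]
  [LinearOrder ι₂] [Fintype ι₃] [LinearOrder ι₃] [Fintype κ₁] [LinearOrder κ₁] [Fintype κ₂]
  [LinearOrder κ₂] [Fintype κ₃] [LinearOrder κ₃]
  {c₁ : ι₁ → PairColor} {c₂ : ι₂ → PairColor} {c₃ : ι₃ → PairColor} {d₁ d₂ d₃ : PairColor}
  {c₁' : κ₁ → PairColor} {c₂' : κ₂ → PairColor} {c₃' : κ₃ → PairColor}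

/-- The value of an element of a triple tensor product at three trees. -/
def valAt₃ (u₁ : FreeMagma ι₁) (u₂ : FreeMagma ι₂) (u₃ : FreeMagma ι₃) :
    (Coop K c₁ d₁ ⊗[K] Coop K c₂ d₂) ⊗[K] Coop K c₃ d₃ →ₗ[K] K :=
  TensorProduct.dualDistrib K _ _ (valAt₂ u₁ u₂ ⊗ₜ valAt u₃)

theorem valAt₃_tmul (u₁ : FreeMagma ι₁) (u₂ : FreeMagma ι₂) (u₃ : FreeMagma ι₃)
    (τ : Coop K c₁ d₁ ⊗[K] Coop K c₂ d₂) (x : Coop K c₃ d₃) :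
    valAt₃ u₁ u₂ u₃ (τ ⊗ₜ x) = valAt₂ u₁ u₂ τ * val x u₃ :=
  TensorProduct.dualDistrib_apply _ _ _ _

theorem tensor_ext_val₃ {τ τ' : (Coop K c₁ d₁ ⊗[K] Coop K c₂ d₂) ⊗[K] Coop K c₃ d₃}
    (h : ∀ u₁ u₂ u₃, Adm c₁ d₁ u₁ → Adm c₂ d₂ u₂ → Adm c₃ d₃ u₃ →
      valAt₃ u₁ u₂ u₃ τ = valAt₃ u₁ u₂ u₃ τ') : τ = τ' := by
  rw [← sub_eq_zero]
  refine tensor_ext (α := {u : FreeMagma ι₁ × FreeMagma ι₂ // Adm c₁ d₁ u.1 ∧ Adm c₂ d₂ u.2})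
    (β := {v // Adm c₃ d₃ v}) (fun u => valAt₂ u.1.1 u.1.2)
    (fun v => valAt v.1) (fun x hx => ?_)
    (fun x hx => eq_zero_of_val fun u hu => hx ⟨u, hu⟩) fun u v => ?_
  · exact tensor_ext_val fun u v hu hv => by rw [hx ⟨(u, v), hu, hv⟩, map_zero]
  · rw [map_sub, sub_eq_zero]
    exact h u.1.1 u.1.2 v.1 u.2.1 u.2.2 v.2

theorem valAt₃_pull₀ (σ₁ : ι₁ ≃ κ₁) (h₁ : ∀ i, c₁ i = c₁' (σ₁ i)) (σ₂ : ι₂ ≃ κ₂)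
    (h₂ : ∀ i, c₂ i = c₂' (σ₂ i)) (σ₃ : ι₃ ≃ κ₃) (h₃ : ∀ i, c₃ i = c₃' (σ₃ i)) (u₁ : FreeMagma ι₁)
    (u₂ : FreeMagma ι₂) (u₃ : FreeMagma ι₃)
    (τ : (Coop K c₁' d₁ ⊗[K] Coop K c₂' d₂) ⊗[K] Coop K c₃' d₃) :
    valAt₃ u₁ u₂ u₃ (TensorProduct.map (TensorProduct.map (pull₀ σ₁ h₁ d₁) (pull₀ σ₂ h₂ d₂))
      (pull₀ σ₃ h₃ d₃) τ) = valAt₃ (rename σ₁ u₁) (rename σ₂ u₂) (rename σ₃ u₃) τ := by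
  induction τ with
  | zero => simp
  | add y z hy hz => rw [map_add, map_add, hy, hz, map_add]
  | tmul y z =>
    rw [TensorProduct.map_tmul, valAt₃_tmul, valAt₃_tmul, val_pull₀,
      valAt₂_map (fun _ => val_pull₀ _ _ _ _ _) (fun _ => val_pull₀ _ _ _ _ _)]

end Triple

section Nested

/-- The equality test of the order takes precedence, so that finite sets of inputs, of subsets of
inputs and of contractions are formed with the same instance. -/
local instance (priority := 2000) decidableEqOfLinearOrder {α : Type} [LinearOrder α] : DecidableEq α :=
  LinearOrder.toDecidableEq

variable {K : Type u} [Field K] {ι : Type} [Fintype ι] [LinearOrder ι] {c : ι → PairColor}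
  {I J : Finset ι} {J₂ : Finset (Contract I)} {I₂ : Finset (Contract J)} {I' : Finset J}
  {d e e' : PairColor}

theorem valAt₃_dec_left (x : Coop K c d) {u₁ : FreeMagma (Contract J₂)}
    {u₂ : FreeMagma J₂} {u₃ : FreeMagma I} (h₁ : Adm (color (color c I e) J₂ e') d u₁)
    (h₂ : Adm (restrictColor (color c I e) J₂) e' u₂) (h₃ : Adm (restrictColor c I) e u₃) :
    valAt₃ u₁ u₂ u₃ ((dec (color c I e) J₂ d e').rTensor _ (dec c I d e x)) =
      val x (graftAt (graftAt u₁ u₂) u₃) := by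
  rw [← valAt₂_dec x (adm_graftAt h₁ h₂) h₃]
  induction dec c I d e x with
  | zero => simp
  | add y z hy hz => rw [map_add, map_add, hy, hz, map_add]
  | tmul y z => rw [LinearMap.rTensor_tmul, valAt₃_tmul, valAt₂_dec _ h₁ h₂, valAt₂_tmul]

theorem valAt₃_dec_right (x : Coop K c d) {u₁ : FreeMagma (Contract J)}
    {u₂ : FreeMagma (Contract I')} {u₃ : FreeMagma I'} (h₁ : Adm (color c J e) d u₁)
    (h₂ : Adm (color (restrictColor c J) I' e') e u₂)
    (h₃ : Adm (restrictColor (restrictColor c J) I') e' u₃) : valAt₃ u₁ u₂ u₃ (tensorAssoc K _ _ _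
      ((dec (restrictColor c J) I' e e').lTensor _ (dec c J d e x))) =
      val x (graftAt u₁ (graftAt u₂ u₃)) := by
  rw [← valAt₂_dec x h₁ (adm_graftAt h₂ h₃)]
  induction dec c J d e x with
  | zero => simp
  | add y z hy hz => rw [map_add, map_add, map_add, hy, hz, map_add]
  | tmul y z =>
    rw [LinearMap.lTensor_tmul, valAt₂_tmul, ← valAt₂_dec _ h₂ h₃]
    induction dec (restrictColor c J) I' e e' z with
    | zero => simp
    | add v w hv hw =>
      rw [TensorProduct.tmul_add, map_add, map_add, hv, hw, map_add, mul_add]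
    | tmul v w =>
      rw [tensorAssoc_tmul, valAt₃_tmul, valAt₂_tmul, valAt₂_tmul, mul_assoc]

/-- Contracting nested subsets in two ways: the remaining inputs. -/
def nestedRoot (hnew : new ∈ J₂) (hold : ∀ i, old i ∈ J₂ ↔ (i : ι) ∈ J)
    (hd : I ⊆ J) : Contract J₂ ≃ Contract J where
  toFun o := match o with
    | .new => .new
    | .old ⟨.new, h⟩ => absurd hnew h
    | .old ⟨.old i, h⟩ => .old ⟨i, fun hi => h ((hold i).2 hi)⟩
  invFun o := match o with
    | .new => .new
    | .old i => .old ⟨.old ⟨i, fun hi => i.2 (hd hi)⟩, fun h => i.2 ((hold _).1 h)⟩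
  left_inv o := by
    match o with
    | .new => rfl
    | .old ⟨.new, h⟩ => exact absurd hnew h
    | .old ⟨.old i, h⟩ => rfl
  right_inv o := by cases o <;> rfl

/-- Contracting nested subsets in two ways: the intermediate inputs. -/
def nestedMid (hnew : new ∈ J₂) (hold : ∀ i, old i ∈ J₂ ↔ (i : ι) ∈ J)
    (hsub : ∀ j, j ∈ I' ↔ (j : ι) ∈ I) : J₂ ≃ Contract I' where
  toFun o := match o with
    | ⟨.new, _⟩ => .new
    | ⟨.old i, h⟩ => .old ⟨⟨i, (hold i).1 h⟩, fun hi => i.2 ((hsub _).1 hi)⟩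
  invFun o := match o with
    | .new => ⟨.new, hnew⟩
    | .old j => ⟨.old ⟨j, fun h => j.2 ((hsub _).2 h)⟩, (hold _).2 j.1.2⟩
  left_inv o := by
    match o with
    | ⟨.new, _⟩ => rfl
    | ⟨.old i, h⟩ => rfl
  right_inv o := by cases o <;> rfl

/-- Contracting nested subsets in two ways: the innermost inputs. -/
def nestedTop (hsub : ∀ j, j ∈ I' ↔ (j : ι) ∈ I) (hd : I ⊆ J) : I ≃ I' where
  toFun i := ⟨⟨i, hd i.2⟩, (hsub _).2 i.2⟩
  invFun i := ⟨i, (hsub _).1 i.2⟩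
  left_inv _ := rfl
  right_inv _ := rfl

variable (hnew : new ∈ J₂) (hold : ∀ i, old i ∈ J₂ ↔ (i : ι) ∈ J) (hd : I ⊆ J)
  (hsub : ∀ j, j ∈ I' ↔ (j : ι) ∈ I)

theorem nestedRoot_color (o : Contract J₂) : color (color c I e) J₂ e' o =
    color c J e' (nestedRoot hnew hold hd o) := by
  match o with
  | .new => rfl
  | .old ⟨.new, h⟩ => exact absurd hnew h
  | .old ⟨.old i, h⟩ => rfl

theorem nestedMid_color (o : J₂) : restrictColor (color c I e) J₂ o =
    color (restrictColor c J) I' e (nestedMid hnew hold hsub o) := by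
  match o with
  | ⟨.new, _⟩ => rfl
  | ⟨.old i, h⟩ => rfl

theorem nestedTop_color (o : I) : restrictColor c I o =
    restrictColor (restrictColor c J) I' (nestedTop hsub hd o) := rfl

theorem strictMono_nestedRoot : StrictMono (nestedRoot hnew hold hd) := by
  intro o p h
  match o, p with
  | .new, .new => exact absurd h (lt_irrefl _)
  | .new, .old ⟨.new, h'⟩ => exact absurd hnew h'
  | .new, .old ⟨.old i, _⟩ => exact new_lt_old _
  | .old ⟨.new, h'⟩, _ => exact absurd hnew h'
  | .old ⟨.old i, _⟩, .new => exact absurd h (not_old_lt_new _)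
  | .old ⟨.old i, _⟩, .old ⟨.new, h'⟩ => exact absurd hnew h'
  | .old ⟨.old i, _⟩, .old ⟨.old j, _⟩ =>
    exact Contract.old_lt_old.2 (Contract.old_lt_old.1 (Contract.old_lt_old.1 h))

theorem strictMono_nestedMid : StrictMono (nestedMid hnew hold hsub) := by
  intro o p h
  match o, p with
  | ⟨.new, _⟩, ⟨.new, _⟩ => exact absurd h (lt_irrefl _)
  | ⟨.new, _⟩, ⟨.old i, _⟩ => exact new_lt_old _
  | ⟨.old i, _⟩, ⟨.new, _⟩ => exact absurd h (not_old_lt_new i)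
  | ⟨.old i, _⟩, ⟨.old j, _⟩ =>
    have h' : (old i : Contract I) < old j := h
    have h'' := Contract.old_lt_old.1 h'
    exact Contract.old_lt_old.2 h''

theorem strictMono_nestedTop : StrictMono (nestedTop hsub hd) := fun _ _ h => h

theorem graftAt_nested (u₁ : FreeMagma (Contract J₂)) (u₂ : FreeMagma J₂) (u₃ : FreeMagma I) :
    graftAt (rename (nestedRoot hnew hold hd) u₁) (graftAt (rename (nestedMid hnew hold hsub) u₂)
      (rename (nestedTop hsub hd) u₃)) = graftAt (graftAt u₁ u₂) u₃ := by
  refine (subst_subst _ _ _).trans (Eq.trans ?_ (subst_subst _ _ _).symm)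
  congr 1
  funext o
  match o with
  | .old ⟨.new, h⟩ => exact absurd hnew h
  | .old ⟨.old i, h⟩ => rfl
  | .new =>
    refine (subst_subst _ _ _).trans ((subst_subst _ _ _).trans (Eq.trans ?_ (subst_subst _ _ _).symm))
    congr 1
    funext o
    match o with
    | ⟨.old i, h⟩ => rfl
    | ⟨.new, _⟩ => exact (subst_subst _ _ _).trans (subst_subst _ _ _)

/-- Coassociativity, for nested subsets of the inputs. -/
theorem dec_nested (x : Coop K c d) : (dec (color c I e) J₂ d e').rTensor _ (dec c I d e x) =
      TensorProduct.map (TensorProduct.map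
        (pull₀ (nestedRoot hnew hold hd) (nestedRoot_color hnew hold hd) d)
        (pull₀ (nestedMid hnew hold hsub) (nestedMid_color hnew hold hsub) e'))
        (pull₀ (nestedTop hsub hd) (nestedTop_color hd hsub) e) (tensorAssoc K _ _ _
        ((dec (restrictColor c J) I' e' e).lTensor _ (dec c J d e' x))) := by
  refine tensor_ext_val₃ fun u₁ u₂ u₃ h₁ h₂ h₃ => ?_
  rw [valAt₃_dec_left x h₁ h₂ h₃, ← graftAt_nested hnew hold hd hsub]
  refine Eq.trans ?_ (valAt₃_pull₀ _ _ _ _ _ _ _ _ _ _).symm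
  rw [valAt₃_dec_right x
    ((adm_rename_iff _ (nestedRoot_color hnew hold hd)).2 h₁)
    ((adm_rename_iff _ (nestedMid_color hnew hold hsub)).2 h₂)
    ((adm_rename_iff _ (nestedTop_color hd hsub)).2 h₃)]

end Nested

section Disjoint

variable {K : Type u} [Field K] {ι : Type} [Fintype ι] [LinearOrder ι] {c : ι → PairColor}
  {I J : Finset ι} {J₂ : Finset (Contract I)} {I₂ : Finset (Contract J)}
  {d e e' : PairColor}

/-- Contracting disjoint subsets in two orders: the remaining inputs. The two new inputs are
interchanged. -/
def disjointRoot (hnew : new ∉ J₂) (hold : ∀ i, old i ∈ J₂ ↔ (i : ι) ∈ J)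
    (hnew' : new ∉ I₂) (hold' : ∀ i, old i ∈ I₂ ↔ (i : ι) ∈ I) : Contract J₂ ≃ Contract I₂ where
  toFun o := match o with
    | .new => .old ⟨.new, hnew'⟩
    | .old ⟨.new, _⟩ => .new
    | .old ⟨.old i, h⟩ => .old ⟨.old ⟨i, fun hi => h ((hold i).2 hi)⟩, fun hi => i.2 ((hold' _).1 hi)⟩
  invFun o := match o with
    | .new => .old ⟨.new, hnew⟩
    | .old ⟨.new, _⟩ => .new
    | .old ⟨.old i, h⟩ => .old ⟨.old ⟨i, fun hi => h ((hold' i).2 hi)⟩, fun hi => i.2 ((hold _).1 hi)⟩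
  left_inv o := by
    match o with
    | .new => rfl
    | .old ⟨.new, h⟩ => rfl
    | .old ⟨.old i, h⟩ => rfl
  right_inv o := by
    match o with
    | .new => rfl
    | .old ⟨.new, h⟩ => rfl
    | .old ⟨.old i, h⟩ => rfl

/-- Contracting disjoint subsets in two orders: the inputs of the contracted vertices. -/
def disjointTop (hnew : new ∉ J₂) (hold : ∀ i, old i ∈ J₂ ↔ (i : ι) ∈ J)
    (hd : Disjoint I J) : J₂ ≃ J where
  toFun o := match o with
    | ⟨.new, h⟩ => absurd h hnew
    | ⟨.old i, h⟩ => ⟨i, (hold i).1 h⟩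
  invFun j := ⟨.old ⟨j, fun h => disjoint_left.1 hd h j.2⟩, (hold _).2 j.2⟩
  left_inv o := by
    match o with
    | ⟨.new, h⟩ => exact absurd h hnew
    | ⟨.old i, h⟩ => rfl
  right_inv _ := rfl

variable (hnew : new ∉ J₂) (hold : ∀ i, old i ∈ J₂ ↔ (i : ι) ∈ J)
  (hnew' : new ∉ I₂) (hold' : ∀ i, old i ∈ I₂ ↔ (i : ι) ∈ I) (hd : Disjoint I J)

theorem disjointRoot_color (o : Contract J₂) : color (color c I e) J₂ e' o =
    color (color c J e') I₂ e (disjointRoot hnew hold hnew' hold' o) := by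
  match o with
  | .new => rfl
  | .old ⟨.new, h⟩ => rfl
  | .old ⟨.old i, h⟩ => rfl

theorem disjointTop_color (o : J₂) : restrictColor (color c I e) J₂ o =
    restrictColor c J (disjointTop hnew hold hd o) := by
  match o with
  | ⟨.new, h⟩ => exact absurd h hnew
  | ⟨.old i, h⟩ => rfl

theorem disjointTop_symm_color (o : I) : restrictColor c I o =
    restrictColor (color c J e') I₂ ((disjointTop hnew' hold' hd.symm).symm o) := rfl

theorem strictMono_disjointTop : StrictMono (disjointTop hnew hold hd) := by
  intro o p h
  match o, p with
  | ⟨.new, h'⟩, _ => exact absurd h' hnew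
  | ⟨.old i, _⟩, ⟨.new, h'⟩ => exact absurd h' hnew
  | ⟨.old i, _⟩, ⟨.old j, _⟩ =>
    have h' : (old i : Contract I) < old j := h
    exact Contract.old_lt_old.1 h'

theorem koszulSign_disjointRoot (n : Contract I₂ → ℤ) :
    koszulSign (disjointRoot hnew hold hnew' hold') n =
      (n (.old ⟨.new, hnew'⟩) * n .new).negOnePow := by
  have : (univ.filter fun p : Contract J₂ × Contract J₂ => p.1 < p.2 ∧
      disjointRoot hnew hold hnew' hold' p.2 < disjointRoot hnew hold hnew' hold' p.1) =
      {(.new, .old ⟨.new, hnew⟩)} := by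
    ext ⟨o, p⟩
    simp only [mem_filter, mem_univ, true_and, mem_singleton, Prod.mk.injEq]
    constructor
    · rintro ⟨h₁, h₂⟩
      match o, p with
      | .new, .new => exact absurd h₁ (lt_irrefl _)
      | .new, .old ⟨.new, _⟩ => exact ⟨rfl, rfl⟩
      | .new, .old ⟨.old i, _⟩ =>
        exact absurd (Contract.old_lt_old.1 h₂) (not_old_lt_new _)
      | .old ⟨.new, _⟩, p => exact absurd h₂ (by
          change ¬ _ < new
          match p with
          | .new => exact not_old_lt_new _
          | .old ⟨.new, _⟩ => exact lt_irrefl _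
          | .old ⟨.old i, _⟩ => exact not_old_lt_new _)
      | .old ⟨.old i, _⟩, .new => exact absurd h₁ (not_old_lt_new _)
      | .old ⟨.old i, _⟩, .old ⟨.new, _⟩ =>
        exact absurd (Contract.old_lt_old.1 h₁) (not_old_lt_new _)
      | .old ⟨.old i, _⟩, .old ⟨.old j, _⟩ =>
        exact absurd (Contract.old_lt_old.1 (Contract.old_lt_old.1 h₂))
          (Contract.old_lt_old.1 (Contract.old_lt_old.1 h₁)).not_gt
    · rintro ⟨rfl, rfl⟩
      exact ⟨new_lt_old _, new_lt_old _⟩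
  rw [koszulSign, this, prod_singleton]
  rfl

theorem graftAt_disjoint (u₁ : FreeMagma (Contract J₂)) (u₂ : FreeMagma J₂) (u₃ : FreeMagma I) :
    graftAt (graftAt (rename (disjointRoot hnew hold hnew' hold') u₁)
      (rename (disjointTop hnew' hold' hd.symm).symm u₃)) (rename (disjointTop hnew hold hd) u₂) =
    graftAt (graftAt u₁ u₂) u₃ := by
  refine (subst_subst _ _ _).trans ((subst_subst _ _ _).trans
    (Eq.trans ?_ (subst_subst _ _ _).symm))
  congr 1
  funext o
  match o with
  | .old ⟨.old i, h⟩ => rfl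
  | .old ⟨.new, h⟩ =>
    refine (subst_subst _ _ _).trans ((subst_subst _ _ _).trans ?_)
    rfl
  | .new =>
    refine (subst_subst _ _ _).trans (Eq.trans ?_ (subst_subst _ _ _).symm)
    congr 1
    funext o
    match o with
    | ⟨.old i, h⟩ => rfl
    | ⟨.new, h⟩ => exact absurd h hnew

/-- The transposition of the last two factors of a triple tensor product. -/
def tensorRightComm (K : Type*) [Field K] (V₁ V₂ V₃ : Type*) [AddCommGroup V₁] [AddCommGroup V₂]
    [AddCommGroup V₃] [Module K V₁] [Module K V₂] [Module K V₃] :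
    (V₁ ⊗[K] V₂) ⊗[K] V₃ →ₗ[K] (V₁ ⊗[K] V₃) ⊗[K] V₂ := TensorProduct.rightComm K V₁ V₂ V₃

theorem tensorRightComm_tmul {K V₁ V₂ V₃ : Type*} [Field K] [AddCommGroup V₁] [AddCommGroup V₂]
    [AddCommGroup V₃] [Module K V₁] [Module K V₂] [Module K V₃] (x : V₁) (y : V₂) (z : V₃) :
    tensorRightComm K V₁ V₂ V₃ ((x ⊗ₜ y) ⊗ₜ z) = (x ⊗ₜ z) ⊗ₜ y := rfl

theorem valAt₃_rightComm {ι₁ ι₂ ι₃ : Type} [Fintype ι₁] [LinearOrder ι₁] [Fintype ι₂]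
    [LinearOrder ι₂] [Fintype ι₃] [LinearOrder ι₃] {c₁ : ι₁ → PairColor} {c₂ : ι₂ → PairColor}
    {c₃ : ι₃ → PairColor} {d₁ d₂ d₃ : PairColor} (u₁ : FreeMagma ι₁) (u₂ : FreeMagma ι₂)
    (u₃ : FreeMagma ι₃) (τ : (Coop K c₁ d₁ ⊗[K] Coop K c₂ d₂) ⊗[K] Coop K c₃ d₃) :
    valAt₃ u₁ u₃ u₂ (tensorRightComm K _ _ _ τ) = valAt₃ u₁ u₂ u₃ τ := by
  induction τ with
  | zero => simp
  | add y z hy hz => rw [map_add, map_add, hy, hz, map_add]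
  | tmul w z =>
    induction w with
    | zero => simp
    | add y w hy hw => rw [TensorProduct.add_tmul, map_add, map_add, hy, hw, map_add]
    | tmul x y =>
      rw [tensorRightComm_tmul, valAt₃_tmul, valAt₃_tmul, valAt₂_tmul, valAt₂_tmul, mul_right_comm]

/-- Coassociativity, for disjoint subsets of the inputs. -/
theorem dec_disjoint (x : Coop K c d) : (dec (color c I e) J₂ d e').rTensor _ (dec c I d e x) =
      TensorProduct.map (TensorProduct.map
        (pull₀ (disjointRoot hnew hold hnew' hold') (disjointRoot_color hnew hold hnew' hold') d)
        (pull₀ (disjointTop hnew hold hd) (disjointTop_color hnew hold hd) e'))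
        (pull₀ (disjointTop hnew' hold' hd.symm).symm (disjointTop_symm_color hnew' hold' hd) e)
      (tensorRightComm K _ _ _ ((dec (color c J e') I₂ d e).rTensor _ (dec c J d e' x))) := by
  refine tensor_ext_val₃ fun u₁ u₂ u₃ h₁ h₂ h₃ => ?_
  rw [valAt₃_dec_left x h₁ h₂ h₃, ← graftAt_disjoint hnew hold hnew' hold' hd]
  refine Eq.trans ?_ (valAt₃_pull₀ _ _ _ _ _ _ _ _ _ _).symm
  rw [valAt₃_rightComm, valAt₃_dec_left x
    ((adm_rename_iff _ (disjointRoot_color hnew hold hnew' hold')).2 h₁)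
    ((adm_rename_iff _ (disjointTop_symm_color hnew' hold' hd)).2 h₃)
    ((adm_rename_iff _ (disjointTop_color hnew hold hd)).2 h₂)]

end Disjoint

end Iterated

variable {K : Type u} [Field K] {κ : Type} {b : κ → PairColor} {a d e e' : PairColor}

section

local instance (priority := 2000) decidableEqOfLinearOrder' {α : Type} [LinearOrder α] :
    DecidableEq α :=
  LinearOrder.toDecidableEq

namespace Cobar

open CobarTree Finset

section

section Congr

variable {ι : Type} [Fintype ι] [LinearOrder ι] {c : ι → PairColor} {I J : Finset ι}
  {J₂ : Finset (Contract I)} {I₂ : Finset (Contract J)} {I' : Finset J}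

omit [LinearOrder ι] [Fintype ι] in
theorem triple_smul {V : Type*} [AddCommGroup V] {ε₁ ε₂ ε₁' ε₂' : ℤˣ} {x y z : V}
    (h₁ : ε₁ • x = ε₁' • y) (h₂ : ε₂ • y = ε₂' • z) : (ε₁ * ε₂) • x = (ε₂' * ε₁') • z := by
  rw [mul_comm, mul_smul, h₁, smul_comm, h₂, smul_smul, mul_comm]

theorem nd_update_congr (hι : 2 ≤ Fintype.card ι) (x : Coop K c d)
    (ts : Branches K b c) (i : ι) {t t' : CTree K b (c i)}
    (hd : t.deg = t'.deg) {ε ε' : ℤˣ} (h : ε • (mk t : CAlg K b (c i)) = ε' • mk t') :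
    ε • nd hι x (update ts i t) = ε' • nd hι x (update ts i t') := by
  have h' := congrArg (plug hι x ts i) h
  rw [map_units_smul, map_units_smul, plug_mk, plug_mk] at h'
  rw [nd, nd, pars_update, pars_update, hd, smul_comm, smul_comm ε', h']

theorem exists_splitN_contractBranches (t₀ : CTree K b e) (ts : Branches K b c) (n : ℤ)
    (w : Coop K (color (color c I e) J₂ e') d ⊗[K] Coop K (restrictColor (color c I e) J₂) e') :
    ∃ G : CAlg K b e →ₗ[K] CAlg K b d, ∀ t : CTree K b e, t.deg = n →
      splitN (contractBranches t ts) J₂ d e' w = G (mk t) := by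
  obtain ⟨G, hG⟩ := exists_splitN_update (contractBranches t₀ ts) new n w
  exact ⟨G, fun t ht => by rw [← update_contractBranches t₀ t ts]; exact hG t ht⟩

/-- Splitting the root of a tree in three vertices, by contracting the set `I` of inputs and then
the set `J₂`. -/
def splitLeft (ts : Branches K b c) (I : Finset ι) (e : PairColor) (J₂ : Finset (Contract I))
    (d e' : PairColor) : (Coop K (color (color c I e) J₂ e') d ⊗[K]
      Coop K (restrictColor (color c I e) J₂) e') ⊗[K]
        Coop K (restrictColor c I) e →ₗ[K] CAlg K b d :=
  open Classical in
  if hI : Splits I then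
    TensorProduct.lift <| LinearMap.mk₂ K
      (fun w z => rootSign (fun j : I => pars ts j) •
        splitN (contractBranches (upper hI z ts) ts) J₂ d e' w)
      (fun w w' z => by rw [map_add, smul_add])
      (fun r w z => by rw [map_smul, smul_comm])
      (fun w z z' => by
        obtain ⟨G, hG⟩ := exists_splitN_contractBranches (upper hI 0 ts) ts (upper hI z ts).deg w
        rw [hG _ rfl, hG (upper hI z' ts) rfl, hG (upper hI (z + z') ts) rfl, mk_node_add, map_add,
          smul_add])
      (fun r w z => by
        obtain ⟨G, hG⟩ := exists_splitN_contractBranches (upper hI 0 ts) ts (upper hI z ts).deg w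
        rw [hG _ rfl, hG (upper hI (r • z) ts) rfl, mk_node_smul, map_smul, smul_comm])
  else 0

theorem splitLeft_tmul (ts : Branches K b c) (hI : Splits I)
    (w : Coop K (color (color c I e) J₂ e') d ⊗[K] Coop K (restrictColor (color c I e) J₂) e')
    (z : Coop K (restrictColor c I) e) :
    splitLeft ts I e J₂ d e' (w ⊗ₜ z) = rootSign (fun j : I => pars ts j) •
        splitN (contractBranches (upper hI z ts) ts) J₂ d e' w := by
  rw [splitLeft, dif_pos hI]
  rfl

theorem splitLeft_of_not (ts : Branches K b c) (h : ¬ (Splits I ∧ Splits J₂))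
    (τ : (Coop K (color (color c I e) J₂ e') d ⊗[K] Coop K (restrictColor (color c I e) J₂) e') ⊗[K]
        Coop K (restrictColor c I) e) : splitLeft ts I e J₂ d e' τ = 0 := by
  by_cases hI : Splits I
  · have hJ : ¬ Splits J₂ := fun hJ => h ⟨hI, hJ⟩
    induction τ with
    | zero => rw [map_zero]
    | add x y hx hy => rw [map_add, hx, hy, add_zero]
    | tmul w z => rw [splitLeft_tmul ts hI, splitN_of_not _ hJ, LinearMap.zero_apply, smul_zero]
  · rw [splitLeft, dif_neg hI, LinearMap.zero_apply]

theorem splitLeft_tmul_tmul (ts : Branches K b c) (hI : Splits I) (hJ : Splits J₂)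
    (x : Coop K (color (color c I e) J₂ e') d) (y : Coop K (restrictColor (color c I e) J₂) e')
    (z : Coop K (restrictColor c I) e) :
    splitLeft ts I e J₂ d e' ((x ⊗ₜ y) ⊗ₜ z) = (rootSign (fun j : I => pars ts j) *
      rootSign fun o : J₂ => pars (contractBranches (J := I) (upper hI z ts) ts) o) •
        nd (two_le_card_contract hJ.2) x
          (contractBranches (upper hJ y (contractBranches (upper hI z ts) ts))
            (contractBranches (upper hI z ts) ts)) := by
  rw [splitLeft_tmul ts hI, splitN_tmul _ hJ, smul_smul]

/-- Grafting an element of the appropriate degree at the first input of a vertex whose other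
branches are those not in `J`. -/
def plugNew (hJ : Splits J) (x : Coop K (color c J e) d)
    (ts : Branches K b c) : CAlg K b e →ₗ[K] CAlg K b d :=
  plugSucc (two_le_card_contract hJ.2) x (contractBranches (upper hJ 0 ts) ts) new

theorem plugNew_mk (hJ : Splits J) (x : Coop K (color c J e) d)
    (ts : Branches K b c) {t : CTree K b e} (ht : t.deg = upperPar ts J e) :
    plugNew hJ x ts (mk t) = nd (two_le_card_contract hJ.2) x (contractBranches t ts) := by
  refine (plugSucc_mk _ _ _ _ ht).trans ?_
  rw [update_contractBranches]

theorem plugNew_eq (hJ : Splits J) (x : Coop K (color c J e) d)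
    (ts : Branches K b c) (z : Coop K (restrictColor c J) e) :
    plugSucc (two_le_card_contract hJ.2) x (contractBranches (upper hJ z ts) ts) new =
      plugNew hJ x ts := by
  refine LinearMap.ext fun w => ?_
  have h₁ : plug (two_le_card_contract hJ.2) x (contractBranches (upper hJ z ts) ts) new =
      plug (two_le_card_contract hJ.2) x (contractBranches (upper hJ 0 ts) ts) new :=
    (congrArg (fun f => plug _ x f new)
      (update_contractBranches (upper hJ 0 ts) (upper hJ z ts) ts).symm).trans
      (plug_update_self _ _ _ _ _)
  rw [plugNew, plugSucc_apply, plugSucc_apply, h₁, pars_contractBranches, pars_contractBranches]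
  rfl

/-- Splitting the root of a tree in three vertices, by contracting the set `J` of inputs and then
splitting the upper vertex. -/
def splitRight (ts : Branches K b c) (J : Finset ι) (d e' : PairColor) (I' : Finset J)
    (e : PairColor) : Coop K (color c J e') d ⊗[K] (Coop K (color (restrictColor c J) I' e) e' ⊗[K]
        Coop K (restrictColor (restrictColor c J) I') e) →ₗ[K] CAlg K b d :=
  open Classical in
  if hJ : Splits J then
    TensorProduct.lift <| LinearMap.mk₂ K
      (fun x w => plugNew hJ x ts (splitN (c := restrictColor c J) (fun j => ts j) I' e' e w))
      (fun x x' w => plugSucc_add _ _ _ _ _ _)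
      (fun r x w => plugSucc_smul _ _ _ _ _ _)
      (fun x w w' => by rw [map_add, map_add])
      (fun r x w => by rw [map_smul, map_smul])
  else 0

theorem splitRight_tmul (ts : Branches K b c) (hJ : Splits J) (x : Coop K (color c J e') d)
    (w : Coop K (color (restrictColor c J) I' e) e' ⊗[K]
        Coop K (restrictColor (restrictColor c J) I') e) :
    splitRight ts J d e' I' e (x ⊗ₜ w) = plugNew hJ x ts
        (splitN (c := restrictColor c J) (fun j => ts j) I' e' e w) := by
  rw [splitRight, dif_pos hJ]
  rfl

theorem splitRight_of_not (ts : Branches K b c) (h : ¬ (Splits J ∧ Splits I'))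
    (τ : Coop K (color c J e') d ⊗[K] (Coop K (color (restrictColor c J) I' e) e' ⊗[K]
        Coop K (restrictColor (restrictColor c J) I') e)) : splitRight ts J d e' I' e τ = 0 := by
  by_cases hJ : Splits J
  · have hI : ¬ Splits I' := fun hI => h ⟨hJ, hI⟩
    induction τ with
    | zero => rw [map_zero]
    | add x y hx hy => rw [map_add, hx, hy, add_zero]
    | tmul x w =>
      rw [splitRight_tmul ts hJ, splitN_of_not _ hI, LinearMap.zero_apply, map_zero]
  · rw [splitRight, dif_neg hJ, LinearMap.zero_apply]

theorem splitRight_tmul_tmul (ts : Branches K b c) (hJ : Splits J) (hI : Splits I')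
    (x : Coop K (color c J e') d) (y : Coop K (color (restrictColor c J) I' e) e')
    (z : Coop K (restrictColor (restrictColor c J) I') e) :
    splitRight ts J d e' I' e (x ⊗ₜ (y ⊗ₜ z)) =
      (rootSign (fun j : I' => pars (fun j : J => ts j) j) *
      rootSign (pars (contractBranches (J := I') (upper (c := restrictColor c J) hI z fun j => ts j)
        fun j : J => ts j))) •
        nd (two_le_card_contract hJ.2) x
          (contractBranches (node (two_le_card_contract hI.2) y
            (contractBranches (J := I') (upper (c := restrictColor c J) hI z fun j => ts j)
              fun j : J => ts j)) ts) := by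
  rw [splitRight_tmul ts hJ, splitN_tmul _ hI, nd, smul_smul, map_units_smul]
  congr 1
  have hdeg : (node (two_le_card_contract hI.2) y
      (contractBranches (J := I') (upper (c := restrictColor c J) hI z fun j => ts j) fun j : J => ts j)).deg =
      upperPar ts J e' := by
    have h₁ : ∑ o, (contractBranches (J := I') (upper (c := restrictColor c J) hI z fun j => ts j)
        (fun j : J => ts j) o).deg =
        (upper (c := restrictColor c J) hI z fun j => ts j).deg +
          ∑ i : {i // i ∉ I'}, (ts i).deg := by
      rw [← Equiv.sum_comp Contract.equivOption.symm, Fintype.sum_option]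
      rfl
    have h₂ : ∑ j : J, (ts j).deg = ∑ j : I', (ts j).deg + ∑ i : {i // i ∉ I'}, (ts i).deg := by
      rw [sum_coe_sort I' fun j => (ts j).deg, ← sum_compl_add_sum I', add_comm]
      congr 1
      exact sum_subtype I'ᶜ (fun i => by simp) _
    rw [upperPar, koszulCoop_deg, deg_node, h₁, deg_node, card_contract, h₂, Fintype.card_coe,
      Fintype.card_coe]
    ring
  exact plugNew_mk hJ x ts hdeg

/-- Equality of the two ways of splitting the root along nested subsets. -/
theorem splitLeft_nested (ts : Branches K b c) (hI : Splits I) (hJ₂ : Splits J₂) (hJ : Splits J)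
    (hI' : Splits I') (hnew : new ∈ J₂) (hold : ∀ i, old i ∈ J₂ ↔ (i : ι) ∈ J)
    (hd : I ⊆ J) (hsub : ∀ j, j ∈ I' ↔ (j : ι) ∈ I) (τ : Coop K (color c J e') d ⊗[K]
      (Coop K (color (restrictColor c J) I' e) e' ⊗[K]
        Coop K (restrictColor (restrictColor c J) I') e)) :
    splitLeft ts I e J₂ d e' (TensorProduct.map (TensorProduct.map
        (pull₀ (nestedRoot hnew hold hd) (nestedRoot_color hnew hold hd) d)
        (pull₀ (nestedMid hnew hold hsub) (nestedMid_color hnew hold hsub) e'))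
        (pull₀ (nestedTop hsub hd) (nestedTop_color hd hsub) e) (tensorAssoc K _ _ _ τ)) =
      splitRight ts J d e' I' e τ := by
  induction τ with
  | zero => simp only [map_zero]
  | add x y hx hy => rw [map_add, map_add, map_add, hx, hy, map_add]
  | tmul x w =>
    induction w with
    | zero => simp only [TensorProduct.tmul_zero, map_zero]
    | add y z hy hz =>
      rw [TensorProduct.tmul_add, map_add, map_add, map_add, hy, hz, map_add]
    | tmul y z =>
      rw [tensorAssoc_tmul, TensorProduct.map_tmul, TensorProduct.map_tmul,
        splitLeft_tmul_tmul ts hI hJ₂, splitRight_tmul_tmul ts hJ hI']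
      set T₃ := upper hI (pull₀ (nestedTop hsub hd) (nestedTop_color hd hsub) e z) ts with hT₃
      set T₃' : CTree K b e := upper (c := restrictColor c J) hI' z (fun j => ts j) with hT₃'
      have d₃ : T₃.deg = T₃'.deg := deg_node_congr (nestedTop hsub hd) fun _ => rfl
      have e₃ := nd_pull₀_of_strictMono hI.two_le_card hI'.two_le_card
        (strictMono_nestedTop hd hsub) (nestedTop_color hd hsub) z (fun j => ts j) (fun j => ts j)
        (fun _ => HEq.rfl)
      rw [nd, nd] at e₃
      set T₂ := upper hJ₂ (pull₀ (nestedMid hnew hold hsub) (nestedMid_color hnew hold hsub) e' y)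
        (contractBranches T₃ ts) with hT₂
      set T₂' : CTree K b e' := node (two_le_card_contract hI'.2) y
        (contractBranches (J := I') T₃' fun j : J => ts j) with hT₂'
      have e₂ := nd_pull₀_of_strictMono hJ₂.two_le_card (two_le_card_contract hI'.2)
        (strictMono_nestedMid hnew hold hsub) (nestedMid_color hnew hold hsub) y
        (fun o => contractBranches (J := I) T₃ ts o)
        (contractBranches (J := I') T₃ fun j : J => ts j) (fun o => by
          match o with
          | ⟨.new, _⟩ => rfl
          | ⟨.old i, h⟩ => rfl)
      have e₁ := nd_pull₀_of_strictMono (two_le_card_contract hJ₂.2) (two_le_card_contract hJ.2)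
        (strictMono_nestedRoot hnew hold hd) (nestedRoot_color hnew hold hd) x
        (contractBranches T₂ (contractBranches T₃ ts)) (contractBranches T₂ ts) (fun o => by
          match o with
          | .new => rfl
          | .old ⟨.new, h⟩ => exact absurd hnew h
          | .old ⟨.old i, h⟩ => rfl)
      rw [e₁]
      have d₂ : T₂.deg = T₂'.deg := deg_node_congr (nestedMid hnew hold hsub) fun o =>
        match o with
        | ⟨.new, _⟩ => d₃
        | ⟨.old i, h⟩ => rfl
      refine nd_contractBranches_congr _ _ _ d₂ ?_
      rw [mul_smul, mul_smul]
      refine Eq.trans (congrArg _ e₂) ?_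
      exact nd_contractBranches_congr _ _ _ d₃ e₃

/-- Splitting the root along disjoint subsets in the two possible orders gives the same result up to
the sign of the transposition of the two new branches. -/
theorem splitLeft_disjoint (ts : Branches K b c) (hI : Splits I) (hJ₂ : Splits J₂)
    (hJ : Splits J) (hI₂ : Splits I₂) (hnew : new ∉ J₂)
    (hold : ∀ i, old i ∈ J₂ ↔ (i : ι) ∈ J) (hnew' : new ∉ I₂)
    (hold' : ∀ i, old i ∈ I₂ ↔ (i : ι) ∈ I) (hd : Disjoint I J)
    (τ : (Coop K (color (color c J e') I₂ e) d ⊗[K] Coop K (restrictColor (color c J e') I₂) e) ⊗[K]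
        Coop K (restrictColor c J) e') :
    splitLeft ts I e J₂ d e' (TensorProduct.map (TensorProduct.map
        (pull₀ (disjointRoot hnew hold hnew' hold') (disjointRoot_color hnew hold hnew' hold') d)
        (pull₀ (disjointTop hnew hold hd) (disjointTop_color hnew hold hd) e'))
        (pull₀ (disjointTop hnew' hold' hd.symm).symm (disjointTop_symm_color hnew' hold' hd) e)
      (tensorRightComm K _ _ _ τ)) =
      (upperPar ts I e * upperPar ts J e').negOnePow • splitLeft ts J e' I₂ d e τ := by
  induction τ with
  | zero => simp only [map_zero, smul_zero]
  | add x y hx hy => rw [map_add, map_add, map_add, hx, hy, map_add, smul_add]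
  | tmul w z =>
    induction w with
    | zero => simp only [TensorProduct.zero_tmul, map_zero, smul_zero]
    | add x y hx hy =>
      rw [TensorProduct.add_tmul, map_add, map_add, map_add, hx, hy, map_add, smul_add]
    | tmul x y =>
      rw [tensorRightComm_tmul, TensorProduct.map_tmul, TensorProduct.map_tmul,
        splitLeft_tmul_tmul ts hI hJ₂, splitLeft_tmul_tmul ts hJ hI₂]
      set y' := pull₀ (disjointTop hnew' hold' hd.symm).symm (disjointTop_symm_color hnew' hold' hd) e y
        with hy'
      set z' := pull₀ (disjointTop hnew hold hd) (disjointTop_color hnew hold hd) e' z with hz'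
      set TI := upper hI y' ts with hTI
      set TJ := upper hJ z ts with hTJ
      set TI₂ := upper hI₂ y (contractBranches TJ ts) with hTI₂
      set TJ₂ := upper hJ₂ z' (contractBranches TI ts) with hTJ₂
      have dI : TI.deg = TI₂.deg :=
        deg_node_congr (disjointTop hnew' hold' hd.symm).symm fun _ => rfl
      have dJ : TJ₂.deg = TJ.deg := deg_node_congr (disjointTop hnew hold hd) fun o =>
        match o with
        | ⟨.new, h⟩ => absurd h hnew
        | ⟨.old i, h⟩ => rfl
      have eI := nd_pull₀_of_strictMono hI.two_le_card hI₂.two_le_card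
        (fun _ _ h => Contract.old_lt_old.2 h) (disjointTop_symm_color hnew' hold' hd) y
        (fun j => ts j) (fun j => contractBranches (J := J) TJ ts j) (fun _ => HEq.rfl)
      have eJ := nd_pull₀_of_strictMono hJ₂.two_le_card hJ.two_le_card
        (strictMono_disjointTop hnew hold hd) (disjointTop_color hnew hold hd) z
        (fun j => contractBranches (J := I) TI ts j) (fun j => ts j) (fun o => by
          match o with
          | ⟨.new, h⟩ => exact absurd h hnew
          | ⟨.old i, h⟩ => rfl)
      rw [nd, nd] at eI eJ
      have e₁ := nd_pull₀ (two_le_card_contract hJ₂.2) (two_le_card_contract hI₂.2)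
        (disjointRoot_color hnew hold hnew' hold') x (contractBranches TJ₂ (contractBranches TI ts))
        (contractBranches TI (contractBranches TJ₂ ts)) (fun o => by
          match o with
          | .new => rfl
          | .old ⟨.new, h⟩ => rfl
          | .old ⟨.old i, h⟩ => rfl)
      rw [koszulSign_disjointRoot] at e₁
      rw [e₁, smul_comm]
      have hs : pars (contractBranches (J := I₂) TI (contractBranches (J := J) TJ₂ ts))
          (.old ⟨.new, hnew'⟩) * pars (contractBranches (J := I₂) TI (contractBranches (J := J) TJ₂ ts))
            .new = upperPar ts I e * upperPar ts J e' := by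
        rw [mul_comm]
        change (TI.deg + 1) * (TJ₂.deg + 1) = _
        rw [dJ]
        rfl
      rw [hs]
      refine congrArg _ ?_
      have f₁ := nd_contractBranches_congr (two_le_card_contract hI₂.2) x (contractBranches TJ₂ ts)
        dI eI
      have f₂ : rootSign (pars fun o : J₂ => contractBranches (J := I) TI ts o) •
          nd (two_le_card_contract hI₂.2) x (contractBranches TI₂ (contractBranches TJ₂ ts)) =
          rootSign (pars fun j : J => ts j) •
          nd (two_le_card_contract hI₂.2) x (contractBranches TI₂ (contractBranches TJ ts)) := by
        have hu : ∀ T : CTree K b e', contractBranches (J := I₂) TI₂ (contractBranches (J := J) T ts) =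
            update (contractBranches (J := I₂) TI₂ (contractBranches (J := J) TJ ts))
              (.old ⟨.new, hnew'⟩) T := fun T => by
          rw [← update_contractBranches TJ T ts]
          exact contractBranches_update_of_notMem hnew' TI₂ (contractBranches TJ ts) T
        rw [hu TJ₂]
        refine (nd_update_congr _ _ _ _ dJ eJ).trans ?_
        rw [← hu TJ]
      exact triple_smul f₁ f₂

end Congr

end

section

/-! ### The square of the differential -/

section SubsetSums

variable {ι : Type} [Fintype ι] [LinearOrder ι] {I J : Finset ι}

open Classical in
/-- The subset of a contraction consisting of the old inputs in `J` and, if `p` holds, the new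
input. -/
def contractSub (p : Prop) (I J : Finset ι) : Finset (Contract I) :=
  univ.filter fun o => match o with
    | .new => p
    | .old i => (i : ι) ∈ J

theorem new_mem_contractSub {p : Prop} : new ∈ contractSub p I J ↔ p := by
  simp [contractSub]

theorem old_mem_contractSub {p : Prop} (i : {i // i ∉ I}) :
    old i ∈ contractSub p I J ↔ (i : ι) ∈ J := by
  simp [contractSub]

/-- Subsets of a contraction of `I` correspond to the subsets of inputs that are disjoint from `I`
and to those that contain `I`. -/
theorem sum_contract_subsets {V : Type*} [AddCommGroup V] (I : Finset ι)
    (F : Finset (Contract I) → V) : ∑ J₂, F J₂ = ∑ J with Disjoint I J, F (contractSub False I J) +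
      ∑ J with I ⊆ J, F (contractSub True I J) := by
  classical
  rw [← sum_filter_add_sum_filter_not univ fun J₂ : Finset (Contract I) => new ∉ J₂]
  congr 1
  · refine sum_nbij' (fun J₂ => univ.filter fun i => ∃ hi, old ⟨i, hi⟩ ∈ J₂)
      (contractSub False I) ?_ ?_ ?_ ?_ ?_
    · intro J₂ _
      simp only [mem_filter, mem_univ, true_and, disjoint_left]
      rintro i hi ⟨hi', -⟩
      exact hi' hi
    · intro J _
      simp only [mem_filter, mem_univ, true_and, new_mem_contractSub, not_false_eq_true]
    · intro J₂ h
      simp only [mem_filter, mem_univ, true_and] at h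
      ext o
      match o with
      | .new => simp only [new_mem_contractSub, h]
      | .old ⟨i, hi⟩ => simp [old_mem_contractSub, hi]
    · intro J h
      simp only [mem_filter, mem_univ, true_and] at h
      ext i
      simp only [mem_filter, mem_univ, true_and, old_mem_contractSub]
      exact ⟨fun h => h.2, fun hi => ⟨fun hi' => disjoint_left.1 h hi' hi, hi⟩⟩
    · intro J₂ h
      simp only [mem_filter, mem_univ, true_and] at h
      congr 1
      ext o
      match o with
      | .new => simp only [new_mem_contractSub, h]
      | .old ⟨i, hi⟩ => simp [old_mem_contractSub, hi]
  · refine sum_nbij' (fun J₂ => univ.filter fun i => ∀ hi, old ⟨i, hi⟩ ∈ J₂)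
      (contractSub True I) ?_ ?_ ?_ ?_ ?_
    · intro J₂ _
      simp only [mem_filter, mem_univ, true_and]
      intro i hi
      simp only [mem_filter, mem_univ, true_and]
      exact fun hi' => absurd hi hi'
    · intro J _
      simp only [mem_filter, mem_univ, true_and, new_mem_contractSub, not_true_eq_false,
        not_false_eq_true]
    · intro J₂ h
      simp only [mem_filter, mem_univ, true_and, not_not] at h
      ext o
      match o with
      | .new => simp only [new_mem_contractSub, h]
      | .old ⟨i, hi⟩ => simp [old_mem_contractSub, hi]
    · intro J h
      simp only [mem_filter, mem_univ, true_and] at h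
      ext i
      simp only [mem_filter, mem_univ, true_and, old_mem_contractSub]
      exact ⟨fun h' => by_contra fun hi => hi (h' fun hi' => hi (h hi')), fun hi _ => hi⟩
    · intro J₂ h
      simp only [mem_filter, mem_univ, true_and, not_not] at h
      congr 1
      ext o
      match o with
      | .new => simp only [new_mem_contractSub, h]
      | .old ⟨i, hi⟩ => simp [old_mem_contractSub, hi]

/-- The part of `I` in `J`. -/
def restrictSub (J I : Finset ι) : Finset J := I.subtype (· ∈ J)

theorem mem_restrictSub (j : J) : j ∈ restrictSub J I ↔ (j : ι) ∈ I := mem_subtype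

theorem sum_restrict_subsets {V : Type*} [AddCommGroup V] (J : Finset ι) (F : Finset J → V) :
    ∑ I', F I' = ∑ I with I ⊆ J, F (restrictSub J I) := by
  have h : ∀ I' : Finset J, restrictSub J (I'.map (.subtype _)) = I' := fun I' => by
    ext j; simp [mem_restrictSub]
  refine sum_nbij' (fun I' => I'.map (.subtype _)) (restrictSub J) ?_ ?_ ?_ ?_ ?_
  · intro I' _
    simp only [mem_filter, mem_univ, true_and]
    intro i hi
    obtain ⟨j, -, rfl⟩ := mem_map.1 hi
    exact j.2
  · intro I _; exact mem_univ _
  · intro I' _; exact h I'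
  · intro I hI
    simp only [mem_filter, mem_univ, true_and] at hI
    ext i
    simp only [mem_map, mem_restrictSub, Function.Embedding.coe_subtype, Subtype.exists,
      exists_and_left, exists_prop, exists_eq_right_right]
    exact ⟨fun h => h.1, fun h => ⟨h, hI h⟩⟩
  · intro I' _; rw [h]

theorem splits_nested {J₂ : Finset (Contract I)} {I' : Finset J} (hnew : new ∈ J₂)
    (hold : ∀ i, old i ∈ J₂ ↔ (i : ι) ∈ J) (hd : I ⊆ J) (hsub : ∀ j, j ∈ I' ↔ (j : ι) ∈ I) :
    Splits I ∧ Splits J₂ ↔ Splits J ∧ Splits I' := by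
  have h₁ := Fintype.card_congr (nestedTop hsub hd)
  have h₂ := Fintype.card_congr (nestedMid hnew hold hsub)
  have h₃ := card_contract I
  have h₄ := card_contract I'
  rw [Fintype.card_coe, Fintype.card_coe] at h₁
  rw [Fintype.card_coe] at h₂ h₄
  rw [Splits, Splits, Splits, Splits, Fintype.card_coe]
  have h₅ := card_le_card hd
  have h₆ := card_le_univ I
  omega

theorem splits_disjoint {J₂ : Finset (Contract I)} {I₂ : Finset (Contract J)}
    (hnew : new ∉ J₂) (hold : ∀ i, old i ∈ J₂ ↔ (i : ι) ∈ J)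
    (hnew' : new ∉ I₂) (hold' : ∀ i, old i ∈ I₂ ↔ (i : ι) ∈ I)
    (hd : Disjoint I J) : Splits I ∧ Splits J₂ ↔ Splits J ∧ Splits I₂ := by
  have h₁ := Fintype.card_congr (disjointTop hnew hold hd)
  have h₂ := Fintype.card_congr (disjointTop hnew' hold' hd.symm)
  have h₃ := card_contract I
  have h₄ := card_contract J
  rw [Fintype.card_coe, Fintype.card_coe] at h₁ h₂
  rw [Splits, Splits, Splits, Splits]
  have h₅ := card_le_univ J
  have h₆ := card_le_univ I
  omega

end SubsetSums

variable {ι : Type} [Fintype ι] [LinearOrder ι] {c : ι → PairColor} {I J : Finset ι}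

/-- The contribution to the square of the differential of splitting the root and then its lower
part. -/
def lowerTerm (ts : Branches K b c) (x : Coop K c d) (I : Finset ι) (e : PairColor)
    (J₂ : Finset (Contract I)) (e' : PairColor) : CAlg K b d :=
  (frontSign I (pars ts) * frontSign J₂ (color (pars ts) I (upperPar ts I e))) •
    splitLeft ts I e J₂ d e' ((dec (color c I e) J₂ d e').rTensor _ (dec c I d e x))

/-- The contribution to the square of the differential of splitting the root and then its upper
part. -/
def upperTerm (ts : Branches K b c) (x : Coop K c d) (J : Finset ι)
    (e' : PairColor) (I' : Finset J) (e : PairColor) : CAlg K b d :=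
  (frontSign J (pars ts) * frontSign I' fun j => pars ts j) •
    splitRight ts J d e' I' e ((dec (restrictColor c J) I' e' e).lTensor _ (dec c J d e' x))

theorem lowerTerm_nested (ts : Branches K b c) (x : Coop K c d) (hd : I ⊆ J) :
    lowerTerm ts x I e (contractSub True I J) e' = upperTerm ts x J e' (restrictSub J I) e := by
  have hnew : new ∈ contractSub True I J := new_mem_contractSub.2 trivial
  have hold : ∀ i, old i ∈ contractSub True I J ↔ (i : ι) ∈ J := old_mem_contractSub
  have hsub : ∀ j, j ∈ restrictSub J I ↔ (j : ι) ∈ I := mem_restrictSub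
  have hs := splits_nested hnew hold hd hsub
  rw [lowerTerm, upperTerm, frontSign_nested _ hnew hold hsub hd]
  refine congrArg _ ?_
  by_cases h : Splits I ∧ Splits (contractSub True I J)
  · obtain ⟨hJ, hI'⟩ := hs.1 h
    rw [dec_nested hnew hold hd hsub x]
    exact splitLeft_nested ts h.1 h.2 hJ hI' hnew hold hd hsub _
  · rw [splitLeft_of_not ts h, splitRight_of_not ts (mt hs.2 h)]

theorem lowerTerm_disjoint (ts : Branches K b c) (x : Coop K c d)
    (hd : Disjoint I J) : lowerTerm ts x I e (contractSub False I J) e' =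
      - lowerTerm ts x J e' (contractSub False J I) e := by
  have hnew : new ∉ contractSub False I J := fun h => new_mem_contractSub.1 h
  have hold : ∀ i, old i ∈ contractSub False I J ↔ (i : ι) ∈ J := old_mem_contractSub
  have hnew' : new ∉ contractSub False J I := fun h => new_mem_contractSub.1 h
  have hold' : ∀ i, old i ∈ contractSub False J I ↔ (i : ι) ∈ I := old_mem_contractSub
  have hs := splits_disjoint hnew hold hnew' hold' hd
  rw [lowerTerm, lowerTerm]
  by_cases h : Splits I ∧ Splits (contractSub False I J)
  · obtain ⟨hJ, hI₂⟩ := hs.1 h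
    rw [dec_disjoint hnew hold hnew' hold' hd x,
      splitLeft_disjoint ts h.1 h.2 hJ hI₂ hnew hold hnew' hold' hd, smul_smul,
      frontSign_disjoint _ hnew hold hnew' hold' hd (negOnePow_upperPar ts I e)
        (negOnePow_upperPar ts J e'), Units.neg_smul]
  · rw [splitLeft_of_not ts h, splitLeft_of_not ts (mt hs.2 h), smul_zero, smul_zero, neg_zero]

theorem eq_zero_of_eq_neg [CharZero K] {V : Type*} [AddCommGroup V] [Module K V] {v : V}
    (h : v = -v) : v = 0 := by
  have h₂ : (2 : K) • v = 0 := by rw [two_smul]; nth_rw 1 [h]; exact neg_add_cancel v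
  exact (smul_eq_zero.1 h₂).resolve_left two_ne_zero

/-- Coassociativity: the terms in which the root is split twice cancel. -/
theorem sum_lowerTerm_sub_upperTerm [CharZero K] (ts : Branches K b c) (x : Coop K c d) :
    ∑ J, ∑ e, (∑ J₂, ∑ e', lowerTerm ts x J e J₂ e' - ∑ I', ∑ e', upperTerm ts x J e I' e') = 0 := by
  simp only [sum_sub_distrib]
  have h₁ : ∑ J, ∑ e, ∑ I', ∑ e', upperTerm ts x J e I' e' =
      ∑ I, ∑ J with I ⊆ J, ∑ e, ∑ e', lowerTerm ts x I e (contractSub True I J) e' := by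
    have : ∀ J, ∑ e, ∑ I', ∑ e', upperTerm ts x J e I' e' =
        ∑ I with I ⊆ J, ∑ e, ∑ e', lowerTerm ts x I e (contractSub True I J) e' := by
      intro J
      rw [sum_comm, sum_restrict_subsets]
      refine sum_congr rfl fun I hI => ?_
      rw [sum_comm]
      exact sum_congr rfl fun e _ => sum_congr rfl fun e' _ =>
        (lowerTerm_nested ts x (mem_filter.1 hI).2).symm
    rw [sum_congr rfl fun J _ => this J]
    exact sum_comm' fun J I => by simp
  have h₂ : ∑ I, ∑ e, ∑ J₂, ∑ e', lowerTerm ts x I e J₂ e' =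
      ∑ I, ∑ J with Disjoint I J, ∑ e, ∑ e', lowerTerm ts x I e (contractSub False I J) e' +
      ∑ I, ∑ J with I ⊆ J, ∑ e, ∑ e', lowerTerm ts x I e (contractSub True I J) e' := by
    rw [← sum_add_distrib]
    refine sum_congr rfl fun I _ => ?_
    rw [sum_comm, sum_contract_subsets]
  rw [h₁, h₂, add_sub_cancel_right]
  refine eq_zero_of_eq_neg (K := K) ?_
  conv_rhs => rw [sum_comm' (t' := univ) (s' := fun J => univ.filter fun I => Disjoint I J)
    fun I J => by simp]
  rw [← sum_neg_distrib]
  refine sum_congr rfl fun I _ => ?_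
  rw [← sum_neg_distrib]
  refine sum_congr (by ext; simp [disjoint_comm]) fun J hJ => ?_
  rw [sum_comm, ← sum_neg_distrib]
  refine sum_congr rfl fun e' _ => ?_
  rw [← sum_neg_distrib]
  refine sum_congr rfl fun e _ => ?_
  rw [lowerTerm_disjoint ts x (mem_filter.1 hJ).2.symm]

end

end Cobar

end

namespace Cobar

open CobarTree Finset

section

variable {ι : Type} [Fintype ι] [LinearOrder ι] {c : ι → PairColor} {J : Finset ι}

theorem passSign_new (N : Contract J → ℤ) : passSign N .new = 1 := by
  rw [passSign]
  refine prod_eq_one fun o _ => if_neg ?_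
  cases o with
  | new => exact lt_irrefl _
  | old i => exact not_old_lt_new i

theorem splitLeft_rTensor (ts : Branches K b c) (hJ : Splits J) {J₂ : Finset (Contract J)}
    (y : Coop K (color c J e) d) (z : Coop K (restrictColor c J) e) :
    splitLeft ts J e J₂ d e' ((dec (color c J e) J₂ d e').rTensor _ (y ⊗ₜ z)) =
      rootSign (fun j : J => pars ts j) • splitN (contractBranches (upper hJ z ts) ts) J₂ d e'
        (dec (color c J e) J₂ d e' y) := by
  rw [LinearMap.rTensor_tmul]
  exact splitLeft_tmul ts hJ _ _

theorem splitRight_lTensor (ts : Branches K b c) (hJ : Splits J) {I' : Finset J}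
    (y : Coop K (color c J e) d) (z : Coop K (restrictColor c J) e) :
    splitRight ts J d e I' e' ((dec (restrictColor c J) I' e e').lTensor _ (y ⊗ₜ z)) =
      plugNew hJ y ts (splitN (c := restrictColor c J) (fun j => ts j) I' e e'
        (dec (restrictColor c J) I' e e' z)) := by
  rw [LinearMap.lTensor_tmul]
  exact splitRight_tmul ts hJ _ _

/-- Grafting an element at an input of the lower vertex of a tree whose root has been split. -/
def plugOld (ts : Branches K b c) (hJ : Splits J)
    (y : Coop K (color c J e) d) (z : Coop K (restrictColor c J) e)
    {i : ι} (hi : i ∉ J) : CAlg K b (c i) →ₗ[K] CAlg K b d :=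
  plugSucc (two_le_card_contract hJ.2) y (contractBranches (upper hJ z ts) ts) (.old ⟨i, hi⟩)

theorem plugOld_mk (ts : Branches K b c) (hJ : Splits J)
    (y : Coop K (color c J e) d) (z : Coop K (restrictColor c J) e)
    {i : ι} (hi : i ∉ J) {t : CTree K b (c i)} (ht : t.deg = (ts i).deg + 1) :
    plugOld ts hJ y z hi (mk t) = nd (two_le_card_contract hJ.2) y
      (contractBranches (upper hJ z ts) (update ts i t)) := by
  rw [contractBranches_update_of_notMem hi]
  exact plugSucc_mk (two_le_card_contract hJ.2) y (contractBranches (upper hJ z ts) ts)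
    (.old ⟨i, hi⟩) (t := t) ht

/-- The operation of changing a branch of a tree whose root has been split. -/
def crossTerm (ts : Branches K b c) (hJ : Splits J)
    (y : Coop K (color c J e) d) (z : Coop K (restrictColor c J) e)
    (i : ι) : CAlg K b (c i) →ₗ[K] CAlg K b d :=
  if hi : i ∈ J then
    plugNew hJ y ts ∘ₗ plugSucc (c := restrictColor c J) hJ.two_le_card z
      (fun j => ts j) ⟨i, hi⟩
  else rootSign (fun j : J => pars ts j) • plugOld ts hJ y z hi

theorem crossTerm_mk (ts : Branches K b c) (hJ : Splits J)
    (y : Coop K (color c J e) d) (z : Coop K (restrictColor c J) e)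
    (i : ι) {t : CTree K b (c i)} (ht : t.deg = (ts i).deg + 1) :
    crossTerm ts hJ y z i (mk t) = splitN (update ts i t) J d e (y ⊗ₜ z) := by
  rw [splitN_tmul _ hJ, crossTerm]
  split_ifs with hi
  · have hcard : 2 ≤ Fintype.card J := hJ.two_le_card
    rw [contractBranches_update_of_mem hi, comp_apply]
    have h₁ : plugSucc (c := restrictColor c J) hcard z (fun j => ts j) ⟨i, hi⟩ (mk t) =
        nd (c := restrictColor c J) hcard z (update (fun j : J => ts j) ⟨i, hi⟩ t) :=
      plugSucc_mk _ _ _ _ ht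
    refine (congrArg _ h₁).trans ?_
    rw [← restrict_update_of_mem hi, nd, map_units_smul]
    refine congrArg _ ?_
    refine plugNew_mk hJ y ts ?_
    rw [deg_node, upperPar, koszulCoop_deg]
    have h₂ : ∀ j : J, (update ts i t j).deg =
        update (fun j : J => (ts j).deg) ⟨i, hi⟩ ((ts i).deg + 1) j := fun j => by
      rw [← ht]
      exact (congrArg deg (congrFun (restrict_update_of_mem hi ts t) j)).trans <| Function.apply_update (fun (j : J) (t : CTree K b (c j)) => t.deg) (fun j : J => ts j)
        ⟨i, hi⟩ t j
    rw [sum_congr rfl fun j _ => h₂ j, sum_update_of_mem (mem_univ _), sdiff_singleton_eq_erase,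
      ← add_sum_erase _ (fun j : J => (ts j).deg) (mem_univ ⟨i, hi⟩)]
    ring
  · have hp : (fun j : J => pars (update ts i t) j) = fun j : J => pars ts j :=
      congrArg (fun f : ∀ j : J, CTree K b (c j) => pars f) (restrict_update_of_notMem hi ts t)
    have hu : upper hJ z (update ts i t) = upper hJ z ts :=
      congrArg (fun f : ∀ j : J, CTree K b (c j) =>
        (node (c := restrictColor c J) hJ.two_le_card z f : CTree K b e))
        (restrict_update_of_notMem hi ts t)
    rw [hp, hu]
    exact congrArg (rootSign (fun j : J => pars ts j) • ·) (plugOld_mk ts hJ y z hi ht)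

theorem D_splitN_tmul (ts : Branches K b c) (hJ : Splits J)
    (y : Coop K (color c J e) d) (z : Coop K (restrictColor c J) e) :
    D d (splitN ts J d e (y ⊗ₜ z)) =
      ∑ J₂, ∑ e', frontSign J₂ (color (pars ts) J (upperPar ts J e)) •
        splitLeft ts J e J₂ d e' ((dec (color c J e) J₂ d e').rTensor _ (y ⊗ₜ z)) -
      ∑ I', ∑ e', frontSign I' (fun j : J => pars ts j) •
        splitRight ts J d e I' e' ((dec (restrictColor c J) I' e e').lTensor _ (y ⊗ₜ z)) +
      ∑ i, (frontSign J (pars ts) * passSign (pars ts) i * frontSign J (raise (pars ts) i)) •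
        crossTerm ts hJ y z i (D (c i) (mk (ts i))) := by
  have hcard : 2 ≤ Fintype.card J := hJ.two_le_card
  simp only [splitLeft_rTensor ts hJ, splitRight_lTensor ts hJ]
  rw [splitN_tmul _ hJ, map_units_smul, D_nd, smul_sub, sub_eq_add_neg, sub_eq_add_neg, add_assoc]
  refine congrArg₂ (· + ·) ?_ ?_
  · rw [rootPart_apply, smul_sum]
    refine sum_congr rfl fun J₂ _ => ?_
    rw [smul_sum]
    refine sum_congr rfl fun e' _ => ?_
    rw [pars_contractBranches, deg_upper, smul_comm]
  · have hnew : rootSign (fun j : J => pars ts j) •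
        plugSucc (two_le_card_contract hJ.2) y (contractBranches (upper hJ z ts) ts) new
          (D e (mk (upper hJ z ts))) =
        ∑ I', ∑ e', frontSign I' (fun j : J => pars ts j) • plugNew hJ y ts
          (splitN (c := restrictColor c J) (fun j => ts j) I' e e' (dec (restrictColor c J) I' e e' z)) -
        ∑ j : J, passSign (fun j : J => pars ts j) j • crossTerm ts hJ y z j (D (c j) (mk (ts j))) := by
      refine (congrArg (rootSign (fun j : J => pars ts j) • ·)
        (LinearMap.congr_fun (plugNew_eq hJ y ts z) (D e (mk (upper hJ z ts))))).trans ?_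
      change rootSign (fun j : J => pars ts j) • plugNew hJ y ts (D e (mk (upper hJ z ts))) = _
      rw [← map_units_smul]
      have h₁ : rootSign (fun j : J => pars ts j) • D e (mk (upper hJ z ts)) =
          D e (nd (c := restrictColor c J) hcard z fun j => ts j) := by
        rw [nd, map_units_smul]
      rw [h₁, D_nd, map_sub, rootPart_apply, map_sum, map_sum]
      refine congrArg₂ (· - ·) ?_ ?_
      · refine sum_congr rfl fun I' _ => ?_
        rw [map_sum]
        refine sum_congr rfl fun e' _ => ?_
        rw [map_units_smul]
      · refine sum_congr rfl fun j _ => ?_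
        rw [map_units_smul, crossTerm, dif_pos j.2]
        rfl
    rw [← Equiv.sum_comp Contract.equivOption.symm, Fintype.sum_option, smul_add, neg_add]
    have hn : ∀ v : CAlg K b d,
        passSign (pars (contractBranches (J := J) (upper hJ z ts) ts)) new • v = v :=
      fun v => by rw [passSign_new, one_smul]
    refine (congrArg₂ (fun v w => -v + w) ((congrArg (rootSign (fun j : J => pars ts j) • ·)
      (hn _)).trans hnew) rfl).trans ?_
    rw [neg_sub, sub_eq_neg_add, add_assoc]
    refine congrArg _ ?_
    have hsplit : ∀ f : ι → CAlg K b d, ∑ i, f i = ∑ j : J, f j + ∑ i : {i // i ∉ J}, f i := by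
      intro f
      rw [sum_coe_sort J f, ← sum_add_sum_compl J]
      congr 1
      exact sum_subtype Jᶜ (fun i => by simp) _
    rw [hsplit]
    refine congrArg₂ (· + ·) ?_ ?_
    · refine sum_congr rfl fun j _ => ?_
      rw [mul_assoc, ← passSign_restrict, ← mul_assoc, Int.units_mul_self, one_mul]
    · rw [smul_sum, ← sum_neg_distrib]
      refine sum_congr rfl fun i _ => ?_
      rw [crossTerm, dif_neg i.2, mul_assoc, ← neg_eq_iff_eq_neg.2
        (passSign_contract_old (pars ts) (negOnePow_upperPar ts J e) i), mul_neg, ← mul_assoc,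
        Int.units_mul_self, one_mul, Units.neg_smul, neg_inj, smul_comm]
      have hp : passSign (pars (contractBranches (J := J) (upper hJ z ts) ts)) (.old i) =
          passSign (color (pars ts) J (upperPar ts J e)) (.old i) := by
        rw [pars_contractBranches, deg_upper]
      exact congrArg₂ (· • ·) hp rfl

/-- The differential of a tree whose root has been split: the lower or the upper part of the root is
split again, or the differential is applied to a branch. -/
theorem exists_D_splitN (ts : Branches K b c)
    (τ : Coop K (color c J e) d ⊗[K] Coop K (restrictColor c J) e) :
    ∃ G : ∀ i, CAlg K b (c i) →ₗ[K] CAlg K b d,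
      (∀ i t, t.deg = (ts i).deg + 1 → splitN (update ts i t) J d e τ = G i (mk t)) ∧
      D d (splitN ts J d e τ) = ∑ J₂, ∑ e', frontSign J₂ (color (pars ts) J (upperPar ts J e)) •
        splitLeft ts J e J₂ d e' ((dec (color c J e) J₂ d e').rTensor _ τ) -
      ∑ I', ∑ e', frontSign I' (fun j : J => pars ts j) •
        splitRight ts J d e I' e' ((dec (restrictColor c J) I' e e').lTensor _ τ) +
      ∑ i, (frontSign J (pars ts) * passSign (pars ts) i * frontSign J (raise (pars ts) i)) •
        G i (D (c i) (mk (ts i))) := by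
  by_cases hJ : Splits J
  swap
  · refine ⟨0, fun i t _ => by rw [splitN_of_not _ hJ]; rfl, ?_⟩
    rw [splitN_of_not _ hJ, LinearMap.zero_apply, map_zero]
    simp only [splitLeft_of_not ts (fun h => hJ h.1), splitRight_of_not ts (fun h => hJ h.1),
      smul_zero, sum_const_zero, sub_zero, Pi.zero_apply, LinearMap.zero_apply, add_zero]
  induction τ with
  | zero =>
    refine ⟨0, fun i t _ => by rw [map_zero]; rfl, ?_⟩
    simp only [map_zero, smul_zero, sum_const_zero, sub_zero, Pi.zero_apply, LinearMap.zero_apply,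
      add_zero]
  | add x y hx hy =>
    obtain ⟨G, hG, h⟩ := hx
    obtain ⟨G', hG', h'⟩ := hy
    refine ⟨G + G', fun i t ht => by rw [map_add, hG i t ht, hG' i t ht]; rfl, ?_⟩
    rw [map_add, map_add, h, h']
    simp only [map_add, smul_add, sum_add_distrib, Pi.add_apply, LinearMap.add_apply]
    abel
  | tmul y z => exact ⟨crossTerm ts hJ y z, fun i t ht => (crossTerm_mk ts hJ y z i ht).symm,
      D_splitN_tmul ts hJ y z⟩

open Classical in
/-- The differential of a tree one of whose branches has been replaced by a cycle. -/
theorem D_plugSucc (hι : 2 ≤ Fintype.card ι) (x : Coop K c d) (ts : Branches K b c)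
    (i : ι) {z : CAlg K b (c i)} (hz : z ∈ homog K b (c i) ((ts i).deg + 1)) (hD : D (c i) z = 0)
    (G : ∀ (J : Finset ι) (e : PairColor), CAlg K b (c i) →ₗ[K] CAlg K b d)
    (hG : ∀ J e t, t.deg = (ts i).deg + 1 →
      splitN (update ts i t) J d e (dec c J d e x) = G J e (mk t)) :
    D d (plugSucc hι x ts i z) = ∑ J, ∑ e, frontSign J (raise (pars ts) i) • G J e z -
      ∑ j, if h : j ≠ i then (passSign (raise (pars ts) i) j *
        rootSign (raise (raise (pars ts) i) j)) • plug₂ hι x ts h z (D (c j) (mk (ts j))) else 0 := by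
  let B : ∀ j, CAlg K b (c i) →ₗ[K] CAlg K b d := fun j =>
    if h : j ≠ i then (passSign (raise (pars ts) i) j *
      rootSign (raise (raise (pars ts) i) j)) • (plug₂ hι x ts h).flip (D (c j) (mk (ts j)))
    else (passSign (raise (pars ts) i) i * rootSign (raise (raise (pars ts) i) i)) •
      plug hι x ts i ∘ₗ D (c i)
  have key : (D d ∘ₗ plugSucc hι x ts i) z =
      (∑ J, ∑ e, frontSign J (raise (pars ts) i) • G J e - ∑ j, B j) z := by
    refine eq_of_mem_homog (fun t ht => ?_) hz
    rw [comp_apply, plugSucc_mk _ _ _ _ ht, D_nd, pars_update_succ _ _ _ ht,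
      rootPart_apply, pars_update_succ _ _ _ ht, LinearMap.sub_apply, LinearMap.sum_apply,
      LinearMap.sum_apply]
    refine congrArg₂ (· - ·) (sum_congr rfl fun J _ => ?_) (sum_congr rfl fun j _ => ?_)
    · rw [LinearMap.sum_apply]
      exact sum_congr rfl fun e _ => by rw [hG J e t ht]; rfl
    · rw [plugSucc_apply, pars_update_succ _ _ _ ht, smul_smul]
      simp only [B]
      split_ifs with h
      · change _ = (passSign (raise (pars ts) i) j * rootSign (raise (raise (pars ts) i) j)) •
          plug₂ hι x ts h (mk t) (D (c j) (mk (ts j)))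
        rw [plug₂_mk, update_of_ne h]
      · obtain rfl := not_not.1 h
        rw [plug_update_self, update_self]
        rfl
  refine key.trans ?_
  rw [LinearMap.sub_apply, LinearMap.sum_apply, LinearMap.sum_apply]
  refine congrArg₂ (· - ·) (sum_congr rfl fun J _ => ?_) (sum_congr rfl fun j _ => ?_)
  · rw [LinearMap.sum_apply]; rfl
  · simp only [B]
    split_ifs with h
    · rfl
    · change (passSign (raise (pars ts) i) i * rootSign (raise (raise (pars ts) i) i)) •
        plug hι x ts i (D (c i) z) = 0
      rw [hD, map_zero, smul_zero]

theorem passSign_mul_passSign_raise (N : ι → ℤ) {i j : ι} (h : j ≠ i) :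
    passSign N i * passSign (raise N i) j = - (passSign N j * passSign (raise N j) i) := by
  rcases lt_or_gt_of_ne h with h' | h'
  · rw [passSign_raise_of_lt N h', passSign_raise_of_not_lt N h'.not_gt, mul_neg, neg_neg, mul_comm]
  · rw [passSign_raise_of_lt N h', passSign_raise_of_not_lt N h'.not_gt, mul_neg, mul_comm]

theorem raise_comm (N : ι → ℤ) {i j : ι} (h : j ≠ i) :
    raise (raise N i) j = raise (raise N j) i := by
  rw [raise, raise, raise, raise, update_of_ne h, update_of_ne h.symm,
    update_comm h]

theorem D_D_mk [CharZero K] (t : CTree K b d) : D d (D d (mk t)) = 0 := by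
  classical
  induction t with
  | leaf k => rw [D_mk]; exact map_zero _
  | @node ι _ _ hι c d x ts ih =>
    suffices h : D d (D d (nd hι x ts)) = 0 by
      rw [mk_node, map_units_smul, map_units_smul, h, smul_zero]
    choose G hG hDG using fun (J : Finset ι) (e : PairColor) =>
      exists_D_splitN (K := K) (b := b) (d := d) (J := J) (e := e) ts (dec c J d e x)
    have hz : ∀ i, D (c i) (mk (ts i)) ∈ homog K b (c i) ((ts i).deg + 1) := fun i =>
      D_mem_homog (mk_mem_homog rfl)
    have h₁ : ∀ i, D d (plugSucc hι x ts i (D (c i) (mk (ts i)))) = _ := fun i =>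
      D_plugSucc hι x ts i (hz i) (ih i) (fun J e => G J e i) fun J e t ht => hG J e i t ht
    rw [D_nd, map_sub, map_sum, rootPart_apply, map_sum]
    simp only [map_sum, map_units_smul, h₁, hDG]
    have h₂ := sum_lowerTerm_sub_upperTerm ts x
    -- Changing the branches `i` and `j` in the two orders gives opposite signs.
    have h₃ : ∑ i, passSign (pars ts) i • ∑ j, (if h : j ≠ i then
        (passSign (raise (pars ts) i) j * rootSign (raise (raise (pars ts) i) j)) •
          plug₂ hι x ts h (D (c i) (mk (ts i))) (D (c j) (mk (ts j))) else 0) = 0 := by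
      refine eq_zero_of_eq_neg (K := K) ?_
      simp only [smul_sum]
      conv_rhs => rw [sum_comm]
      rw [← sum_neg_distrib]
      refine sum_congr rfl fun i _ => ?_
      rw [← sum_neg_distrib]
      refine sum_congr rfl fun j _ => ?_
      by_cases h : j = i
      · subst h
        simp
      · rw [dif_pos h, dif_pos (Ne.symm h), smul_smul, smul_smul, plug₂_comm, ← mul_assoc,
          ← mul_assoc, passSign_mul_passSign_raise _ h, raise_comm _ h, neg_mul, Units.neg_smul]
    simp only [smul_sub, smul_add, sum_sub_distrib, sum_add_distrib, h₃, sub_zero]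
    -- Splitting the root and changing a branch anticommute.
    have h₄ : ∑ J, ∑ e, frontSign J (pars ts) • ∑ i,
        (frontSign J (pars ts) * passSign (pars ts) i * frontSign J (raise (pars ts) i)) •
          G J e i (D (c i) (mk (ts i))) =
        ∑ i, passSign (pars ts) i • ∑ J, ∑ e, frontSign J (raise (pars ts) i) •
          G J e i (D (c i) (mk (ts i))) := by
      simp only [smul_sum]
      rw [sum_congr rfl fun J _ => sum_comm, sum_comm]
      refine sum_congr rfl fun i _ => sum_congr rfl fun J _ => sum_congr rfl fun e _ => ?_
      rw [smul_smul, smul_smul, ← mul_assoc, ← mul_assoc, Int.units_mul_self, one_mul]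
    rw [h₄, add_sub_cancel_right, ← h₂]
    simp only [sum_sub_distrib]
    refine congrArg₂ (· - ·) ?_ ?_
    · simp only [smul_sum, smul_smul]; rfl
    · simp only [smul_sum, smul_smul]; rfl

/-- The square of the differential vanishes. -/
theorem D_D [CharZero K] (z : CAlg K b d) : D d (D d z) = 0 :=
  LinearMap.congr_fun (f := D d ∘ₗ D d) (g := 0) (hom_ext D_D_mk) z

end

end Cobar

section

/-! ### The canonical map -/

section ValRelations

variable {ι : Type} {c : ι → PairColor} {d : PairColor}

theorem HasColor.exists_based {u : FreeMagma ι} (h : HasColor c u d) :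
    ∃ i ∈ labels u, c i = d ∧ ∀ j ∈ labels u, j ≠ i → c j = .algebra := by
  induction u using magma_induction generalizing d with
  | hof i => exact ⟨i, by simp, h, fun j hj hne => absurd (by simpa using hj) hne⟩
  | hmul s t hs ht =>
    obtain ⟨a, a', ⟨g⟩, h₁, h₂⟩ := h
    obtain ⟨i, hi, hci, hi'⟩ := hs h₁
    obtain ⟨j, hj, hcj, hj'⟩ := ht h₂
    have hall : ∀ {u : FreeMagma ι} {i : ι}, c i = .algebra →
        (∀ j ∈ labels u, j ≠ i → c j = .algebra) → ∀ j ∈ labels u, c j = .algebra := by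
      intro u i hi h j hj
      by_cases hji : j = i
      · rw [hji, hi]
      · exact h j hj hji
    cases g with
    | product =>
      refine ⟨i, by simp [hi], hci, fun k hk hne => ?_⟩
      rw [labels_mul, Multiset.mem_add] at hk
      exact hk.elim (fun hk => hi' k hk hne) (hall hcj hj' k)
    | action =>
      refine ⟨j, by simp [hj], hcj, fun k hk hne => ?_⟩
      rw [labels_mul, Multiset.mem_add] at hk
      exact hk.elim (hall hci hi' k) (fun hk => hj' k hk hne)
    | actionSwap =>
      refine ⟨i, by simp [hi], hci, fun k hk hne => ?_⟩
      rw [labels_mul, Multiset.mem_add] at hk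
      exact hk.elim (fun hk => hi' k hk hne) (hall hcj hj' k)

theorem Adm.exists_based {u : FreeMagma ι} (h : Adm c d u) : ∃ i, Based c d i := by
  obtain ⟨i, -, hi, hi'⟩ := h.1.exists_based
  exact ⟨i, hi, fun j hj => hi' j (h.2.2 j) hj⟩

variable [Fintype ι] [LinearOrder ι]

/-- The values of an element of the cooperad depend linearly on the associative polynomials of
trees. -/
theorem exists_val_eq (x : Coop K c d) :
    ∃ φ : FreeAlgebra K ι →ₗ[K] K, ∀ u, Adm c d u → val x u = φ (assoc K u) := by
  by_cases h : ∃ i, Based c d i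
  · obtain ⟨i, hi⟩ := h
    exact ⟨wordForm i x ∘ₗ stripLast i, fun u hu => val_eq_wordForm hi x hu⟩
  · exact ⟨0, fun u hu => absurd hu.exists_based h⟩

theorem HasColor.swap {s t : FreeMagma ι} (h : HasColor c (s * t) d) : HasColor c (t * s) d := by
  obtain ⟨a, a', ⟨g⟩, h₁, h₂⟩ := h
  exact ⟨a', a, ⟨g.swap⟩, h₂, h₁⟩

theorem HasColor.rot {s t r : FreeMagma ι} (h : HasColor c (s * t * r) d) :
    HasColor c (t * r * s) d := by
  obtain ⟨e, a'', ⟨g⟩, ⟨a, a', ⟨g'⟩, h₁, h₂⟩, h₃⟩ := h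
  obtain ⟨⟨e', k, k'⟩⟩ := PairGen.nonempty_mono_rot (ε := 1) (a := a) (b := a') (c := a'') (d := d)
    ⟨e, g, g'⟩
  exact ⟨e', a, ⟨k⟩, ⟨a', a'', ⟨k'⟩, h₂, h₃⟩, h₁⟩

theorem val_swap (x : Coop K c d) (s t : FreeMagma ι) : val x (s * t) = - val x (t * s) := by
  have hl : ∀ s t : FreeMagma ι, labels (s * t) = labels (t * s) := fun s t => by
    rw [labels_mul, labels_mul, add_comm]
  obtain ⟨φ, hφ⟩ := exists_val_eq x
  by_cases h : Adm c d (s * t)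
  · have h' : Adm c d (t * s) := ⟨h.1.swap, by rw [IsML, hl]; exact h.2⟩
    rw [hφ _ h, hφ _ h', ← map_neg, assoc_mul, assoc_mul, neg_sub]
  · have h' : ¬ Adm c d (t * s) := fun h' => h ⟨h'.1.swap, by rw [IsML, hl]; exact h'.2⟩
    rw [val_of_not_adm _ h, val_of_not_adm _ h', neg_zero]

theorem val_jacobi (x : Coop K c d) (s t r : FreeMagma ι) :
    val x (s * t * r) + val x (t * r * s) + val x (r * s * t) = 0 := by
  have hl : ∀ s t r : FreeMagma ι, labels (s * t * r) = labels (t * r * s) := fun s t r => by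
    simp only [labels_mul]; abel
  have hr : ∀ s t r : FreeMagma ι, Adm c d (s * t * r) → Adm c d (t * r * s) := fun s t r h =>
    ⟨h.1.rot, by rw [IsML, ← hl]; exact h.2⟩
  obtain ⟨φ, hφ⟩ := exists_val_eq x
  by_cases h : Adm c d (s * t * r)
  · rw [hφ _ h, hφ _ (hr _ _ _ h), hφ _ (hr _ _ _ (hr _ _ _ h)), ← map_add, ← map_add]
    refine (congrArg φ ?_).trans (map_zero φ)
    simp only [assoc_mul]
    noncomm_ring
  · rw [val_of_not_adm _ h, val_of_not_adm _ fun h' => h (hr _ _ _ (hr _ _ _ h')),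
      val_of_not_adm _ fun h' => h (hr _ _ _ h'), add_zero, add_zero]

end ValRelations

section FreeMul

variable {κ : Type} {b : κ → PairColor}

/-- The action of a generator on the free algebra over `comm⁺`. -/
def commAct (b : κ → PairColor) {a a' d : PairColor} (g : PairGen a a' d) :
    (commPlus K).FreeAlg b a →ₗ[K] (commPlus K).FreeAlg b a' →ₗ[K] (commPlus K).FreeAlg b d :=
  (commPlus K).act (a := a) (b := a') (d := d) g

/-- The sum of the products of the two arguments by the generators with given colours; there is at
most one. -/
def freeMul (b : κ → PairColor) (a a' d : PairColor) : (commPlus K).FreeAlg b a →ₗ[K]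
    (commPlus K).FreeAlg b a' →ₗ[K] (commPlus K).FreeAlg b d :=
  ∑ g : PairGen a a' d, commAct b g

theorem freeMul_eq {a a' d : PairColor} (g : PairGen a a' d) :
    freeMul (K := K) b a a' d = commAct b g :=
  Fintype.sum_subsingleton (fun g : PairGen a a' d => commAct (K := K) b g) g

theorem freeMul_of_isEmpty {a a' d : PairColor} (h : IsEmpty (PairGen a a' d)) :
    freeMul (K := K) b a a' d = 0 :=
  Finset.sum_eq_zero fun g _ => h.elim g

theorem freeMul_apply {a a' d : PairColor} (x : (commPlus K).FreeAlg b a)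
    (y : (commPlus K).FreeAlg b a') : freeMul b a a' d x y = ∑ g, commAct b g x y := by
  rw [freeMul, LinearMap.sum_apply, LinearMap.sum_apply]

theorem freeMul_comm {a a' d : PairColor} (x : (commPlus K).FreeAlg b a)
    (y : (commPlus K).FreeAlg b a') : freeMul b a a' d x y = freeMul b a' a d y x := by
  by_cases h : Nonempty (PairGen a a' d)
  · obtain ⟨g⟩ := h
    rw [freeMul_eq g, freeMul_eq g.swap]
    refine (QuadraticData.act_swap (Q := commPlus K) (a := a) (b := a') (d := d) g x y).trans ?_
    exact one_smul _ _
  · rw [freeMul_of_isEmpty (not_nonempty_iff.1 h),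
      freeMul_of_isEmpty (not_nonempty_iff.1 fun ⟨g⟩ => h ⟨g.swap⟩)]
    rfl

/-- The product of three elements. -/
def freeMul₃ {a₁ a₂ a₃ : PairColor} (d : PairColor) (x : (commPlus K).FreeAlg b a₁)
    (y : (commPlus K).FreeAlg b a₂) (z : (commPlus K).FreeAlg b a₃) : (commPlus K).FreeAlg b d :=
  ∑ e, freeMul b e a₃ d (freeMul b a₁ a₂ e x y) z

theorem freeMul₃_swap {a₁ a₂ a₃ d : PairColor} (x : (commPlus K).FreeAlg b a₁)
    (y : (commPlus K).FreeAlg b a₂) (z : (commPlus K).FreeAlg b a₃) :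
    freeMul₃ d y x z = freeMul₃ d x y z :=
  Finset.sum_congr rfl fun e _ => by rw [freeMul_comm x y]

theorem freeMul₃_eq {a₁ a₂ a₃ d : PairColor} (x : (commPlus K).FreeAlg b a₁)
    (y : (commPlus K).FreeAlg b a₂) (z : (commPlus K).FreeAlg b a₃) : freeMul₃ d x y z =
      ∑ m : (commPlus K).Mono a₁ a₂ a₃ d, commAct b (a := m.1) (a' := a₃) (d := d) m.2.1
          (commAct b (a := a₁) (a' := a₂) (d := m.1) m.2.2 x y) z := by
  rw [Fintype.sum_sigma, freeMul₃]
  refine Finset.sum_congr rfl fun e _ => ?_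
  rw [Fintype.sum_prod_type, freeMul_apply]
  refine Finset.sum_congr rfl fun g _ => ?_
  rw [freeMul_apply, map_sum, LinearMap.sum_apply]
  rfl

theorem freeMul₃_rot {a₁ a₂ a₃ d : PairColor} (x : (commPlus K).FreeAlg b a₁)
    (y : (commPlus K).FreeAlg b a₂) (z : (commPlus K).FreeAlg b a₃) :
    freeMul₃ d y z x = freeMul₃ d x y z := by
  have hw : ((fun _ => 1, fun _ => -1, fun _ => 0) : (commPlus K).Weight2 K a₁ a₂ a₃ d) ∈
      (commPlus K).Rel a₁ a₂ a₃ d := by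
    change ∑ _m : (PairGen.generators 1).Mono a₁ a₂ a₃ d, (1 : K) +
      ∑ _m : (PairGen.generators 1).Mono a₂ a₃ a₁ d, (-1 : K) + ∑ _m, (0 : K) = 0
    rw [Finset.sum_const, Finset.sum_const, Finset.sum_const_zero, Finset.card_univ,
      Finset.card_univ, PairGen.card_mono_rot a₁ a₂ a₃ d 1, smul_neg, add_neg_cancel, add_zero]
  have h := QuadraticData.act_rel (Q := commPlus K) hw x y z
  simp only [one_smul, neg_smul, zero_smul, Finset.sum_const_zero, add_zero,
    Finset.sum_neg_distrib] at h
  rw [freeMul₃_eq, freeMul₃_eq]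
  exact (eq_of_sub_eq_zero ((sub_eq_add_neg _ _).trans h)).symm

end FreeMul

namespace Cobar

open CobarTree Finset

section PairSum

variable {ι : Type} [Fintype ι] [LinearOrder ι] {c : ι → PairColor} {d : PairColor} {V : Type*}
  [AddCommGroup V] [Module K V]

/-- The coefficient of an element of arity two, multiplied by the value at the two inputs
of a function `B`; it is zero in other arities. -/
def pairSum (x : Coop K c d) (B : ι → ι → V) : V :=
  if Fintype.card ι = 2 then ∑ i, ∑ j, if i < j then val x (.of i * .of j) • B i j else 0 else 0

theorem pairSum_of_card_ne (h : Fintype.card ι ≠ 2) (x : Coop K c d) (B : ι → ι → V) :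
    pairSum x B = 0 := if_neg h

theorem exists_lt_of_card_eq_two (h : Fintype.card ι = 2) :
    ∃ i j : ι, i < j ∧ ∀ k, k = i ∨ k = j := by
  obtain ⟨i, j, hij, hu⟩ := card_eq_two.1 (card_univ.trans h)
  have hk : ∀ k, k = i ∨ k = j := fun k => by
    have := mem_univ k
    rw [hu] at this
    simpa using this
  rcases lt_or_gt_of_ne hij with h | h
  · exact ⟨i, j, h, hk⟩
  · exact ⟨j, i, h, fun k => (hk k).symm⟩

theorem card_eq_two_of_pair {i j : ι} (hij : i ≠ j) (h : ∀ k, k = i ∨ k = j) :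
    Fintype.card ι = 2 := by
  rw [← card_univ, card_eq_two]
  exact ⟨i, j, hij, eq_univ_iff_forall.2 (fun k => by simpa using h k) |>.symm⟩

theorem pairSum_eq {i j : ι} (hij : i < j) (h : ∀ k, k = i ∨ k = j) (x : Coop K c d)
    (B : ι → ι → V) : pairSum x B = val x (.of i * .of j) • B i j := by
  rw [pairSum, if_pos (card_eq_two_of_pair hij.ne h)]
  refine (Fintype.sum_eq_single i fun k hk => ?_).trans
    ((Fintype.sum_eq_single j fun k hk => ?_).trans (if_pos hij))
  · obtain rfl := (h k).resolve_left hk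
    refine sum_eq_zero fun l _ => if_neg ?_
    rcases h l with rfl | rfl
    · exact hij.not_gt
    · exact lt_irrefl _
  · obtain rfl := (h k).resolve_right hk
    exact if_neg (lt_irrefl _)

theorem pairSum_add (x y : Coop K c d) (B : ι → ι → V) :
    pairSum (x + y) B = pairSum x B + pairSum y B := by
  by_cases h : Fintype.card ι = 2
  · obtain ⟨i, j, hij, h⟩ := exists_lt_of_card_eq_two h
    rw [pairSum_eq hij h, pairSum_eq hij h, pairSum_eq hij h, val_add, add_smul]
  · simp only [pairSum_of_card_ne h, add_zero]

theorem pairSum_smul (r : K) (x : Coop K c d) (B : ι → ι → V) :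
    pairSum (r • x) B = r • pairSum x B := by
  by_cases h : Fintype.card ι = 2
  · obtain ⟨i, j, hij, h⟩ := exists_lt_of_card_eq_two h
    rw [pairSum_eq hij h, pairSum_eq hij h, val_smul, mul_smul]
  · simp only [pairSum_of_card_ne h, smul_zero]

theorem koszulSign_of_lt {κ : Type} [Fintype κ] [LinearOrder κ] {σ : ι ≃ κ} {i j : ι} (hij : i < j)
    (h : ∀ k, k = i ∨ k = j) (hσ : σ i < σ j) (N : κ → ℤ) : koszulSign σ N = 1 := by
  refine koszulSign_strictMono σ (fun p q hpq => ?_) N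
  rcases h p with rfl | rfl <;> rcases h q with rfl | rfl
  · exact absurd hpq (lt_irrefl _)
  · exact hσ
  · exact absurd hpq hij.not_gt
  · exact absurd hpq (lt_irrefl _)

theorem koszulSign_of_gt {κ : Type} [LinearOrder κ] {σ : ι ≃ κ} {i j : ι} (hij : i < j)
    (h : ∀ k, k = i ∨ k = j) (hσ : σ j < σ i) (N : κ → ℤ) :
    koszulSign σ N = (N (σ i) * N (σ j)).negOnePow := by
  have : univ.filter (fun p : ι × ι => p.1 < p.2 ∧ σ p.2 < σ p.1) = {(i, j)} := by
    ext ⟨p, q⟩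
    simp only [mem_filter, mem_univ, true_and, mem_singleton, Prod.mk.injEq]
    constructor
    · rintro ⟨hpq, hσ'⟩
      rcases h p with rfl | rfl <;> rcases h q with rfl | rfl
      · exact absurd hpq (lt_irrefl _)
      · exact ⟨rfl, rfl⟩
      · exact absurd hpq hij.not_gt
      · exact absurd hpq (lt_irrefl _)
    · rintro ⟨rfl, rfl⟩; exact ⟨hij, hσ⟩
  rw [koszulSign, this, prod_singleton]

/-- A graded symmetric function of the two inputs is compatible with bijections. -/
theorem pairSum_perm {ι' : Type} [Fintype ι'] [LinearOrder ι'] (σ : ι ≃ ι') {c' : ι' → PairColor}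
    (x : Coop K c' d) (B : ι' → ι' → V) (N : ι' → ℤ)
    (hB : ∀ k l, B k l = - (N k * N l).negOnePow • B l k) :
    pairSum (c := c' ∘ σ) (pull₀ σ (fun _ => rfl) d x) (fun i j => B (σ i) (σ j)) =
      koszulSign σ N • pairSum x B := by
  by_cases h : Fintype.card ι = 2
  swap
  · rw [pairSum_of_card_ne h, pairSum_of_card_ne (Fintype.card_congr σ ▸ h), smul_zero]
  obtain ⟨i, j, hij, h⟩ := exists_lt_of_card_eq_two h
  have h' : ∀ k, k = σ i ∨ k = σ j := fun k => by
    simpa only [Equiv.symm_apply_eq] using h (σ.symm k)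
  rw [pairSum_eq hij h, val_pull₀]
  change val x (.of (σ i) * .of (σ j)) • _ = _
  rcases lt_or_gt_of_ne (σ.injective.ne hij.ne) with hσ | hσ
  · rw [pairSum_eq hσ h', koszulSign_of_lt hij h hσ, one_smul]
  · rw [pairSum_eq hσ fun k => (h' k).symm, koszulSign_of_gt hij h hσ, hB, val_swap, neg_smul,
      Units.neg_smul, smul_neg, neg_neg, smul_comm]

end PairSum

variable {κ : Type} {b : κ → PairColor} {d e : PairColor}

/-- The canonical map on trees. -/
def treeγ : ∀ {d : PairColor}, CTree K b d → (commPlus K).FreeAlg b d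
  | _, leaf k => (commPlus K).cls (.leaf k)
  | _, node (c := c) (d := d) _ x ts =>
    pairSum x fun i j => freeMul b (c i) (c j) d (treeγ (ts i)) (treeγ (ts j))

theorem treeγ_node {ι : Type} [Fintype ι] [LinearOrder ι] {c : ι → PairColor}
    (hι : 2 ≤ Fintype.card ι) (x : Coop K c d) (ts : Branches K b c) : treeγ (node hι x ts) =
      pairSum x fun i j => freeMul b (c i) (c j) d (treeγ (ts i)) (treeγ (ts j)) := rfl

theorem deg_nonpos (t : CTree K b d) : t.deg ≤ 0 := by
  induction t with
  | leaf k => exact le_rfl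
  | node hι x ts ih =>
    rw [deg_node]
    have := sum_nonpos fun i (_ : i ∈ univ) => ih i
    omega

theorem treeγ_eq_zero {t : CTree K b d} (h : t.deg ≠ 0) : treeγ t = 0 := by
  induction t with
  | leaf k => exact absurd rfl h
  | @node ι _ _ hι c d x ts ih =>
    rw [treeγ]
    by_cases hc : Fintype.card ι = 2
    · obtain ⟨i, j, hij, hk⟩ := exists_lt_of_card_eq_two hc
      rw [pairSum_eq hij hk]
      by_cases hi : (ts i).deg = 0
      · have hj : (ts j).deg ≠ 0 := fun hj => h (by
          rw [deg_node, hc, sum_eq_zero]; · rfl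
          intro k _
          rcases hk k with rfl | rfl <;> assumption)
        rw [ih j hj, map_zero, smul_zero]
      · rw [ih i hi, map_zero, LinearMap.zero_apply, smul_zero]
    · exact pairSum_of_card_ne hc _ _

variable {ι : Type} [Fintype ι] [LinearOrder ι] {c : ι → PairColor}

theorem treeγ_perm {ι' : Type} [Fintype ι'] [LinearOrder ι'] (hι : 2 ≤ Fintype.card ι)
    (hι' : 2 ≤ Fintype.card ι') (σ : ι ≃ ι') {c' : ι' → PairColor} (x : Coop K c' d)
    (ts : Branches K b c') : treeγ (node hι ((koszulCoop K).pull σ c' d x) fun i => ts (σ i)) =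
      koszulSign σ (fun i => (ts i).deg) • treeγ (node hι' x ts) := by
  by_cases h : ∀ i, (ts i).deg = 0
  · have h₀ : koszulSign σ (fun i => (ts i).deg) = 1 := by
      rw [koszulSign]
      exact prod_eq_one fun p _ => by simp [h]
    have h₁ := pairSum_perm σ x (fun i j => freeMul b (c' i) (c' j) d (treeγ (ts i)) (treeγ (ts j)))
      (fun _ => 1) fun k l => by rw [freeMul_comm]; simp
    rw [h₀, one_smul, treeγ_node, treeγ_node, koszulCoop_pull, Units.smul_def, ← Int.cast_smul_eq_zsmul K,
      pairSum_smul, Int.cast_smul_eq_zsmul, ← Units.smul_def]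
    refine (congrArg _ h₁).trans ?_
    rw [smul_smul, Int.units_mul_self, one_smul]
  · push Not at h
    obtain ⟨i, hi⟩ := h
    have hneg : ∑ i, (ts i).deg < 0 :=
      sum_neg' (fun i _ => deg_nonpos _) ⟨i, mem_univ _, lt_of_le_of_ne (deg_nonpos _) hi⟩
    have hneg' : ∑ i, (ts (σ i)).deg < 0 := by rwa [Equiv.sum_comp σ fun i => (ts i).deg]
    rw [treeγ_eq_zero, treeγ_eq_zero, smul_zero]
    · rw [deg_node]; omega
    · rw [deg_node]; simp only [Function.comp_apply]; omega

theorem exists_treeγ_update (hι : 2 ≤ Fintype.card ι) (x : Coop K c d)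
    (ts : Branches K b c) (i : ι) :
    ∃ H : (commPlus K).FreeAlg b (c i) →ₗ[K] (commPlus K).FreeAlg b d,
      ∀ t, treeγ (node hι x (update ts i t)) = H (treeγ t) := by
  by_cases hc : Fintype.card ι = 2
  swap
  · exact ⟨0, fun t => by rw [treeγ_node]; exact pairSum_of_card_ne hc _ _⟩
  obtain ⟨p, q, hpq, hk⟩ := exists_lt_of_card_eq_two hc
  rcases hk i with rfl | rfl
  · refine ⟨val x (.of i * .of q) • (freeMul b (c i) (c q) d).flip (treeγ (ts q)), fun t => ?_⟩
    rw [treeγ_node, pairSum_eq hpq hk, update_self, update_of_ne hpq.ne']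
    rfl
  · refine ⟨val x (.of p * .of i) • freeMul b (c p) (c i) d (treeγ (ts p)), fun t => ?_⟩
    rw [treeγ_node, pairSum_eq hpq hk, update_self, update_of_ne hpq.ne]
    rfl

/-- The canonical map from the cobar construction to `comm⁺`. -/
def γ (d : PairColor) : CAlg K b d →ₗ[K] (commPlus K).FreeAlg b d :=
  liftTree treeγ fun _ hf => linearCombination_eq_zero
    (V := fun d => (commPlus K).FreeAlg b d) treeγ
    (fun hι c d x y ts => pairSum_add x y _)
    (fun hι c d r x ts => pairSum_smul r x _)
    (fun hι hι' σ c d x ts => treeγ_perm hι hι' σ x ts)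
    (fun hι c d x ts i n m => by
      obtain ⟨H, h⟩ := exists_treeγ_update hι x ts i
      exact ⟨0, H, fun t _ _ => by rw [h]; simp⟩) hf

theorem γ_mk (t : CTree K b d) : γ d (mk t) = treeγ t := liftTree_mk _ _ t

theorem γ_binary {i j : ι} (hij : i < j) (h : ∀ k, k = i ∨ k = j) (hι : 2 ≤ Fintype.card ι)
    (x : Coop K c d) (ts : Branches K b c) : γ d (mk (node hι x ts)) =
      val x (.of i * .of j) • freeMul b (c i) (c j) d (γ (c i) (mk (ts i))) (γ (c j) (mk (ts j))) := by
  rw [γ_mk, treeγ_node, pairSum_eq hij h, γ_mk, γ_mk]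

theorem γ_higher (h : Fintype.card ι ≠ 2) (hι : 2 ≤ Fintype.card ι)
    (x : Coop K c d) (ts : Branches K b c) : γ d (mk (node hι x ts)) = 0 := by
  rw [γ_mk, treeγ_node, pairSum_of_card_ne h]

theorem isCanonicalMap_γ : (commPlus K).IsCanonicalMap b (γ : ∀ d, CAlg K b d →ₗ[K] _) where
  leaf k := γ_mk _
  binary {ι} _ _ hι c d x ts i j hij h := by
    refine (γ_binary (c := c) (d := d) hij h hι x ts).trans ?_
    rw [freeMul_apply, smul_sum]
    refine sum_congr rfl fun g _ => ?_
    exact congrArg₂ (· • ·) (val_erase (c := c) (d := d) x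
      ((commDual K).corolla (c := c) hij.ne h g)) rfl
  higher hι c d x ts h := γ_higher h.ne' hι x ts

theorem γ_eq_zero_of_mem_homog {n : ℤ} (hn : n ≠ 0) {z : CAlg K b d} (hz : z ∈ homog K b d n) :
    γ d z = 0 := by
  have h := eq_of_mem_homog (F := γ d) (G := 0) (fun t ht => by
    rw [γ_mk, treeγ_eq_zero (by rwa [ht]), LinearMap.zero_apply]) hz
  exact h

end Cobar

end

section

theorem val_swap_left {ι : Type} {c : ι → PairColor} {d : PairColor} [Fintype ι] [LinearOrder ι]
    (x : Coop K c d) (s t r : FreeMagma ι) : val x (s * t * r) = - val x (t * s * r) := by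
  have hr : ∀ s t : FreeMagma ι, Adm c d (s * t * r) → Adm c d (t * s * r) := by
    rintro s t ⟨⟨e, a, hg, h₁, h₂⟩, h⟩
    refine ⟨⟨e, a, hg, h₁.swap, h₂⟩, ?_⟩
    rw [IsML, labels_mul, labels_mul, add_comm (labels t), ← labels_mul, ← labels_mul]
    exact h
  obtain ⟨φ, hφ⟩ := exists_val_eq x
  by_cases h : Adm c d (s * t * r)
  · rw [hφ _ h, hφ _ (hr _ _ h), ← map_neg]
    refine congrArg φ ?_
    simp only [assoc_mul]
    noncomm_ring
  · rw [val_of_not_adm _ h, val_of_not_adm _ fun h' => h (hr _ _ h'), neg_zero]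

variable {κ : Type} {b : κ → PairColor} {d e : PairColor}

namespace Cobar

open CobarTree Finset

variable {ι : Type} [Fintype ι] [LinearOrder ι] {c : ι → PairColor}

theorem rootSign_pair {i j : ι} (hij : i < j) (h : ∀ k, k = i ∨ k = j) (N : ι → ℤ) :
    rootSign N = -(N i).negOnePow := by
  have hs : ((2 : ℕ) - 1 : ℤ).negOnePow = -1 := rfl
  rw [rootSign, card_eq_two_of_pair hij.ne h, hs, neg_one_mul]
  refine congrArg Neg.neg ?_
  refine (Fintype.prod_eq_single i fun k hk => ?_).trans
    ((Fintype.prod_eq_single j fun k hk => ?_).trans (if_pos hij))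
  · obtain rfl := (h k).resolve_left hk
    refine prod_eq_one fun l _ => if_neg ?_
    rcases h l with rfl | rfl
    · exact hij.not_gt
    · exact lt_irrefl _
  · obtain rfl := (h k).resolve_right hk
    exact if_neg (lt_irrefl _)

/-- The canonical map at a tree whose root, with three inputs, has been split. -/
theorem γ_splitN {p q r : ι} (hpq : p < q) (hrp : r ≠ p) (hrq : r ≠ q)
    (hk : ∀ k, k = p ∨ k = q ∨ k = r) (ts : Branches K b c) (hts : ∀ i, (ts i).deg = 0)
    (x : Coop K c d) :
    ∑ e, γ d (splitN ts {p, q} d e (dec c {p, q} d e x)) = val x (.of p * .of q * .of r) •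
      freeMul₃ d (γ (c p) (mk (ts p))) (γ (c q) (mk (ts q))) (γ (c r) (mk (ts r))) := by
  set J : Finset ι := {p, q} with hJdef
  have hr : r ∉ J := by simp [hJdef, hrp, hrq]
  have hp : p ∈ J := by simp [hJdef]
  have hq : q ∈ J := by simp [hJdef]
  have hJ : Splits J := by
    refine ⟨(card_pair hpq.ne).ge, ?_⟩
    rw [← card_univ]
    exact card_lt_card ⟨subset_univ _, fun h => hr (h (mem_univ r))⟩
  have hcJ : 2 ≤ Fintype.card J := hJ.two_le_card
  have hJk : ∀ k : J, k = ⟨p, hp⟩ ∨ k = ⟨q, hq⟩ := by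
    rintro ⟨k, hk⟩
    simpa [hJdef] using hk
  have hCk : ∀ o : Contract J, o = .new ∨ o = .old ⟨r, hr⟩ := by
    intro o
    match o with
    | .new => exact .inl rfl
    | .old ⟨k, hk'⟩ =>
      right
      rcases hk k with rfl | rfl | rfl
      · exact absurd hp hk'
      · exact absurd hq hk'
      · rfl
  have key : ∀ e, ∀ τ : Coop K (color c J e) d ⊗[K]
      Coop K (restrictColor c J) e, γ d (splitN ts J d e τ) =
      valAt₂ (.of .new * .of (.old ⟨r, hr⟩)) (.of ⟨p, hp⟩ * .of ⟨q, hq⟩) τ •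
        freeMul b e (c r) d (freeMul b (c p) (c q) e (γ (c p) (mk (ts p))) (γ (c q) (mk (ts q))))
          (γ (c r) (mk (ts r))) := by
    intro e τ
    induction τ with
    | zero => simp only [map_zero, zero_smul]
    | add x y hx hy => rw [map_add, map_add, hx, hy, map_add, add_smul]
    | tmul y z =>
      rw [splitN_tmul ts hJ, nd, smul_smul, map_units_smul, valAt₂_tmul]
      -- All branches have degree zero, and the upper vertex is of arity two.
      have hs : rootSign (fun j : J => pars ts j) *
          rootSign (pars (contractBranches (J := J) (upper hJ z ts) ts)) = 1 := by
        rw [rootSign_pair (i := (⟨p, hp⟩ : J)) (j := ⟨q, hq⟩) hpq hJk,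
          rootSign_pair (new_lt_old _) hCk]
        change -((ts p).deg + 1).negOnePow * -((upper hJ z ts).deg + 1).negOnePow = 1
        rw [neg_mul_neg, deg_node, hts, sum_eq_zero fun j _ => hts _, Fintype.card_coe, card_pair hpq.ne]
        rfl
      rw [hs, one_smul]
      have h₁ := γ_binary (new_lt_old _) hCk (two_le_card_contract hJ.2) y
        (contractBranches (upper hJ z ts) ts)
      have h₂ := γ_binary (c := restrictColor c J) (i := ⟨p, hp⟩) (j := ⟨q, hq⟩) hpq hJk hcJ z
        fun j => ts j
      refine h₁.trans ?_
      rw [mul_smul]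
      refine congrArg _ ?_
      have h₃ := congrArg (fun v => freeMul b e (c r) d v (γ (c r) (mk (ts r)))) h₂
      refine h₃.trans ?_
      simp only [map_smul, LinearMap.smul_apply]
  rw [sum_congr rfl fun e _ => key e _, freeMul₃, smul_sum]
  refine sum_congr rfl fun e _ => ?_
  by_cases h₁ : Nonempty (PairGen e (c r) d)
  swap
  · rw [freeMul_of_isEmpty (not_nonempty_iff.1 h₁)]; simp
  by_cases h₂ : Nonempty (PairGen (c p) (c q) e)
  swap
  · rw [freeMul_of_isEmpty (not_nonempty_iff.1 h₂)]; simp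
  rw [valAt₂_dec]
  · rfl
  · refine ⟨⟨e, c r, h₁, rfl, rfl⟩, ?_⟩
    rw [IsML, labels_mul, labels_of, labels_of]
    exact ⟨by simp, fun o => by simpa using hCk o⟩
  · refine ⟨⟨c p, c q, h₂, rfl, rfl⟩, ?_⟩
    rw [IsML, labels_mul, labels_of, labels_of]
    exact ⟨by simp [hpq.ne], fun o => by simpa using hJk o⟩

/-- The canonical map vanishes on the result of splitting a root with three inputs, by the Jacobi
identity. -/
theorem γ_rootPart_fin_three {c : Fin 3 → PairColor} (ts : Branches K b c)
    (hts : ∀ i, (ts i).deg = 0) (x : Coop K c d) : γ d (rootPart ts d x) = 0 := by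
  have hN : pars ts = fun _ => 1 := funext fun i => by rw [pars, hts]; rfl
  rw [rootPart_apply, map_sum, hN]
  rw [← sum_subset (subset_univ ({{0, 1}, {1, 2}, {0, 2}} : Finset (Finset (Fin 3))))
    fun J _ hJ => ?_]
  swap
  · have hJ' : ¬ Splits J := by
      rw [Splits, Fintype.card_fin]
      revert hJ
      revert J
      decide
    rw [map_sum]
    exact sum_eq_zero fun e _ => by rw [splitN_of_not _ hJ', LinearMap.zero_apply, smul_zero, map_zero]
  rw [sum_insert (by decide), sum_insert (by decide), sum_singleton]
  have h₁ : frontSign ({0, 1} : Finset (Fin 3)) (fun _ => 1) = 1 := by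
    rw [frontSign_eq]; simp [Fin.prod_univ_three]
  have h₂ : frontSign ({1, 2} : Finset (Fin 3)) (fun _ => 1) = 1 := by
    rw [frontSign_eq]; simp [Fin.prod_univ_three]
  have h₃ : frontSign ({0, 2} : Finset (Fin 3)) (fun _ => 1) = -1 := by
    rw [frontSign_eq]; simp [Fin.prod_univ_three]
  have e₁ := γ_splitN (p := 0) (q := 1) (r := 2) (by decide) (by decide) (by decide) (by decide)
    ts hts x
  have e₂ := γ_splitN (p := 1) (q := 2) (r := 0) (by decide) (by decide) (by decide) (by decide)
    ts hts x
  have e₃ := γ_splitN (p := 0) (q := 2) (r := 1) (by decide) (by decide) (by decide) (by decide)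
    ts hts x
  simp only [h₁, h₂, h₃, one_smul, map_sum, Units.neg_smul, map_neg, sum_neg_distrib]
  rw [freeMul₃_rot] at e₂
  rw [freeMul₃_swap (γ (c 2) (mk (ts 2))), freeMul₃_rot (γ (c 1) (mk (ts 1))), freeMul₃_rot] at e₃
  have hsum := congrArg₂ (· + ·) e₁ (congrArg₂ (· + ·) e₂ (congrArg Neg.neg e₃))
  refine hsum.trans ?_
  rw [val_swap_left x (.of 0) (.of 2), ← neg_smul, neg_neg, ← add_smul, ← add_smul, ← add_assoc,
    val_jacobi, zero_smul]

theorem γ_rootPart (ts : Branches K b c) (x : Coop K c d) 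
    (hts : Fintype.card ι = 3 → ∀ i, (ts i).deg = 0) : γ d (rootPart ts d x) = 0 := by
  by_cases hc : Fintype.card ι = 3
  · let σ : Fin 3 ≃ ι := (Fintype.equivFinOfCardEq hc).symm
    have h := rootPart_perm σ ts x
    have h' := congrArg (γ d) h
    rw [γ_rootPart_fin_three (c := c ∘ σ) (fun i => ts (σ i)) (fun i => hts hc _), map_units_smul] at h'
    have h'' := congrArg (koszulSign σ (pars ts) • ·) h'
    simp only [smul_zero, smul_smul, Int.units_mul_self, one_smul] at h''
    exact h''.symm
  · rw [rootPart_apply, map_sum]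
    refine sum_eq_zero fun J _ => ?_
    rw [map_sum]
    refine sum_eq_zero fun e _ => ?_
    rw [map_units_smul]
    by_cases hJ : Splits J
    swap
    · rw [splitN_of_not _ hJ, LinearMap.zero_apply, map_zero, smul_zero]
    have hcJ : 2 ≤ Fintype.card J := hJ.two_le_card
    have key : ∀ τ : Coop K (color c J e) d ⊗[K]
        Coop K (restrictColor c J) e, γ d (splitN ts J d e τ) = 0 := by
      intro τ
      induction τ with
      | zero => simp only [map_zero]
      | add x y hx hy => rw [map_add, map_add, hx, hy, add_zero]
      | tmul y z =>
        rw [splitN_tmul ts hJ, nd, smul_smul, map_units_smul]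
        refine (congrArg _ ?_).trans (smul_zero _)
        by_cases h₂ : Fintype.card (Contract J) = 2
        · obtain ⟨i, j, hij, hk⟩ := exists_lt_of_card_eq_two h₂
          have h₃ := γ_higher (c := restrictColor c J) (by
            have := card_contract J
            rw [Fintype.card_coe]
            omega) hcJ z fun j => ts j
          have h₄ : γ e (mk (upper hJ z ts)) = 0 := h₃
          refine (γ_binary hij hk (two_le_card_contract hJ.2) y
            (contractBranches (upper hJ z ts) ts)).trans ?_
          refine (congrArg _ ?_).trans (smul_zero _)
          rcases hk .new with h | h
          · subst h
            exact (congrArg (fun v => freeMul b e (color c J e j) d v _) h₄).trans (by simp)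
          · subst h
            exact (congrArg (freeMul b (color c J e i) e d _) h₄).trans (by simp)
        · exact γ_higher h₂ _ _ _
    rw [key, smul_zero]

theorem γ_plug (hι : 2 ≤ Fintype.card ι) (x : Coop K c d)
    (ts : Branches K b c) (i : ι) {z : CAlg K b (c i)} (hz : γ (c i) z = 0) :
    γ d (plug hι x ts i z) = 0 := by
  obtain ⟨H, hH⟩ := exists_treeγ_update hι x ts i
  have : γ d ∘ₗ plug hι x ts i = H ∘ₗ γ (c i) := hom_ext fun t => by
    rw [comp_apply, comp_apply, plug_mk, γ_mk, γ_mk, hH]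
  have h := LinearMap.congr_fun this z
  rw [comp_apply, comp_apply, hz, map_zero] at h
  exact h

theorem γ_D_mk (t : CTree K b d) : γ d (D d (mk t)) = 0 := by
  induction t with
  | leaf k => rw [D_mk]; exact map_zero _
  | @node ι _ _ hι c d x ts ih =>
    by_cases hts : Fintype.card ι = 3 → ∀ i, (ts i).deg = 0
    · rw [mk_node, map_units_smul, map_units_smul, D_nd, map_sub, γ_rootPart ts x hts, map_sum,
        sum_eq_zero, sub_zero, smul_zero]
      intro i _
      rw [map_units_smul, plugSucc_apply, map_units_smul, γ_plug hι x ts i (ih i), smul_zero, smul_zero]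
    · refine γ_eq_zero_of_mem_homog ?_ (D_mem_homog (mk_mem_homog rfl))
      push Not at hts
      obtain ⟨hc, i, hi⟩ := hts
      have hneg : ∑ i, (ts i).deg < 0 :=
        sum_neg' (fun i _ => deg_nonpos _) ⟨i, mem_univ _, lt_of_le_of_ne (deg_nonpos _) hi⟩
      rw [deg_node]
      omega

/-- The canonical map is a map of complexes. -/
theorem γ_D (z : CAlg K b d) : γ d (D d z) = 0 :=
  LinearMap.congr_fun (f := γ d ∘ₗ D d) (g := 0) (hom_ext γ_D_mk) z

end Cobar

end

local instance (priority := 2000) decidableEqOfLinearOrder₂ {α : Type} [LinearOrder α] :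
    DecidableEq α :=
  LinearOrder.toDecidableEq

section

/-! ### Adding a first letter to a word form -/

section Rename

variable {ι κ : Type}

theorem exists_rename_eq (f : ι → κ) {u : FreeMagma κ} (h : ∀ k ∈ labels u, ∃ i, f i = k) :
    ∃ s, rename f s = u := by
  induction u using magma_induction with
  | hof k =>
    obtain ⟨i, rfl⟩ := h k (by simp)
    exact ⟨.of i, rfl⟩
  | hmul s t hs ht =>
    obtain ⟨s', rfl⟩ := hs fun k hk => h k (by simp [hk])
    obtain ⟨t', rfl⟩ := ht fun k hk => h k (by simp [hk])
    exact ⟨s' * t', rfl⟩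

theorem hasColor_rename {c : κ → PairColor} {f : ι → κ} {s : FreeMagma ι} {d : PairColor} :
    HasColor c (rename f s) d ↔ HasColor (c ∘ f) s d := by
  induction s using magma_induction generalizing d with
  | hof i => rfl
  | hmul s t hs ht =>
    change HasColor c (rename f s * rename f t) d ↔ _
    simp only [hasColor_mul, hs, ht]

end Rename

section CombExt

variable {ι : Type} [Fintype ι] [LinearOrder ι] {c : ι → PairColor} {d : PairColor} {i : ι}

/-- Elements that agree at the right-normed trees with a given last leaf agree. -/
theorem eq_zero_of_val_comb (h : Based c d i) (hι : 2 ≤ Fintype.card ι) {x : Coop K c d}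
    (hx : ∀ j w, Adm c d (.of j * comb i w) → val x (.of j * comb i w) = 0) : x = 0 := by
  refine eq_zero_of_val fun u hu => ?_
  rw [val_eq_wordForm h x hu]
  obtain ⟨m, hm⟩ := Multiset.exists_cons_of_mem (hu.2.2 i)
  refine eq_of_mem_wordSpan (f := wordForm i x) (g := 0) (m := m) (fun w hw => ?_)
    (stripLast_mem_wordSpan (hm ▸ assoc_mem_wordSpan u))
  have hml : IsML (comb i w) := by
    refine isML_comb ?_ ?_ <;> rw [hw, ← hm]
    exacts [hu.2.1, hu.2.2]
  have hiw : i ∉ w := by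
    have := hml.1
    rw [labels_comb, Multiset.nodup_cons] at this
    simpa using this.1
  have hadm : Adm c d (comb i w) := ⟨h.1 ▸ hasColor_comb h.2 hiw, hml⟩
  rw [wordForm_word]
  cases w with
  | nil =>
    have h₁ := Fintype.card_le_one_iff_subsingleton.2 ⟨fun p q => by
      have h' : ∀ p, p = i := fun p => by simpa [comb] using hml.2 p
      rw [h' p, h' q]⟩
    omega
  | cons j w => exact hx j w hadm

end CombExt

section Pre

variable {ι : Type} [Fintype ι] [LinearOrder ι] {c : ι → PairColor} {d : PairColor} {i : ι}
  {J : Finset ι}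

/-- The input `i` after adding a new first input. -/
abbrev oldE (i : ι) : Contract (∅ : Finset ι) := .old ⟨i, Finset.notMem_empty i⟩

/-- Forgetting the new input; it is sent to `i`. -/
def collapse (i : ι) : Contract (∅ : Finset ι) → ι
  | .new => i
  | .old j => j

theorem wordForm_add (i : ι) (x y : Coop K c d) :
    wordForm i (x + y) = wordForm i x + wordForm i y :=
  word_ext fun w => by
    rw [LinearMap.add_apply, wordForm_word, wordForm_word, wordForm_word, val_add]

theorem wordForm_smul (i : ι) (r : K) (x : Coop K c d) : wordForm i (r • x) = r • wordForm i x :=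
  word_ext fun w => by
    rw [LinearMap.smul_apply, wordForm_word, wordForm_word, val_smul, smul_eq_mul]

/-- The functional on words with an additional letter that is supported on the words starting with
this letter. -/
def preForm (i : ι) (x : Coop K c d) : FreeAlgebra K (Contract (∅ : Finset ι)) →ₗ[K] K :=
  wordForm i x ∘ₗ (assocSubst fun o => .of (collapse i o)).toLinearMap ∘ₗ
    stripFirst .new ∘ₗ stripLast (oldE i)

open Classical in
/-- Adding a new first letter to the word form with base point `i` of an element of the cooperad.
This is defined to be zero if `i` is not a base point or if the new input has the wrong colour. -/
def pre (i : ι) (a : PairColor) : Coop K c d →ₗ[K] Coop K (color c ∅ a) d :=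
  if Based c d i ∧ a = .algebra then
    { toFun x := ofAssoc _ d (preForm i x)
      map_add' x y := obj_ext fun u hu => by
        rw [val_add, val_ofAssoc _ hu, val_ofAssoc _ hu, val_ofAssoc _ hu]
        simp only [preForm, wordForm_add, comp_apply, LinearMap.add_apply]
      map_smul' r x := obj_ext fun u hu => by
        rw [RingHom.id_apply, val_smul, val_ofAssoc _ hu, val_ofAssoc _ hu]
        simp only [preForm, wordForm_smul, comp_apply, LinearMap.smul_apply, smul_eq_mul] }
  else 0

theorem pre_of_not {a : PairColor} (h : ¬ (Based c d i ∧ a = .algebra))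
    (x : Coop K c d) : pre i a x = 0 := by
  rw [pre, if_neg h, LinearMap.zero_apply]

theorem val_pre (h : Based c d i) (x : Coop K c d)
    {u : FreeMagma (Contract (∅ : Finset ι))} (hu : Adm (color c ∅ .algebra) d u) :
    val (pre i .algebra x) u = preForm i x (assoc K u) := by
  rw [pre, if_pos ⟨h, rfl⟩]
  exact val_ofAssoc _ hu

theorem Based.nonempty_gen (h : Based c d i) : Nonempty (PairGen .algebra d d) := by
  cases d
  · exact ⟨.product⟩
  · exact ⟨.action⟩

theorem adm_new_mul {s : FreeMagma ι} (hs : Adm c d s) :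
    Adm (color c ∅ .algebra) d (.of .new * rename oldE s) := by
  refine ⟨⟨.algebra, d, ?_, rfl, hasColor_rename.2 hs.1⟩, ?_⟩
  · cases d
    · exact ⟨.product⟩
    · exact ⟨.action⟩
  · rw [IsML, labels_mul, labels_of, labels_rename, Multiset.singleton_add, Multiset.nodup_cons]
    refine ⟨⟨by simp, hs.2.1.map fun i j h => by simpa using h⟩, fun o => ?_⟩
    cases o with
    | new => simp
    | old k => exact Multiset.mem_cons_of_mem (Multiset.mem_map.2 ⟨k, hs.2.2 k, rfl⟩)

theorem adm_of_new_mul {a : PairColor} {s : FreeMagma ι}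
    (h : Adm (color c ∅ a) d (.of .new * rename oldE s)) (hc : ∃ i, Based c d i) : Adm c d s := by
  obtain ⟨⟨a', e, ⟨g⟩, h₁, h₂⟩, h₃⟩ := h
  rw [IsML, labels_mul, labels_of, labels_rename, Multiset.singleton_add, Multiset.nodup_cons] at h₃
  have hml : IsML s := by
    refine ⟨h₃.1.2.of_map _, fun i => ?_⟩
    obtain ⟨j, hj, hji⟩ : ∃ j ∈ labels s, oldE j = oldE i := by
      simpa using h₃.2 (oldE i)
    obtain rfl : j = i := by simpa using hji
    exact hj
  have h₂' : HasColor c s e :=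
    (hasColor_rename (f := oldE) (c := color c ∅ a)).1 h₂
  obtain ⟨i, hi⟩ := hc
  obtain ⟨j, -, hj, hj'⟩ := h₂'.exists_based
  have : e = d := by
    by_cases hij : j = i
    · rw [← hj, hij, hi.1]
    · rw [← hj, hi.2 j hij, ← hi.1, hj' i (hml.2 i) (Ne.symm hij)]
  exact ⟨this ▸ h₂', hml⟩

theorem val_pre_new_mul (h : Based c d i) (x : Coop K c d) (s : FreeMagma ι) :
    val (pre i .algebra x) (.of .new * rename oldE s) = val x s := by
  by_cases hs : Adm c d s
  swap
  · rw [val_of_not_adm _ hs, val_of_not_adm _ fun h' => hs (adm_of_new_mul h' ⟨i, h⟩)]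
  rw [val_pre h x (adm_new_mul hs), val_eq_wordForm h x hs, preForm, comp_apply]
  congr 1
  rw [comp_apply, comp_apply, assoc_mul, assoc_of, map_sub, stripLast_mul_assoc,
    stripLast_mul_ι_of_ne (by simp), sub_zero, stripFirst_ι_self_mul, assoc_subst,
    stripLast_assocSubst (i := oldE i) (j := i) _ (fun j hj => by simpa using fun h => hj h.symm),
    assoc_of, stripLast_ι_self, mul_one, AlgHom.toLinearMap_apply, assocSubst_assocSubst]
  exact assocSubst_of _

theorem val_pre_mul_eq_zero {a : PairColor} (x : Coop K c d)
    {t s : FreeMagma (Contract (∅ : Finset ι))} (hn : .new ∉ labels t) (hi : oldE i ∉ labels t) :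
    val (pre i a x) (t * s) = 0 := by
  by_cases hb : Based c d i ∧ a = .algebra
  swap
  · rw [pre_of_not hb]; exact map_zero (valAt (t * s))
  obtain ⟨hb, rfl⟩ := hb
  by_cases hu : Adm (color c ∅ .algebra) d (t * s)
  swap
  · exact val_of_not_adm _ hu
  rw [val_pre hb x hu, preForm, comp_apply, comp_apply, comp_apply,
    assoc_mul, map_sub, stripLast_mul_assoc, stripLast_mul_assoc, stripLast_assoc_eq_zero hi,
    mul_zero, sub_zero, stripFirst_assoc_mul, stripFirst_assoc_eq_zero hn, zero_mul, map_zero,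
    map_zero]

theorem Based.oldE (h : Based c d i) : Based (color c ∅ .algebra) d (oldE i) :=
  ⟨h.1, fun o ho => by
    cases o with
    | new => rfl
    | old j => exact h.2 j fun hj => ho (congrArg old (Subtype.ext hj))⟩

theorem two_le_card_contract_empty [Nonempty ι] : 2 ≤ Fintype.card (Contract (∅ : Finset ι)) :=
  Cobar.two_le_card_contract (by rw [Finset.card_empty]; exact Fintype.card_pos)

theorem exists_rename_oldE {u : FreeMagma (Contract (∅ : Finset ι))} (h : .new ∉ labels u) :
    ∃ s, rename ColoredKoszul.oldE s = u :=
  exists_rename_eq _ fun o ho => by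
    cases o with
    | new => exact absurd ho h
    | old j => exact ⟨j, rfl⟩

theorem based_iff {ι' : Type} {σ : ι ≃ ι'} {c' : ι' → PairColor} (h : ∀ i, c i = c' (σ i)) :
    Based c' d (σ i) ↔ Based c d i := by
  rw [Based, Based, h]
  refine and_congr_right fun _ => ⟨fun h' j hj => ?_, fun h' j hj => ?_⟩
  · rw [h]; exact h' _ (σ.injective.ne hj)
  · have := h' (σ.symm j) fun hj' => hj (by rw [← hj', σ.apply_symm_apply])
    rwa [h, σ.apply_symm_apply] at this

/-- Adding a first letter is compatible with bijections of the inputs. -/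
theorem val_pre_pull₀ {ι' : Type} [Fintype ι'] [LinearOrder ι'] {c' : ι' → PairColor} (σ : ι ≃ ι')
    (h : ∀ i, c i = c' (σ i)) (a : PairColor) (x : Coop K c' d)
    (u : FreeMagma (Contract (∅ : Finset ι))) : val (pre i a (pull₀ σ h d x)) u =
      val (pre (σ i) a x) (rename (Contract.congr σ (J' := ∅) (by simp)) u) := by
  have hcol := Contract.color_congr (J := ∅) (J' := ∅) σ (by simp) h a
  rw [← val_pull₀ _ hcol]
  congr 1
  by_cases hb : Based c d i ∧ a = .algebra
  swap
  · rw [pre_of_not hb, pre_of_not (by rwa [based_iff h]), map_zero]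
  obtain ⟨hb, rfl⟩ := hb
  haveI : Nonempty ι := ⟨i⟩
  rw [← sub_eq_zero]
  refine eq_zero_of_val_comb hb.oldE two_le_card_contract_empty fun j w hw => ?_
  refine (map_sub (valAt _) _ _).trans (sub_eq_zero.2 ?_)
  rw [valAt_apply, valAt_apply, val_pull₀]
  have hnd := hw.2.1
  rw [labels_mul, labels_of, labels_comb, Multiset.singleton_add, Multiset.nodup_cons] at hnd
  cases j with
  | new =>
    obtain ⟨s, hs⟩ := exists_rename_oldE (by rw [labels_comb]; exact hnd.1)
    rw [← hs] at hw ⊢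
    rw [val_pre_new_mul hb, val_pull₀]
    have e : rename (Contract.congr σ (J := ∅) (J' := ∅) (by simp)) (.of .new * rename oldE s) =
        .of .new * rename ColoredKoszul.oldE (rename σ s) := by
      change FreeMagma.of _ * _ = _
      congr 1
      exact (subst_subst _ _ _).trans
        (subst_subst (fun i => .of (σ i)) (fun i => .of (ColoredKoszul.oldE i)) s).symm
    rw [e, val_pre_new_mul ((based_iff h).2 hb)]
  | old j =>
    have hji : (j : ι) ≠ i := by
      rintro rfl
      exact hnd.1 (Multiset.mem_cons_self _ _)
    rw [val_pre_mul_eq_zero _ (by simp) (by simpa using fun h => hji (congrArg Subtype.val h).symm)]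
    symm
    refine val_pre_mul_eq_zero _ ?_ ?_
    · rw [labels_subst]; simp [Contract.congr]
    · rw [labels_subst]
      simp only [labels_of, Multiset.singleton_bind, Multiset.mem_singleton, Contract.congr,
        Equiv.coe_fn_mk, Contract.old.injEq, Subtype.mk.injEq]
      exact fun h => hji (σ.injective h).symm

end Pre

open Finset

section PreDec

variable {ι : Type} [Fintype ι] [LinearOrder ι] {c : ι → PairColor} {d e : PairColor} {i : ι}
  {J : Finset ι}

/-- The input of the contraction of `J` that contains the input `i`. -/
def Contract.proj (J : Finset ι) (i : ι) : Contract J :=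
  if h : i ∈ J then .new else .old ⟨i, h⟩

theorem Contract.proj_of_mem (h : i ∈ J) : Contract.proj J i = .new := dif_pos h

theorem Contract.proj_of_notMem (h : i ∉ J) : Contract.proj J i = .old ⟨i, h⟩ := dif_neg h

theorem based_proj (h : Based c d i) {v : FreeMagma J} (hv : Adm (restrictColor c J) e v) :
    Based (color c J e) d (Contract.proj J i) := by
  obtain ⟨j, -, hj, hj'⟩ := hv.1.exists_based
  have hj' : ∀ k : J, k ≠ j → c k = .algebra := fun k hk => hj' k (hv.2.2 k) hk
  by_cases hi : i ∈ J
  · rw [Contract.proj_of_mem hi]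
    refine ⟨?_, fun o ho => ?_⟩
    · change e = d
      by_cases hji : (j : ι) = i
      · rw [← hj, ← h.1, ← hji]
      · rw [← hj, ← h.1, hj' ⟨i, hi⟩ fun h' => hji (congrArg Subtype.val h').symm]
        exact h.2 j hji
    · match o with
      | .old k => exact h.2 k fun hk => k.2 (hk ▸ hi)
  · rw [Contract.proj_of_notMem hi]
    refine ⟨h.1, fun o ho => ?_⟩
    match o with
    | .new => exact hj.symm.trans (h.2 j fun hji => hi (hji ▸ j.2))
    | .old k => exact h.2 k fun hk => ho (congrArg old (Subtype.ext hk))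

variable {J₂ : Finset (Contract (∅ : Finset ι))} (hnew : new ∉ J₂)
  (hold : ∀ i, old i ∈ J₂ ↔ (i : ι) ∈ J)

/-- Contracting a set of old inputs and adding a new input commute. -/
abbrev emptyRoot : Contract J₂ ≃ Contract (∅ : Finset (Contract J)) :=
  disjointRoot hnew hold (notMem_empty _) fun i => by simp

/-- The inputs contracted after a new input has been added. -/
abbrev emptyTop : J₂ ≃ J := disjointTop hnew hold (disjoint_empty_left J)

theorem emptyRoot_color (a : PairColor) (o : Contract J₂) : color (color c ∅ a) J₂ e o =
      color (color c J e) ∅ a (emptyRoot hnew hold o) :=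
  disjointRoot_color hnew hold _ _ o

theorem emptyTop_color (a : PairColor) (o : J₂) : restrictColor (color c ∅ a) J₂ o =
    restrictColor c J (emptyTop hnew hold o) :=
  disjointTop_color hnew hold _ o

theorem graftAt_emptyRoot (s : FreeMagma (Contract J)) (v : FreeMagma J₂) :
    graftAt (rename (emptyRoot hnew hold).symm (rename oldE s)) v =
      rename oldE (graftAt s (rename (emptyTop hnew hold) v)) := by
  refine (subst_subst _ _ _).trans ((subst_subst _ _ _).trans (Eq.trans ?_ (subst_subst _ _ _).symm))
  congr 1
  funext o
  match o with
  | .old i => rfl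
  | .new =>
    refine Eq.trans ?_ ((subst_subst _ _ _).trans (subst_subst _ _ _)).symm
    change subst _ v = _
    congr 1
    funext o
    match o with
    | ⟨.old i, h⟩ => rfl
    | ⟨.new, h⟩ => exact absurd h hnew

/-- Adding a first letter commutes with the partial cocompositions that do not involve it. -/
theorem dec_pre (h : Based c d i) (x : Coop K c d) :
    dec (color c ∅ .algebra) J₂ d e (pre i .algebra x) = TensorProduct.map
        (pull₀ (emptyRoot hnew hold) (emptyRoot_color hnew hold .algebra) d ∘ₗ
          pre (Contract.proj J i) .algebra)
        (pull₀ (emptyTop hnew hold) (emptyTop_color hnew hold .algebra) e) (dec c J d e x) := by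
  have tc := emptyTop_color (c := c) hnew hold .algebra
  have rc := emptyRoot_color (c := c) (e := e) hnew hold .algebra
  by_cases hv₀ : ∃ v, Adm (restrictColor (color c ∅ .algebra) J₂) e v
  swap
  · exact tensor_ext_val fun u v hu hv => absurd ⟨v, hv⟩ hv₀
  obtain ⟨v₀, hv₀⟩ := hv₀
  set i' := Contract.proj J i with hi'
  have hb : Based (color c J e) d i' :=
    based_proj h ((adm_rename_iff (emptyTop hnew hold) tc).2 hv₀)
  set er := emptyRoot hnew hold with her
  set k₀ := er.symm (oldE i') with hk₀
  have hb' : Based (color (color c ∅ .algebra) J₂ e) d k₀ := by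
    refine (based_iff rc).1 ?_
    rw [hk₀, Equiv.apply_symm_apply]
    exact hb.oldE
  have hcard : 2 ≤ Fintype.card (Contract J₂) :=
    Cobar.two_le_card_contract (card_lt_univ_of_notMem hnew)
  rw [← sub_eq_zero]
  refine tensor_ext
    (fun p : {p : Contract J₂ × List (Contract J₂) // Adm (color
      (color c ∅ .algebra) J₂ e) d (.of p.1 * comb k₀ p.2)} =>
        valAt (.of p.1.1 * comb k₀ p.1.2))
    (fun v : {v // Adm (restrictColor (color c ∅ .algebra) J₂) e v} => valAt v.1)
    (fun y hy => eq_zero_of_val_comb hb' hcard fun j w hw =>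
      (valAt_apply _ _).symm.trans (hy ⟨(j, w), hw⟩))
    (fun z hz => eq_zero_of_val fun v hv => hz ⟨v, hv⟩) ?_
  rintro ⟨⟨j, w⟩, hu⟩ ⟨v, hv⟩
  refine (map_sub (valAt₂ _ _) _ _).trans (sub_eq_zero.2 ?_)
  rw [valAt₂_dec _ hu hv]
  have hnd := hu.2.1
  rw [labels_mul, labels_of, labels_comb, Multiset.singleton_add, Multiset.nodup_cons] at hnd
  change val _ (graftAt (.of j) v * graftAt (comb _ w) v) = _
  -- The extension is supported on words whose first letter is the new input. At such words both sides are
  -- the value of `x` at the rest of the tree; at all other words both sides vanish.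
  by_cases hj : j = .old ⟨.new, hnew⟩
  · subst hj
    obtain ⟨s, hs⟩ : ∃ s, rename ColoredKoszul.oldE s = rename er (comb k₀ w) := by
      refine exists_rename_oldE ?_
      rw [labels_rename, labels_comb]
      intro hm
      obtain ⟨o, ho, ho'⟩ := Multiset.mem_map.1 hm
      have : o = .old ⟨.new, hnew⟩ := er.injective ho'
      exact hnd.1 (this ▸ ho)
    have hs' : comb k₀ w = rename er.symm (rename ColoredKoszul.oldE s) := by
      rw [hs]
      refine Eq.trans ?_ (subst_subst _ _ _).symm
      simp only [subst_of, Equiv.symm_apply_apply]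
      exact (subst_id _).symm
    have hru : rename er (.of (.old ⟨.new, hnew⟩) * comb k₀ w) =
        .of .new * rename ColoredKoszul.oldE s := congrArg (FreeMagma.of new * ·) hs.symm
    have hsA : Adm (color c J e) d s := by
      refine adm_of_new_mul (a := .algebra) ?_ ⟨i', hb⟩
      rw [← hru]
      exact (adm_rename_iff er rc).2 hu
    refine Eq.trans ?_ (valAt₂_map (u' := s) (v' := rename (emptyTop hnew hold) v)
      (fun y => ?_) (fun z => val_pull₀ _ _ _ _ _) _).symm
    · rw [hs', graftAt_emptyRoot]
      refine (val_pre_new_mul h x _).trans ?_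
      rw [valAt₂_dec _ hsA
        ((adm_rename_iff (emptyTop hnew hold) tc).2 hv)]
    · rw [comp_apply, val_pull₀, hru, val_pre_new_mul hb]
  · have hji : j ≠ k₀ := fun h' => hnd.1 (h' ▸ Multiset.mem_cons_self _ _)
    have hz : ∀ y : Coop K (color c J e) d,
        val ((pull₀ er (emptyRoot_color (c := c) (e := e) hnew hold .algebra) d ∘ₗ
          pre i' .algebra) y) (.of j * comb k₀ w) = 0 := by
      intro y
      rw [comp_apply, val_pull₀]
      refine val_pre_mul_eq_zero _ ?_ ?_
      · simp only [subst_of, labels_of, Multiset.mem_singleton]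
        exact fun h' => hj (er.injective h'.symm)
      · simp only [subst_of, labels_of, Multiset.mem_singleton]
        exact fun h' => hji (er.injective (by rw [hk₀, Equiv.apply_symm_apply, h']))
    rw [val_pre_mul_eq_zero]
    · symm
      generalize dec c J d e x = τ
      induction τ with
      | zero => rw [map_zero, map_zero]
      | add τ τ' h₁ h₂ => rw [map_add, map_add, h₁, h₂, add_zero]
      | tmul y z => rw [TensorProduct.map_tmul, valAt₂_tmul, hz, zero_mul]
    · match j with
      | .new =>
        refine fun h' => ?_
        change _ ∈ labels (rename Subtype.val v) at h'
        rw [labels_rename] at h'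
        obtain ⟨o, -, ho⟩ := Multiset.mem_map.1 h'
        exact hnew (ho ▸ o.2)
      | .old ⟨.old k, hk⟩ => exact fun h' => by simpa [graftAt] using h'
      | .old ⟨.new, hk⟩ => exact absurd rfl hj
    · match j with
      | .new =>
        refine fun h' => ?_
        change _ ∈ labels (rename Subtype.val v) at h'
        rw [labels_rename] at h'
        obtain ⟨o, -, ho⟩ := Multiset.mem_map.1 h'
        have hiJ : i ∈ J := (hold _).1 (ho ▸ o.2)
        refine hji (er.injective ?_)
        rw [hk₀, Equiv.apply_symm_apply, hi', Contract.proj_of_mem hiJ]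
        rfl
      | .old ⟨.old k, hk⟩ =>
        refine fun h' => hji (er.injective ?_)
        have hki : k = ⟨i, notMem_empty i⟩ := by
          have : oldE i = old k := by simpa [graftAt] using h'
          exact (Contract.old.inj this).symm
        subst hki
        have hiJ : i ∉ J := fun hi => hk ((hold _).2 hi)
        rw [hk₀, Equiv.apply_symm_apply, hi', Contract.proj_of_notMem hiJ]
        rfl
      | .old ⟨.new, hk⟩ => exact absurd rfl hj

/-- The new first letter is not separated from all the others by a partial cocomposition that leaves
them with the base point. -/
theorem dec_pre_eq_zero {a : PairColor} (hnew : new ∈ J₂) (hi : oldE i ∈ J₂)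
    (hcard : J₂.card < Fintype.card (Contract (∅ : Finset ι))) (x : Coop K c d) :
    dec (color c ∅ a) J₂ d e (pre i a x) = 0 := by
  by_cases h : Based c d i ∧ a = .algebra
  swap
  · rw [pre_of_not h, map_zero]
  obtain ⟨h, rfl⟩ := h
  by_cases hv₀ : ∃ v, Adm (restrictColor (color c ∅ .algebra) J₂) e v
  swap
  · exact tensor_ext_val fun u v hu hv => absurd ⟨v, hv⟩ hv₀
  obtain ⟨v₀, hv₀⟩ := hv₀
  have hb : Based (color (color c ∅ .algebra) J₂ e) d .new := by
    have := based_proj h.oldE hv₀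
    rwa [Contract.proj_of_mem hi] at this
  refine tensor_ext
    (fun p : {p : Contract J₂ × List (Contract J₂) // Adm (color
      (color c ∅ .algebra) J₂ e) d (.of p.1 * comb .new p.2)} =>
        valAt (.of p.1.1 * comb .new p.1.2))
    (fun v : {v // Adm (restrictColor (color c ∅ .algebra) J₂) e v} => valAt v.1)
    (fun y hy => eq_zero_of_val_comb hb (Cobar.two_le_card_contract hcard) fun j w hw =>
      (valAt_apply _ _).symm.trans (hy ⟨(j, w), hw⟩))
    (fun z hz => eq_zero_of_val fun v hv => hz ⟨v, hv⟩) ?_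
  rintro ⟨⟨j, w⟩, hu⟩ ⟨v, hv⟩
  refine (valAt₂_dec _ hu hv).trans ?_
  have hnd := hu.2.1
  rw [labels_mul, labels_of, labels_comb, Multiset.singleton_add, Multiset.nodup_cons] at hnd
  match j with
  | .new => exact absurd (Multiset.mem_cons_self _ _) hnd.1
  | .old ⟨k, hk⟩ =>
    change val _ (.of k * graftAt (comb _ w) v) = _
    refine val_pre_mul_eq_zero _ ?_ ?_ <;> rw [labels_of, Multiset.mem_singleton]
    · exact fun h' => hk (h' ▸ hnew)
    · exact fun h' => hk (h' ▸ hi)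

end PreDec

open Finset

section PreSum

variable {ι : Type} [Fintype ι] [LinearOrder ι] {c : ι → PairColor} {d : PairColor} {i : ι}

/-- The input `j` is regarded as an input added to all the others. -/
def insertEquiv (j : ι) : ι ≃ Contract (∅ : Finset {k // k ≠ j}) where
  toFun k := if h : k = j then .new else oldE ⟨k, h⟩
  invFun o := match o with
    | .new => j
    | .old k => k.1
  left_inv k := by
    by_cases h : k = j
    · subst h; simp
    · simp [h]
  right_inv o := by
    match o with
    | .new => exact dif_pos rfl
    | .old ⟨k, _⟩ => exact dif_neg k.2

theorem insertEquiv_self (j : ι) : insertEquiv j j = .new := dif_pos rfl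

theorem insertEquiv_of_ne {j k : ι} (h : k ≠ j) : insertEquiv j k = oldE ⟨k, h⟩ := dif_neg h

theorem insertEquiv_color (h : Based c d i) {j : ι} (hj : j ≠ i) (k : ι) :
    c k = color (fun k : {k // k ≠ j} => c k) ∅ .algebra (insertEquiv j k) := by
  by_cases hk : k = j
  · subst hk
    rw [insertEquiv_self]
    exact h.2 k hj
  · rw [insertEquiv_of_ne hk]
    rfl

/-- The partial value of an element of the cooperad at a bracket with a given first input. -/
theorem exists_val_of_mul (h : Based c d i) {j : ι} (hj : j ≠ i) (x : Coop K c d) :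
    ∃ z : Coop K (fun k : {k // k ≠ j} => c k) d, ∀ s,
      Adm (fun k : {k // k ≠ j} => c k) d s → val z s = val x (.of j * rename Subtype.val s) := by
  obtain ⟨φ, hφ⟩ := exists_val_eq x
  refine ⟨ofAssoc _ d (φ ∘ₗ (LinearMap.mulLeft K (FreeAlgebra.ι K j) -
    LinearMap.mulRight K (FreeAlgebra.ι K j)) ∘ₗ
      (assocSubst fun k : {k // k ≠ j} => .of (k : ι)).toLinearMap), fun s hs => ?_⟩
  have hu : Adm c d (.of j * rename Subtype.val s) := by
    refine ⟨⟨.algebra, d, h.nonempty_gen, h.2 j hj, hasColor_rename.2 hs.1⟩, ?_⟩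
    rw [IsML, labels_mul, labels_of, labels_rename, Multiset.singleton_add, Multiset.nodup_cons]
    refine ⟨⟨fun hm => ?_, hs.2.1.map Subtype.val_injective⟩, fun k => ?_⟩
    · obtain ⟨k, -, hk⟩ := Multiset.mem_map.1 hm
      exact k.2 hk
    · by_cases hk : k = j
      · rw [hk]; exact Multiset.mem_cons_self _ _
      · exact Multiset.mem_cons_of_mem (Multiset.mem_map.2 ⟨⟨k, hk⟩, hs.2.2 _, rfl⟩)
  rw [val_ofAssoc _ hs, hφ _ hu]
  simp only [comp_apply, assoc_mul, assoc_of, LinearMap.sub_apply,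
    LinearMap.mulLeft_apply, LinearMap.mulRight_apply, AlgHom.toLinearMap_apply]
  rw [assoc_subst]

/-- An element of the cooperad is the sum, over the possible first letters of words, of elements
obtained by adding this letter. -/
theorem exists_eq_sum_pre (h : Based c d i) (hι : 2 ≤ Fintype.card ι) (x : Coop K c d) :
    ∃ z : ∀ j : {j // j ≠ i}, Coop K (fun k : {k // k ≠ j.1} => c k) d,
      x = ∑ j : {j // j ≠ i}, pull₀ (insertEquiv j.1) (insertEquiv_color h j.2) d
        (pre ⟨i, j.2.symm⟩ .algebra (z j)) := by
  choose z hz using fun j : {j // j ≠ i} => exists_val_of_mul h j.2 x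
  have hb : ∀ j : {j // j ≠ i}, Based (fun k : {k // k ≠ j.1} => c k) d ⟨i, j.2.symm⟩ := fun j =>
    ⟨h.1, fun k hk => h.2 k fun hk' => hk (Subtype.ext hk')⟩
  refine ⟨z, ?_⟩
  rw [← sub_eq_zero]
  refine eq_zero_of_val_comb h hι fun k w hu => ?_
  have hnd := hu.2.1
  rw [labels_mul, labels_of, labels_comb, Multiset.singleton_add, Multiset.nodup_cons] at hnd
  have hki : k ≠ i := fun hk => hnd.1 (hk ▸ Multiset.mem_cons_self _ _)
  -- At a word with first letter `k` only the summand of `k` contributes.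
  rw [← valAt_apply, map_sub, map_sum, sub_eq_zero, Finset.sum_eq_single ⟨k, hki⟩]
  · rw [valAt_apply, valAt_apply, val_pull₀]
    obtain ⟨s, hs⟩ : ∃ s : FreeMagma {l // l ≠ k}, rename Subtype.val s = comb i w :=
      exists_rename_eq _ fun l hl => ⟨⟨l, by
        rintro rfl
        rw [labels_comb] at hl
        exact hnd.1 hl⟩, rfl⟩
    have hu' : rename (insertEquiv k) (.of k * comb i w) = .of .new * rename oldE s := by
      change FreeMagma.of _ * _ = _
      rw [insertEquiv_self, ← hs]
      refine congrArg (FreeMagma.of new * ·) ((subst_subst _ _ _).trans ?_)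
      refine congrArg (subst · s) (funext fun l => ?_)
      exact congrArg FreeMagma.of (insertEquiv_of_ne l.2)
    have hA := (adm_rename_iff (insertEquiv k) (insertEquiv_color h hki)).2 hu
    rw [hu'] at hA
    change _ = val _ (rename (insertEquiv k) (.of k * comb i w))
    rw [hu', val_pre_new_mul (hb ⟨k, hki⟩), hz ⟨k, hki⟩ s (adm_of_new_mul hA ⟨_, hb ⟨k, hki⟩⟩), hs]
  · intro j _ hj
    have hkj : k ≠ j.1 := fun h' => hj (Subtype.ext h'.symm)
    rw [valAt_apply, val_pull₀]
    change val _ (rename (insertEquiv j.1) (.of k) * rename (insertEquiv j.1) (comb i w)) = 0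
    refine val_pre_mul_eq_zero _ ?_ ?_ <;>
      simp only [subst_of, labels_of, Multiset.mem_singleton, insertEquiv_of_ne hkj]
    · simp
    · intro h'
      simp only [Contract.old.injEq, Subtype.mk.injEq] at h'
      exact hki h'.symm
  · exact fun h' => absurd (mem_univ _) h'

end PreSum

end

namespace Cobar

open CobarTree Finset QuadraticData

section

/-! ### Adding a branch in front of the root -/

section Prefix

variable {ι : Type} [Fintype ι] [LinearOrder ι] {c : ι → PairColor}

/-- The signs of a construction that is graded symmetric in the shifted degrees of the branches. -/
theorem rootSign_smul_perm {V : Type*} [AddCommGroup V] {ι' : Type} [Fintype ι'] [LinearOrder ι']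
    (σ : ι ≃ ι') {c' : ι' → PairColor} (ts : Branches K b c') {v v' : V}
    (h : v' = koszulSign σ (pars ts) • v) :
    rootSign (pars (c := c' ∘ σ) fun i => ts (σ i)) • (koszulSign σ fun _ => 1) • v' =
      koszulSign σ (fun i => (ts i).deg) • rootSign (pars ts) • v := by
  have h₂ := rootSign_perm σ (pars ts)
  have h₃ : (fun k => pars ts k - 1) = fun k => (ts k).deg := by funext k; simp [pars]
  rw [h₃] at h₂
  rw [h, smul_smul, smul_smul, smul_smul, mul_assoc]
  refine congrArg (· • v) ?_
  have h₄ : ∀ a b c e f : ℤˣ, a * b * c = e * f → c * (b * e) = a * f := by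
    intro a b c e f h
    calc c * (b * e) = (a * a) * (b * c * e) := by rw [Int.units_mul_self, one_mul]; ac_rfl
      _ = a * e * (a * b * c) := by ac_rfl
      _ = (e * e) * (a * f) := by rw [h]; ac_rfl
      _ = _ := by rw [Int.units_mul_self, one_mul]
  exact h₄ _ _ _ _ _ h₂

/-- The tree obtained from a tree with root `x` and branches `ts` by adding the branch `T` in
front, where the base point of the word form is the input `i`. -/
def prefixed (T : CTree K b a) (i : ι) (ts : Branches K b c) (d : PairColor) :
    Coop K c d →ₗ[K] CAlg K b d :=
  haveI : Nonempty ι := ⟨i⟩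
  ndLin two_le_card_contract_empty (contractBranches T ts) d ∘ₗ pre i a

theorem prefixed_apply [Nonempty ι] (T : CTree K b a) (i : ι) (ts : Branches K b c)
    (x : Coop K c d) : prefixed T i ts d x =
      nd two_le_card_contract_empty (pre i a x) (contractBranches T ts) := rfl

theorem koszulSign_congr_empty {ι' : Type} [Fintype ι'] [LinearOrder ι'] (σ : ι ≃ ι') (N : ι' → ℤ)
    (ν : ℤ) : koszulSign (Contract.congr σ (J := ∅) (J' := ∅) (by simp)) (color N ∅ ν) =
      koszulSign σ N := by
  rw [koszulSign_congr, koszulSign_eq]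
  simp

theorem prefixed_perm {ι' : Type} [Fintype ι'] [LinearOrder ι'] (σ : ι ≃ ι') {c' : ι' → PairColor}
    (T : CTree K b a) (i : ι) (ts : Branches K b c') (x : Coop K c' d) :
    prefixed (c := c' ∘ σ) T i (fun i => ts (σ i)) d (pull₀ σ (fun _ => rfl) d x) =
      koszulSign σ (pars ts) • prefixed T (σ i) ts d x := by
  have : Nonempty ι := ⟨i⟩
  have : Nonempty ι' := ⟨σ i⟩
  rw [prefixed_apply, prefixed_apply, nd_perm two_le_card_contract_empty two_le_card_contract_empty
    (Contract.congr σ (J := ∅) (J' := ∅) (by simp))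
    (Contract.color_congr (c := c' ∘ σ) σ (by simp) (fun _ => rfl) a)
    (fun u _ => val_pre_pull₀ σ (fun _ => rfl) a x u) (ts' := contractBranches T ts)
    (fun o => by cases o <;> rfl), pars_contractBranches, koszulSign_congr_empty]

theorem exists_nd_update (hι : 2 ≤ Fintype.card ι) (x : Coop K c d)
    (ts : Branches K b c) (i : ι) (n : ℤ) : ∃ G : CAlg K b (c i) →ₗ[K] CAlg K b d,
      ∀ t, t.deg = n → nd hι x (update ts i t) = G (mk t) :=
  ⟨rootSign (update (pars ts) i (n + 1)) • plug hι x ts i, fun t ht => by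
    rw [nd, pars_update, ht]
    exact congrArg _ (plug_mk _ _ _ _ _).symm⟩

theorem exists_prefixed_update (T : CTree K b a) (i : ι) (ts : Branches K b c)
    (x : Coop K c d) (j : ι) (n : ℤ) : ∃ G : CAlg K b (c j) →ₗ[K] CAlg K b d,
      ∀ t, t.deg = n → prefixed T i (update ts j t) d x = G (mk t) := by
  have : Nonempty ι := ⟨i⟩
  obtain ⟨G, hG⟩ := exists_nd_update (two_le_card_contract_empty) (pre i a x)
    (contractBranches T ts) (oldE j) n
  refine ⟨G, fun t ht => ?_⟩
  rw [prefixed_apply, contractBranches_update_of_notMem (notMem_empty j)]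
  exact hG t ht

theorem exists_prefixed (i : ι) (ts : Branches K b c) (x : Coop K c d) (n : ℤ) :
    ∃ G : CAlg K b a →ₗ[K] CAlg K b d, ∀ T, T.deg = n → prefixed T i ts d x = G (mk T) := by
  have : Nonempty ι := ⟨i⟩
  by_cases h : Nonempty (CTree K b a)
  swap
  · exact ⟨0, fun T => absurd ⟨T⟩ h⟩
  obtain ⟨T₀⟩ := h
  obtain ⟨G, hG⟩ := exists_nd_update (two_le_card_contract_empty) (pre i a x)
    (contractBranches T₀ ts) .new n
  refine ⟨G, fun T hT => ?_⟩
  rw [prefixed_apply, ← update_contractBranches T₀ T]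
  exact hG T hT

end Prefix

section PrefixHom

variable (k₀ : κ)

open Classical in
/-- Adding the branch `T` in front of the root of a tree; the base point of the root is the
input whose branch contains the leaf `k₀`. -/
def treePrefix (T : CTree K b a) : ∀ {d : PairColor}, CTree K b d → CAlg K b d
  | _, leaf _ => 0
  | _, node (d := d) _ x ts =>
    rootSign (pars ts) • ∑ i, if k₀ ∈ (ts i).leaves then prefixed T i ts d x else 0

variable {ι : Type} [Fintype ι] [LinearOrder ι] {c : ι → PairColor}

open Classical in
theorem treePrefix_node (T : CTree K b a) (hι : 2 ≤ Fintype.card ι) (x : Coop K c d)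
    (ts : Branches K b c) : treePrefix k₀ T (node hι x ts) =
      rootSign (pars ts) • ∑ i, if k₀ ∈ (ts i).leaves then prefixed T i ts d x else 0 := rfl

theorem exists_treePrefix_update (T : CTree K b a) (hι : 2 ≤ Fintype.card ι)
    (x : Coop K c d) (ts : Branches K b c) (j : ι) (n : ℤ) (m : Multiset κ) :
    ∃ G : CAlg K b (c j) →ₗ[K] CAlg K b d, ∀ t, t.deg = n → t.leaves = m →
      treePrefix k₀ T (node hι x (update ts j t)) = G (mk t) := by
  classical
  choose G hG using fun i => exists_prefixed_update T i ts x j n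
  refine ⟨rootSign (update (pars ts) j (n + 1)) • ∑ i,
    if k₀ ∈ update (fun i => (ts i).leaves) j m i then G i else 0, fun t ht hm => ?_⟩
  rw [treePrefix_node, pars_update, ht]
  refine congrArg _ ?_
  rw [LinearMap.sum_apply]
  refine sum_congr rfl fun i _ => ?_
  have : (update ts j t i).leaves = update (fun i => (ts i).leaves) j m i := by
    rw [← hm]
    exact Function.apply_update (fun i (t : CTree K b (c i)) => t.leaves) ts j t i
  rw [this]
  split
  · exact hG i t ht
  · rfl

/-- The linear extension of `treePrefix`. -/
def prefixHom (T : CTree K b a) (d : PairColor) : CAlg K b d →ₗ[K] CAlg K b d :=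
  liftTree (treePrefix k₀ T) fun _ hf => linearCombination_eq_zero (V := fun d => CAlg K b d)
    (treePrefix k₀ T)
    (fun hι c d x y ts => by
      rw [treePrefix_node, treePrefix_node, treePrefix_node, ← smul_add, ← sum_add_distrib]
      refine congrArg _ (sum_congr rfl fun i _ => ?_)
      split
      · exact map_add _ _ _
      · exact (add_zero (0 : CAlg K b d)).symm)
    (fun hι c d r x ts => by
      classical
      refine (congrArg (rootSign (pars ts) • ·) ?_).trans (smul_comm (rootSign (pars ts)) r
        (∑ i, if k₀ ∈ (ts i).leaves then prefixed T i ts d x else (0 : CAlg K b d)))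
      rw [smul_sum]
      refine sum_congr rfl fun i _ => ?_
      split
      · exact map_smul _ _ _
      · exact (smul_zero r).symm)
    (fun hι hι' σ c d x ts => by
      classical
      rw [treePrefix_node, treePrefix_node, koszulCoop_pull]
      have h := rootSign_smul_perm σ ts (v := ∑ i, if k₀ ∈ (ts i).leaves then
        prefixed T i ts d x else 0) (v' := ∑ i, if k₀ ∈ (ts (σ i)).leaves then
        prefixed (c := c ∘ σ) T i (fun i => ts (σ i)) d (pull₀ σ (fun _ => rfl) d x) else 0) (by
          rw [smul_sum, ← Equiv.sum_comp σ]
          refine sum_congr rfl fun i _ => ?_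
          split
          · exact prefixed_perm σ T i ts x
          · exact (smul_zero _).symm)
      refine Eq.trans (congrArg _ ?_) h
      rw [smul_sum]
      refine sum_congr rfl fun i _ => ?_
      split
      · exact map_units_smul _ _ _
      · exact (smul_zero _).symm)
    (fun hι c d x ts i n m => by
      obtain ⟨G, h⟩ := exists_treePrefix_update k₀ T hι x ts i n m
      exact ⟨G, 0, fun t ht hm => by rw [h t ht hm, LinearMap.zero_apply, add_zero]⟩) hf

theorem prefixHom_mk (T : CTree K b a) (t : CTree K b d) :
    prefixHom k₀ T d (mk t) = treePrefix k₀ T t := liftTree_mk _ _ t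

theorem exists_treePrefix (t : CTree K b d) (n : ℤ) : ∃ G : CAlg K b a →ₗ[K] CAlg K b d,
    ∀ T, T.deg = n → treePrefix k₀ T t = G (mk T) := by
  classical
  cases t with
  | leaf k => exact ⟨0, fun T _ => rfl⟩
  | @node ι _ _ hι c d x ts =>
    choose G hG using fun i => exists_prefixed (a := a) i ts x n
    refine ⟨rootSign (pars ts) • ∑ i, if k₀ ∈ (ts i).leaves then G i else 0, fun T hT => ?_⟩
    rw [treePrefix_node]
    refine congrArg _ ?_
    rw [LinearMap.sum_apply]
    refine sum_congr rfl fun i _ => ?_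
    split
    · exact hG i T hT
    · rfl

end PrefixHom

/-! ### Linear maps supported on trees with a binary root -/

section BinaryLift

variable {V : PairColor → Type*} [∀ d, AddCommGroup (V d)] [∀ d, Module K (V d)]
  (B : ∀ {a e : PairColor} (d : PairColor), CTree K b a → CTree K b e → V d)

/-- The graded symmetrisation of a function of two branches, in their shifted degrees. -/
def symmPair (d : PairColor) (s : CTree K b a) (t : CTree K b e) : V d :=
  B d s t - ((s.deg + 1) * (t.deg + 1)).negOnePow • B d t s

/-- The function on trees with a binary root determined by a function of two branches. -/
def treeBinary : ∀ {d : PairColor}, CTree K b d → V d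
  | _, leaf _ => 0
  | d, node _ x ts => rootSign (pars ts) • pairSum x fun i j => symmPair B d (ts i) (ts j)

variable {ι : Type} [Fintype ι] [LinearOrder ι] {c : ι → PairColor}

theorem treeBinary_node (hι : 2 ≤ Fintype.card ι) (x : Coop K c d)
    (ts : Branches K b c) : treeBinary B (node hι x ts) =
      rootSign (pars ts) • pairSum x fun i j => symmPair B d (ts i) (ts j) := rfl

theorem symmPair_swap (s : CTree K b a) (t : CTree K b e) : symmPair B d s t =
    -((s.deg + 1) * (t.deg + 1)).negOnePow • symmPair B d t s := by
  rw [symmPair, symmPair, smul_sub, smul_smul, mul_comm (t.deg + 1), neg_mul, Int.units_mul_self,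
    Units.neg_smul, Units.neg_smul, one_smul]
  abel

theorem pairSum_units_smul {V : Type*} [AddCommGroup V] [Module K V] (ε : ℤˣ)
    (x : Coop K c d) (B : ι → ι → V) : pairSum (ε • x) B = ε • pairSum x B := by
  rw [Units.smul_def, ← Int.cast_smul_eq_zsmul K, pairSum_smul, Int.cast_smul_eq_zsmul,
    ← Units.smul_def]

variable {B}

/-- Linear dependence of a function of two branches on each of them, for fixed degrees. -/
structure IsBranchLinear
    (B : ∀ {a e : PairColor} (d : PairColor), CTree K b a → CTree K b e → V d) : Prop where
  right : ∀ (a e d : PairColor) (s : CTree K b a) (n : ℤ), ∃ G : CAlg K b e →ₗ[K] V d,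
    ∀ t, t.deg = n → B d s t = G (mk t)
  left : ∀ (a e d : PairColor) (t : CTree K b e) (n : ℤ), ∃ G : CAlg K b a →ₗ[K] V d,
    ∀ s, s.deg = n → B d s t = G (mk s)

theorem IsBranchLinear.exists_symmPair (hB : IsBranchLinear B) (s : CTree K b a) (n : ℤ) :
    ∃ G : CAlg K b e →ₗ[K] V d, ∀ t, t.deg = n → symmPair B d s t = G (Cobar.mk t) := by
  obtain ⟨G, hG⟩ := hB.right a e d s n
  obtain ⟨H, hH⟩ := hB.left e a d s n
  refine ⟨G - ((s.deg + 1) * (n + 1)).negOnePow • H, fun t ht => ?_⟩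
  rw [symmPair, hG t ht, hH t ht, ht]
  rfl

theorem IsBranchLinear.exists_treeBinary_update (hB : IsBranchLinear B) (hι : 2 ≤ Fintype.card ι)
    (x : Coop K c d) (ts : Branches K b c) (i : ι) (n : ℤ) : ∃ G : CAlg K b (c i) →ₗ[K] V d,
      ∀ t, t.deg = n → treeBinary B (node hι x (update ts i t)) = G (Cobar.mk t) := by
  by_cases hc : Fintype.card ι = 2
  swap
  · exact ⟨0, fun t _ => by rw [treeBinary_node, pairSum_of_card_ne hc, smul_zero]; rfl⟩
  obtain ⟨p, q, hpq, hk⟩ := exists_lt_of_card_eq_two hc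
  have hs : ∀ (ε : ℤˣ) (r : K) (L : CAlg K b (c i) →ₗ[K] V d) (z : CAlg K b (c i)),
      (ε • r • L) z = ε • r • L z := fun _ _ _ _ => rfl
  rcases hk i with rfl | rfl
  · obtain ⟨G, hG⟩ := hB.exists_symmPair (d := d) (e := c i) (ts q) n
    refine ⟨rootSign (update (pars ts) i (n + 1)) • val x (.of i * .of q) •
      (-(((ts q).deg + 1) * (n + 1)).negOnePow • G), fun t ht => ?_⟩
    rw [treeBinary_node, pairSum_eq hpq hk, update_self, update_of_ne hpq.ne',
      symmPair_swap, hG t ht, pars_update, ht, mul_comm (n + 1)]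
    rfl
  · obtain ⟨G, hG⟩ := hB.exists_symmPair (d := d) (e := c i) (ts p) n
    refine ⟨rootSign (update (pars ts) i (n + 1)) • val x (.of p * .of i) • G,
      fun t ht => ?_⟩
    rw [treeBinary_node, pairSum_eq hpq hk, update_self, update_of_ne hpq.ne,
      hG t ht, pars_update, ht]
    rfl

/-- The linear map supported on trees with a binary root determined by a function of the two
branches. -/
def binaryHom (hB : IsBranchLinear B) (d : PairColor) : CAlg K b d →ₗ[K] V d :=
  liftTree (treeBinary B) fun _ hf => linearCombination_eq_zero (V := V) (treeBinary B)
    (fun hι c d x y ts => by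
      rw [treeBinary_node, treeBinary_node, treeBinary_node, pairSum_add, smul_add])
    (fun hι c d r x ts => by
      rw [treeBinary_node, treeBinary_node, pairSum_smul, smul_comm r])
    (fun hι hι' σ c d x ts => by
      rw [treeBinary_node, treeBinary_node, koszulCoop_pull]
      refine (congrArg _ (pairSum_units_smul _ _ _)).trans ?_
      exact rootSign_smul_perm σ ts (pairSum_perm σ x (fun i j => symmPair B d (ts i) (ts j))
        (pars ts) fun k l => symmPair_swap B _ _))
    (fun hι c d x ts i n m => by
      obtain ⟨G, h⟩ := hB.exists_treeBinary_update hι x ts i n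
      exact ⟨G, 0, fun t ht hm => by rw [h t ht, LinearMap.zero_apply, add_zero]⟩) hf

theorem binaryHom_nd (hB : IsBranchLinear B) (hι : 2 ≤ Fintype.card ι) (x : Coop K c d)
    (ts : Branches K b c) : binaryHom hB d (nd hι x ts) =
      pairSum x fun i j => symmPair B d (ts i) (ts j) := by
  rw [nd, map_units_smul, binaryHom, liftTree_mk, treeBinary_node, smul_smul, Int.units_mul_self,
    one_smul]

theorem binaryHom_mk (hB : IsBranchLinear B) (t : CTree K b d) :
    binaryHom hB d (mk t) = treeBinary B t := liftTree_mk _ _ t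

end BinaryLift

/-! ### The homotopy -/

/-- The identity if the two colours agree, and zero otherwise. -/
def castHom (K : Type u) [Field K] (b : κ → PairColor) (e d : PairColor) :
    CAlg K b e →ₗ[K] CAlg K b d :=
  if h : e = d then h ▸ LinearMap.id else 0

theorem castHom_self (z : CAlg K b d) : castHom K b d d z = z := by
  rw [castHom, dif_pos rfl]
  rfl

theorem castHom_of_ne (h : e ≠ d) (z : CAlg K b e) : castHom K b e d z = 0 := by
  rw [castHom, dif_neg h]
  rfl

theorem isBranchLinear_prefix (k₀ : κ) : IsBranchLinear (K := K) (b := b) (V := fun d => CAlg K b d)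
    fun {_ e} d s t => (s.deg + 1).negOnePow • castHom K b e d (treePrefix k₀ s t) where
  right a e d s n := ⟨(s.deg + 1).negOnePow • castHom K b e d ∘ₗ prefixHom k₀ s e, fun t _ =>
    congrArg (fun z => _ • castHom K b e d z) (prefixHom_mk k₀ s t).symm⟩
  left a e d t n := by
    obtain ⟨G, hG⟩ := exists_treePrefix (a := a) k₀ t n
    exact ⟨(n + 1).negOnePow • castHom K b e d ∘ₗ G, fun s hs => by rw [hG s hs, hs]; rfl⟩

/-- The contracting homotopy: a tree with a binary root is replaced by the tree obtained by adding the
branch not containing the leaf `k₀` in front of the root of the other branch. -/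
def homotopy (k₀ : κ) (d : PairColor) : CAlg K b d →ₗ[K] CAlg K b d :=
  binaryHom (isBranchLinear_prefix k₀) d

end

section

theorem units_smul_mem {V : Type*} [AddCommGroup V] [Module K V] {p : Submodule K V} (ε : ℤˣ) {v : V}
    (h : v ∈ p) : ε • v ∈ p := by
  rw [Units.smul_def]
  exact zsmul_mem h _

/-! ### The filtration by the length of the trunk -/

section Sums

variable {ι : Type} [Fintype ι] [LinearOrder ι] {J : Finset ι} {M : Type*} [AddCommMonoid M]

theorem sum_contract (f : Contract J → M) : ∑ o, f o = f .new + ∑ i : {i // i ∉ J}, f (.old i) := by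
  rw [← Equiv.sum_comp Contract.equivOption.symm, Fintype.sum_option]
  rfl

theorem sum_eq_add_sum_compl (J : Finset ι) (f : ι → M) :
    ∑ i, f i = ∑ j : J, f j + ∑ i : {i // i ∉ J}, f i := by
  rw [sum_coe_sort J f, ← sum_compl_add_sum J, add_comm]
  congr 1
  exact sum_subtype Jᶜ (fun i => by simp) _

end Sums

variable (k₀ : κ)

open Classical in
/-- The length of the trunk, that is, of the path from the root to the leaf `k₀`, where a vertex
with `m` inputs counts `m - 1`. -/
def trunk : ∀ {d : PairColor}, CTree K b d → ℕ
  | _, leaf _ => 0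
  | _, node (ι := ι) _ _ ts =>
    Fintype.card ι - 1 + ∑ i, if k₀ ∈ (ts i).leaves then trunk (ts i) else 0

section

variable {ι : Type} [Fintype ι] [LinearOrder ι] {c : ι → PairColor} {J : Finset ι}

open Classical in
/-- The contribution of a branch to the length of the trunk. -/
def branchTrunk (t : CTree K b d) : ℕ := if k₀ ∈ t.leaves then trunk k₀ t else 0

theorem branchTrunk_of_notMem {t : CTree K b d} (h : k₀ ∉ t.leaves) : branchTrunk k₀ t = 0 :=
  if_neg h

theorem branchTrunk_of_mem {t : CTree K b d} (h : k₀ ∈ t.leaves) :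
    branchTrunk k₀ t = trunk k₀ t := if_pos h

theorem branchTrunk_le (t : CTree K b d) : branchTrunk k₀ t ≤ trunk k₀ t := by
  rw [branchTrunk]; split <;> omega

variable (hι : 2 ≤ Fintype.card ι) (x : Coop K c d) (ts : Branches K b c)

theorem trunk_node :
    trunk k₀ (node hι x ts) = Fintype.card ι - 1 + ∑ i, branchTrunk k₀ (ts i) := rfl

theorem leaves_node : (node hι x ts).leaves = ∑ i, (ts i).leaves := rfl

theorem leaves_split (hJ : Splits J) (y : Coop K (color c J e) d)
    (z : Coop K (restrictColor c J) e) (ts : Branches K b c) :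
    (node (two_le_card_contract hJ.2) y (contractBranches (upper hJ z ts) ts)).leaves =
      ∑ i, (ts i).leaves := by
  rw [leaves_node, sum_contract, sum_eq_add_sum_compl J fun i => (ts i).leaves]
  rfl

theorem deg_split (hJ : Splits J) (y : Coop K (color c J e) d)
    (z : Coop K (restrictColor c J) e) (ts : Branches K b c) :
    (node (two_le_card_contract hJ.2) y (contractBranches (upper hJ z ts) ts)).deg =
      3 - Fintype.card ι + ∑ i, (ts i).deg := by
  rw [deg_node, sum_contract, sum_eq_add_sum_compl J fun i => (ts i).deg, card_contract]
  change _ + ((upper hJ z ts).deg + ∑ i : {i // i ∉ J}, (ts i).deg) = _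
  rw [deg_node, Fintype.card_coe]
  ring

theorem trunk_split (hJ : Splits J) (y : Coop K (color c J e) d)
    (z : Coop K (restrictColor c J) e) (ts : Branches K b c) :
    trunk k₀ (node (two_le_card_contract hJ.2) y (contractBranches (upper hJ z ts) ts)) ≤
      Fintype.card ι - 1 + ∑ i, branchTrunk k₀ (ts i) := by
  rw [trunk_node, sum_contract, sum_eq_add_sum_compl J fun i => branchTrunk k₀ (ts i)]
  change _ + (branchTrunk k₀ (upper hJ z ts) + ∑ i : {i // i ∉ J}, branchTrunk k₀ (ts i)) ≤ _
  have h := branchTrunk_le k₀ (upper hJ z ts)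
  rw [trunk_node, Fintype.card_coe] at h
  have h₁ := card_contract J
  have h₂ := hJ.1
  have h₃ := hJ.2
  omega

theorem trunk_split_lt (hJ : Splits J) (y : Coop K (color c J e) d)
    (z : Coop K (restrictColor c J) e) (ts : Branches K b c) (h : ∀ j ∈ J, k₀ ∉ (ts j).leaves) :
    trunk k₀ (node (two_le_card_contract hJ.2) y (contractBranches (upper hJ z ts) ts)) + 1 ≤
      Fintype.card ι - 1 + ∑ i, branchTrunk k₀ (ts i) := by
  rw [trunk_node, sum_contract, sum_eq_add_sum_compl J fun i => branchTrunk k₀ (ts i)]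
  change _ + (branchTrunk k₀ (upper hJ z ts) + ∑ i : {i // i ∉ J}, branchTrunk k₀ (ts i)) + 1 ≤ _
  have h : k₀ ∉ (upper hJ z ts).leaves := by
    rw [leaves_node, Multiset.mem_sum]
    rintro ⟨j, -, hj⟩
    exact h j j.2 hj
  rw [branchTrunk_of_notMem k₀ h]
  have h₁ := card_contract J
  have h₂ := hJ.1
  have h₃ := hJ.2
  omega

theorem sum_update_eq {M : Type*} [AddCommMonoid M] (F : ∀ {d}, CTree K b d → M)
    (ts : Branches K b c) (i : ι) (t : CTree K b (c i)) :
    ∑ j, F (update ts i t j) = F t + ∑ j ∈ univ.erase i, F (ts j) := by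
  rw [← add_sum_erase _ _ (mem_univ i), update_self]
  exact congrArg _ (sum_congr rfl fun j hj => by rw [update_of_ne (ne_of_mem_erase hj)])

end

/-- The span of the trees of degree `n` with leaves `S`. -/
def graded (K : Type u) [Field K] {κ : Type} (b : κ → PairColor) (d : PairColor) (S : Multiset κ)
    (n : ℤ) : Submodule K (CAlg K b d) := Submodule.span K (mk '' {t | t.leaves = S ∧ t.deg = n})

/-- The span of the trees of degree `n` with leaves `S` and trunk of length at most `m`. -/
def fil (K : Type u) [Field K] {κ : Type} (b : κ → PairColor) (d : PairColor) (k₀ : κ)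
    (S : Multiset κ) (n : ℤ) (m : ℕ) : Submodule K (CAlg K b d) :=
  Submodule.span K (mk '' {t | t.leaves = S ∧ t.deg = n ∧ trunk k₀ t ≤ m})

variable {k₀} {S : Multiset κ} {n : ℤ} {m : ℕ}

theorem mk_mem_graded {t : CTree K b d} (hS : t.leaves = S) (hn : t.deg = n) :
    mk t ∈ graded K b d S n := Submodule.subset_span ⟨t, ⟨hS, hn⟩, rfl⟩

theorem mk_mem_fil {t : CTree K b d} (hS : t.leaves = S) (hn : t.deg = n) (hm : trunk k₀ t ≤ m) :
    mk t ∈ fil K b d k₀ S n m := Submodule.subset_span ⟨t, ⟨hS, hn, hm⟩, rfl⟩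

theorem map_mem_of_graded {V : Type*} [AddCommGroup V] [Module K V] {F : CAlg K b d →ₗ[K] V}
    {p : Submodule K V} (h : ∀ t : CTree K b d, t.leaves = S → t.deg = n → F (mk t) ∈ p)
    {z : CAlg K b d} (hz : z ∈ graded K b d S n) : F z ∈ p := by
  have : graded K b d S n ≤ p.comap F := by
    refine Submodule.span_le.2 ?_
    rintro _ ⟨t, ht, rfl⟩
    exact h t ht.1 ht.2
  exact this hz

theorem map_mem_of_fil {V : Type*} [AddCommGroup V] [Module K V] {F : CAlg K b d →ₗ[K] V}
    {p : Submodule K V}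
    (h : ∀ t : CTree K b d, t.leaves = S → t.deg = n → trunk k₀ t ≤ m → F (mk t) ∈ p)
    {z : CAlg K b d} (hz : z ∈ fil K b d k₀ S n m) : F z ∈ p := by
  have : fil K b d k₀ S n m ≤ p.comap F := by
    refine Submodule.span_le.2 ?_
    rintro _ ⟨t, ht, rfl⟩
    exact h t ht.1 ht.2.1 ht.2.2
  exact this hz

theorem fil_mono {m' : ℕ} (h : m ≤ m') : fil K b d k₀ S n m ≤ fil K b d k₀ S n m' :=
  Submodule.span_mono (Set.image_mono fun _ ht => ⟨ht.1, ht.2.1, ht.2.2.trans h⟩)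

theorem fil_le_graded : fil K b d k₀ S n m ≤ graded K b d S n :=
  Submodule.span_mono (Set.image_mono fun _ ht => ⟨ht.1, ht.2.1⟩)

theorem exists_mem_fil (k₀ : κ) {z : CAlg K b d} (hz : z ∈ graded K b d S n) :
    ∃ m, z ∈ fil K b d k₀ S n m := by
  induction hz using Submodule.span_induction with
  | mem z h =>
    obtain ⟨t, ht, rfl⟩ := h
    exact ⟨_, mk_mem_fil ht.1 ht.2 le_rfl⟩
  | zero => exact ⟨0, zero_mem _⟩
  | add x y _ _ hx hy =>
    obtain ⟨m, hm⟩ := hx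
    obtain ⟨m', hm'⟩ := hy
    exact ⟨max m m', add_mem (fil_mono (le_max_left _ _) hm) (fil_mono (le_max_right _ _) hm')⟩
  | smul r x _ hx =>
    obtain ⟨m, hm⟩ := hx
    exact ⟨m, Submodule.smul_mem _ _ hm⟩

variable {ι : Type} [Fintype ι] [LinearOrder ι] {c : ι → PairColor} {J : Finset ι}

theorem splitN_mem (ts : Branches K b c) {p : Submodule K (CAlg K b d)}
    (h : ∀ (hJ : Splits J) (y : Coop K (color c J e) d) (z : Coop K (restrictColor c J) e),
      mk (node (two_le_card_contract hJ.2) y (contractBranches (upper hJ z ts) ts)) ∈ p)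
    (τ : Coop K (color c J e) d ⊗[K] Coop K (restrictColor c J) e) : splitN ts J d e τ ∈ p := by
  by_cases hJ : Splits J
  swap
  · rw [splitN_of_not _ hJ]; exact zero_mem _
  induction τ with
  | zero => rw [map_zero]; exact zero_mem _
  | add x y hx hy => rw [map_add]; exact add_mem hx hy
  | tmul y z =>
    rw [splitN_tmul _ hJ, nd]
    exact units_smul_mem _ (units_smul_mem _ (h hJ y z))

theorem splitN_mem_fil (ts : Branches K b c)
    (τ : Coop K (color c J e) d ⊗[K] Coop K (restrictColor c J) e) :
    splitN ts J d e τ ∈ fil K b d k₀ (∑ i, (ts i).leaves) (3 - Fintype.card ι + ∑ i, (ts i).deg)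
      (Fintype.card ι - 1 + ∑ i, branchTrunk k₀ (ts i)) :=
  splitN_mem ts (fun hJ y z => mk_mem_fil (leaves_split hJ y z ts) (deg_split hJ y z ts)
    (trunk_split k₀ hJ y z ts)) τ

/-- Splitting off branches that do not contain the leaf `k₀` shortens the trunk. -/
theorem splitN_mem_fil_of_notMem (ts : Branches K b c) (h : ∀ j ∈ J, k₀ ∉ (ts j).leaves)
    (hm : Fintype.card ι - 1 + ∑ i, branchTrunk k₀ (ts i) ≤ m + 1)
    (τ : Coop K (color c J e) d ⊗[K] Coop K (restrictColor c J) e) :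
    splitN ts J d e τ ∈ fil K b d k₀ (∑ i, (ts i).leaves)
      (3 - Fintype.card ι + ∑ i, (ts i).deg) m :=
  splitN_mem ts (fun hJ y z => mk_mem_fil (leaves_split hJ y z ts) (deg_split hJ y z ts) (by
    have := trunk_split_lt k₀ hJ y z ts h
    omega)) τ

theorem plug_mem_fil (hι : 2 ≤ Fintype.card ι) (x : Coop K c d)
    (ts : Branches K b c) (i : ι) {z : CAlg K b (c i)}
    (hz : z ∈ fil K b (c i) k₀ (ts i).leaves ((ts i).deg + 1) (trunk k₀ (ts i))) :
    plug hι x ts i z ∈ fil K b d k₀ (∑ i, (ts i).leaves) (3 - Fintype.card ι + ∑ i, (ts i).deg)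
      (Fintype.card ι - 1 + ∑ i, branchTrunk k₀ (ts i)) := by
  refine map_mem_of_fil (fun t h₁ h₂ h₃ => ?_) hz
  rw [plug_mk]
  refine mk_mem_fil ?_ ?_ ?_
  · rw [leaves_node, sum_update_eq CobarTree.leaves, h₁]
    exact add_sum_erase _ (fun j => (ts j).leaves) (mem_univ i)
  · rw [deg_node, sum_update_eq CobarTree.deg, h₂, ← add_sum_erase _ _ (mem_univ i)]
    ring
  · rw [trunk_node, sum_update_eq (branchTrunk k₀),
      ← add_sum_erase _ (fun j => branchTrunk k₀ (ts j)) (mem_univ i)]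
    have : branchTrunk k₀ t ≤ branchTrunk k₀ (ts i) := by
      rw [branchTrunk, branchTrunk, h₁]
      split
      · exact h₃
      · exact le_rfl
    omega

theorem treeD_mem_fil (t : CTree K b d) :
    treeD t ∈ fil K b d k₀ t.leaves (t.deg + 1) (trunk k₀ t) := by
  induction t with
  | leaf k => exact zero_mem _
  | @node ι _ _ hι c d x ts ih =>
    have hd : (node hι x ts).deg + 1 = 3 - Fintype.card ι + ∑ i, (ts i).deg := by
      rw [deg_node]; ring
    rw [treeD_node, rootPart_apply, hd]
    refine units_smul_mem _ (sub_mem (sum_mem fun J _ => sum_mem fun e _ =>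
      units_smul_mem _ (splitN_mem_fil ts _)) (sum_mem fun i _ => units_smul_mem _ ?_))
    rw [plugSucc_apply]
    exact units_smul_mem _ (plug_mem_fil hι x ts i (ih i))

theorem D_mem_fil {z : CAlg K b d} (hz : z ∈ fil K b d k₀ S n m) :
    D d z ∈ fil K b d k₀ S (n + 1) m :=
  map_mem_of_fil (fun t h₁ h₂ h₃ => by
    rw [D_mk, ← h₁, ← h₂]
    exact fil_mono h₃ (treeD_mem_fil t)) hz

theorem exists_mem_leaves (t : CTree K b d) : ∃ k, k ∈ t.leaves := by
  induction t with
  | leaf k => exact ⟨k, Multiset.mem_singleton_self k⟩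
  | @node ι _ _ hι c d x ts ih =>
    have : Nonempty ι := Fintype.card_pos_iff.1 (by omega)
    obtain ⟨i⟩ := this
    obtain ⟨k, hk⟩ := ih i
    exact ⟨k, Multiset.mem_sum.2 ⟨i, mem_univ i, hk⟩⟩

theorem D_mem_graded {z : CAlg K b d} (hz : z ∈ graded K b d S n) :
    D d z ∈ graded K b d S (n + 1) :=
  map_mem_of_graded (fun t h₁ h₂ => by
    obtain ⟨k₀, -⟩ := exists_mem_leaves t
    rw [← h₁, ← h₂, D_mk]
    exact fil_le_graded (treeD_mem_fil (k₀ := k₀) t)) hz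

theorem castHom_mem_fil {z : CAlg K b e} (hz : z ∈ fil K b e k₀ S n m) :
    castHom K b e d z ∈ fil K b d k₀ S n m := by
  by_cases h : e = d
  · subst h
    rwa [castHom_self]
  · rw [castHom_of_ne h]
    exact zero_mem _

theorem treePrefix_of_notMem (T : CTree K b a) {t : CTree K b d} (h : k₀ ∉ t.leaves) :
    treePrefix k₀ T t = 0 := by
  classical
  cases t with
  | leaf k => rfl
  | @node ι _ _ hι c d x ts =>
    rw [treePrefix_node, sum_eq_zero, smul_zero]
    intro i _
    rw [if_neg fun hi => h (Multiset.mem_sum.2 ⟨i, mem_univ i, hi⟩)]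

theorem card_contract_empty : Fintype.card (Contract (∅ : Finset ι)) = Fintype.card ι + 1 := by
  have := card_contract (∅ : Finset ι)
  rw [card_empty] at this
  omega

theorem sum_contract_empty {M : Type*} [AddCommMonoid M] (f : Contract (∅ : Finset ι) → M) :
    ∑ o, f o = f .new + ∑ i, f (oldE i) := by
  rw [sum_contract]
  refine congrArg _ (Fintype.sum_equiv (Equiv.subtypeUnivEquiv fun i => notMem_empty i) _ _ ?_)
  exact fun i => rfl

theorem prefixed_mem_fil {T : CTree K b a} (hT : k₀ ∉ T.leaves) (i : ι)
    (ts : Branches K b c) (x : Coop K c d) :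
    prefixed T i ts d x ∈ fil K b d k₀ (T.leaves + ∑ i, (ts i).leaves)
      (1 - Fintype.card ι + T.deg + ∑ i, (ts i).deg)
      (Fintype.card ι + ∑ i, branchTrunk k₀ (ts i)) := by
  have : Nonempty ι := ⟨i⟩
  rw [prefixed_apply]
  refine units_smul_mem _ (mk_mem_fil ?_ ?_ ?_)
  · rw [leaves_node, sum_contract_empty]
    rfl
  · rw [deg_node, sum_contract_empty, card_contract_empty]
    change _ + (T.deg + ∑ i, (ts i).deg) = _
    push_cast
    ring
  · rw [trunk_node, sum_contract_empty, card_contract_empty]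
    change _ + (branchTrunk k₀ T + ∑ i, branchTrunk k₀ (ts i)) ≤ _
    rw [branchTrunk_of_notMem k₀ hT]
    omega

theorem treePrefix_mem_fil {T : CTree K b a} (hT : k₀ ∉ T.leaves) (t : CTree K b d) :
    treePrefix k₀ T t ∈ fil K b d k₀ (T.leaves + t.leaves) (T.deg + t.deg - 1) (trunk k₀ t + 1) := by
  classical
  cases t with
  | leaf k => exact zero_mem _
  | @node ι _ _ hι c d x ts =>
    rw [treePrefix_node]
    refine units_smul_mem _ (sum_mem fun i _ => ?_)
    split
    · have h := prefixed_mem_fil hT i ts x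
      have e₁ : T.deg + (node hι x ts).deg - 1 = 1 - Fintype.card ι + T.deg + ∑ i, (ts i).deg := by
        rw [deg_node]; ring
      have e₂ : trunk k₀ (node hι x ts) + 1 = Fintype.card ι + ∑ i, branchTrunk k₀ (ts i) := by
        rw [trunk_node]; omega
      rw [leaves_node, e₁, e₂]
      exact h
    · exact zero_mem _

theorem symmPair_prefix_mem_fil {s : CTree K b a} {t : CTree K b e} (d : PairColor)
    (hS : (s.leaves + t.leaves).Nodup) : symmPair (V := fun d => CAlg K b d) (fun {_ e} d s t =>
      (s.deg + 1).negOnePow • castHom K b e d (treePrefix k₀ s t)) d s t ∈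
      fil K b d k₀ (s.leaves + t.leaves) (s.deg + t.deg - 1)
        (branchTrunk k₀ s + branchTrunk k₀ t + 1) := by
  have key : ∀ {a e : PairColor} (s : CTree K b a) (t : CTree K b e),
      (s.leaves + t.leaves).Nodup → (s.deg + 1).negOnePow • castHom K b e d (treePrefix k₀ s t) ∈
      fil K b d k₀ (s.leaves + t.leaves) (s.deg + t.deg - 1)
        (branchTrunk k₀ s + branchTrunk k₀ t + 1) := by
    intro a e s t h
    refine units_smul_mem _ (castHom_mem_fil ?_)
    by_cases ht : k₀ ∈ t.leaves
    · have hs : k₀ ∉ s.leaves := fun hs => Multiset.disjoint_left.1 (Multiset.nodup_add.1 h).2.2 hs ht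
      rw [branchTrunk_of_mem k₀ ht, branchTrunk_of_notMem k₀ hs, zero_add]
      exact treePrefix_mem_fil hs t
    · rw [treePrefix_of_notMem s ht]
      exact zero_mem _
  refine sub_mem (key s t hS) (units_smul_mem _ ?_)
  have := key t s (by rwa [add_comm])
  rwa [add_comm t.leaves, add_comm t.deg, add_comm (branchTrunk k₀ t)] at this

theorem sum_pair {M : Type*} [AddCommMonoid M] {p q : ι} (hpq : p ≠ q) (hk : ∀ k, k = p ∨ k = q)
    (f : ι → M) : ∑ i, f i = f p + f q := by
  have : (univ : Finset ι) = {p, q} := by ext k; simpa using hk k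
  rw [this, Finset.sum_pair hpq]

theorem homotopy_mem_fil (hS : S.Nodup) {z : CAlg K b d} (hz : z ∈ fil K b d k₀ S n m) :
    homotopy k₀ d z ∈ fil K b d k₀ S (n - 1) m := by
  refine map_mem_of_fil (fun t h₁ h₂ h₃ => ?_) hz
  rw [homotopy, binaryHom_mk]
  cases t with
  | leaf k => exact zero_mem _
  | @node ι _ _ hι c d x ts =>
    rw [treeBinary_node]
    refine units_smul_mem _ ?_
    by_cases hc : Fintype.card ι = 2
    swap
    · rw [pairSum_of_card_ne hc]; exact zero_mem _
    obtain ⟨p, q, hpq, hk⟩ := exists_lt_of_card_eq_two hc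
    rw [pairSum_eq hpq hk]
    refine Submodule.smul_mem _ _ ?_
    have e₁ : (ts p).leaves + (ts q).leaves = S := by
      rw [← h₁, leaves_node, sum_pair hpq.ne hk]
    have e₂ : (ts p).deg + (ts q).deg - 1 = n - 1 := by
      rw [← h₂, deg_node, sum_pair hpq.ne hk, hc]; push_cast; ring
    have e₃ : branchTrunk k₀ (ts p) + branchTrunk k₀ (ts q) + 1 ≤ m := by
      rw [trunk_node, sum_pair hpq.ne hk, hc] at h₃; omega
    have := symmPair_prefix_mem_fil (k₀ := k₀) (s := ts p) (t := ts q) d (e₁ ▸ hS)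
    rw [e₁, e₂] at this
    exact fil_mono e₃ this

end

section

/-- The element of the cooperad that corresponds to the unit of the operad. -/
def unitElt (K : Type u) [Field K] (d : PairColor) : Coop K (fun _ : Unit => d) d :=
  ofAssoc _ d (wordLift fun w => if w = [()] then 1 else 0)

theorem val_unitElt (d : PairColor) : val (unitElt K d) (.of ()) = 1 := by
  have h : Adm (fun _ : Unit => d) d (.of ()) := ⟨hasColor_of.2 rfl, by simp [IsML]⟩
  rw [unitElt, val_ofAssoc _ h, assoc_of, ← word_singleton, wordLift_word,
    if_pos rfl]

/-! ### Trees with a binary root -/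

section Attach

/-- The tree with a binary root with branches `T` and `t`. -/
def attach (T : CTree K b a) (t : CTree K b d) : CAlg K b d :=
  prefixed (c := fun _ : Unit => d) T () (fun _ => t) d (unitElt K d)

theorem based_unit (d : PairColor) : Based (fun _ : Unit => d) d () :=
  ⟨rfl, fun _ h => absurd rfl h⟩

variable {ι : Type} [Fintype ι] [LinearOrder ι] {c : ι → PairColor}

theorem prefixed_eq_attach [Unique ι] (T : CTree K b a) (i : ι) (ts : Branches K b c)
    (z : Coop K c d) (h : c i = d) {t : CTree K b d} (ht : ts i ≍ t) :
    prefixed T i ts d z = val z (.of i) • attach T t := by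
  obtain rfl : c = fun _ => d := funext fun j => by rw [Subsingleton.elim j i, h]
  obtain rfl : ts = fun _ => t := funext fun j => by
    rw [Subsingleton.elim j i]; exact eq_of_heq ht
  let σ : ι ≃ Unit := Equiv.ofUnique ι Unit
  have hz : z = val z (.of i) • pull₀ σ (c := fun _ : ι => d) (fun _ => rfl) d (unitElt K d) := by
    have hml : ∀ u : FreeMagma ι, Adm (fun _ => d) d u → u = .of i := by
      intro u hu
      induction u using magma_induction with
      | hof j => rw [Subsingleton.elim j i]
      | hmul s t _ _ =>
        have h := hu.2.1
        obtain ⟨p, hp, -⟩ := HasColor.exists_based (c := fun _ : ι => d) (u := s) (d := d)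
          (by obtain ⟨a, e, ⟨g⟩, h₁, h₂⟩ := hu.1
              obtain ⟨p, hp, hp', -⟩ := h₁.exists_based
              exact hp' ▸ h₁)
        obtain ⟨q, hq, -⟩ := HasColor.exists_based (c := fun _ : ι => d) (u := t) (d := d)
          (by obtain ⟨a, e, ⟨g⟩, h₁, h₂⟩ := hu.1
              obtain ⟨p, hp, hp', -⟩ := h₂.exists_based
              exact hp' ▸ h₂)
        rw [labels_mul] at h
        exact absurd (Subsingleton.elim p q ▸ hq)
          (Multiset.disjoint_left.1 (Multiset.nodup_add.1 h).2.2 hp)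
    refine obj_ext fun u hu => ?_
    rw [hml u hu, val_smul, val_pull₀]
    change _ = _ * val (unitElt K d) (.of ())
    rw [val_unitElt, mul_one]
  rw [hz, map_smul]
  refine congrArg₂ (· • ·) ?_ ?_
  · rw [← hz]
  · refine (prefixed_perm σ T i (fun _ => t) (unitElt K d)).trans ?_
    rw [koszulSign_strictMono σ fun p q h => absurd h (by rw [Subsingleton.elim p q]; exact lt_irrefl _),
      one_smul]
    rfl

theorem exists_attach (T : CTree K b a) (d : PairColor) (n : ℤ) :
    ∃ G : CAlg K b d →ₗ[K] CAlg K b d, ∀ t : CTree K b d, t.deg = n → attach T t = G (mk t) := by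
  by_cases h : Nonempty (CTree K b d)
  swap
  · exact ⟨0, fun t => absurd ⟨t⟩ h⟩
  obtain ⟨t₀⟩ := h
  obtain ⟨G, hG⟩ := exists_prefixed_update T () (fun _ : Unit => t₀) (unitElt K d) () n
  refine ⟨G, fun t ht => ?_⟩
  rw [← hG t ht, attach]
  rfl

theorem attach_congr (T : CTree K b a) {t t' : CTree K b d} (hd : t.deg = t'.deg) {ε ε' : ℤˣ}
    (h : ε • (mk t : CAlg K b d) = ε' • mk t') : ε • attach T t = ε' • attach T t' := by
  obtain ⟨G, hG⟩ := exists_attach T d t'.deg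
  rw [hG t hd, hG t' rfl, ← map_units_smul, ← map_units_smul, h]

end Attach

/-! ### The differential and the addition of a branch in front of the root -/

section PrefixSplit

variable {ι : Type} [Fintype ι] [LinearOrder ι] {c : ι → PairColor} {i : ι} {J : Finset ι}

/-- The upper vertex of a split tree, if `J` is allowed to consist of all the inputs. -/
abbrev upperNode (hJ : 2 ≤ J.card) (y : Coop K (restrictColor c J) e)
    (ts : Branches K b c) : CTree K b e :=
  node (by rwa [Fintype.card_coe]) y fun j => ts j

variable {J₂ : Finset (Contract (∅ : Finset ι))} (hnew : new ∉ J₂)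
  (hold : ∀ i, old i ∈ J₂ ↔ (i : ι) ∈ J)

theorem card_of_new_notMem {J : Finset ι} {J₂ : Finset (Contract (∅ : Finset ι))}
    (hnew : new ∉ J₂) (hold : ∀ i, old i ∈ J₂ ↔ (i : ι) ∈ J) : J₂.card = J.card := by
  rw [← Fintype.card_coe, ← Fintype.card_coe]
  exact Fintype.card_congr (emptyTop hnew hold)

theorem splits_of_new_notMem {J : Finset ι} {J₂ : Finset (Contract (∅ : Finset ι))}
    (hnew : new ∉ J₂) (hold : ∀ i, old i ∈ J₂ ↔ (i : ι) ∈ J) (hJ : 2 ≤ J.card) : Splits J₂ := by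
  have h := card_of_new_notMem hnew hold
  refine ⟨h ▸ hJ, ?_⟩
  rw [card_contract_empty, h]
  exact Nat.lt_succ_of_le (card_le_univ J)

theorem splitN_prefix_tmul (hJ : 2 ≤ J.card) (T : CTree K b a) (i' : Contract J)
    (ts : Branches K b c) (y : Coop K (color c J e) d) (z : Coop K (restrictColor c J) e) :
    splitN (contractBranches (J := ∅) T ts) J₂ d e (TensorProduct.map
        (pull₀ (emptyRoot hnew hold) (emptyRoot_color hnew hold a) d ∘ₗ pre i' a)
        (pull₀ (emptyTop hnew hold) (emptyTop_color hnew hold a) e) (y ⊗ₜ z)) =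
      ((T.deg + 1) * upperPar ts J e).negOnePow • rootSign (fun j : J => pars ts j) •
        prefixed T i' (contractBranches (upperNode hJ z ts) ts) d y := by
  have hJ₂ := splits_of_new_notMem hnew hold hJ
  have : Nonempty (Contract J) := ⟨i'⟩
  rw [TensorProduct.map_tmul, splitN_tmul _ hJ₂, comp_apply, prefixed_apply]
  set z' := pull₀ (emptyTop hnew hold) (emptyTop_color hnew hold a) e z with hz'
  set TJ := upperNode hJ z ts with hTJ
  set TJ₂ := upper hJ₂ z' (contractBranches (J := ∅) T ts) with hTJ₂
  have dJ : TJ₂.deg = TJ.deg := deg_node_congr (emptyTop hnew hold) fun o =>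
    match o with
    | ⟨.new, h⟩ => absurd h hnew
    | ⟨.old i, h⟩ => rfl
  have eJ := nd_pull₀_of_strictMono hJ₂.two_le_card (by rwa [Fintype.card_coe])
    (strictMono_disjointTop hnew hold (disjoint_empty_left J)) (emptyTop_color hnew hold a) z
    (fun j => contractBranches (J := ∅) T ts j) (fun j => ts j) (fun o => by
      match o with
      | ⟨.new, h⟩ => exact absurd h hnew
      | ⟨.old i, h⟩ => rfl)
  rw [nd, nd] at eJ
  have e₁ := nd_pull₀ (two_le_card_contract hJ₂.2) two_le_card_contract_empty
    (emptyRoot_color hnew hold a) (pre i' a y) (contractBranches TJ₂ (contractBranches T ts))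
    (contractBranches T (contractBranches TJ₂ ts)) (fun o => by
      match o with
      | .new => rfl
      | .old ⟨.new, h⟩ => rfl
      | .old ⟨.old i, h⟩ => rfl)
  rw [koszulSign_disjointRoot] at e₁
  refine (congrArg (_ • ·) e₁).trans ?_
  rw [smul_comm]
  have hs : pars (contractBranches (J := (∅ : Finset (Contract J))) T (contractBranches (J := J) TJ₂ ts))
      (oldE .new) * pars (contractBranches (J := (∅ : Finset (Contract J))) T
        (contractBranches (J := J) TJ₂ ts)) .new = (T.deg + 1) * upperPar ts J e := by
    rw [mul_comm]
    change (T.deg + 1) * (TJ₂.deg + 1) = _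
    rw [dJ]
    rfl
  refine (congrArg (fun n : ℤ => n.negOnePow • _ • _) hs).trans ?_
  refine congrArg _ ?_
  have hu : ∀ T' : CTree K b e, contractBranches (J := (∅ : Finset (Contract J))) T
      (contractBranches (J := J) T' ts) =
      update (contractBranches (J := (∅ : Finset (Contract J))) T
        (contractBranches (J := J) TJ ts)) (oldE .new) T' := fun T' => by
    rw [← update_contractBranches TJ T' ts]
    exact contractBranches_update_of_notMem (i := (new : Contract J)) (notMem_empty _) T
      (contractBranches TJ ts) T'
  rw [hu TJ₂]
  refine (nd_update_congr _ _ _ _ dJ eJ).trans ?_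
  rw [← hu TJ]

end PrefixSplit

end

section

section PrefixDiff

variable {k₀ : κ} {ι : Type} [Fintype ι] [LinearOrder ι] {c : ι → PairColor} {i : ι} {J : Finset ι}

/-- The leaf `k₀` belongs to the branch `i` and to no other branch. -/
def OnlyBranch (k₀ : κ) (ts : Branches K b c) (i : ι) : Prop :=
  k₀ ∈ (ts i).leaves ∧ ∀ j, j ≠ i → k₀ ∉ (ts j).leaves

theorem OnlyBranch.of_nodup {ts : Branches K b c} (h : (∑ i, (ts i).leaves).Nodup)
    (hi : k₀ ∈ (ts i).leaves) : OnlyBranch k₀ ts i := by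
  refine ⟨hi, fun j hj hj' => ?_⟩
  rw [← add_sum_erase _ _ (mem_univ i), Multiset.nodup_add] at h
  exact Multiset.disjoint_left.1 h.2.2 hi
    (Multiset.mem_sum.2 ⟨j, mem_erase.2 ⟨hj, mem_univ _⟩, hj'⟩)

theorem OnlyBranch.sum_branchTrunk {ts : Branches K b c} (h : OnlyBranch k₀ ts i) :
    ∑ j, branchTrunk k₀ (ts j) = trunk k₀ (ts i) := by
  rw [Fintype.sum_eq_single i fun j hj => branchTrunk_of_notMem k₀ (h.2 j hj),
    branchTrunk_of_mem k₀ h.1]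

theorem OnlyBranch.prefixHom_nd {ts : Branches K b c} (h : OnlyBranch k₀ ts i)
    (T : CTree K b a) (hι : 2 ≤ Fintype.card ι) (x : Coop K c d) :
    prefixHom k₀ T d (nd hι x ts) = prefixed T i ts d x := by
  classical
  rw [nd, map_units_smul, prefixHom_mk, treePrefix_node, smul_smul, Int.units_mul_self, one_smul,
    Fintype.sum_eq_single i fun j hj => if_neg (h.2 j hj), if_pos h.1]

theorem OnlyBranch.split {ts : Branches K b c} (h : OnlyBranch k₀ ts i) (hJ : Splits J)
    (z : Coop K (restrictColor c J) e) :
    OnlyBranch k₀ (contractBranches (upper hJ z ts) ts) (Contract.proj J i) := by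
  have hu : k₀ ∈ (upper hJ z ts).leaves ↔ i ∈ J := by
    rw [leaves_node, Multiset.mem_sum]
    constructor
    · rintro ⟨j, -, hj⟩
      by_contra hi
      exact h.2 j (fun hji => hi (hji ▸ j.2)) hj
    · exact fun hi => ⟨⟨i, hi⟩, mem_univ _, h.1⟩
  by_cases hi : i ∈ J
  · rw [Contract.proj_of_mem hi]
    refine ⟨hu.2 hi, fun o ho => ?_⟩
    match o with
    | .old k => exact h.2 k fun hk => k.2 (hk ▸ hi)
  · rw [Contract.proj_of_notMem hi]
    refine ⟨h.1, fun o ho => ?_⟩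
    match o with
    | .new => exact fun h' => hi (hu.1 h')
    | .old k => exact h.2 k fun hk => ho (congrArg old (Subtype.ext hk))

theorem prefixHom_splitN {J₂ : Finset (Contract (∅ : Finset ι))} (hnew : new ∉ J₂)
    (hold : ∀ i, old i ∈ J₂ ↔ (i : ι) ∈ J) (hJ : Splits J) (T : CTree K b a)
    {ts : Branches K b c} (h : OnlyBranch k₀ ts i)
    (τ : Coop K (color c J e) d ⊗[K] Coop K (restrictColor c J) e) :
    splitN (contractBranches (J := ∅) T ts) J₂ d e (TensorProduct.map
        (pull₀ (emptyRoot hnew hold) (emptyRoot_color hnew hold a) d ∘ₗ pre (Contract.proj J i) a)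
        (pull₀ (emptyTop hnew hold) (emptyTop_color hnew hold a) e) τ) =
      ((T.deg + 1) * upperPar ts J e).negOnePow • prefixHom k₀ T d (splitN ts J d e τ) := by
  induction τ with
  | zero => simp only [map_zero, smul_zero]
  | add x y hx hy => rw [map_add, map_add, hx, hy, map_add, map_add, smul_add]
  | tmul y z =>
    rw [splitN_prefix_tmul hnew hold hJ.1, splitN_tmul ts hJ, map_units_smul,
      (h.split hJ z).prefixHom_nd]

theorem dec_univ_of_ne (x : Coop K c d) (h : e ≠ d) : dec c univ d e x = 0 := by
  refine tensor_ext_val fun u v hu hv => absurd ?_ h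
  obtain ⟨o, -, ho, -⟩ := hu.1.exists_based
  match o with
  | .new => exact ho
  | .old k => exact absurd (mem_univ _) k.2

/-- After contracting all the inputs only the new one is left. -/
instance uniqueContractUniv : Unique (Contract (univ : Finset ι)) where
  default := .new
  uniq o := match o with
    | .new => rfl
    | .old k => absurd (mem_univ _) k.2

/-- Splitting off all the branches below the new first branch. -/
theorem splitN_prefix_univ {J₂ : Finset (Contract (∅ : Finset ι))} (hnew : new ∉ J₂)
    (hold : ∀ i, old i ∈ J₂ ↔ (i : ι) ∈ (univ : Finset ι)) (hι : 2 ≤ Fintype.card ι)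
    (T : CTree K b a) (ts : Branches K b c) (x : Coop K c d) :
    splitN (contractBranches (J := ∅) T ts) J₂ d d (TensorProduct.map
        (pull₀ (emptyRoot hnew hold) (emptyRoot_color hnew hold a) d ∘ₗ pre (Contract.proj univ i) a)
        (pull₀ (emptyTop hnew hold) (emptyTop_color hnew hold a) d) (dec c univ d d x)) =
      ((T.deg + 1) * upperPar ts univ d).negOnePow • rootSign (pars ts) •
        attach T (node hι x ts) := by
  let σ : (univ : Finset ι) ≃ ι := Equiv.subtypeUnivEquiv fun i => mem_univ i
  let σ' : Contract (univ : Finset ι) ≃ Unit := Equiv.ofUnique _ _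
  have hc : ∀ o, color c univ d o = d := fun o => by
    match o with
    | .new => rfl
    | .old k => exact absurd (mem_univ _) k.2
  set y : Coop K (color c univ d) d :=
    pull₀ σ' (c' := fun _ => d) hc d (unitElt K d) with hy
  set z : Coop K (restrictColor c univ) d :=
    pull₀ σ (c := restrictColor c univ) (fun _ => rfl) d x with hz
  have hyv : val y (.of .new) = 1 := by
    rw [hy, val_pull₀]
    exact val_unitElt d
  have hdec : dec c univ d d x = y ⊗ₜ z := by
    refine tensor_ext_val fun u v hu hv => ?_
    have hu' : u = .of .new := by
      induction u using magma_induction with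
      | hof o => rw [Subsingleton.elim o .new]
      | hmul s t _ _ =>
        have hn := hu.2.1
        obtain ⟨a, e, -, h₁, h₂⟩ := hu.1
        obtain ⟨p, hp, -⟩ := h₁.exists_based
        obtain ⟨q, hq, -⟩ := h₂.exists_based
        rw [labels_mul] at hn
        exact absurd (Subsingleton.elim p q ▸ hq)
          (Multiset.disjoint_left.1 (Multiset.nodup_add.1 hn).2.2 hp)
    subst hu'
    rw [valAt₂_dec x hu hv, valAt₂_tmul, hyv, one_mul]
    exact (val_pull₀ σ (c := restrictColor c univ) (fun _ => rfl) d x v).symm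
  have hcard : 2 ≤ (univ : Finset ι).card := by rwa [card_univ]
  rw [hdec, splitN_prefix_tmul hnew hold hcard, prefixed_eq_attach T (Contract.proj univ i) _ y
    (hc _) (t := upperNode hcard z ts) (by rw [Contract.proj_of_mem (mem_univ i)]; rfl),
    Contract.proj_of_mem (mem_univ i), hyv, one_smul]
  exact congrArg _ (attach_congr T (deg_node_congr σ fun _ => rfl) (nd_pull₀_of_strictMono
    (σ := σ) (by rwa [Fintype.card_coe]) hι (fun _ _ h => h) (fun _ => rfl) x (fun j => ts j) ts
    fun _ => HEq.rfl))

theorem prefixHom_plugSucc (T : CTree K b a) {ts : Branches K b c}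
    (h : OnlyBranch k₀ ts i) (hι : 2 ≤ Fintype.card ι) (x : Coop K c d) (j : ι)
    {z : CAlg K b (c j)} (hz : z ∈ graded K b (c j) (ts j).leaves ((ts j).deg + 1)) :
    haveI : Nonempty ι := ⟨i⟩
    plugSucc two_le_card_contract_empty (pre i a x) (contractBranches T ts) (oldE j) z =
      prefixHom k₀ T d (plugSucc hι x ts j z) := by
  have : Nonempty ι := ⟨i⟩
  let L : CAlg K b (c j) →ₗ[K] CAlg K b d :=
    plugSucc two_le_card_contract_empty (pre i a x) (contractBranches (J := ∅) T ts) (oldE j)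
  have key : L z - (prefixHom k₀ T d ∘ₗ plugSucc hι x ts j) z = 0 := by
    refine (Submodule.mem_bot K).1 (map_mem_of_graded (F := L -
        (prefixHom k₀ T d ∘ₗ plugSucc hι x ts j)) (fun t hS hn => ?_) hz)
    rw [Submodule.mem_bot, LinearMap.sub_apply, sub_eq_zero, comp_apply,
      plugSucc_mk _ _ _ _ hn]
    refine (plugSucc_mk two_le_card_contract_empty (pre i a x) (contractBranches (J := ∅) T ts)
      (oldE j) hn).trans ?_
    have hl : ∀ l, (update ts j t l).leaves = (ts l).leaves := fun l => by
      by_cases hl : l = j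
      · subst hl; rw [update_self, hS]
      · rw [update_of_ne hl]
    have h' : OnlyBranch k₀ (update ts j t) i :=
      ⟨by rw [hl]; exact h.1, fun l hlj => by rw [hl]; exact h.2 l hlj⟩
    rw [h'.prefixHom_nd, prefixed_apply, contractBranches_update_of_notMem (notMem_empty j)]
  exact sub_eq_zero.1 key

theorem passSign_oldE (T : CTree K b a) (ts : Branches K b c) (j : ι) :
    passSign (pars (contractBranches (J := ∅) T ts)) (oldE j) =
      (T.deg + 1).negOnePow * passSign (pars ts) j := by
  rw [passSign, prod_contract]
  simp [oldE, new_lt_old, old_lt_old, pars, passSign]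
  rfl

end PrefixDiff

end

section

section RootPartPrefix

variable {k₀ : κ} {ι : Type} [Fintype ι] [LinearOrder ι] {c : ι → PairColor} {i : ι}

theorem sum_splitN_prefix {T : CTree K b .algebra} {ts : Branches K b c}
    (h : OnlyBranch k₀ ts i) (hι : 2 ≤ Fintype.card ι) (hb : Based c d i)
    (x : Coop K c d) (J : Finset ι) :
    ∑ e, frontSign (contractSub False ∅ J) (pars (contractBranches (J := ∅) T ts)) •
      splitN (contractBranches (J := ∅) T ts) (contractSub False ∅ J) d e
        (dec _ (contractSub False ∅ J) d e (pre i .algebra x)) =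
      (T.deg + 1).negOnePow • (prefixHom k₀ T d
        (∑ e, frontSign J (pars ts) • splitN ts J d e (dec c J d e x)) +
        if J = univ then rootSign (pars ts) • attach T (node hι x ts) else 0) := by
  have hnew : new ∉ contractSub False ∅ J := fun h => new_mem_contractSub.1 h
  have hold : ∀ i, old i ∈ contractSub False ∅ J ↔ (i : ι) ∈ J := old_mem_contractSub
  have hsgn : ∀ e, frontSign (contractSub False ∅ J) (pars (contractBranches (J := ∅) T ts)) *
      ((T.deg + 1) * upperPar ts J e).negOnePow =
        (T.deg + 1).negOnePow * frontSign J (pars ts) := fun e => by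
    rw [pars_contractBranches]
    exact frontSign_contract_empty (pars ts) hnew hold (negOnePow_upperPar ts J e)
  simp only [dec_pre hnew hold hb]
  by_cases hJ : J = univ
  · subst hJ
    have hs : ¬ Splits (univ : Finset ι) := fun hs => (hs.2.trans_eq (card_univ).symm).false
    simp only [splitN_of_not ts hs, LinearMap.zero_apply, smul_zero, sum_const_zero, map_zero,
      zero_add, if_true]
    rw [Fintype.sum_eq_single d fun e he => by
      rw [dec_univ_of_ne x he, map_zero, map_zero, smul_zero], splitN_prefix_univ hnew hold hι,
      smul_smul, hsgn, frontSign_eq]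
    simp
  · rw [if_neg hJ, add_zero, map_sum, smul_sum]
    refine sum_congr rfl fun e _ => ?_
    by_cases hs : Splits J
    · rw [prefixHom_splitN hnew hold hs T h, smul_smul, hsgn, map_units_smul, smul_smul]
    · have hs' : ¬ Splits (contractSub False ∅ J) := fun h' => hs
        ⟨card_of_new_notMem hnew hold ▸ h'.1, lt_of_le_of_ne (card_le_univ J) fun hc =>
          hJ ((card_eq_iff_eq_univ J).1 hc)⟩
      rw [splitN_of_not _ hs, splitN_of_not _ hs', LinearMap.zero_apply, LinearMap.zero_apply,
        smul_zero, smul_zero, map_zero, smul_zero]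

/-- Up to trees in which the vertices on the path to `k₀` have fewer inputs altogether, the root of
a tree is split after the addition of a first branch `T` as it was before, with the exception of
the binary root that separates `T` from all the other branches. -/
theorem rootPart_prefix {T : CTree K b .algebra} {ts : Branches K b c}
    (h : OnlyBranch k₀ ts i) (hT : k₀ ∉ T.leaves) (hι : 2 ≤ Fintype.card ι) (hb : Based c d i)
    (x : Coop K c d) : rootPart (contractBranches (J := ∅) T ts) d (pre i .algebra x) -
      (T.deg + 1).negOnePow • (prefixHom k₀ T d (rootPart ts d x) +
        rootSign (pars ts) • attach T (node hι x ts)) ∈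
      fil K b d k₀ (T.leaves + ∑ i, (ts i).leaves)
        (2 - Fintype.card ι + T.deg + ∑ i, (ts i).deg)
        (Fintype.card ι - 1 + ∑ i, branchTrunk k₀ (ts i)) := by
  have h₁ : ∑ J with Disjoint ∅ J, ((T.deg + 1).negOnePow • (prefixHom k₀ T d
        (∑ e, frontSign J (pars ts) • splitN ts J d e (dec c J d e x)) +
        if J = univ then rootSign (pars ts) • attach T (node hι x ts) else 0)) =
      (T.deg + 1).negOnePow • (prefixHom k₀ T d (rootPart ts d x) +
        rootSign (pars ts) • attach T (node hι x ts)) := by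
    rw [filter_true_of_mem fun J _ => disjoint_empty_left J, ← smul_sum, sum_add_distrib,
      ← map_sum, sum_ite_eq' univ, if_pos (mem_univ _), ← rootPart_apply]
  rw [rootPart_apply, sum_contract_subsets, ← h₁, sum_congr rfl fun J _ => sum_splitN_prefix h hι hb x J,
    add_sub_cancel_left]
  refine sum_mem fun J _ => sum_mem fun e _ => units_smul_mem _ ?_
  by_cases hs : Splits (contractSub True ∅ J)
  swap
  · rw [splitN_of_not _ hs, LinearMap.zero_apply]
    exact zero_mem _
  by_cases hi : i ∈ J
  · rw [dec_pre_eq_zero (i := i) (new_mem_contractSub.2 trivial)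
      ((old_mem_contractSub _).2 hi) hs.2, map_zero]
    exact zero_mem _
  · have hm := splitN_mem_fil_of_notMem (k₀ := k₀) (J := contractSub True ∅ J)
      (m := Fintype.card ι - 1 + ∑ i, branchTrunk k₀ (ts i))
      (contractBranches (J := ∅) T ts) (fun o ho => ?_) ?_
      (dec _ (contractSub True ∅ J) d e (pre i .algebra x))
    · rw [sum_contract_empty, sum_contract_empty, card_contract_empty] at hm
      convert hm using 2
      · rfl
      · change _ = 3 - ((Fintype.card ι + 1 : ℕ) : ℤ) + (T.deg + ∑ i, (ts i).deg)
        push_cast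
        ring
    · match o with
      | .new => exact hT
      | .old k => exact h.2 k fun hk => hi (hk ▸ (old_mem_contractSub k).1 ho)
    · rw [sum_contract_empty, card_contract_empty]
      change _ + (branchTrunk k₀ T + ∑ i, branchTrunk k₀ (ts i)) ≤ _
      rw [branchTrunk_of_notMem k₀ hT]
      omega

/-- The differential of a tree with an added first branch `T`, up to trees with a shorter path
from the root to `k₀`. -/
theorem D_prefixed {T : CTree K b .algebra} {ts : Branches K b c}
    (h : OnlyBranch k₀ ts i) (hT : k₀ ∉ T.leaves) (hι : 2 ≤ Fintype.card ι) (hb : Based c d i)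
    (x : Coop K c d) : haveI : Nonempty ι := ⟨i⟩
    ∃ r ∈ fil K b d k₀ (T.leaves + ∑ i, (ts i).leaves)
        (2 - Fintype.card ι + T.deg + ∑ i, (ts i).deg)
        (Fintype.card ι - 1 + ∑ i, branchTrunk k₀ (ts i)),
      D d (prefixed T i ts d x) = r + (T.deg + 1).negOnePow • (prefixHom k₀ T d (D d (nd hι x ts)) +
        rootSign (pars ts) • attach T (node hι x ts)) -
        plugSucc two_le_card_contract_empty (pre i .algebra x) (contractBranches (J := ∅) T ts) .new
          (D _ (mk T)) := by
  have : Nonempty ι := ⟨i⟩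
  refine ⟨_, rootPart_prefix h hT hι hb x, ?_⟩
  have h₂ : ∑ j, passSign (pars (contractBranches (J := ∅) T ts)) (oldE j) •
      plugSucc two_le_card_contract_empty (pre i .algebra x) (contractBranches (J := ∅) T ts) (oldE j)
          (D (c j) (mk (ts j))) = (T.deg + 1).negOnePow • prefixHom k₀ T d
        (∑ j, passSign (pars ts) j • plugSucc hι x ts j (D (c j) (mk (ts j)))) := by
    rw [map_sum, smul_sum]
    refine sum_congr rfl fun j _ => ?_
    rw [passSign_oldE, mul_smul, map_units_smul, prefixHom_plugSucc T h hι x j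
      (D_mem_graded (mk_mem_graded rfl rfl))]
  rw [prefixed_apply, D_nd, D_nd, sum_contract_empty, passSign_new, one_smul, map_sub]
  refine (congrArg (fun z => _ - (_ + z)) h₂).trans ?_
  simp only [smul_add, smul_sub]
  exact (by intros; abel : ∀ u v w y z : CAlg K b d,
    u - (v + w) = u - (y + z) + (y - w + z) - v) _ _ _ _ _

end RootPartPrefix

end

section

variable {k₀ : κ}

section HomotopyFormula

variable {ι : Type} [Fintype ι] [LinearOrder ι] {c : ι → PairColor}

theorem homotopy_nd_of_card_ne (hc : Fintype.card ι ≠ 2) (hι : 2 ≤ Fintype.card ι)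
    (x : Coop K c d) (ts : Branches K b c) : homotopy k₀ d (nd hι x ts) = 0 := by
  rw [homotopy, binaryHom_nd, pairSum_of_card_ne hc]

theorem homotopy_plugSucc_of_card_ne (hc : Fintype.card ι ≠ 2) (hι : 2 ≤ Fintype.card ι)
    (x : Coop K c d) (ts : Branches K b c) (i : ι) (z : CAlg K b (c i)) :
    homotopy k₀ d (plugSucc hι x ts i z) = 0 := by
  refine LinearMap.congr_fun (f := homotopy k₀ d ∘ₗ plugSucc hι x ts i) (g := 0) (hom_ext fun t => ?_) z
  rw [comp_apply, plugSucc_apply, plug_mk, map_units_smul, homotopy, binaryHom_mk,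
    treeBinary_node, pairSum_of_card_ne hc, smul_zero, smul_zero, LinearMap.zero_apply]

theorem homotopy_prefixed (hι : 2 ≤ Fintype.card ι) (T : CTree K b a) (i : ι)
    (ts : Branches K b c) (x : Coop K c d) : homotopy k₀ d (prefixed T i ts d x) = 0 :=
  haveI : Nonempty ι := ⟨i⟩
  homotopy_nd_of_card_ne (by rw [card_contract_empty]; omega) _ _ _

end HomotopyFormula

theorem homotopy_prefixHom (T : CTree K b a) (z : CAlg K b d) :
    homotopy k₀ d (prefixHom k₀ T d z) = 0 := by
  refine LinearMap.congr_fun (f := homotopy k₀ d ∘ₗ prefixHom k₀ T d) (g := 0) (hom_ext fun t => ?_) z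
  rw [comp_apply, prefixHom_mk, LinearMap.zero_apply]
  cases t with
  | leaf k => exact map_zero _
  | node hι x ts =>
    rw [treePrefix_node, map_units_smul, map_sum, sum_eq_zero fun i _ => ?_, smul_zero]
    split
    · exact homotopy_prefixed hι T i ts x
    · exact map_zero _

theorem plugSucc_new_mk {ι : Type} [Fintype ι] [LinearOrder ι] [Nonempty ι] {c : ι → PairColor}
    {T T' : CTree K b a} (h : T'.deg = T.deg + 1) (i : ι) (ts : Branches K b c) (x : Coop K c d) :
    plugSucc two_le_card_contract_empty (pre i a x) (contractBranches (J := ∅) T ts) .new (mk T') =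
      prefixed T' i ts d x := by
  have e : update (contractBranches (J := ∅) T ts) .new T' = contractBranches T' ts := by
    funext o
    cases o <;> rfl
  rw [prefixed_apply, ← e]
  exact plugSucc_mk two_le_card_contract_empty (pre i a x) (contractBranches (J := ∅) T ts) .new h

/-- The decoration of a binary root that separates a first branch. -/
abbrev attachElt (K : Type u) [Field K] (d : PairColor) :
    Coop K (color (fun _ : Unit => d) ∅ .algebra) d :=
  pre () .algebra (unitElt K d)

theorem val_attachElt (d : PairColor) : val (attachElt K d) (.of .new * .of (oldE ())) = 1 :=
  (val_pre_new_mul (based_unit d) (unitElt K d) (.of ())).trans (val_unitElt d)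

theorem attach_eq_nd (T : CTree K b .algebra) (t : CTree K b d) : attach T t =
    nd two_le_card_contract_empty (attachElt K d) (contractBranches (J := ∅) T fun _ : Unit => t) := rfl

theorem binaryHom_attach {V : PairColor → Type*} [∀ d, AddCommGroup (V d)] [∀ d, Module K (V d)]
    {B : ∀ {a e : PairColor} (d : PairColor), CTree K b a → CTree K b e → V d}
    (hB : IsBranchLinear B) (T : CTree K b .algebra) (t : CTree K b d) :
    binaryHom hB d (attach T t) = symmPair B d T t := by
  rw [attach_eq_nd, binaryHom_nd, pairSum_eq (i := .new) (j := oldE ()) (new_lt_old _)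
    fun o => by
      match o with
      | .new => exact .inl rfl
      | .old k => exact .inr rfl]
  exact (congrArg (· • _) (val_attachElt d)).trans (one_smul _ _)

theorem homotopy_attach {T : CTree K b .algebra} (hT : k₀ ∉ T.leaves) (t : CTree K b d) :
    homotopy k₀ d (attach T t) = (T.deg + 1).negOnePow • treePrefix k₀ T t := by
  rw [homotopy, binaryHom_attach, symmPair, castHom_self, treePrefix_of_notMem t hT, map_zero,
    smul_zero, smul_zero, sub_zero]

theorem rootPart_of_card_eq_two {ι : Type} [Fintype ι] [LinearOrder ι] {c : ι → PairColor}
    (h : Fintype.card ι = 2) (ts : Branches K b c) (x : Coop K c d) : rootPart ts d x = 0 := by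
  rw [rootPart_apply]
  refine sum_eq_zero fun J _ => sum_eq_zero fun e _ => ?_
  rw [splitN_of_not ts fun hs => by have := hs.1; have := hs.2; omega, LinearMap.zero_apply, smul_zero]

/-- The differential of the tree with a binary root with branches `T` and `t`, computed by any pair
of linear maps that extend `attach` in one branch each. -/
theorem D_attach (T : CTree K b .algebra) (t : CTree K b d) :
    ∃ (G : CAlg K b .algebra →ₗ[K] CAlg K b d) (H : CAlg K b d →ₗ[K] CAlg K b d),
      (∀ T', T'.deg = T.deg + 1 → G (mk T') = attach T' t) ∧
      (∀ t', t'.deg = t.deg + 1 → H (mk t') = attach T t') ∧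
      D d (attach T t) = -G (D _ (mk T)) - (T.deg + 1).negOnePow • H (D d (mk t)) := by
  refine ⟨plugSucc two_le_card_contract_empty (attachElt K d)
    (contractBranches (J := ∅) T fun _ : Unit => t) .new, plugSucc two_le_card_contract_empty
    (attachElt K d) (contractBranches (J := ∅) T fun _ : Unit => t) (oldE ()), fun T' h => ?_,
    fun t' h => ?_, ?_⟩
  · exact plugSucc_new_mk h () (fun _ => t) (unitElt K d)
  · refine (plugSucc_mk (i := oldE ()) _ _ _ h).trans (congrArg (nd _ _) (funext fun o => ?_))
    cases o <;> rfl
  · have h₄ : passSign (pars (contractBranches (J := ∅) T fun _ : Unit => t)) (oldE ()) =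
        (T.deg + 1).negOnePow := (passSign_oldE T _ ()).trans (by simp [passSign])
    rw [attach_eq_nd, D_nd, rootPart_of_card_eq_two (by rw [card_contract_empty]; rfl),
      sum_contract_empty, passSign_new, one_smul, Fintype.sum_unique, zero_sub, neg_add']
    refine congrArg (fun z : CAlg K b d => _ - z) ?_
    exact congrArg (· • _) h₄

theorem homotopy_D_attach {T : CTree K b .algebra} (hT : k₀ ∉ T.leaves) (t : CTree K b d)
    {G : CAlg K b .algebra →ₗ[K] CAlg K b d}
    (hG : ∀ T', T'.deg = T.deg + 1 → treePrefix k₀ T' t = G (mk T')) :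
    homotopy k₀ d (D d (attach T t)) =
      (T.deg + 1).negOnePow • G (D _ (mk T)) - prefixHom k₀ T d (D d (mk t)) := by
  obtain ⟨F, H, hF, hH, hD⟩ := D_attach T t
  have h₁ : (homotopy k₀ d ∘ₗ F + (T.deg + 1).negOnePow • G) (D _ (mk T)) = 0 := by
    refine (Submodule.mem_bot K).1 (map_mem_of_graded (fun T' hl hn => ?_)
      (D_mem_graded (mk_mem_graded (t := T) rfl rfl)))
    rw [Submodule.mem_bot, LinearMap.add_apply, comp_apply, hF T' hn,
      homotopy_attach (hl ▸ hT), hn, hG T' hn, Int.negOnePow_succ, Units.neg_smul]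
    exact neg_add_cancel _
  have h₂ : (homotopy k₀ d ∘ₗ H - (T.deg + 1).negOnePow • prefixHom k₀ T d) (D d (mk t)) = 0 := by
    refine (Submodule.mem_bot K).1 (map_mem_of_graded (fun t' hl hn => ?_)
      (D_mem_graded (mk_mem_graded (t := t) rfl rfl)))
    rw [Submodule.mem_bot, LinearMap.sub_apply, comp_apply, hH t' hn, homotopy_attach hT,
      ← prefixHom_mk]
    exact sub_self _
  have h₁' : homotopy k₀ d (F (D _ (mk T))) = -((T.deg + 1).negOnePow • G (D _ (mk T))) :=
    eq_neg_of_add_eq_zero_left h₁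
  have h₂' : homotopy k₀ d (H (D d (mk t))) = (T.deg + 1).negOnePow • prefixHom k₀ T d (D d (mk t)) :=
    sub_eq_zero.1 h₂
  rw [hD, map_sub, map_neg, map_units_smul, h₁', h₂', smul_smul, Int.units_mul_self, one_smul, neg_neg]

/-! ### The homotopy identity -/

/-- The deviation of the homotopy from a contraction. -/
def homotopyError (K : Type u) [Field K] {κ : Type} (b : κ → PairColor) (k₀ : κ) (d : PairColor) :
    CAlg K b d →ₗ[K] CAlg K b d :=
  D d ∘ₗ homotopy k₀ d + homotopy k₀ d ∘ₗ D d - LinearMap.id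

theorem homotopyError_apply (z : CAlg K b d) :
    homotopyError K b k₀ d z = D d (homotopy k₀ d z) + homotopy k₀ d (D d z) - z := rfl

theorem homotopyError_mem_of_mem_fil {S : Multiset κ} {n : ℤ} {m : ℕ} (hS : S.Nodup)
    {z : CAlg K b d} (hz : z ∈ fil K b d k₀ S n m) : homotopyError K b k₀ d z ∈ fil K b d k₀ S n m := by
  refine sub_mem (add_mem ?_ ?_) hz
  · have := D_mem_fil (homotopy_mem_fil hS hz)
    rwa [sub_add_cancel] at this
  · have := homotopy_mem_fil hS (D_mem_fil hz)
    rwa [add_sub_cancel_right] at this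

theorem exists_onlyBranch {ι : Type} [Fintype ι] [LinearOrder ι] {c : ι → PairColor} {ts : Branches K b c}
    (hS : (∑ i, (ts i).leaves).Nodup) (hk : k₀ ∈ ∑ i, (ts i).leaves) : ∃ i, OnlyBranch k₀ ts i := by
  obtain ⟨i, -, hi⟩ := Multiset.mem_sum.1 hk
  exact ⟨i, .of_nodup hS hi⟩

section ErrorPrefixed

variable {ι : Type} [Fintype ι] [LinearOrder ι] {c : ι → PairColor} {i : ι}

/-- On trees with an added first branch the homotopy contracts the filtration: `homotopy` vanishes on
the tree, and recovers it from the term of the differential with a binary root. -/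
theorem homotopyError_prefixed {T : CTree K b .algebra} {ts : Branches K b c}
    (hS : (T.leaves + ∑ i, (ts i).leaves).Nodup) (h : OnlyBranch k₀ ts i) (hT : k₀ ∉ T.leaves)
    (hι : 2 ≤ Fintype.card ι) (hb : Based c d i) (x : Coop K c d) :
    homotopyError K b k₀ d (prefixed T i ts d x) ∈ fil K b d k₀ (T.leaves + ∑ i, (ts i).leaves)
      (1 - Fintype.card ι + T.deg + ∑ i, (ts i).deg)
      (Fintype.card ι - 1 + ∑ i, branchTrunk k₀ (ts i)) := by
  have : Nonempty ι := ⟨i⟩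
  obtain ⟨r, hr, hD⟩ := D_prefixed h hT hι hb x
  have h₁ := homotopy_mem_fil hS hr
  rw [homotopyError_apply, homotopy_prefixed hι, map_zero, zero_add, hD, map_sub, map_add,
    homotopy_plugSucc_of_card_ne (by rw [card_contract_empty]; omega), map_units_smul, map_add,
    homotopy_prefixHom, map_units_smul, homotopy_attach hT, ← prefixHom_mk, zero_add, sub_zero,
    smul_comm (rootSign _), smul_smul, Int.units_mul_self, one_smul, ← map_units_smul]
  have h₂ : rootSign (pars ts) • (mk (node hι x ts) : CAlg K b d) = nd hι x ts := rfl
  rw [h₂, h.prefixHom_nd, add_sub_cancel_right]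
  convert h₁ using 1
  congr 1
  ring

theorem homotopyError_attach_leaf {T : CTree K b .algebra} (hT : k₀ ∉ T.leaves) (k : κ) :
    homotopyError K b k₀ (b k) (attach T (leaf k)) = -attach T (leaf k) := by
  have h := homotopy_D_attach hT (leaf k) (G := 0) fun T' _ => rfl
  rw [isDifferential_D.leaf k, map_zero, sub_zero, LinearMap.zero_apply, smul_zero] at h
  rw [homotopyError_apply, h, homotopy_attach hT, treePrefix, smul_zero, map_zero, zero_add, zero_sub]

theorem attach_eq_zero (T : CTree K b a) {t : CTree K b d} (h : (mk t : CAlg K b d) = 0) :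
    attach T t = 0 := by
  obtain ⟨G, hG⟩ := exists_attach T d t.deg
  rw [hG t rfl, h, map_zero]

/-- On trees with a binary root the differential of the homotopy returns the tree, and the terms in
which the root of the second branch is split or a branch is changed cancel. -/
theorem homotopyError_attach_node {T : CTree K b .algebra} {ts : Branches K b c}
    (h : OnlyBranch k₀ ts i) (hT : k₀ ∉ T.leaves)
    (hι : 2 ≤ Fintype.card ι) (hb : Based c d i) (x : Coop K c d) :
    homotopyError K b k₀ d (attach T (node hι x ts)) ∈ fil K b d k₀ (T.leaves + ∑ i, (ts i).leaves)
      (2 - Fintype.card ι + T.deg + ∑ i, (ts i).deg)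
      (Fintype.card ι - 1 + ∑ i, branchTrunk k₀ (ts i)) := by
  have : Nonempty ι := ⟨i⟩
  obtain ⟨r, hr, hD⟩ := D_prefixed h hT hι hb x
  let P : CAlg K b .algebra →ₗ[K] CAlg K b d :=
    plugSucc two_le_card_contract_empty (pre i .algebra x) (contractBranches (J := ∅) T ts) .new
  have hp : ∀ T' : CTree K b .algebra, prefixHom k₀ T' d (mk (node hι x ts)) = rootSign (pars ts) • prefixed T' i ts d x :=
    fun T' => by
      rw [← h.prefixHom_nd T' hι, nd, map_units_smul, smul_smul, Int.units_mul_self, one_smul]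
  have hG : ∀ T' : CTree K b .algebra, T'.deg = T.deg + 1 → treePrefix k₀ T' (node hι x ts) =
      (rootSign (pars ts) • P) (mk T') := fun T' hT' => by
    rw [← prefixHom_mk, hp]
    exact congrArg (rootSign (pars ts) • ·) (plugSucc_new_mk hT' i ts x).symm
  rw [homotopyError_apply, homotopy_D_attach hT _ hG, homotopy_attach hT, ← prefixHom_mk, hp,
    map_units_smul, map_units_smul, hD, nd, map_units_smul, map_units_smul]
  have hs : (rootSign (pars ts) • P) (D _ (mk T)) = rootSign (pars ts) • P (D _ (mk T)) := rfl
  rw [hs]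
  have key : ∀ (ε ρ : ℤˣ) (r q a p : CAlg K b d),
      ε • ρ • (r + ε • (ρ • q + ρ • a) - p) + (ε • ρ • p - q) - a = ε • ρ • r := by
    intro ε ρ r q a p
    simp only [smul_add, smul_sub, smul_smul]
    have h₁ : ε * (ρ * (ε * ρ)) = 1 := by
      rw [mul_left_comm ρ, ← mul_assoc, Int.units_mul_self, Int.units_mul_self, one_mul]
    rw [h₁, one_smul, one_smul]
    abel
  refine (congrArg (· ∈ _) (key _ _ _ _ _ _)).mpr ?_
  exact units_smul_mem _ (units_smul_mem _ hr)

end ErrorPrefixed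

end

section

variable {k₀ : κ}

theorem ndLin_apply {ι : Type} [Fintype ι] [LinearOrder ι] {c : ι → PairColor}
    (hι : 2 ≤ Fintype.card ι) (ts : Branches K b c) (x : Coop K c d) :
    ndLin hι ts d x = nd hι x ts := rfl

theorem mk_node_eq_zero {ι : Type} [Fintype ι] [LinearOrder ι] {c : ι → PairColor}
    (hι : 2 ≤ Fintype.card ι) (x : Coop K c d) {ts : Branches K b c} {i : ι}
    (h : (mk (ts i) : CAlg K b (c i)) = 0) : (mk (node hι x ts) : CAlg K b d) = 0 := by
  have := plug_mk hι x ts i (ts i)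
  rw [h, map_zero, Function.update_eq_self] at this
  exact this.symm

theorem exists_based_of_mk_ne_zero {ι : Type} [Fintype ι] [LinearOrder ι] {c : ι → PairColor}
    (hι : 2 ≤ Fintype.card ι) (x : Coop K c d) {ts : Branches K b c}
    (h : (mk (node hι x ts) : CAlg K b d) ≠ 0) : ∃ i, Based c d i := by
  by_contra hn
  refine h ?_
  rw [obj_ext (x := x) (y := 0) fun u hu => absurd hu.exists_based hn, ← zero_smul K x,
    mk_node_smul, zero_smul]

/-- The colours of the leaves of a nonzero tree: one of them is the colour of the root, and all
are of the colour of the algebra if the root is. -/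
theorem leaf_color {t : CTree K b d} (h : (mk t : CAlg K b d) ≠ 0) :
    (∃ k ∈ t.leaves, b k = d) ∧ (d = .algebra → ∀ k ∈ t.leaves, b k = .algebra) := by
  induction t with
  | leaf k => exact ⟨⟨k, Multiset.mem_singleton_self k, rfl⟩, fun hk k' hk' => by
      rwa [Multiset.mem_singleton.1 hk']⟩
  | @node ι _ _ hι c d x ts ih =>
    obtain ⟨i, hi⟩ := exists_based_of_mk_ne_zero hι x h
    replace ih := fun j => ih j fun h' => h (mk_node_eq_zero hι x h')
    refine ⟨?_, fun hd k hk => ?_⟩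
    · obtain ⟨k, hk, hk'⟩ := (ih i).1
      exact ⟨k, Multiset.mem_sum.2 ⟨i, mem_univ i, hk⟩, hk'.trans hi.1⟩
    · obtain ⟨j, -, hj⟩ := Multiset.mem_sum.1 hk
      refine (ih j).2 ?_ k hj
      by_cases hji : j = i
      · rw [hji, hi.1, hd]
      · exact hi.2 j hji

theorem based_of_onlyBranch {ι : Type} [Fintype ι] [LinearOrder ι] {c : ι → PairColor}
    (hι : 2 ≤ Fintype.card ι) (x : Coop K c d) {ts : Branches K b c} {i : ι}
    (h : OnlyBranch k₀ ts i) (hk : b k₀ = d) (hx : (mk (node hι x ts) : CAlg K b d) ≠ 0) :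
    Based c d i := by
  obtain ⟨j, hj⟩ := exists_based_of_mk_ne_zero hι x hx
  by_cases hij : i = j
  · rwa [hij]
  · have hd : d = .algebra := hk ▸
      (leaf_color fun h' => hx (mk_node_eq_zero hι x h')).2 (hj.2 i hij) k₀ h.1
    subst hd
    have hc : ∀ k, c k = .algebra := fun k => by
      by_cases hkj : k = j
      · rw [hkj, hj.1]
      · exact hj.2 k hkj
    exact ⟨hc i, fun k _ => hc k⟩

theorem homotopyError_prefixed_mem {ι : Type} [Fintype ι] [LinearOrder ι] {c : ι → PairColor} {i : ι}
    {T : CTree K b .algebra} {ts : Branches K b c}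
    (hS : (T.leaves + ∑ i, (ts i).leaves).Nodup) (h : OnlyBranch k₀ ts i) (hT : k₀ ∉ T.leaves)
    (hb : Based c d i) (hk : b k₀ = d) (x : Coop K c d) {m : ℕ} (hm : 1 ≤ m)
    (hm' : Fintype.card ι + ∑ i, branchTrunk k₀ (ts i) ≤ m + 1) :
    homotopyError K b k₀ d (prefixed T i ts d x) ∈ fil K b d k₀ (T.leaves + ∑ i, (ts i).leaves)
      (1 - Fintype.card ι + T.deg + ∑ i, (ts i).deg) m := by
  have : Nonempty ι := ⟨i⟩
  rcases (Fintype.card_pos (α := ι)).nat_succ_le.eq_or_lt with hι | hι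
  swap
  · exact fil_mono (by omega) (homotopyError_prefixed hS h hT hι hb x)
  have hu : Subsingleton ι := Fintype.card_le_one_iff_subsingleton.1 hι.ge
  let _ : Unique ι := ⟨⟨i⟩, fun j => Subsingleton.elim j i⟩
  obtain ⟨t, ht⟩ : ∃ t : CTree K b d, ts i ≍ t := hb.1 ▸ ⟨ts i, HEq.rfl⟩
  rw [prefixed_eq_attach T i ts x hb.1 ht, map_smul]
  refine Submodule.smul_mem _ _ ?_
  obtain rfl : c = fun _ => d := funext fun j => by rw [Subsingleton.elim j i, hb.1]
  obtain rfl : ts = fun _ => t := funext fun j => by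
    rw [Subsingleton.elim j i]; exact eq_of_heq ht
  have hmem := h.1
  simp only [Fintype.sum_unique] at hS hm' ⊢
  rw [← hι, branchTrunk_of_mem k₀ hmem] at hm'
  have e : (1 : ℤ) - Fintype.card ι + T.deg + t.deg = T.deg + t.deg := by rw [← hι]; simp
  rw [e]
  clear ht hb h e
  cases t with
  | leaf k =>
    rw [homotopyError_attach_leaf hT]
    have := prefixed_mem_fil hT () (fun _ => leaf k) (unitElt K (b k))
    simp only [Fintype.sum_unique, Fintype.card_unit, Nat.cast_one, sub_self, zero_add] at this
    refine neg_mem (fil_mono ?_ this)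
    exact (add_le_add le_rfl (branchTrunk_le k₀ _)).trans hm
  | @node ι' _ _ hι' c d y us =>
    by_cases h₀ : (mk (node hι' y us) : CAlg K b d) = 0
    · rw [attach_eq_zero T h₀, map_zero]
      exact zero_mem _
    obtain ⟨p, hp⟩ := exists_onlyBranch (Multiset.nodup_add.1 hS).2.1 hmem
    have := homotopyError_attach_node hp hT hι' (based_of_onlyBranch hι' y hp hk h₀) y
    have e : T.deg + (node hι' y us).deg =
      2 - Fintype.card ι' + T.deg + ∑ i, (us i).deg := by rw [deg_node]; ring
    rw [e]
    rw [trunk_node] at hm'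
    exact fil_mono (by omega) this

/-- A tree is a linear combination of trees obtained by the addition of a first branch to a tree
of which `k₀` is a leaf. -/
theorem map_node_mem {V : Type*} [AddCommGroup V] [Module K V] {F : CAlg K b d →ₗ[K] V}
    {p : Submodule K V} {ι : Type} [Fintype ι] [LinearOrder ι] {c : ι → PairColor} {i : ι}
    (hι : 2 ≤ Fintype.card ι) (x : Coop K c d) {ts : Branches K b c}
    (hi : OnlyBranch k₀ ts i) (hb : Based c d i)
    (hF : ∀ {ι' : Type} [Fintype ι'] [LinearOrder ι'] {c' : ι' → PairColor} (T : CTree K b .algebra)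
      (us : Branches K b c') (i' : ι') (z : Coop K c' d), k₀ ∉ T.leaves →
      OnlyBranch k₀ us i' → Based c' d i' → (node hι x ts).leaves = T.leaves + ∑ i, (us i).leaves →
      (node hι x ts).deg = 1 - Fintype.card ι' + T.deg + ∑ i, (us i).deg →
      trunk k₀ (node hι x ts) = Fintype.card ι' + ∑ i, branchTrunk k₀ (us i) →
      F (prefixed T i' us d z) ∈ p) : F (mk (node hι x ts)) ∈ p := by
  obtain ⟨z, hz⟩ := exists_eq_sum_pre hb hι x
  rw [mk_node, ← ndLin_apply, hz, map_sum, map_units_smul, map_sum]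
  refine units_smul_mem _ (sum_mem fun j _ => ?_)
  obtain ⟨T, hT⟩ : ∃ T : CTree K b .algebra, ts j.1 ≍ T := hb.2 j.1 j.2 ▸ ⟨ts j.1, HEq.rfl⟩
  let us := fun k : {k // k ≠ j.1} => ts k
  have hts : ∀ k, ts k ≍ contractBranches (J := ∅) T us (insertEquiv j.1 k) := fun k => by
    by_cases hk : k = j.1
    · subst hk
      rw [insertEquiv_self]
      exact hT
    · rw [insertEquiv_of_ne hk]
      rfl
  have hcongr {M : Type} (F : ∀ {d}, CTree K b d → M) {d e : PairColor} {s : CTree K b d}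
      {t : CTree K b e} (h : d = e) (h' : s ≍ t) : F s = F t := by
    subst h
    rw [eq_of_heq h']
  have hsum : ∀ {M : Type} [AddCommMonoid M] (F : ∀ {d}, CTree K b d → M),
      ∑ k, F (ts k) = F T + ∑ k, F (us k) := fun F => by
    refine (Fintype.sum_equiv (insertEquiv j.1) _
      (fun o => F (contractBranches (J := ∅) T us o)) fun k => ?_).trans (sum_contract_empty _)
    exact hcongr F (insertEquiv_color hb j.2 k) (hts k)
  have : Nonempty {k // k ≠ j.1} := ⟨⟨i, j.2.symm⟩⟩
  have hcard : Fintype.card {k // k ≠ j.1} + 1 = Fintype.card ι :=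
    (Fintype.card_congr (insertEquiv j.1)).trans card_contract_empty |>.symm
  have hleaf : k₀ ∉ T.leaves := fun h => hi.2 j.1 j.2 (by rwa [hcongr leaves (hb.2 j.1 j.2) hT])
  rw [ndLin_apply, nd_perm hι two_le_card_contract_empty (insertEquiv j.1) (insertEquiv_color hb j.2)
    (fun u _ => val_pull₀ _ _ _ _ _) hts, ← prefixed_apply, map_units_smul]
  refine units_smul_mem _ (hF T us ⟨i, j.2.symm⟩ (z j) hleaf
    ⟨hi.1, fun k hk' => hi.2 k fun h => hk' (Subtype.ext h)⟩
    ⟨hb.1, fun k hk' => hb.2 k fun h => hk' (Subtype.ext h)⟩ ?_ ?_ ?_)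
  · rw [leaves_node, hsum leaves]
  · rw [deg_node, hsum deg, ← hcard]
    push_cast
    ring
  · rw [trunk_node, hsum (branchTrunk k₀), branchTrunk_of_notMem k₀ hleaf, zero_add]
    omega

/-- On trees with a given leaf `k₀` of the colour of the root, the homotopy contracts the quotients of
the filtration by the number of inputs on the path to `k₀`, except for the first. -/
theorem homotopyError_mem_fil {S : Multiset κ} {n : ℤ} {m : ℕ} (hS : S.Nodup) (hS₀ : k₀ ∈ S)
    (hk : b k₀ = d) (hm : 1 ≤ m) {z : CAlg K b d} (hz : z ∈ fil K b d k₀ S n (m + 1)) :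
    homotopyError K b k₀ d z ∈ fil K b d k₀ S n m := by
  refine map_mem_of_fil (fun t h₁ h₂ h₃ => ?_) hz
  subst h₁ h₂
  by_cases h₀ : (mk t : CAlg K b d) = 0
  · rw [h₀, map_zero]
    exact zero_mem _
  cases t with
  | leaf k => exact homotopyError_mem_of_mem_fil hS (mk_mem_fil rfl rfl (Nat.zero_le _))
  | @node ι _ _ hι c d x ts =>
    obtain ⟨i, hi⟩ := exists_onlyBranch hS hS₀
    have hb := based_of_onlyBranch hι x hi hk h₀
    refine map_node_mem hι x hi hb fun T us i z hT hi hb hl hd ht => ?_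
    rw [hl] at hS ⊢
    rw [hd]
    exact homotopyError_prefixed_mem hS hi hT hb hk z hm (ht ▸ h₃)

end

section

variable {k₀ : κ} {S : Multiset κ} {n : ℤ}

/-- Iterating the homotopy, a cocycle is moved to the first step of the filtration. -/
theorem exists_sub_D_mem_fil [CharZero K] (hS : S.Nodup) (hS₀ : k₀ ∈ S) (hk : b k₀ = d)
    {x : CAlg K b d} (hx : x ∈ graded K b d S n) (hD : D d x = 0) :
    ∃ y ∈ graded K b d S (n - 1), x - D d y ∈ fil K b d k₀ S n 1 := by
  obtain ⟨m, hm⟩ := exists_mem_fil k₀ hx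
  replace hm := fil_mono (Nat.le_succ m) hm
  clear hx
  induction m generalizing x with
  | zero => exact ⟨0, zero_mem _, by rwa [map_zero, sub_zero]⟩
  | succ m ih =>
    have h := homotopyError_mem_fil hS hS₀ hk (by omega) hm
    rw [homotopyError_apply, hD, map_zero, add_zero] at h
    obtain ⟨y, hy, hxy⟩ := ih (x := x - D d (homotopy k₀ d x)) (by rw [map_sub, hD, D_D, sub_zero])
      (by rw [← neg_sub]; exact neg_mem h)
    refine ⟨homotopy k₀ d x + y, add_mem (fil_le_graded (homotopy_mem_fil hS hm)) hy, ?_⟩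
    rwa [map_add, ← sub_sub]

/-! ### Trees with a binary root and a leaf as second branch -/

theorem exists_addLeaf (k₀ : κ) : ∃ L : CAlg K b .algebra →ₗ[K] CAlg K b (b k₀), ∀ T, L (mk T) =
    mk (node two_le_card_contract_empty (attachElt K (b k₀))
      (contractBranches (J := ∅) T fun _ : Unit => leaf k₀)) := by
  by_cases h : Nonempty (CTree K b .algebra)
  swap
  · exact ⟨0, fun T => absurd ⟨T⟩ h⟩
  refine ⟨plug two_le_card_contract_empty (attachElt K (b k₀))
    (contractBranches (J := ∅) h.some fun _ : Unit => leaf k₀) .new, fun T => ?_⟩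
  refine (plug_mk two_le_card_contract_empty (attachElt K (b k₀))
    (contractBranches (J := ∅) h.some fun _ : Unit => leaf k₀) .new T).trans ?_
  refine congrArg (fun ts => (mk (node _ _ ts) : CAlg K b (b k₀))) (funext fun o => ?_)
  cases o <;> rfl

variable (K b) in
/-- The linear map that sends a tree to the tree with a binary root that has it as first branch and
the leaf `k₀` as second branch. -/
def addLeaf (k₀ : κ) : CAlg K b .algebra →ₗ[K] CAlg K b (b k₀) := (exists_addLeaf k₀).choose

theorem addLeaf_mk (k₀ : κ) (T : CTree K b .algebra) : addLeaf K b k₀ (mk T) =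
    mk (node two_le_card_contract_empty (attachElt K (b k₀))
      (contractBranches (J := ∅) T fun _ : Unit => leaf k₀)) := (exists_addLeaf k₀).choose_spec T

theorem eq_new_or_oldE (o : Contract (∅ : Finset Unit)) : o = .new ∨ o = oldE () := by
  match o with
  | .new => exact .inl rfl
  | .old k => exact .inr rfl

theorem attach_leaf (k₀ : κ) (T : CTree K b .algebra) :
    attach T (leaf k₀) = T.deg.negOnePow • addLeaf K b k₀ (mk T) := by
  rw [attach_eq_nd, nd, addLeaf_mk, rootSign_pair (new_lt_old _) eq_new_or_oldE]
  change (-(T.deg + 1).negOnePow) • _ = _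
  rw [Int.negOnePow_succ, neg_neg]

theorem D_addLeaf (k₀ : κ) (z : CAlg K b .algebra) :
    D (b k₀) (addLeaf K b k₀ z) = addLeaf K b k₀ (D .algebra z) := by
  refine LinearMap.congr_fun (f := D (b k₀) ∘ₗ addLeaf K b k₀) (g := addLeaf K b k₀ ∘ₗ D .algebra)
    (hom_ext fun T => ?_) z
  obtain ⟨G, H, hG, -, hD⟩ := D_attach T (leaf k₀)
  have h : (G + T.deg.negOnePow • addLeaf K b k₀) (D _ (mk T)) = 0 := by
    refine (Submodule.mem_bot K).1 (map_mem_of_graded (fun T' hl hn => ?_)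
      (D_mem_graded (mk_mem_graded (t := T) rfl rfl)))
    rw [Submodule.mem_bot, LinearMap.add_apply, hG T' hn, attach_leaf, hn, Int.negOnePow_succ,
      Units.neg_smul]
    exact neg_add_cancel _
  rw [isDifferential_D.leaf k₀, map_zero, smul_zero, sub_zero, attach_leaf, map_units_smul,
    eq_neg_of_add_eq_zero_left h, neg_neg] at hD
  exact smul_left_cancel _ hD

theorem addLeaf_mem_graded {z : CAlg K b .algebra} (hz : z ∈ graded K b .algebra S n) :
    addLeaf K b k₀ z ∈ graded K b (b k₀) (S + {k₀}) n := by
  refine map_mem_of_graded (fun T hl hn => ?_) hz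
  rw [addLeaf_mk]
  refine mk_mem_graded ?_ ?_
  · rw [leaves_node, sum_contract_empty, ← hl]
    rfl
  · rw [deg_node, sum_contract_empty, card_contract_empty, ← hn]
    change _ + (T.deg + 0) = _
    simp

open Classical in
/-- The function with value one on the leaf `k₀` and zero on all other trees. -/
def treeLeafCoeff (k₀ : κ) : ∀ {d : PairColor}, CTree K b d → K
  | _, leaf k => if k = k₀ then 1 else 0
  | _, node _ _ _ => 0

variable (K b) in
/-- The coefficient of the tree that consists of the leaf `k₀`. -/
def leafCoeff (k₀ : κ) (d : PairColor) : CAlg K b d →ₗ[K] K :=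
  liftTree (treeLeafCoeff k₀) fun _ hf => linearCombination_eq_zero (V := fun _ => K) (treeLeafCoeff k₀)
    (fun _ _ _ _ _ _ => (add_zero 0).symm) (fun _ _ _ _ _ _ => (smul_zero _).symm)
    (fun _ _ _ _ _ _ _ => (smul_zero _).symm)
    (fun _ _ _ _ _ _ _ _ => ⟨0, 0, fun _ _ _ => (add_zero 0).symm⟩) hf

theorem leafCoeff_leaf : leafCoeff K b k₀ (b k₀) (mk (leaf k₀)) = 1 :=
  (liftTree_mk _ _ _).trans (if_pos rfl)

theorem leafCoeff_of_notMem {t : CTree K b d} (h : k₀ ∉ t.leaves) :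
    leafCoeff K b k₀ d (mk t) = 0 := by
  refine (liftTree_mk _ _ _).trans ?_
  cases t with
  | leaf k => exact if_neg fun hk : k = k₀ => h (hk ▸ Multiset.mem_singleton_self k)
  | node _ _ _ => rfl

theorem isBranchLinear_leafCoeff (k₀ : κ) :
    IsBranchLinear (K := K) (b := b) (V := fun _ => CAlg K b .algebra)
      fun {a e} _ s t => s.deg.negOnePow • leafCoeff K b k₀ e (mk t) • castHom K b a .algebra (mk s) where
  right a e d s n := ⟨s.deg.negOnePow • (leafCoeff K b k₀ e).smulRight (castHom K b a .algebra (mk s)),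
    fun t _ => rfl⟩
  left a e d t n := ⟨n.negOnePow • leafCoeff K b k₀ e (mk t) • castHom K b a .algebra,
    fun s hs => by rw [hs]; rfl⟩

theorem eq_zero_of_addLeaf_eq_zero (hk : k₀ ∉ S) {z : CAlg K b .algebra}
    (hz : z ∈ graded K b .algebra S n) (h : addLeaf K b k₀ z = 0) : z = 0 := by
  let R : CAlg K b (b k₀) →ₗ[K] CAlg K b .algebra := binaryHom (isBranchLinear_leafCoeff k₀) (b k₀)
  have key : (R ∘ₗ addLeaf K b k₀ - LinearMap.id :
      CAlg K b .algebra →ₗ[K] CAlg K b .algebra) z = 0 := by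
    refine (Submodule.mem_bot K).1 (map_mem_of_graded (fun T hl hn => ?_) hz)
    have h₁ : addLeaf K b k₀ (mk T) = T.deg.negOnePow • attach T (leaf k₀) := by
      rw [attach_leaf, smul_smul, Int.units_mul_self, one_smul]
    rw [Submodule.mem_bot, LinearMap.sub_apply, comp_apply, h₁, map_units_smul,
      binaryHom_attach, symmPair, leafCoeff_leaf, leafCoeff_of_notMem (hl ▸ hk), castHom_self,
      zero_smul, smul_zero, smul_zero, sub_zero, one_smul, smul_smul, Int.units_mul_self, one_smul]
    exact sub_self _
  rw [LinearMap.sub_apply, comp_apply, h, map_zero, zero_sub, neg_eq_zero] at key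
  exact key

theorem attach_of_trunk_eq_zero (T : CTree K b .algebra) {s : CTree K b d} (hk : k₀ ∈ s.leaves)
    (h : trunk k₀ s = 0) : s.leaves = {k₀} ∧ s.deg = 0 ∧
      castHom K b (b k₀) d (addLeaf K b k₀ (T.deg.negOnePow • mk T)) = attach T s := by
  cases s with
  | node hι y vs =>
    rw [trunk_node] at h
    omega
  | leaf k =>
    obtain rfl := Multiset.mem_singleton.1 hk
    exact ⟨rfl, rfl, by rw [map_units_smul, ← attach_leaf, castHom_self]⟩

/-- Trees with a path from the root to `k₀` that consists of a single binary vertex. -/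
theorem mk_mem_map_addLeaf {t : CTree K b d} (hd : b k₀ = d) (hS : t.leaves.Nodup)
    (hk : t.leaves = S + {k₀}) (hS₁ : S ≠ 0) (ht : trunk k₀ t ≤ 1) :
    ∃ z ∈ graded K b .algebra S t.deg, castHom K b (b k₀) d (addLeaf K b k₀ z) = mk t := by
  change mk t ∈ (graded K b .algebra S t.deg).map (castHom K b (b k₀) d ∘ₗ addLeaf K b k₀)
  by_cases h₀ : (mk t : CAlg K b d) = 0
  · rw [h₀]
    exact zero_mem _
  cases t with
  | leaf k =>
    have := congrArg Multiset.card hk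
    rw [Multiset.card_add, Multiset.card_singleton] at this
    exact absurd (Multiset.card_eq_zero.1 (Nat.succ_injective this.symm)) hS₁
  | @node ι _ _ hι c d x ts =>
    obtain ⟨i, hi⟩ := exists_onlyBranch hS (k₀ := k₀) (by
      rw [← leaves_node hι x, hk]
      exact Multiset.mem_add.2 (.inr (Multiset.mem_singleton_self k₀)))
    refine map_node_mem (F := LinearMap.id) hι x hi (based_of_onlyBranch hι x hi hd h₀)
      fun {ι'} _ _ c' T us i z hT hi hb hl hdeg htr => ?_
    rw [LinearMap.id_apply, hdeg]
    rw [hl] at hk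
    rw [htr, hi.sum_branchTrunk] at ht
    have : Nonempty ι' := ⟨i⟩
    have hι' : Fintype.card ι' = 1 := le_antisymm (by omega) Fintype.card_pos
    have hu : Subsingleton ι' := Fintype.card_le_one_iff_subsingleton.1 hι'.le
    let _ : Unique ι' := ⟨⟨i⟩, fun j => Subsingleton.elim j i⟩
    obtain ⟨s, hs⟩ : ∃ s : CTree K b d, us i ≍ s := hb.1 ▸ ⟨us i, HEq.rfl⟩
    obtain rfl : c' = fun _ => d := funext fun j => by rw [Subsingleton.elim j i, hb.1]
    obtain rfl := eq_of_heq hs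
    rw [prefixed_eq_attach T i us z rfl HEq.rfl]
    refine Submodule.smul_mem _ _ ?_
    simp only [Fintype.sum_unique, hι'] at hk ⊢
    rw [Subsingleton.elim default i] at hk ⊢
    obtain ⟨h₁, h₂, h₃⟩ := attach_of_trunk_eq_zero T hi.1 (by omega)
    rw [h₁] at hk
    refine ⟨T.deg.negOnePow • mk T, units_smul_mem _ (mk_mem_graded (add_right_cancel hk) ?_), h₃⟩
    rw [h₂]
    simp

/-- The first step of the filtration is the image of the complex for the leaves other than `k₀`. -/
theorem exists_addLeaf_eq (hS : (S + {k₀}).Nodup) (hS₁ : S ≠ 0) {x : CAlg K b (b k₀)}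
    (hx : x ∈ fil K b (b k₀) k₀ (S + {k₀}) n 1) :
    ∃ z ∈ graded K b .algebra S n, addLeaf K b k₀ z = x := by
  change x ∈ (graded K b .algebra S n).map (addLeaf K b k₀)
  refine map_mem_of_fil (F := LinearMap.id) (fun t hl hn ht => ?_) hx
  subst hn
  obtain ⟨z, hz, h⟩ := mk_mem_map_addLeaf rfl (hl ▸ hS) hl hS₁ ht
  exact ⟨z, hz, (castHom_self _).symm.trans h⟩

end

section

variable {k₀ : κ} {S : Multiset κ} {n : ℤ}

/-! ### The sum of the coefficients -/

variable (K b) in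
/-- The sum of the coefficients of an element of the free algebra over `comm⁺`. -/
def coeffSum (d : PairColor) : (commPlus K).FreeAlg b d →ₗ[K] K :=
  Submodule.liftQ _ (Finsupp.linearCombination K fun _ => (1 : K)) <| Submodule.span_le.2 fun f hf => by
    have h : ∀ {a d : PairColor} (F : (commPlus K).Tree b a → (commPlus K).Tree b d)
        (f : (commPlus K).Tree b a →₀ K), Finsupp.linearCombination K (fun _ => (1 : K))
          (Finsupp.lmapDomain K K F f) = Finsupp.linearCombination K (fun _ => (1 : K)) f :=
      fun F f => Finsupp.linearCombination_mapDomain K F f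
    change Finsupp.linearCombination K (fun _ => (1 : K)) f = 0
    induction hf with
    | symm g s t =>
      change Finsupp.linearCombination K _ (_ - (1 : ℤˣ) • _) = 0
      rw [one_smul, map_sub, Finsupp.linearCombination_single, Finsupp.linearCombination_single,
        sub_self]
    | quad w hw x y z =>
      simp only [relator, map_add, map_sum, Finsupp.linearCombination_single, smul_eq_mul, mul_one]
      exact hw
    | left g t _ ih => rw [h, ih]
    | right g s _ ih => rw [h, ih]

theorem coeffSum_cls (t : (commPlus K).Tree b d) : coeffSum K b d ((commPlus K).cls t) = 1 := by
  rw [coeffSum, cls]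
  exact (Submodule.liftQ_apply _ _ _).trans (by rw [Finsupp.linearCombination_single, one_smul])

theorem coeffSum_freeMul (h : Nonempty (PairGen a e d)) (x : (commPlus K).FreeAlg b a)
    (y : (commPlus K).FreeAlg b e) :
    coeffSum K b d (freeMul b a e d x y) = coeffSum K b a x * coeffSum K b e y := by
  obtain ⟨g⟩ := h
  rw [freeMul_eq g]
  induction x using freeAlg_induction with
  | h0 => simp
  | hadd x x' hx hx' => simp only [map_add, LinearMap.add_apply, hx, hx', add_mul]
  | hsmul r x hx => simp only [map_smul, LinearMap.smul_apply, hx, smul_eq_mul, mul_assoc]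
  | hcls s =>
    induction y using freeAlg_induction with
    | h0 => simp
    | hadd y y' hy hy' => simp only [map_add, hy, hy', mul_add]
    | hsmul r y hy => simp only [map_smul, hy, smul_eq_mul, mul_left_comm]
    | hcls t =>
      rw [coeffSum_cls, coeffSum_cls, one_mul]
      exact (congrArg _ (act_cls (Q := commPlus K) (a := a) (b := e) (d := d) g s t)).trans
        (coeffSum_cls _)

theorem γ_addLeaf (z : CAlg K b .algebra) : γ (b k₀) (addLeaf K b k₀ z) =
    freeMul b .algebra (b k₀) (b k₀) (γ .algebra z) ((commPlus K).cls (.leaf k₀)) := by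
  refine LinearMap.congr_fun (f := γ (b k₀) ∘ₗ addLeaf K b k₀)
    (g := (freeMul b .algebra (b k₀) (b k₀)).flip ((commPlus K).cls (.leaf k₀)) ∘ₗ γ .algebra)
    (hom_ext fun T => ?_) z
  rw [comp_apply, comp_apply, addLeaf_mk]
  refine (γ_binary (new_lt_old _) eq_new_or_oldE _ _ _).trans ?_
  refine (congrArg (· • _) (val_attachElt (b k₀))).trans ((one_smul _ _).trans ?_)
  exact congrArg (freeMul b .algebra (b k₀) (b k₀) (γ .algebra (mk T))) (γ_mk (leaf k₀))

/-! ### The cohomology of the cobar construction -/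

theorem exists_color_of_ne_zero {x : CAlg K b d} (hx : x ∈ graded K b d S n) (h : x ≠ 0) :
    ∃ k ∈ S, b k = d := by
  by_contra hk
  refine h ((Submodule.mem_bot K).1 (map_mem_of_graded (F := LinearMap.id) (fun t hl hn => ?_) hx))
  by_contra h'
  exact hk (hl ▸ (leaf_color (K := K) fun h₀ => h' h₀).1)

/-- A tree with a single leaf is trivial. -/
theorem eq_leaf_of_leaves {t : CTree K b d} (h : t.leaves = {k₀}) :
    coeffSum K b d (γ d (mk t)) = 1 ∧ (mk t : CAlg K b d) = castHom K b (b k₀) d (mk (leaf k₀)) := by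
  cases t with
  | leaf k =>
    obtain rfl : k = k₀ := Multiset.singleton_inj.1 h
    refine ⟨?_, (castHom_self _).symm⟩
    rw [γ_mk]
    exact coeffSum_cls _
  | @node ι _ _ hι c d x ts =>
    exfalso
    have h₁ := congrArg Multiset.card h
    rw [leaves_node, Multiset.card_sum, Multiset.card_singleton] at h₁
    have h₂ : ∀ i, 1 ≤ (ts i).leaves.card := fun i => by
      obtain ⟨k, hk⟩ := exists_mem_leaves (ts i)
      exact Multiset.card_pos_iff_exists_mem.2 ⟨k, hk⟩
    have h₃ := sum_le_sum fun i (_ : i ∈ univ) => h₂ i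
    rw [h₁, sum_const, card_univ, smul_eq_mul, mul_one] at h₃
    omega

/-- A cocycle is a coboundary, provided that the sum of the coefficients of its image vanishes. -/
theorem exists_D_eq [CharZero K] (hS : S.Nodup) {x : CAlg K b d} (hx : x ∈ graded K b d S n)
    (hD : D d x = 0) (hγ : coeffSum K b d (γ d x) = 0) : ∃ y ∈ graded K b d S (n - 1), D d y = x := by
  induction hm : S.card generalizing S d n x with
  | zero =>
    obtain rfl := Multiset.card_eq_zero.1 hm
    by_cases h : x = 0
    · exact ⟨0, zero_mem _, by rw [map_zero, h]⟩
    · obtain ⟨k, hk, -⟩ := exists_color_of_ne_zero hx h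
      exact absurd hk (Multiset.notMem_zero k)
  | succ m ih =>
    by_cases h : x = 0
    · exact ⟨0, zero_mem _, by rw [map_zero, h]⟩
    obtain ⟨k, hk, rfl⟩ := exists_color_of_ne_zero hx h
    -- It suffices to treat cocycles in the first step of the filtration for the leaf `k`.
    obtain ⟨y, hy, hxy⟩ := exists_sub_D_mem_fil hS hk rfl hx hD
    obtain ⟨S', rfl⟩ := Multiset.exists_cons_of_mem hk
    rw [← Multiset.singleton_add, add_comm] at hS hx hxy hy hm ⊢
    rw [Multiset.card_add, Multiset.card_singleton] at hm
    have hγ' : coeffSum K b (b k) (γ (b k) (x - D (b k) y)) = 0 := by rw [map_sub, γ_D, sub_zero, hγ]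
    have hD' : D (b k) (x - D (b k) y) = 0 := by rw [map_sub, D_D, hD, sub_zero]
    suffices h : ∃ w ∈ graded K b (b k) (S' + {k}) (n - 1), D (b k) w = x - D (b k) y by
      obtain ⟨w, hw, hw'⟩ := h
      exact ⟨w + y, add_mem hw hy, by rw [map_add, hw', sub_add_cancel]⟩
    generalize x - D (b k) y = x at hxy hγ' hD'
    -- With the single leaf `k` there is only the trivial tree, and its coefficient is zero.
    by_cases hS₁ : S' = 0
    · subst hS₁
      rw [zero_add] at hxy
      refine ⟨0, zero_mem _, ?_⟩
      have hl : x = coeffSum K b (b k) (γ (b k) x) • mk (leaf k) := by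
        refine sub_eq_zero.1 ((Submodule.mem_bot K).1 (map_mem_of_fil (F := LinearMap.id -
          (coeffSum K b (b k) ∘ₗ γ (b k)).smulRight (mk (leaf k))) (fun t hl _ _ => ?_) hxy))
        obtain ⟨h₁, h₂⟩ := eq_leaf_of_leaves hl
        rw [castHom_self] at h₂
        rw [Submodule.mem_bot, LinearMap.sub_apply, LinearMap.smulRight_apply, comp_apply,
          h₁, one_smul, h₂]
        exact sub_self _
      rw [hl, hγ', zero_smul, map_zero]
    · obtain ⟨z, hz, rfl⟩ := exists_addLeaf_eq hS hS₁ hxy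
      -- The element is the image of a cocycle in the complex for the leaves `S'`.
      rw [D_addLeaf] at hD'
      have hk' : k ∉ S' := fun h' => (Multiset.disjoint_left.1 (Multiset.nodup_add.1 hS).2.2 h')
        (Multiset.mem_singleton_self k)
      rw [γ_addLeaf, coeffSum_freeMul (based_unit (b k)).nonempty_gen, coeffSum_cls, mul_one] at hγ'
      obtain ⟨w, hw, rfl⟩ := ih (Multiset.nodup_add.1 hS).1 hz
        (eq_zero_of_addLeaf_eq_zero hk' (D_mem_graded hz) hD') hγ' (Nat.succ_injective hm)
      exact ⟨addLeaf K b k w, addLeaf_mem_graded hw, D_addLeaf k w⟩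

end

section

variable {S S' : Multiset κ}

/-! ### The canonical map on cohomology -/

theorem γ_attach (T : CTree K b .algebra) (t : CTree K b d) : γ d (attach T t) =
    (-(T.deg + 1).negOnePow) • freeMul b .algebra d d (γ .algebra (mk T)) (γ d (mk t)) := by
  rw [attach_eq_nd, nd, rootSign_pair (new_lt_old _) eq_new_or_oldE, map_units_smul]
  refine congrArg ((-(T.deg + 1).negOnePow) • ·) ?_
  refine (γ_binary (new_lt_old _) eq_new_or_oldE _ _ _).trans ?_
  exact (congrArg (· • _) (val_attachElt d)).trans (one_smul _ _)

theorem attach_mem_graded (T : CTree K b .algebra) (t : CTree K b d) :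
    attach T t ∈ graded K b d (T.leaves + t.leaves) (T.deg + t.deg) := by
  rw [attach_eq_nd, nd]
  refine units_smul_mem _ (mk_mem_graded ?_ ?_)
  · rw [leaves_node, sum_contract_empty, Fintype.sum_unique]
    rfl
  · rw [deg_node, sum_contract_empty, card_contract_empty, Fintype.sum_unique]
    change _ + (T.deg + t.deg) = _
    simp

/-- Products of images of elements of degree zero. -/
theorem freeMul_mem_map_γ {x : (commPlus K).FreeAlg b .algebra} {y : (commPlus K).FreeAlg b d}
    (hx : x ∈ (graded K b .algebra S 0).map (γ .algebra)) (hy : y ∈ (graded K b d S' 0).map (γ d)) :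
    freeMul b .algebra d d x y ∈ (graded K b d (S + S') 0).map (γ d) := by
  obtain ⟨x, hx, rfl⟩ := hx
  obtain ⟨y, hy, rfl⟩ := hy
  refine map_mem_of_graded (F := (freeMul b .algebra d d).flip (γ d y) ∘ₗ γ .algebra)
    (fun T hT hT' => ?_) hx
  refine map_mem_of_graded (F := freeMul b .algebra d d (γ .algebra (mk T)) ∘ₗ γ d)
    (fun t ht ht' => ?_) hy
  have h := attach_mem_graded T t
  rw [hT, hT', ht, ht', add_zero] at h
  refine ⟨_, h, (γ_attach T t).trans ?_⟩
  rw [hT']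
  exact one_smul _ _

/-- Each tree in the free algebra over `comm⁺` is the image of a tree of degree zero. -/
theorem cls_mem_map_γ (t : (commPlus K).Tree b d) :
    (commPlus K).cls t ∈ (graded K b d t.leaves 0).map (γ d) := by
  induction t with
  | leaf k => exact ⟨mk (leaf k), mk_mem_graded rfl rfl, γ_mk _⟩
  | node g s t hs ht =>
    have h := congrArg (fun F => F ((commPlus K).cls s) ((commPlus K).cls t)) (freeMul_eq (K := K) (b := b) g)
    replace h := h.trans (act_cls (Q := commPlus K) g s t)
    rw [← h]
    cases g with
    | product => exact freeMul_mem_map_γ hs ht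
    | action => exact freeMul_mem_map_γ hs ht
    | actionSwap =>
      change freeMul b .module .algebra .module _ _ ∈ (graded K b _ (s.leaves + t.leaves) 0).map _
      rw [freeMul_comm, add_comm]
      exact freeMul_mem_map_γ ht hs

variable (K b) in
/-- The span of the trees in the free algebra with given leaves. -/
def freeGraded (d : PairColor) (S : Multiset κ) : Submodule K ((commPlus K).FreeAlg b d) :=
  Submodule.span K ((commPlus K).cls '' {t | t.leaves = S})

theorem freeMul_mem_freeGraded {x : (commPlus K).FreeAlg b a} {y : (commPlus K).FreeAlg b e}
    (hx : x ∈ freeGraded K b a S) (hy : y ∈ freeGraded K b e S') :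
    freeMul b a e d x y ∈ freeGraded K b d (S + S') := by
  by_cases h : Nonempty (PairGen a e d)
  swap
  · rw [freeMul_of_isEmpty (not_nonempty_iff.1 h)]
    exact zero_mem _
  obtain ⟨g⟩ := h
  rw [freeMul_eq g]
  refine (Submodule.map₂_le (p := freeGraded K b a S) (q := freeGraded K b e S')).1 ?_ x hx y hy
  rw [freeGraded, freeGraded, Submodule.map₂_span_span, Submodule.span_le]
  rintro _ ⟨_, ⟨s, rfl, rfl⟩, _, ⟨t, rfl, rfl⟩, rfl⟩
  exact Submodule.subset_span ⟨.node (Q := commPlus K) g s t, rfl,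
    (act_cls (Q := commPlus K) (a := a) (b := e) (d := d) g s t).symm⟩

theorem treeγ_mem_freeGraded (t : CTree K b d) : treeγ t ∈ freeGraded K b d t.leaves := by
  induction t with
  | leaf k => exact Submodule.subset_span ⟨_, rfl, rfl⟩
  | @node ι _ _ hι c d x ts ih =>
    rw [treeγ_node]
    by_cases h : Fintype.card ι = 2
    · obtain ⟨p, q, hpq, hk⟩ := exists_lt_of_card_eq_two h
      rw [pairSum_eq hpq hk, leaves_node, sum_pair hpq.ne hk]
      exact Submodule.smul_mem _ _ (freeMul_mem_freeGraded (ih p) (ih q))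
    · rw [pairSum_of_card_ne h]
      exact zero_mem _

theorem isMultilinear_iff [Fintype κ] {M : Multiset κ} :
    (M.Nodup ∧ ∀ k, k ∈ M) ↔ M = (univ : Finset κ).val :=
  ⟨fun h => (Multiset.Nodup.ext h.1 univ.nodup).2 fun k => ⟨fun _ => mem_univ k, fun _ => h.2 k⟩,
    fun h => h ▸ ⟨univ.nodup, mem_univ⟩⟩

theorem part_eq_graded [Fintype κ] (b : κ → PairColor) (d : PairColor) (n : ℤ) :
    Cobar.part (commPlus K).koszulDual b d n = graded K b d (univ : Finset κ).val n := by
  refine congrArg (Submodule.span K) (Set.ext fun x => ⟨?_, ?_⟩)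
  · rintro ⟨t, ht, hn, rfl⟩
    exact ⟨t, ⟨isMultilinear_iff.1 ht, hn⟩, rfl⟩
  · rintro ⟨t, ⟨ht, hn⟩, rfl⟩
    exact ⟨t, isMultilinear_iff.2 ht, hn, rfl⟩

theorem freeGraded_univ_le [Fintype κ] : freeGraded K b d (univ : Finset κ).val ≤
    LinearMap.range ((commPlus K).toFreeAlg b d) := by
  refine Submodule.span_le.2 ?_
  rintro _ ⟨t, ht, rfl⟩
  exact ⟨(commPlus K).treeClass ⟨t, isMultilinear_iff.2 ht⟩, toFreeAlg_treeClass _⟩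

theorem graded_eq_bot_of_pos {n : ℤ} (hn : 0 < n) {x : CAlg K b d} (hx : x ∈ graded K b d S n) : x = 0 :=
  (Submodule.mem_bot K).1 (map_mem_of_graded (F := LinearMap.id)
    (fun t _ h => absurd (h ▸ deg_nonpos t) hn.not_ge) hx)

theorem graded_le_homog {n : ℤ} {x : CAlg K b d} (hx : x ∈ graded K b d S n) : x ∈ homog K b d n :=
  map_mem_of_graded (F := LinearMap.id) (p := homog K b d n)
    (fun t _ h => Submodule.subset_span ⟨t, h, rfl⟩) hx

theorem γ_mem_range [Fintype κ] {x : CAlg K b d} (hx : x ∈ graded K b d (univ : Finset κ).val 0) :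
    γ d x ∈ LinearMap.range ((commPlus K).toFreeAlg b d) := by
  refine map_mem_of_graded (F := γ d) (fun t ht _ => freeGraded_univ_le ?_) hx
  rw [γ_mk, ← ht]
  exact treeγ_mem_freeGraded t

theorem toFreeAlg_mem_map_γ [Fintype κ] (z : (commPlus K).Op b d) :
    (commPlus K).toFreeAlg b d z ∈ (graded K b d (univ : Finset κ).val 0).map (γ d) := by
  obtain ⟨f, rfl⟩ := Submodule.Quotient.mk_surjective _ z
  induction f using Finsupp.induction_linear with
  | zero => rw [Submodule.Quotient.mk_zero, map_zero]; exact zero_mem _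
  | add f g hf hg => rw [Submodule.Quotient.mk_add, map_add]; exact add_mem hf hg
  | single t r =>
    have h : (commPlus K).toFreeAlg b d ((commPlus K).treeClass t) ∈
        (graded K b d (univ : Finset κ).val 0).map (γ d) := by
      have h := cls_mem_map_γ t.1
      rw [isMultilinear_iff.1 t.2] at h
      rwa [toFreeAlg_treeClass]
    have e : Finsupp.single t r = r • Finsupp.single t (1 : K) := by
      rw [Finsupp.smul_single, smul_eq_mul, mul_one]
    rw [e, Submodule.Quotient.mk_smul, map_smul]
    exact Submodule.smul_mem _ _ h

theorem exists_γ_eq [Fintype κ] (z : (commPlus K).Op b d) :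
    ∃ x ∈ graded K b d (univ : Finset κ).val 0, D d x = 0 ∧ γ d x = (commPlus K).toFreeAlg b d z := by
  obtain ⟨x, hx, h⟩ := Submodule.mem_map.1 (toFreeAlg_mem_map_γ z)
  have hD : D d x = 0 := by
    have h := D_mem_graded hx
    rw [zero_add] at h
    exact graded_eq_bot_of_pos one_pos h
  exact ⟨x, hx, hD, h⟩

theorem isQuasiIso [CharZero K] [Fintype κ] (b : κ → PairColor) (d : PairColor) :
    (commPlus K).IsQuasiIso b (D : ∀ d, CAlg K b d →ₗ[K] CAlg K b d) γ d where
  differential_mem n x hx :=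
    (part_eq_graded b d (n + 1)).ge (D_mem_graded ((part_eq_graded b d n).le hx))
  differential_sq n x _ := D_D (b := b) (d := d) x
  map_mem x hx := γ_mem_range ((part_eq_graded b d 0).le hx)
  map_eq_zero n hn x hx := γ_eq_zero_of_mem_homog hn (graded_le_homog ((part_eq_graded b d n).le hx))
  map_differential n x _ := γ_D (b := b) (d := d) x
  exact n hn x hx hD := by
    have hx' := (part_eq_graded b d n).le hx
    -- Outside degree zero the canonical map vanishes.
    obtain ⟨y, hy, h⟩ := exists_D_eq univ.nodup hx' hD
      (by rw [γ_eq_zero_of_mem_homog hn (graded_le_homog hx'), map_zero])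
    exact ⟨y, (part_eq_graded b d (n - 1)).ge hy, h⟩
  injective x hx hD hγ := by
    obtain ⟨y, hy, h⟩ := exists_D_eq univ.nodup ((part_eq_graded b d 0).le hx) hD
      ((congrArg (coeffSum K b d) hγ).trans (map_zero _))
    exact ⟨y, (part_eq_graded b d (0 - 1)).ge hy, h⟩
  surjective z := by
    obtain ⟨x, hx, hD, h⟩ := exists_γ_eq z
    exact ⟨x, (part_eq_graded b d 0).ge hx, hD, h⟩

end

end Cobar

theorem commPlus_isKoszul (K : Type u) [Field K] [CharZero K] : (commPlus K).IsKoszul := fun b =>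
  ⟨Cobar.D, Cobar.γ, Cobar.isDifferential_D, Cobar.isCanonicalMap_γ, Cobar.isQuasiIso b⟩

/-- The identity as an isomorphism of cooperads. -/
def GradedCooperad.Iso.refl {C : Type} (A : GradedCooperad K C) : A.Iso A where
  equiv _ _ := LinearEquiv.refl K _
  deg_eq _ _ _ := rfl
  equiv_pull _ _ _ _ := rfl
  counit_equiv _ _ := rfl
  decomp_equiv _ _ _ _ _ := (LinearMap.congr_fun TensorProduct.map_id _).symm

end ColoredKoszul

end

theorem mainTheorem7 (K : Type*) [Field K] [CharZero K] : (ColoredKoszul.commPlus K).IsKoszul ∧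
      Nonempty (ColoredKoszul.GradedCooperad.Iso (ColoredKoszul.commPlus K).koszulDual
        (ColoredKoszul.coliePlus K).susp) := by
  refine ⟨ColoredKoszul.commPlus_isKoszul K, ?_⟩
  have h : (ColoredKoszul.commPlus K).dual = ColoredKoszul.liePlus K :=
    ColoredKoszul.commDual_eq_liePlus K
  rw [ColoredKoszul.QuadraticData.koszulDual, h]
  exact ⟨.refl _⟩
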